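/- **Setting.** Let $n,d\ge 1$ and write $\mathbf x=(\mathbf x_1,\dots,\mathbf x_n)\in(\mathbb R^d)^n=\mathbb R^{nd}$. Let $\eta\in(0,1]$, $\kappa\in\mathbb R$, $\lambda\ge 1$, and let $\mathcal E_1,\mathcal E_2,\dots$ be closed convex sets of invertible $d\times d$ matrices. Let $\mathbf F=(F_1,\dots,F_n):\mathbb R\times\mathbb R^{nd}\to\mathbb R^{nd}$ and $\varsigma:\mathbb R\to\mathbb R^{d\times d}$ satisfy: * $F_i(t,\mathbf x)$ depends only on $t$ and $(\mathbf x_{i-1},\dots,\mathbf x_n)$ for $i\ge 2$; for each $\mathbf x$, $t\mapsto\mathbf F(t,\mathbf x)$ is bounded and measurable; $\mathbf F(t,\cdot)$ is $\kappa$-Lipschitz for every $t$; for $i\in\{2,\dots,n\}$, $D_{\mathbf x_{i-1}}F_i(t,\cdot)$ exists, its entries are $\eta$-Hölder continuous on $\mathbb R^{nd}$ with constant $\kappa$ for every $t$, and its values lie in $\mathcal E_{i-1}$; * $\varsigma$ is measurable, symmetric, and $\lambda^{-1}|\xi|^2\le\langle\varsigma(t)\xi,\xi\rangle\le\lambda|\xi|^2$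 for all $t\in\mathbb R$, $\xi\in\mathbb R^d$. Let $\boldsymbol\theta_{t,s}(\mathbf x)$ be the flow of $\dot{\boldsymbol\theta}_{t,s}(\mathbf x)=\mathbf F(t,\boldsymbol\theta_{t,s}(\mathbf x))$, $\boldsymbol\theta_{s,s}(\mathbf x)=\mathbf x$ (in integral form, forward and backward in time). Let $D\mathbf F(t,\mathbf x)$ be the $nd\times nd$ matrix whose only non-zero $d\times d$ blocks are $D_{\mathbf x_{i-1}}F_i(t,\mathbf x)$ in position $(i,i-1)$, $2\le i\le n$. For $(t,\mathbf y)$ fixed, let $\tilde{\boldsymbol\theta}^{t,\mathbf y}_{u,s}(\mathbf x)$ be the flow of $\dot\phi_u=\mathbf F(u,\boldsymbol\theta_{u,t}(\mathbf y))+D\mathbf F(u,\boldsymbol\theta_{u,t}(\mathbf y))(\phi_u-\boldsymbol\theta_{u,t}(\mathbf y))$, $\phi_s=\mathbf x$, and let $\tilde{\mathbf R}^{t,\mathbf y}(u,s)$ be the resolvent of the linear system with matrix $D\mathbf F(u,\boldsymbol\theta_{u,t}(\mathbf y))$. With $B=(I_d,0,\dots,0)^*$ put, for $s<t$, $$\tilde{\mathbf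 K}^{\mathbf y}(s,t)=\int_s^t\tilde{\mathbf R}^{t,\mathbf y}(t,u)B\varsigma(u)B^*\tilde{\mathbf R}^{t,\mathbf y}(t,u)^*\,du,$$ $$\tilde q(s,t,\mathbf x,\mathbf y)=\frac{\exp\!\big(-\tfrac12\langle\tilde{\mathbf K}^{\mathbf y}(s,t)^{-1}(\tilde{\boldsymbol\theta}^{t,\mathbf y}_{t,s}(\mathbf x)-\mathbf y),\tilde{\boldsymbol\theta}^{t,\mathbf y}_{t,s}(\mathbf x)-\mathbf y\rangle\big)}{(2\pi)^{nd/2}\det(\tilde{\mathbf K}^{\mathbf y}(s,t))^{1/2}},$$ and $k_{ij}(s,t,\mathbf x,\mathbf y)=\mathbb I_{t>s}\,\partial_{\mathbf x_1^i}\partial_{\mathbf x_1^j}\tilde q(s,t,\mathbf x,\mathbf y)$, $1\le i,j\le d$. Let $\rho(t,\mathbf x)=|t|^{1/2}+\sum_{i=1}^n|\mathbf x_i|^{1/(2i-1)}$, $$\mathbf d((s,\mathbf x),(t,\mathbf y))=\rho(t-s,\boldsymbol\theta_{t,s}(\mathbf x)-\mathbf y),\qquad \mathbf d^*((s,\mathbf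 x),(t,\mathbf y))=\mathbf d((t,\mathbf y),(s,\mathbf x)),$$ and $S=[-T,T]\times\mathbb R^{nd}$. For $\delta>0$ let $\eta_\delta:\mathbb R\times\mathbb R^{nd}\to[0,\infty)$ be smooth with $\eta_\delta=1$ where $\rho\le\delta$ and $\eta_\delta=0$ where $\rho\ge2\delta$, and put $$k^d_{ij}(s,t,\mathbf x,\mathbf y)=\eta_\delta(t-s,\boldsymbol\theta_{t,s}(\mathbf x)-\mathbf y)\,k_{ij}(s,t,\mathbf x,\mathbf y),\qquad k^{d,*}_{ij}(s,t,\mathbf x,\mathbf y)=k^d_{ij}(t,s,\mathbf y,\mathbf x).$$ **Proposition.** There exist $T_0\in(0,1]$, $\Lambda\in(0,1]$ and $c>0$, depending only on $n,d,\eta,\kappa,\lambda$ and the sets $\mathcal E_i$, such that for all $T\in(0,T_0]$, $\delta>0$ and every cut-off $\eta_\delta$ as above there is a constant $C$, depending only on these data, $T$, $\delta$ and $\eta_\delta$, such that for all $\mathbf F,\varsigma$ as above and all $1\le i,j\le d$: 1. $|k^d_{ij}(s,t,\mathbf x,\mathbf y)|\le C\,\mathbf d((s,\mathbf x),(t,\mathbf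 y))^{-(n^2d+2)}$ for all $(s,\mathbf x)\ne(t,\mathbf y)$ in $S$, and $k^d_{ij}$ vanishes on the diagonal. 2. For all $(s,\mathbf x),(\sigma,\boldsymbol\xi),(t,\mathbf y)\in S$ with $(s,\mathbf x)\neq(t,\mathbf y)$ and $c\,\mathbf d((s,\mathbf x),(\sigma,\boldsymbol\xi))\le\mathbf d((s,\mathbf x),(t,\mathbf y))\le\Lambda$, $$|k^d_{ij}(s,t,\mathbf x,\mathbf y)-k^d_{ij}(\sigma,t,\boldsymbol\xi,\mathbf y)|\le C\Big\{\frac{\mathbf d((s,\mathbf x),(\sigma,\boldsymbol\xi))^\eta}{\mathbf d((s,\mathbf x),(t,\mathbf y))^{n^2d+2+\eta}}+\frac1{\mathbf d((s,\mathbf x),(t,\mathbf y))^{n^2d+2-\eta}}\Big\}.$$ 3. Both estimates also hold for $k^{d,*}_{ij}$. 4. (Cancellation.) For $k\in\{k^d_{ij},k^{d,*}_{ij}\}$ and all $(s,\mathbf x)\in S$, $\varepsilon>0$, the integral $$I_\varepsilon(s,\mathbf x)=\int_{\{(t,\mathbf y)\in S:\ \mathbf d^*((s,\mathbf x),(t,\mathbf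 y))>\varepsilon\}}k(s,t,\mathbf x,\mathbf y)\,dt\,d\mathbf y$$ converges absolutely and $|I_\varepsilon(s,\mathbf x)|\le C$; moreover $\lim_{\varepsilon\to0}I_\varepsilon(s,\mathbf x)$ exists and is finite for almost every $(s,\mathbf x)\in S$. -/

import Mathlib

open Filter Topology MeasureTheory Set
open scoped Matrix ContDiff

noncomputable section

namespace DegenerateCZ

/-- Index set of the coordinates of `ℝ^{nd}`: `(i, k)` is the `k`-th coordinate of the `i`-th
block. Blocks are numbered `0, …, n - 1`, so the block written `𝐱_i` in the text, `1 ≤ i ≤ n`, is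
block `i - 1` here. -/
abbrev Idx (n d : ℕ) : Type := Fin n × Fin d

/-- The space `ℝ^{nd}` with its Euclidean norm and Lebesgue measure. -/
abbrev Sp (n d : ℕ) : Type := EuclideanSpace ℝ (Idx n d)

/-- `nd × nd` matrices. -/
abbrev Mat (n d : ℕ) : Type := Matrix (Idx n d) (Idx n d) ℝ

variable {n d : ℕ}

/-- The `i`-th `ℝ^d`-valued block of a point of `ℝ^{nd}`. -/
def block (x : Sp n d) (i : Fin n) : EuclideanSpace ℝ (Fin d) :=
  WithLp.toLp 2 fun k => x (i, k)

/-- The point of `ℝ^{nd}` whose `i`-th block is `v` and whose other blocks vanish. -/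
def inject (i : Fin n) (v : EuclideanSpace ℝ (Fin d)) : Sp n d :=
  WithLp.toLp 2 fun a => if a.1 = i then v a.2 else 0

/-- The canonical basis vector of `ℝ^{nd}` with index `a`. -/
def basisVec (a : Idx n d) : Sp n d := EuclideanSpace.single a (1 : ℝ)

/-- The action of a matrix on `ℝ^{nd}`. -/
def act (A : Mat n d) (x : Sp n d) : Sp n d := WithLp.toLp 2 (A *ᵥ x.ofLp)

/-- The `d × d` matrix `D_{x_j} F_i (t, x)`. -/
def blockGrad (F : ℝ → Sp n d → Sp n d) (t : ℝ) (x : Sp n d) (i j : Fin n) :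
    Matrix (Fin d) (Fin d) ℝ :=
  Matrix.of fun k l => lineDeriv ℝ (fun z => F t z (i, k)) x (basisVec (j, l))

/-- The subdiagonal `DF(t, x)` of the Jacobian matrix of `F(t, ·)`: its only nonzero blocks are the
blocks `D_{x_{i-1}} F_i (t, x)` in position `(i, i - 1)`. -/
def subGrad (F : ℝ → Sp n d → Sp n d) (t : ℝ) (x : Sp n d) : Mat n d :=
  Matrix.of fun a b => if b.1.val + 1 = a.1.val then blockGrad F t x a.1 b.1 a.2 b.2 else 0

/-- Closed convex sets of invertible matrices; `𝓔 j` is to contain the values of the derivative of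
the component of `F` with index `j + 1` with respect to block `j`. -/
def IsNondegenerateFamily (𝓔 : Fin n → Set (Matrix (Fin d) (Fin d) ℝ)) : Prop :=
  ∀ j, IsClosed (𝓔 j) ∧ Convex ℝ (𝓔 j) ∧ ∀ A ∈ 𝓔 j, IsUnit A

/-- The assumptions on the drift `F`: structure of the system, regularity with Lipschitz and Hölder
constant `κ` and Hölder exponent `η`, and nondegeneracy of the subdiagonal derivatives. -/
structure DriftAssumption (η κ : ℝ) (𝓔 : Fin n → Set (Matrix (Fin d) (Fin d) ℝ))
    (F : ℝ → Sp n d → Sp n d) : Prop where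
  /-- `F_i(t, x)` only depends on `t` and on `(x_{i-1}, …, x_n)`. -/
  struct : ∀ t (i : Fin n) (x x' : Sp n d),
    (∀ j : Fin n, i.val ≤ j.val + 1 → block x j = block x' j) →
      block (F t x) i = block (F t x') i
  meas : ∀ x, Measurable fun t => F t x
  bdd : ∀ x, ∃ M, ∀ t, ‖F t x‖ ≤ M
  lip : ∀ t x x', ‖F t x - F t x'‖ ≤ κ * ‖x - x'‖
  diff : ∀ t x (i j : Fin n), j.val + 1 = i.val →
    DifferentiableAt ℝ (fun v : EuclideanSpace ℝ (Fin d) => block (F t (x + inject j v)) i) 0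
  holder : ∀ t x x' (i j : Fin n), j.val + 1 = i.val → ∀ k l,
    |blockGrad F t x i j k l - blockGrad F t x' i j k l| ≤ κ * ‖x - x'‖ ^ η
  nondeg : ∀ t x (i j : Fin n), j.val + 1 = i.val → blockGrad F t x i j ∈ 𝓔 j

/-- The assumptions on the frozen diffusion coefficient: measurable, symmetric and uniformly
elliptic with constant `lam`. -/
structure DiffusionAssumption (lam : ℝ) (ς : ℝ → Matrix (Fin d) (Fin d) ℝ) : Prop where
  meas : ∀ k l, Measurable fun t => ς t k l
  symm : ∀ t, (ς t).IsSymm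
  lower : ∀ t (ξ : Fin d → ℝ), lam⁻¹ * (ξ ⬝ᵥ ξ) ≤ (ς t *ᵥ ξ) ⬝ᵥ ξ
  upper : ∀ t (ξ : Fin d → ℝ), (ς t *ᵥ ξ) ⬝ᵥ ξ ≤ lam * (ξ ⬝ᵥ ξ)

/-- `φ` solves `φ' = G(t, φ)`, `φ(s) = x`, on the whole time line. The field is only measurable in
time, hence the integral form. -/
def IsIntegralCurveFrom (G : ℝ → Sp n d → Sp n d) (s : ℝ) (x : Sp n d) (φ : ℝ → Sp n d) : Prop :=
  Continuous φ ∧ ∀ t, φ t = x + ∫ u in s..t, G u (φ u)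

/-- The flow: `flow G t s x` is the value at time `t` of the solution of `φ' = G(t, φ)` that starts
from `x` at time `s`. This solution exists and is unique if `G` is Lipschitz continuous in space,
uniformly in time, and bounded and measurable in time. -/
def flow (G : ℝ → Sp n d → Sp n d) (t s : ℝ) (x : Sp n d) : Sp n d :=
  Classical.epsilon (IsIntegralCurveFrom G s x) t

/-- The affine field obtained by linearizing `F` along the curve of `F` that is at `y` at time
`τ`. -/
def frozenDrift (F : ℝ → Sp n d → Sp n d) (τ : ℝ) (y : Sp n d) (t : ℝ) (z : Sp n d) : Sp n d :=
  F t (flow F t τ y) + act (subGrad F t (flow F t τ y)) (z - flow F t τ y)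

/-- The linearized flow `θ̃^{τ,y}_{t,s}(x)`. -/
def linFlow (F : ℝ → Sp n d → Sp n d) (τ : ℝ) (y : Sp n d) (t s : ℝ) (x : Sp n d) : Sp n d :=
  flow (frozenDrift F τ y) t s x

/-- `Φ` solves `Φ' = A(t) Φ`, `Φ(s) = I`. -/
def IsResolventFrom (A : ℝ → Mat n d) (s : ℝ) (Φ : ℝ → Mat n d) : Prop :=
  Continuous Φ ∧ ∀ t a b, Φ t a b = (1 : Mat n d) a b + ∫ u in s..t, (A u * Φ u) a b

/-- The resolvent `R̃^{τ,y}(t, s)` of the linearized system. -/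
def resolvent (F : ℝ → Sp n d → Sp n d) (τ : ℝ) (y : Sp n d) (t s : ℝ) : Mat n d :=
  Classical.epsilon (IsResolventFrom (fun u => subGrad F u (flow F u τ y)) s) t

/-- The embedding matrix `B = (I_d, 0, …, 0)^*` of `ℝ^d` into `ℝ^{nd}`. -/
def embed (n d : ℕ) [NeZero n] : Matrix (Idx n d) (Fin d) ℝ :=
  Matrix.of fun a l => if a.1 = 0 ∧ a.2 = l then 1 else 0

/-- The covariance matrix
`K̃^y(s, t) = ∫_s^t R̃^{t,y}(t, u) B ς(u) B^* R̃^{t,y}(t, u)^* du`. -/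
def cov [NeZero n] (F : ℝ → Sp n d → Sp n d) (ς : ℝ → Matrix (Fin d) (Fin d) ℝ)
    (y : Sp n d) (s t : ℝ) : Mat n d :=
  Matrix.of fun a b => ∫ u in s..t,
    (resolvent F t y t u * embed n d * ς u * (embed n d)ᵀ * (resolvent F t y t u)ᵀ) a b

/-- The frozen Gaussian kernel `q̃(s, t, x, y)`. -/
def qKer [NeZero n] (F : ℝ → Sp n d → Sp n d) (ς : ℝ → Matrix (Fin d) (Fin d) ℝ)
    (s t : ℝ) (x y : Sp n d) : ℝ :=
  ((2 * Real.pi) ^ ((n * d : ℝ) / 2) * Real.sqrt (cov F ς y s t).det)⁻¹ *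
    Real.exp (-(1 / 2) * (((cov F ς y s t)⁻¹ *ᵥ (linFlow F t y t s x - y).ofLp) ⬝ᵥ
      (linFlow F t y t s x - y).ofLp))

/-- The singular kernel `k_{ij} = 𝟙_{t > s} ∂_{x_1^i} ∂_{x_1^j} q̃`. -/
def kKer [NeZero n] (F : ℝ → Sp n d → Sp n d) (ς : ℝ → Matrix (Fin d) (Fin d) ℝ) (i j : Fin d)
    (s t : ℝ) (x y : Sp n d) : ℝ :=
  if s < t then
    lineDeriv ℝ (fun z => lineDeriv ℝ (fun w => qKer F ς s t w y) z (basisVec (0, j))) x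
      (basisVec (0, i))
  else 0

/-- The homogeneous norm `ρ(t, x) = |t|^{1/2} + ∑_{i=1}^n |x_i|^{1/(2i-1)}`. -/
def rho (t : ℝ) (x : Sp n d) : ℝ :=
  |t| ^ (1 / 2 : ℝ) + ∑ i : Fin n, ‖block x i‖ ^ (1 / (2 * (i.val : ℝ) + 1))

/-- The quasi-distance `𝐝((s, x), (t, y)) = ρ(t - s, θ_{t,s}(x) - y)`. -/
def qdist (F : ℝ → Sp n d → Sp n d) (p q : ℝ × Sp n d) : ℝ :=
  rho (q.1 - p.1) (flow F q.1 p.1 p.2 - q.2)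

/-- The quasi-distance `𝐝^*(p, q) = 𝐝(q, p)`. -/
def qdistStar (F : ℝ → Sp n d → Sp n d) (p q : ℝ × Sp n d) : ℝ := qdist F q p

/-- The strip `S = [-T, T] × ℝ^{nd}`. -/
def strip (n d : ℕ) (T : ℝ) : Set (ℝ × Sp n d) := Icc (-T) T ×ˢ univ

/-- `χ` is a smooth non-negative cut-off function at level `δ` for `ρ`. -/
structure IsCutoff (δ : ℝ) (χ : ℝ × Sp n d → ℝ) : Prop where
  smooth : ContDiff ℝ ∞ χ
  nonneg : ∀ p, 0 ≤ χ p
  eq_one : ∀ p : ℝ × Sp n d, rho p.1 p.2 ≤ δ → χ p = 1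
  eq_zero : ∀ p : ℝ × Sp n d, 2 * δ ≤ rho p.1 p.2 → χ p = 0

/-- The cut-off kernel
`k^d_{ij}(s, t, x, y) = η_δ(t - s, θ_{t,s}(x) - y) k_{ij}(s, t, x, y)`, as a function of
`p = (s, x)` and `q = (t, y)`. -/
def kLoc [NeZero n] (F : ℝ → Sp n d → Sp n d) (ς : ℝ → Matrix (Fin d) (Fin d) ℝ)
    (χ : ℝ × Sp n d → ℝ) (i j : Fin d) (p q : ℝ × Sp n d) : ℝ :=
  χ (q.1 - p.1, flow F q.1 p.1 p.2 - q.2) * kKer F ς i j p.1 q.1 p.2 q.2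

/-- The adjoint kernel `k^{d,*}_{ij}(s, t, x, y) = k^d_{ij}(t, s, y, x)`. -/
def kLocAdj [NeZero n] (F : ℝ → Sp n d → Sp n d) (ς : ℝ → Matrix (Fin d) (Fin d) ℝ)
    (χ : ℝ × Sp n d → ℝ) (i j : Fin d) (p q : ℝ × Sp n d) : ℝ :=
  kLoc F ς χ i j q p

/-- The size estimate for a kernel on the strip, with constant `C`. -/
def SizeEstimate (F : ℝ → Sp n d → Sp n d) (T C : ℝ)
    (k : ℝ × Sp n d → ℝ × Sp n d → ℝ) : Prop :=
  ∀ p ∈ strip n d T, ∀ q ∈ strip n d T, |k p q| ≤ C / qdist F p q ^ (n ^ 2 * d + 2)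

/-- The smoothness estimate for a kernel on the strip, with constant `C`. -/
def SmoothnessEstimate (F : ℝ → Sp n d → Sp n d) (η T Λ c C : ℝ)
    (k : ℝ × Sp n d → ℝ × Sp n d → ℝ) : Prop :=
  ∀ p ∈ strip n d T, ∀ p' ∈ strip n d T, ∀ q ∈ strip n d T,
    c * qdist F p p' ≤ qdist F p q → qdist F p q ≤ Λ →
      |k p q - k p' q| ≤
        C * (qdist F p p' ^ η / qdist F p q ^ ((n : ℝ) ^ 2 * d + 2 + η) +
          1 / qdist F p q ^ ((n : ℝ) ^ 2 * d + 2 - η))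

/-- The points of the strip at `𝐝^*`-distance more than `ε` from `p`. -/
def truncDomain (F : ℝ → Sp n d → Sp n d) (T ε : ℝ) (p : ℝ × Sp n d) : Set (ℝ × Sp n d) :=
  {q | q ∈ strip n d T ∧ ε < qdistStar F p q}

/-- The cancellation property for a kernel on the strip: its truncated integrals exist, are bounded
by `C`, and converge almost everywhere. -/
def Cancellation (F : ℝ → Sp n d → Sp n d) (T C : ℝ)
    (k : ℝ × Sp n d → ℝ × Sp n d → ℝ) : Prop :=
  (∀ p ∈ strip n d T, ∀ ε : ℝ, 0 < ε →
    IntegrableOn (k p) (truncDomain F T ε p) volume ∧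
      |∫ q in truncDomain F T ε p, k p q| ≤ C) ∧
  ∀ᵐ p ∂(volume.restrict (strip n d T)),
    ∃ ℓ : ℝ, Tendsto (fun ε : ℝ => ∫ q in truncDomain F T ε p, k p q) (𝓝[>] 0) (𝓝 ℓ)

end DegenerateCZ

end

/-! Everything rests on one symmetry. Multiply block `i` (counted from `0`) by `r ^ (2 i + 1)` and
time by `r ^ 2`: the rescaled drift `scaled F c r` satisfies the same assumptions, with the same
sets `𝓔` and, for `r ≤ 2`, with `κ` enlarged by a factor depending only on `n` and `d`. The
quasi-distance is homogeneous of degree one and the kernel of degree `-(n ^ 2 d + 2)`. Hence each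
pointwise estimate is proved between two times at distance one and transferred with `r = √(t - s)`
(`exists_kKer_le`, `exists_kKer_first`, `exists_kKer_second`, `exists_kKer_frozen`).

At unit scale the kernel is explicit (`kKer_eq`): a second derivative of a Gaussian whose covariance
and resolvent come from the linearization along the trajectory through the second point, evaluated
at the linearized deviation. The essential input is a uniform lower bound on the covariance
(`exists_energy_lower_bound`). If the first block of an adjoint trajectory has small energy, then
all blocks are small, one after the other: the increment of a block over a short time is, to first
order, the time average of the subdiagonal block of `DF` applied to the next block. That average
stays in the closed convex set `𝓔 j` and so has a bounded inverse. Given ellipticity, the Gaussian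
kernel decays faster than any power and is Lipschitz in all its parameters.

Size: decay at scale `r` turns powers of `r` into powers of the quasi-distance. Smoothness: if the
time gap is small against the squared perturbation, the size bound, with its surplus factor `√(t -
s) / 𝐝`, controls both kernels separately. Otherwise the kernels are compared at scale `√(t - s)`.
Moving the first point is a Lipschitz perturbation; moving the second point also moves the
linearization and is only Hölder. The first term of the right-hand side of the smoothness estimate
is enough.

Cancellation: up to an error that gains a power of `|t - s|` and is therefore integrable, the kernel
is a model kernel `k₀` with vanishing space integrals. For the adjoint kernel `k₀` is the kernel
without cut-off (`backKer`), since the frozen trajectory does not involve the integration variable.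
For the kernel itself it is `frozenKer`, linearized along the trajectory through the first point;
the error comes from the Hölder continuity of `DF`. The truncation changes the slices of `k₀` only
for `|t - s| ≤ ε ^ 2`, and there the rescaled slices are dominated by `|a| ^ (-1/2)`, where `t = s +
ε ^ 2 a`. They converge as `ε → 0` when `s` is a Lebesgue point of `DF(·, x)` and of `ς`: the
coefficients become constant, and the boundary of the truncation is a null set for almost every `a`.
-/

noncomputable section

namespace DegenerateCZ

/-! ### Gronwall's inequality and well-posedness of Carathéodory equations. -/

section ODE

/-- The function `(a + L ∫ f) exp (-L (u - s))` is nonincreasing on `[s, t]` and equals `a` at `s`.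
No sign of `f` is needed forward in time. -/
theorem gronwall_forward {f : ℝ → ℝ} (hf : Continuous f) {a L s t : ℝ} (hL : 0 ≤ L) (hst : s ≤ t)
    (h : ∀ u ∈ Icc s t, f u ≤ a + L * ∫ v in s..u, f v) :
    f t ≤ a * Real.exp (L * (t - s)) := by
  set g : ℝ → ℝ := fun u => (a + L * ∫ v in s..u, f v) * Real.exp (-(L * (u - s))) with hg
  have hd : ∀ u, HasDerivAt g ((L * f u) * Real.exp (-(L * (u - s))) +
      (a + L * ∫ v in s..u, f v) * (Real.exp (-(L * (u - s))) * (-L))) u := by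
    intro u
    have h1 : HasDerivAt (fun u => a + L * ∫ v in s..u, f v) (L * f u) u :=
      ((intervalIntegral.integral_hasDerivAt_right (hf.intervalIntegrable _ _)
        (hf.stronglyMeasurableAtFilter _ _) hf.continuousAt).const_mul L).const_add a
    have h2 : HasDerivAt (fun u : ℝ => -(L * (u - s))) (-L) u := by
      have := (((hasDerivAt_id u).sub_const s).const_mul L).fun_neg
      simpa using this
    exact h1.mul h2.exp
  have hanti : AntitoneOn g (Icc s t) := by
    apply antitoneOn_of_deriv_nonpos (convex_Icc s t)
    · exact fun u _ => (hd u).continuousAt.continuousWithinAt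
    · exact fun u _ => (hd u).differentiableAt.differentiableWithinAt
    · intro u hu
      rw [(hd u).deriv]
      have := h u (interior_subset hu)
      have he := Real.exp_pos (-(L * (u - s)))
      have : L * f u ≤ L * (a + L * ∫ v in s..u, f v) := by gcongr
      nlinarith
  have h1 := hanti (left_mem_Icc.2 hst) (right_mem_Icc.2 hst) hst
  have h2 : g s = a := by simp [hg]
  rw [h2] at h1
  have h3 := h t (right_mem_Icc.2 hst)
  refine h3.trans ?_
  have he := Real.exp_pos (L * (t - s))
  calc a + L * ∫ v in s..t, f v = g t * Real.exp (L * (t - s)) := by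
        simp only [hg, mul_assoc, ← Real.exp_add]; simp
    _ ≤ _ := by gcongr

/-- Gronwall's inequality in integral form, in both directions of time. -/
theorem gronwall {f : ℝ → ℝ} (hf : Continuous f) {a L s t : ℝ} (hL : 0 ≤ L)
    (h : ∀ u ∈ uIcc s t, f u ≤ a + L * |∫ v in s..u, f v|) (h0 : ∀ u, 0 ≤ f u) :
    f t ≤ a * Real.exp (L * |t - s|) := by
  rcases le_total s t with hst | hst
  · rw [abs_of_nonneg (sub_nonneg.2 hst)]
    refine gronwall_forward hf hL hst fun u hu => ?_
    have := h u (by rwa [uIcc_of_le hst])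
    rwa [abs_of_nonneg (intervalIntegral.integral_nonneg hu.1 fun _ _ => h0 _)] at this
  -- Backward in time, the forward inequality is applied to `u ↦ f (-u)`.
  · rw [abs_of_nonpos (sub_nonpos.2 hst)]
    have := gronwall_forward (f := fun u => f (-u)) (by fun_prop) (a := a) (s := -s) (t := -t) hL
      (by linarith) (fun u hu => ?_)
    · simpa [sub_eq_add_neg, add_comm] using this
    · have h1 := h (-u) (by rw [uIcc_of_ge hst]; constructor <;> linarith [hu.1, hu.2])
      have h2 : ∫ v in (-s)..u, f (-v) = ∫ v in (-u)..s, f v := by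
        rw [intervalIntegral.integral_comp_neg]; simp
      rw [h2]
      rw [intervalIntegral.integral_symm, abs_neg, abs_of_nonneg
        (intervalIntegral.integral_nonneg (by linarith [hu.1]) fun _ _ => h0 _)] at h1
      exact h1

variable {E : Type*} [NormedAddCommGroup E]

/-- Integration gains a factor `1 / K` on the weight `exp (K |u - s|)`. This makes the Picard map a
contraction on the whole line. -/
theorem abs_integral_exp_le {K : ℝ} (hK : 0 < K) (s t : ℝ) :
    |∫ u in s..t, Real.exp (K * |u - s|)| ≤ Real.exp (K * |t - s|) / K := by
  rcases le_total s t with hst | hst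
  · have h1 : ∫ u in s..t, Real.exp (K * |u - s|) = ∫ u in s..t, Real.exp (K * (u - s)) := by
      refine intervalIntegral.integral_congr fun u hu => ?_
      rw [uIcc_of_le hst] at hu
      simp only [abs_of_nonneg (sub_nonneg.2 hu.1)]
    have h2 : ∫ u in s..t, Real.exp (K * (u - s)) =
        Real.exp (K * (t - s)) / K - Real.exp (K * (s - s)) / K := by
      refine intervalIntegral.integral_eq_sub_of_hasDerivAt (f := fun u => Real.exp (K * (u - s)) / K)
        (fun u _ => ?_) (Continuous.intervalIntegrable (by fun_prop) _ _)
      have := ((((hasDerivAt_id' u).sub_const s).const_mul K).exp.div_const K)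
      refine this.congr_deriv ?_
      rw [mul_one, mul_div_assoc, div_self hK.ne', mul_one]
    rw [h1, abs_of_nonneg (intervalIntegral.integral_nonneg hst fun _ _ => (Real.exp_pos _).le), h2,
      abs_of_nonneg (sub_nonneg.2 hst)]
    have : 0 < Real.exp (K * (s - s)) / K := by positivity
    linarith
  · have h1 : ∫ u in s..t, Real.exp (K * |u - s|) = ∫ u in s..t, Real.exp (-(K * (u - s))) := by
      refine intervalIntegral.integral_congr fun u hu => ?_
      rw [uIcc_of_ge hst] at hu
      simp only [abs_of_nonpos (sub_nonpos.2 hu.2)]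
      ring_nf
    have h2 : ∫ u in s..t, Real.exp (-(K * (u - s))) =
        -(Real.exp (-(K * (t - s))) / K) - -(Real.exp (-(K * (s - s))) / K) := by
      refine intervalIntegral.integral_eq_sub_of_hasDerivAt
        (f := fun u => -(Real.exp (-(K * (u - s))) / K))
        (fun u _ => ?_) (Continuous.intervalIntegrable (by fun_prop) _ _)
      have := ((((hasDerivAt_id' u).sub_const s).const_mul K).fun_neg.exp.div_const K).fun_neg
      convert this using 1
      field_simp
    rw [h1, h2, abs_le, abs_of_nonpos (sub_nonpos.2 hst)]
    have h3 : Real.exp (-(K * (s - s))) / K ≤ Real.exp (-(K * (t - s))) / K := by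
      gcongr
    have h4 : 0 < Real.exp (-(K * (s - s))) / K := by positivity
    have h5 : K * -(t - s) = -(K * (t - s)) := by ring
    rw [h5]
    constructor <;> linarith

/-- Conditions under which the integral equation for a field that is measurable in time and
Lipschitz in space is well-posed. -/
structure IsCaratheodory (G : ℝ → E → E) (L M : ℝ) : Prop where
  meas : ∀ φ : ℝ → E, Continuous φ → StronglyMeasurable fun u => G u (φ u)
  lip : ∀ u x y, ‖G u x - G u y‖ ≤ L * ‖x - y‖
  bdd : ∀ u, ‖G u 0‖ ≤ M

namespace IsCaratheodory

variable {G : ℝ → E → E} {L M : ℝ}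

theorem norm_le (hG : IsCaratheodory G L M) (u : ℝ) (x : E) : ‖G u x‖ ≤ L * ‖x‖ + M := by
  have h1 := hG.lip u x 0
  have h2 := norm_le_norm_add_norm_sub' (G u x) (G u 0)
  have h3 := hG.bdd u
  rw [sub_zero] at h1
  linarith

theorem intervalIntegrable (hG : IsCaratheodory G L M) {φ : ℝ → E} (hφ : Continuous φ) (a b : ℝ) :
    IntervalIntegrable (fun u => G u (φ u)) volume a b := by
  have h : IntervalIntegrable (fun u => L * ‖φ u‖ + M) volume a b :=
    Continuous.intervalIntegrable (by fun_prop) _ _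
  refine h.mono_fun (hG.meas φ hφ).aestronglyMeasurable (ae_of_all _ fun u => ?_)
  exact (hG.norm_le u _).trans (le_abs_self _)

variable [NormedSpace ℝ E]

theorem unique (hG : IsCaratheodory G L M) (hL : 0 ≤ L) {φ ψ : ℝ → E} {s : ℝ} {x : E}
    (hφ : Continuous φ) (hψ : Continuous ψ) (eφ : ∀ t, φ t = x + ∫ u in s..t, G u (φ u))
    (eψ : ∀ t, ψ t = x + ∫ u in s..t, G u (ψ u)) : φ = ψ := by
  funext t
  have := gronwall (f := fun u => ‖φ u - ψ u‖) (by fun_prop) (a := 0) (s := s) (t := t) hL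
    (fun u _ => ?_) (fun _ => norm_nonneg _)
  · rw [zero_mul, norm_le_zero_iff, sub_eq_zero] at this
    exact this
  · rw [eφ u, eψ u, add_sub_add_left_eq_sub, ← intervalIntegral.integral_sub
      (hG.intervalIntegrable hφ _ _) (hG.intervalIntegrable hψ _ _), zero_add]
    refine (intervalIntegral.norm_integral_le_abs_of_norm_le (g := fun u => L * ‖φ u - ψ u‖)
      (ae_of_all _ fun v => hG.lip v _ _) (Continuous.intervalIntegrable (by fun_prop) _ _)).trans ?_
    rw [intervalIntegral.integral_const_mul, abs_mul, abs_of_nonneg hL]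

/-- Picard iteration in a weighted supremum norm: the solution is sought as `wt • ψ` with `ψ`
bounded and continuous, so that a global solution is obtained at once. The requirement `2 L ≤ K`
gives the contraction factor `1 / 2`. -/
theorem exists_solution [CompleteSpace E] (hG : IsCaratheodory G L M) (s : ℝ) (x : E) :
    ∃ φ : ℝ → E, Continuous φ ∧ ∀ t, φ t = x + ∫ u in s..t, G u (φ u) := by
  obtain ⟨K, hK, hKL⟩ : ∃ K : ℝ, 0 < K ∧ 2 * L ≤ K := ⟨2 * |L| + 1, by positivity,
    by linarith [le_abs_self L]⟩
  have hM0 : 0 ≤ M := (norm_nonneg _).trans (hG.bdd 0)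
  set wt : ℝ → ℝ := fun t => Real.exp (K * |t - s|) with hw
  have hwc : Continuous wt := by fun_prop
  have hwp : ∀ t, 0 < wt t := fun t => Real.exp_pos _
  have hw1 : ∀ t, 1 ≤ wt t := fun t => Real.one_le_exp (by positivity)
  have hint : ∀ t, |∫ u in s..t, wt u| ≤ wt t / K := abs_integral_exp_le hK s
  have hIc : ∀ φ : ℝ → E, Continuous φ → Continuous fun t => x + ∫ u in s..t, G u (φ u) :=
    fun φ hφ => continuous_const.add
      (intervalIntegral.continuous_primitive (fun a b => hG.intervalIntegrable hφ a b) s)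
  let I : (ℝ → E) → ℝ → E := fun φ t => x + ∫ u in s..t, G u (φ u)
  have hb : ∀ ψ : BoundedContinuousFunction ℝ E, ∀ t,
      ‖(wt t)⁻¹ • I (fun u => wt u • ψ u) t‖ ≤ ‖x‖ + (|L| * ‖ψ‖ + M) / K := by
    intro ψ t
    rw [norm_smul, norm_inv, Real.norm_of_nonneg (hwp t).le, inv_mul_le_iff₀ (hwp t)]
    have h1 : ‖∫ u in s..t, G u (wt u • ψ u)‖ ≤ (|L| * ‖ψ‖ + M) * (wt t / K) := by
      refine (intervalIntegral.norm_integral_le_abs_of_norm_le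
        (g := fun u => (|L| * ‖ψ‖ + M) * wt u) (ae_of_all _ fun u => ?_)
        (Continuous.intervalIntegrable (by fun_prop) _ _)).trans ?_
      · refine (hG.norm_le _ _).trans ?_
        rw [norm_smul, Real.norm_of_nonneg (hwp u).le, add_mul]
        have h2 := ψ.norm_coe_le_norm u
        have h3 : L * (wt u * ‖ψ u‖) ≤ |L| * (wt u * ‖ψ‖) :=
          mul_le_mul (le_abs_self L) (by gcongr)
            (mul_nonneg (hwp u).le (norm_nonneg _)) (abs_nonneg _)
        nlinarith [hw1 u]
      · rw [intervalIntegral.integral_const_mul, abs_mul, abs_of_nonneg (by positivity)]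
        gcongr
        exact hint t
    calc ‖I (fun u => wt u • ψ u) t‖ ≤ ‖x‖ + (|L| * ‖ψ‖ + M) * (wt t / K) :=
          (norm_add_le _ _).trans (by gcongr)
      _ ≤ wt t * ‖x‖ + (|L| * ‖ψ‖ + M) * (wt t / K) := by
          gcongr
          exact le_mul_of_one_le_left (norm_nonneg _) (hw1 t)
      _ = _ := by field_simp
  let S : BoundedContinuousFunction ℝ E → BoundedContinuousFunction ℝ E := fun ψ =>
    BoundedContinuousFunction.ofNormedAddCommGroup (fun t => (wt t)⁻¹ • I (fun u => wt u • ψ u) t)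
      ((hwc.inv₀ fun t => (hwp t).ne').smul (hIc _ (hwc.smul ψ.continuous))) _ (hb ψ)
  have hS : ContractingWith (1 / 2) S := by
    refine ⟨by rw [← NNReal.coe_lt_coe]; norm_num, LipschitzWith.of_dist_le_mul fun ψ ψ' => ?_⟩
    rw [BoundedContinuousFunction.dist_le (by positivity)]
    intro t
    rw [dist_eq_norm]
    have h0 : S ψ t - S ψ' t =
        (wt t)⁻¹ • ∫ u in s..t, (G u (wt u • ψ u) - G u (wt u • ψ' u)) := by
      rw [intervalIntegral.integral_sub
        (hG.intervalIntegrable (φ := fun u => wt u • ψ u) (hwc.smul ψ.continuous) _ _)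
        (hG.intervalIntegrable (φ := fun u => wt u • ψ' u) (hwc.smul ψ'.continuous) _ _)]
      change (wt t)⁻¹ • I _ t - (wt t)⁻¹ • I _ t = _
      rw [← smul_sub]
      simp only [I, add_sub_add_left_eq_sub]
    rw [h0, norm_smul, norm_inv, Real.norm_of_nonneg (hwp t).le, inv_mul_le_iff₀ (hwp t)]
    refine (intervalIntegral.norm_integral_le_abs_of_norm_le
      (g := fun u => (K / 2 * dist ψ ψ') * wt u) (ae_of_all _ fun u => ?_)
      (Continuous.intervalIntegrable (by fun_prop) _ _)).trans ?_
    · refine (hG.lip _ _ _).trans ?_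
      rw [← smul_sub, norm_smul, Real.norm_of_nonneg (hwp u).le, ← dist_eq_norm]
      have h2 := BoundedContinuousFunction.dist_coe_le_dist (f := ψ) (g := ψ') u
      have : L * (wt u * dist (ψ u) (ψ' u)) ≤ K / 2 * (wt u * dist ψ ψ') :=
        mul_le_mul (by linarith) (by gcongr)
            (mul_nonneg (hwp u).le dist_nonneg) (by positivity)
      linarith
    · rw [intervalIntegral.integral_const_mul, abs_mul, abs_of_nonneg (by positivity)]
      have := hint t
      calc K / 2 * dist ψ ψ' * |∫ u in s..t, wt u| ≤ K / 2 * dist ψ ψ' * (wt t / K) := by gcongr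
        _ = _ := by push_cast; field_simp
  obtain ⟨ψ, hψ, -⟩ := hS.exists_fixedPoint 0 (edist_ne_top _ _)
  refine ⟨fun u => wt u • ψ u, hwc.smul ψ.continuous, fun t => ?_⟩
  have h1 : ψ t = (wt t)⁻¹ • I (fun u => wt u • ψ u) t := by
    conv_lhs => rw [← hψ]
    rfl
  change wt t • ψ t = I (fun u => wt u • ψ u) t
  rw [h1, smul_inv_smul₀ (hwp t).ne']

end IsCaratheodory

end ODE

open scoped Matrix.Norms.L2Operator

variable {n d : ℕ}

/-! ### Matrices acting on `ℝ^{nd}` and the homogeneous dilations. -/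

section Matrices

theorem act_mul (A B : Mat n d) (x : Sp n d) : act (A * B) x = act A (act B x) := by
  simp [act, Matrix.mulVec_mulVec]

theorem act_one (x : Sp n d) : act (1 : Mat n d) x = x := by simp [act]

theorem act_add (A : Mat n d) (x y : Sp n d) : act A (x + y) = act A x + act A y := by
  simp [act, Matrix.mulVec_add]

theorem act_sub (A : Mat n d) (x y : Sp n d) : act A (x - y) = act A x - act A y := by
  simp [act, Matrix.mulVec_sub]

theorem act_neg (A : Mat n d) (x : Sp n d) : act A (-x) = -act A x := by
  simp [act, Matrix.mulVec_neg]

theorem act_zero (A : Mat n d) : act A (0 : Sp n d) = 0 := by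
  simp [act]

theorem act_smul (A : Mat n d) (c : ℝ) (x : Sp n d) : act A (c • x) = c • act A x := by
  simp [act, Matrix.mulVec_smul]

theorem sub_act (A B : Mat n d) (x : Sp n d) : act (A - B) x = act A x - act B x := by
  simp [act, Matrix.sub_mulVec]

theorem smul_act (c : ℝ) (A : Mat n d) (x : Sp n d) : act (c • A) x = c • act A x := by
  simp [act, Matrix.smul_mulVec]

theorem act_apply (A : Mat n d) (x : Sp n d) (a : Idx n d) : act A x a = ∑ b, A a b * x b := rfl

theorem norm_act_le (A : Mat n d) (x : Sp n d) : ‖act A x‖ ≤ ‖A‖ * ‖x‖ :=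
  Matrix.l2_opNorm_mulVec A x

/-- The action of a matrix as a continuous linear map. -/
def actL (A : Mat n d) : Sp n d →L[ℝ] Sp n d := Matrix.toEuclideanCLM (n := Idx n d) (𝕜 := ℝ) A

theorem actL_apply (A : Mat n d) (x : Sp n d) : actL A x = act A x := rfl

theorem continuous_act (A : Mat n d) : Continuous (act A) := (actL A).continuous

theorem continuous_act_uncurry : Continuous fun p : Mat n d × Sp n d => act p.1 p.2 := by
  refine (PiLp.continuous_toLp 2 _).comp ?_
  exact continuous_fst.matrix_mulVec ((PiLp.continuous_ofLp 2 _).comp continuous_snd)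

theorem abs_apply_le (A : Mat n d) (a b : Idx n d) : |A a b| ≤ ‖A‖ := by
  have h := norm_act_le A (EuclideanSpace.single b 1)
  have h1 : act A (EuclideanSpace.single b 1) a = A a b := by
    rw [act_apply]; simp
  have h2 := PiLp.norm_apply_le (act A (EuclideanSpace.single b 1)) a
  rw [h1] at h2
  simpa using h2.trans h

theorem norm_le_sum_abs (A : Mat n d) : ‖A‖ ≤ ∑ a, ∑ b, |A a b| := by
  rw [Matrix.l2_opNorm_def]
  refine ContinuousLinearMap.opNorm_le_bound _ (by positivity) fun x => ?_
  change ‖act A x‖ ≤ _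
  have h1 : ∀ y : Sp n d, ‖y‖ ≤ ∑ a, |y a| := by
    intro y
    rw [EuclideanSpace.norm_eq, Real.sqrt_le_left (by positivity)]
    simp only [Real.norm_eq_abs]
    exact Finset.sum_sq_le_sq_sum_of_nonneg fun _ _ => abs_nonneg _
  refine (h1 _).trans ?_
  rw [Finset.sum_mul]
  refine Finset.sum_le_sum fun a _ => ?_
  rw [act_apply, Finset.sum_mul]
  refine (Finset.abs_sum_le_sum_abs _ _).trans (Finset.sum_le_sum fun b _ => ?_)
  rw [abs_mul]
  gcongr
  exact PiLp.norm_apply_le x b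

theorem norm_one_le : ‖(1 : Mat n d)‖ ≤ 1 := by
  rw [Matrix.l2_opNorm_def]
  refine ContinuousLinearMap.opNorm_le_bound _ zero_le_one fun x => ?_
  change ‖act 1 x‖ ≤ _
  rw [act_one, one_mul]

theorem norm_transpose (A : Mat n d) : ‖Aᵀ‖ = ‖A‖ := by
  have := Matrix.l2_opNorm_conjTranspose A
  rwa [Matrix.conjTranspose_eq_transpose_of_trivial] at this

theorem inner_act (A : Mat n d) (x y : Sp n d) : inner ℝ x (act A y) = inner ℝ (act Aᵀ x) y := by
  simp only [act, EuclideanSpace.inner_eq_star_dotProduct, star_trivial, Matrix.mulVec_transpose]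
  rw [dotProduct_comm, Matrix.dotProduct_mulVec, dotProduct_comm]

/-- The entry of a matrix as a continuous linear functional. -/
def entryL (a b : Idx n d) : Mat n d →L[ℝ] ℝ :=
  LinearMap.toContinuousLinearMap (Matrix.entryLinearMap ℝ ℝ a b)

theorem integral_apply {f : ℝ → Mat n d} {s t : ℝ} (hf : IntervalIntegrable f volume s t)
    (a b : Idx n d) : (∫ u in s..t, f u) a b = ∫ u in s..t, f u a b :=
  ((entryL a b).intervalIntegral_comp_comm hf).symm

theorem integral_mul_matrix {f : ℝ → Mat n d} {s t : ℝ} (hf : IntervalIntegrable f volume s t)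
    (C : Mat n d) : ∫ u in s..t, f u * C = (∫ u in s..t, f u) * C :=
  ((ContinuousLinearMap.mul ℝ (Mat n d)).flip C).intervalIntegral_comp_comm hf

theorem integral_matrix_mul {f : ℝ → Mat n d} {s t : ℝ} (hf : IntervalIntegrable f volume s t)
    (C : Mat n d) : ∫ u in s..t, C * f u = C * ∫ u in s..t, f u :=
  (ContinuousLinearMap.mul ℝ (Mat n d) C).intervalIntegral_comp_comm hf

theorem _root_.MeasureTheory.StronglyMeasurable.matrix_transpose {f : ℝ → Mat n d}
    (hf : StronglyMeasurable f) : StronglyMeasurable fun u => (f u)ᵀ :=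
  (continuous_id.matrix_transpose).comp_stronglyMeasurable hf

/-- The homogeneous dilation: block `i` is multiplied by `r ^ (2 i + 1)`. -/
def dil (r : ℝ) : Mat n d := Matrix.diagonal fun a => r ^ (2 * a.1.val + 1)

theorem dil_mul_dil (r r' : ℝ) : (dil r * dil r' : Mat n d) = dil (r * r') := by
  simp [dil, Matrix.diagonal_mul_diagonal, mul_pow]

theorem dil_one : (dil 1 : Mat n d) = 1 := by simp [dil]

theorem dil_mul_inv {r : ℝ} (hr : r ≠ 0) : (dil r * dil r⁻¹ : Mat n d) = 1 := by
  rw [dil_mul_dil, mul_inv_cancel₀ hr, dil_one]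

theorem dil_inv_mul {r : ℝ} (hr : r ≠ 0) : (dil r⁻¹ * dil r : Mat n d) = 1 := by
  rw [dil_mul_dil, inv_mul_cancel₀ hr, dil_one]

theorem dil_transpose (r : ℝ) : (dil r : Mat n d)ᵀ = dil r := by simp [dil]

theorem act_dil_apply (r : ℝ) (x : Sp n d) (a : Idx n d) :
    act (dil r) x a = r ^ (2 * a.1.val + 1) * x a := by
  simp [act, dil, Matrix.mulVec_diagonal]

theorem act_dil_inv_dil {r : ℝ} (hr : r ≠ 0) (x : Sp n d) : act (dil r⁻¹) (act (dil r) x) = x := by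
  rw [← act_mul, dil_inv_mul hr, act_one]

theorem act_dil_dil_inv {r : ℝ} (hr : r ≠ 0) (x : Sp n d) : act (dil r) (act (dil r⁻¹) x) = x := by
  rw [← act_mul, dil_mul_inv hr, act_one]

/-- A matrix all of whose nonzero blocks are in position `(i, i - 1)`. -/
def IsSubdiag (A : Mat n d) : Prop := ∀ a b : Idx n d, b.1.val + 1 ≠ a.1.val → A a b = 0

/-- Passing from block `i - 1` to block `i` raises the dilation exponent by `2`, so subdiagonal
matrices scale exactly like inverse time. -/
theorem IsSubdiag.dil_conj {A : Mat n d} (hA : IsSubdiag A) (r : ℝ) :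
    dil r⁻¹ * A = (r ^ 2)⁻¹ • (A * dil r⁻¹) := by
  ext a b
  simp only [dil, Matrix.diagonal_mul, Matrix.mul_diagonal, Matrix.smul_apply, smul_eq_mul]
  by_cases h : b.1.val + 1 = a.1.val
  · rw [← h, show 2 * (b.1.val + 1) + 1 = 2 * b.1.val + 1 + 2 by ring, pow_add, inv_pow r 2]
    ring
  · simp [hA a b h]

end Matrices

/-! ### Resolvents of linear systems with bounded measurable coefficients. -/

section Resolvent

/-- The resolvent of the linear system with matrix `A`. -/
def Phi (A : ℝ → Mat n d) (t s : ℝ) : Mat n d := Classical.epsilon (IsResolventFrom A s) t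

variable {A A' : ℝ → Mat n d} {L : ℝ}

theorem isCaratheodory_linear (hm : StronglyMeasurable A) (hb : ∀ u, ‖A u‖ ≤ L) :
    IsCaratheodory (fun u (X : Mat n d) => A u * X) L 0 where
  meas φ hφ := hm.mul hφ.stronglyMeasurable
  lip u x y := by
    rw [← mul_sub]
    exact (norm_mul_le _ _).trans (by gcongr; exact hb u)
  bdd u := by simp

/-- The definition is entrywise; all estimates use the matrix-valued integral. -/
theorem isResolventFrom_iff (hm : StronglyMeasurable A) (hb : ∀ u, ‖A u‖ ≤ L) (s : ℝ)
    (Φ : ℝ → Mat n d) :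
    IsResolventFrom A s Φ ↔ Continuous Φ ∧ ∀ t, Φ t = 1 + ∫ u in s..t, A u * Φ u := by
  refine and_congr_right fun hΦ => forall_congr' fun t => ?_
  have hi := (isCaratheodory_linear hm hb).intervalIntegrable hΦ s t
  constructor
  · intro h
    ext a b
    rw [h a b, Matrix.add_apply, integral_apply hi]
  · intro h a b
    conv_lhs => rw [h, Matrix.add_apply, integral_apply hi]

theorem phi_spec (hm : StronglyMeasurable A) (hb : ∀ u, ‖A u‖ ≤ L) (s : ℝ) :
    (Continuous fun t => Phi A t s) ∧ ∀ t, Phi A t s = 1 + ∫ u in s..t, A u * Phi A u s := by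
  rw [← isResolventFrom_iff hm hb]
  have h := (isCaratheodory_linear hm hb).exists_solution s 1
  simp_rw [← isResolventFrom_iff hm hb] at h
  exact Classical.epsilon_spec h

theorem nonneg_of_bdd (hb : ∀ u, ‖A u‖ ≤ L) : 0 ≤ L := (norm_nonneg _).trans (hb 0)

theorem continuous_phi (hm : StronglyMeasurable A) (hb : ∀ u, ‖A u‖ ≤ L) (s : ℝ) :
    Continuous fun t => Phi A t s := (phi_spec hm hb s).1

theorem phi_self (hm : StronglyMeasurable A) (hb : ∀ u, ‖A u‖ ≤ L) (s : ℝ) : Phi A s s = 1 := by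
  simpa using (phi_spec hm hb s).2 s

theorem intervalIntegrable_mul_phi (hm : StronglyMeasurable A) (hb : ∀ u, ‖A u‖ ≤ L) (s a b : ℝ) :
    IntervalIntegrable (fun u => A u * Phi A u s) volume a b :=
  (isCaratheodory_linear hm hb).intervalIntegrable (continuous_phi hm hb s) a b

theorem phi_sub_phi (hm : StronglyMeasurable A) (hb : ∀ u, ‖A u‖ ≤ L) (s t t' : ℝ) :
    Phi A t s - Phi A t' s = ∫ u in t'..t, A u * Phi A u s := by
  rw [(phi_spec hm hb s).2 t, (phi_spec hm hb s).2 t', add_sub_add_left_eq_sub,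
    intervalIntegral.integral_interval_sub_left] <;> exact intervalIntegrable_mul_phi hm hb _ _ _

/-- Uniqueness for the linear system. The semigroup property and the scaling law follow by
exhibiting a second solution. -/
theorem eq_phi_mul (hm : StronglyMeasurable A) (hb : ∀ u, ‖A u‖ ≤ L) {s : ℝ} {C : Mat n d}
    {Ψ : ℝ → Mat n d} (hΨ : Continuous Ψ) (h : ∀ t, Ψ t = C + ∫ u in s..t, A u * Ψ u) (t : ℝ) :
    Ψ t = Phi A t s * C := by
  have := (isCaratheodory_linear hm hb).unique (nonneg_of_bdd hb) (ψ := fun t => Phi A t s * C) hΨ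
    ((continuous_phi hm hb s).mul continuous_const) h (fun t => ?_)
  · exact congrFun this t
  · have h1 : ∀ u, A u * (Phi A u s * C) = (A u * Phi A u s) * C := fun u => (mul_assoc _ _ _).symm
    simp_rw [h1]
    rw [integral_mul_matrix (intervalIntegrable_mul_phi hm hb _ _ _)]
    conv_lhs => rw [(phi_spec hm hb s).2 t, add_mul, one_mul]

theorem phi_mul_phi (hm : StronglyMeasurable A) (hb : ∀ u, ‖A u‖ ≤ L) (t u s : ℝ) :
    Phi A t u * Phi A u s = Phi A t s := by
  refine (eq_phi_mul hm hb (continuous_phi hm hb s) (fun t => ?_) t).symm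
  rw [← phi_sub_phi hm hb s t u]; abel

theorem norm_phi_le (hm : StronglyMeasurable A) (hb : ∀ u, ‖A u‖ ≤ L) (t s : ℝ) :
    ‖Phi A t s‖ ≤ Real.exp (L * |t - s|) := by
  have hc := continuous_phi hm hb s
  have := gronwall (f := fun u => ‖Phi A u s‖) hc.norm (a := 1) (s := s) (t := t)
    (nonneg_of_bdd hb) (fun u _ => ?_) (fun _ => norm_nonneg _)
  · simpa using this
  · rw [(phi_spec hm hb s).2 u]
    refine (norm_add_le _ _).trans (add_le_add norm_one_le ?_)
    refine (intervalIntegral.norm_integral_le_abs_of_norm_le (g := fun u => L * ‖Phi A u s‖)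
      (ae_of_all _ fun v => ?_) (Continuous.intervalIntegrable (hc.norm.const_mul L) _ _)).trans ?_
    · exact (norm_mul_le _ _).trans (by gcongr; exact hb v)
    · rw [intervalIntegral.integral_const_mul, abs_mul, abs_of_nonneg (nonneg_of_bdd hb)]

end Resolvent

/-! ### Expansion, stability and scaling of resolvents. -/

section Resolvent

variable {A A' : ℝ → Mat n d} {L : ℝ}

theorem norm_phi_sub_one_le (hm : StronglyMeasurable A) (hb : ∀ u, ‖A u‖ ≤ L) (t s : ℝ) :
    ‖Phi A t s - 1‖ ≤ L * Real.exp (L * |t - s|) * |t - s| := by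
  have hL := nonneg_of_bdd hb
  have h := phi_sub_phi hm hb s t s
  rw [phi_self hm hb] at h
  rw [h]
  refine intervalIntegral.norm_integral_le_of_norm_le_const fun u hu => ?_
  refine (norm_mul_le _ _).trans (mul_le_mul (hb u) ((norm_phi_le hm hb u s).trans ?_)
    (norm_nonneg _) hL)
  exact Real.exp_le_exp.2 (mul_le_mul_of_nonneg_left
    (abs_sub_left_of_mem_uIcc (uIoc_subset_uIcc hu)) hL)

/-- The remainder is quadratic in the time increment. In the induction on blocks this lets the
linear term, the time integral of `A`, dominate over short times. -/
theorem norm_phi_sub_one_sub_le (hm : StronglyMeasurable A) (hb : ∀ u, ‖A u‖ ≤ L) (t s : ℝ) :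
    ‖Phi A t s - 1 - ∫ u in s..t, A u‖ ≤ L ^ 2 * Real.exp (L * |t - s|) * |t - s| ^ 2 := by
  have hL := nonneg_of_bdd hb
  have hAi : IntervalIntegrable A volume s t :=
    (intervalIntegrable_const (c := L)).mono_fun hm.aestronglyMeasurable
      (ae_of_all _ fun u => (hb u).trans (le_abs_self _))
  have h := phi_sub_phi hm hb s t s
  rw [phi_self hm hb] at h
  rw [h, ← intervalIntegral.integral_sub (intervalIntegrable_mul_phi hm hb _ _ _) hAi]
  have : ∀ u ∈ uIoc s t, ‖A u * Phi A u s - A u‖ ≤ L ^ 2 * Real.exp (L * |t - s|) * |t - s| := by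
    intro u hu
    have h1 := abs_sub_left_of_mem_uIcc (uIoc_subset_uIcc hu)
    have h2 : A u * Phi A u s - A u = A u * (Phi A u s - 1) := by rw [mul_sub, mul_one]
    rw [h2]
    calc _ ≤ L * (L * Real.exp (L * |u - s|) * |u - s|) :=
          (norm_mul_le _ _).trans (mul_le_mul (hb u) (norm_phi_sub_one_le hm hb u s)
            (norm_nonneg _) hL)
      _ ≤ L * (L * Real.exp (L * |t - s|) * |t - s|) := by gcongr
      _ = _ := by ring
  refine (intervalIntegral.norm_integral_le_of_norm_le_const this).trans (le_of_eq ?_)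
  ring

theorem phi_sub_phi_right (hm : StronglyMeasurable A) (hb : ∀ u, ‖A u‖ ≤ L) (t s s' : ℝ) :
    Phi A t s - Phi A t s' = Phi A t s' * (Phi A s' s - 1) := by
  rw [mul_sub, phi_mul_phi hm hb, mul_one]

theorem continuous_phi_right (hm : StronglyMeasurable A) (hb : ∀ u, ‖A u‖ ≤ L) (t : ℝ) :
    Continuous fun s => Phi A t s := by
  refine continuous_iff_continuousAt.2 fun s₀ => ?_
  rw [ContinuousAt, tendsto_iff_norm_sub_tendsto_zero]
  have h : Tendsto (fun s => Real.exp (L * |t - s₀|) *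
      (L * Real.exp (L * |s₀ - s|) * |s₀ - s|)) (𝓝 s₀) (𝓝 0) := by
    have : Continuous fun s => Real.exp (L * |t - s₀|) *
      (L * Real.exp (L * |s₀ - s|) * |s₀ - s|) := by fun_prop
    simpa using this.tendsto s₀
  refine squeeze_zero (fun _ => norm_nonneg _) (fun s => ?_) h
  rw [phi_sub_phi_right hm hb]
  exact (norm_mul_le _ _).trans (mul_le_mul (norm_phi_le hm hb _ _)
    (norm_phi_sub_one_le hm hb _ _) (norm_nonneg _) (Real.exp_pos _).le)

theorem continuous_phi_uncurry (hm : StronglyMeasurable A) (hb : ∀ u, ‖A u‖ ≤ L) :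
    Continuous fun p : ℝ × ℝ => Phi A p.1 p.2 := by
  have h : (fun p : ℝ × ℝ => Phi A p.1 p.2) = fun p => Phi A p.1 0 * Phi A 0 p.2 :=
    funext fun p => (phi_mul_phi hm hb _ 0 _).symm
  rw [h]
  exact ((continuous_phi hm hb 0).comp continuous_fst).mul
    ((continuous_phi_right hm hb 0).comp continuous_snd)

theorem intervalIntegrable_norm_sub (hm : StronglyMeasurable A) (hb : ∀ u, ‖A u‖ ≤ L)
    (hm' : StronglyMeasurable A') (hb' : ∀ u, ‖A' u‖ ≤ L) (a b : ℝ) :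
    IntervalIntegrable (fun u => ‖A u - A' u‖) volume a b := by
  refine (intervalIntegrable_const (c := L + L)).mono_fun (hm.sub hm').norm.aestronglyMeasurable
    (ae_of_all _ fun u => ?_)
  simp only [norm_norm]
  exact (norm_sub_le _ _).trans ((add_le_add (hb u) (hb' u)).trans (le_abs_self _))

/-- The difference solves the linear system with forcing `(A - A') Φ'`, and Gronwall's inequality
applies. Only the `L¹` distance of the coefficients enters, which is what Lebesgue points control in
the blow-up argument. -/
theorem norm_phi_sub_phi_le (hm : StronglyMeasurable A) (hb : ∀ u, ‖A u‖ ≤ L)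
    (hm' : StronglyMeasurable A') (hb' : ∀ u, ‖A' u‖ ≤ L) (t s : ℝ) :
    ‖Phi A t s - Phi A' t s‖ ≤
      Real.exp (L * |t - s|) ^ 2 * |∫ u in s..t, ‖A u - A' u‖| := by
  have hL := nonneg_of_bdd hb
  have hc := continuous_phi hm hb s
  have hc' := continuous_phi hm' hb' s
  have hi := intervalIntegrable_norm_sub hm hb hm' hb'
  have := gronwall (f := fun u => ‖Phi A u s - Phi A' u s‖) (hc.sub hc').norm
    (a := Real.exp (L * |t - s|) * |∫ u in s..t, ‖A u - A' u‖|) (s := s) (t := t) hL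
    (fun u hu => ?_) (fun _ => norm_nonneg _)
  · refine this.trans (le_of_eq ?_)
    ring
  have h1 : Phi A u s - Phi A' u s =
      (∫ v in s..u, (A v - A' v) * Phi A' v s) + ∫ v in s..u, A v * (Phi A v s - Phi A' v s) := by
    have e1 := phi_sub_phi hm hb s u s
    have e2 := phi_sub_phi hm' hb' s u s
    rw [phi_self hm hb] at e1
    rw [phi_self hm' hb'] at e2
    have e3 : Phi A u s - Phi A' u s = (Phi A u s - 1) - (Phi A' u s - 1) := by abel
    have i1 : IntervalIntegrable (fun v => A v * Phi A' v s) volume s u :=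
      (isCaratheodory_linear hm hb).intervalIntegrable hc' _ _
    have i2 := intervalIntegrable_mul_phi hm hb s s u
    have i3 := intervalIntegrable_mul_phi hm' hb' s s u
    simp_rw [sub_mul, mul_sub]
    rw [intervalIntegral.integral_sub i1 i3, intervalIntegral.integral_sub i2 i1, e3, e1, e2]
    abel
  have hus := abs_sub_left_of_mem_uIcc hu
  have h2 : ‖∫ v in s..u, (A v - A' v) * Phi A' v s‖ ≤
      Real.exp (L * |t - s|) * |∫ u in s..t, ‖A u - A' u‖| := by
    refine (intervalIntegral.norm_integral_le_abs_of_norm_le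
      (g := fun v => Real.exp (L * |t - s|) * ‖A v - A' v‖) ?_ ((hi s u).const_mul _)).trans ?_
    · refine (ae_restrict_iff' measurableSet_uIoc).2 (ae_of_all _ fun v hv => ?_)
      refine (norm_mul_le _ _).trans ?_
      rw [mul_comm]
      gcongr
      refine (norm_phi_le hm' hb' v s).trans ?_
      exact Real.exp_le_exp.2 (mul_le_mul_of_nonneg_left
        ((abs_sub_left_of_mem_uIcc (uIoc_subset_uIcc hv)).trans hus) hL)
    · rw [intervalIntegral.integral_const_mul, abs_mul, abs_of_pos (Real.exp_pos _)]
      refine mul_le_mul_of_nonneg_left ?_ (Real.exp_pos _).le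
      refine intervalIntegral.abs_integral_mono_interval ?_ (ae_of_all _ fun v => norm_nonneg _)
        (hi s t)
      exact uIoc_subset_uIoc_of_uIcc_subset_uIcc (uIcc_subset_uIcc left_mem_uIcc hu)
  have h3 : ‖∫ v in s..u, A v * (Phi A v s - Phi A' v s)‖ ≤
      L * |∫ v in s..u, ‖Phi A v s - Phi A' v s‖| := by
    refine (intervalIntegral.norm_integral_le_abs_of_norm_le
      (g := fun v => L * ‖Phi A v s - Phi A' v s‖) (ae_of_all _ fun v => ?_)
      (Continuous.intervalIntegrable ((hc.sub hc').norm.const_mul L) _ _)).trans ?_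
    · exact (norm_mul_le _ _).trans (by gcongr; exact hb v)
    · rw [intervalIntegral.integral_const_mul, abs_mul, abs_of_nonneg hL]
  change ‖Phi A u s - Phi A' u s‖ ≤ _
  conv_lhs => rw [h1]
  exact (norm_add_le _ _).trans (add_le_add h2 h3)

/-- By `IsSubdiag.dil_conj`, conjugation with the dilation produces exactly the factor `r ^ 2` of
the time change, so both sides solve the same equation. -/
theorem phi_rescale (hm : StronglyMeasurable A) (hb : ∀ u, ‖A u‖ ≤ L) (hs : ∀ u, IsSubdiag (A u))
    {r : ℝ} (hr : 0 < r) (c t s : ℝ) :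
    Phi (fun u => A (c + r ^ 2 * u)) t s =
      dil r⁻¹ * Phi A (c + r ^ 2 * t) (c + r ^ 2 * s) * dil r := by
  have hm' : StronglyMeasurable fun u => A (c + r ^ 2 * u) :=
    hm.comp_measurable (by fun_prop)
  have h := eq_phi_mul hm' (fun u => hb _) (s := s) (C := 1)
    (Ψ := fun t => dil r⁻¹ * Phi A (c + r ^ 2 * t) (c + r ^ 2 * s) * dil r)
    (((continuous_const).mul ((continuous_phi hm hb _).comp (by fun_prop))).mul continuous_const)
    (fun t => ?_) t
  · rw [mul_one] at h
    exact h.symm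
  · have h1 := phi_sub_phi hm hb (c + r ^ 2 * s) (c + r ^ 2 * t) (c + r ^ 2 * s)
    rw [phi_self hm hb, ← intervalIntegral.smul_integral_comp_add_mul] at h1
    have h2 : Phi A (c + r ^ 2 * t) (c + r ^ 2 * s) = 1 + r ^ 2 • ∫ u in s..t,
        A (c + r ^ 2 * u) * Phi A (c + r ^ 2 * u) (c + r ^ 2 * s) := by
      rw [← h1]; abel
    have hi : IntervalIntegrable
        (fun u => A (c + r ^ 2 * u) * Phi A (c + r ^ 2 * u) (c + r ^ 2 * s)) volume s t :=
      (isCaratheodory_linear hm' (fun u => hb _)).intervalIntegrable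
        ((continuous_phi hm hb _).comp (by fun_prop)) _ _
    have h3 : ∀ u, A (c + r ^ 2 * u) * (dil r⁻¹ * Phi A (c + r ^ 2 * u) (c + r ^ 2 * s) * dil r) =
        r ^ 2 • (dil r⁻¹ * (A (c + r ^ 2 * u) * Phi A (c + r ^ 2 * u) (c + r ^ 2 * s)) * dil r) := by
      intro u
      simp only [← mul_assoc]
      rw [(hs _).dil_conj, smul_mul_assoc, smul_mul_assoc, smul_smul, mul_inv_cancel₀ (by positivity),
        one_smul]
    simp_rw [h3]
    rw [intervalIntegral.integral_smul, integral_mul_matrix, integral_matrix_mul hi]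
    · conv_lhs => rw [h2, mul_add, add_mul, mul_one, dil_inv_mul hr.ne', mul_smul_comm,
        smul_mul_assoc]
    · exact ⟨(ContinuousLinearMap.mul ℝ (Mat n d) (dil r⁻¹)).integrable_comp hi.1,
        (ContinuousLinearMap.mul ℝ (Mat n d) (dil r⁻¹)).integrable_comp hi.2⟩

end Resolvent

/-- Bounded measurable curves of subdiagonal matrices whose nonzero blocks take values in given
sets. -/
structure IsCurve (L : ℝ) (𝓔 : Fin n → Set (Matrix (Fin d) (Fin d) ℝ)) (A : ℝ → Mat n d) :
    Prop where
  meas : StronglyMeasurable A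
  bdd : ∀ u, ‖A u‖ ≤ L
  sub : ∀ u, IsSubdiag (A u)
  nondeg : ∀ u (i j : Fin n), j.val + 1 = i.val → (Matrix.of fun k l => A u (i, k) (j, l)) ∈ 𝓔 j

/-! ### Uniform nondegeneracy: energy of adjoint trajectories. -/

section Nondegeneracy

variable {L : ℝ} {𝓔 : Fin n → Set (Matrix (Fin d) (Fin d) ℝ)} {A : ℝ → Mat n d}

theorem IsCurve.comp_affine (hA : IsCurve L 𝓔 A) (c e : ℝ) : IsCurve L 𝓔 fun u => A (c + e * u) where
  meas := hA.meas.comp_measurable (by fun_prop)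
  bdd _ := hA.bdd _
  sub _ := hA.sub _
  nondeg _ := hA.nondeg _

theorem IsCurve.intervalIntegrable (hA : IsCurve L 𝓔 A) (a b : ℝ) :
    IntervalIntegrable A volume a b :=
  (intervalIntegrable_const (c := L)).mono_fun hA.meas.aestronglyMeasurable
    (ae_of_all _ fun u => (hA.bdd u).trans (le_abs_self _))

theorem exists_forall_le_of_finite {ι : Type*} [Finite ι] {δ : ι → ℝ} (h : ∀ i, 0 < δ i) :
    ∃ x : ℝ, 0 < x ∧ ∀ i, x ≤ δ i := by
  have h1 : ∀ᶠ x in 𝓝[>] (0 : ℝ), ∀ i, x ≤ δ i :=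
    eventually_all.2 fun i => eventually_nhdsWithin_of_eventually_nhds
      ((eventually_lt_nhds (h i)).mono fun _ hx => hx.le)
  obtain ⟨x, hx, hx0⟩ := (h1.and self_mem_nhdsWithin).exists
  exact ⟨x, hx0, hx⟩

/-- The elements of `𝓔 j` with entries bounded by `L` form a compact set of invertible matrices, on
which inversion is continuous and therefore bounded; there are finitely many `j`. -/
theorem exists_inverse_bound (h𝓔 : IsNondegenerateFamily 𝓔) (L : ℝ) :
    ∃ m : ℝ, 0 < m ∧ ∀ j, ∀ M ∈ 𝓔 j, (∀ k l, |M k l| ≤ L) → ∀ (w : Fin d → ℝ) l,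
      |w l| ≤ m * ∑ k, |(Mᵀ *ᵥ w) k| := by
  have h : ∀ j, ∃ m : ℝ, 0 < m ∧ ∀ M ∈ 𝓔 j, (∀ k l, |M k l| ≤ L) → ∀ k l, |M⁻¹ k l| ≤ m := by
    intro j
    obtain ⟨hc, -, hu⟩ := h𝓔 j
    set S : Set (Matrix (Fin d) (Fin d) ℝ) := 𝓔 j ∩ {M | ∀ k l, M k l ∈ Icc (-L) L} with hS
    have hcomp : IsCompact S := by
      have h1 : IsCompact (univ.pi fun _ : Fin d => univ.pi fun _ : Fin d => Icc (-L) L) :=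
        isCompact_univ_pi fun _ => isCompact_univ_pi fun _ => isCompact_Icc
      have h2 : Continuous fun f : Fin d → Fin d → ℝ => (Matrix.of f : Matrix (Fin d) (Fin d) ℝ) :=
        continuous_matrix fun k l => (continuous_apply l).comp (continuous_apply k)
      refine (h1.image h2).of_isClosed_subset (hc.inter ?_) fun M hM =>
        ⟨fun k l => M k l, fun k _ l _ => hM.2 k l, rfl⟩
      have h3 : {M : Matrix (Fin d) (Fin d) ℝ | ∀ k l, M k l ∈ Icc (-L) L} =
          ⋂ k, ⋂ l, (fun M : Matrix (Fin d) (Fin d) ℝ => M k l) ⁻¹' Icc (-L) L := by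
        ext M; simp
      rw [h3]
      exact isClosed_iInter fun k => isClosed_iInter fun l =>
        isClosed_Icc.preimage (continuous_id.matrix_elem k l)
    have hcont : ContinuousOn (fun M : Matrix (Fin d) (Fin d) ℝ => M⁻¹) S := by
      intro M hM
      have hdet : M.det ≠ 0 := ((Matrix.isUnit_iff_isUnit_det M).1 (hu M hM.1)).ne_zero
      simp only [Matrix.inv_def, Ring.inverse_eq_inv']
      exact ((ContinuousAt.inv₀ (by fun_prop) hdet).smul
        (continuous_id.matrix_adjugate.continuousAt)).continuousWithinAt
    have h3 : ∀ k l, ∃ C : ℝ, ∀ M ∈ S, |M⁻¹ k l| ≤ C := fun k l =>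
      hcomp.exists_bound_of_continuousOn
        (((continuous_apply l).comp (continuous_apply k)).comp_continuousOn hcont)
    choose C hC using h3
    refine ⟨∑ k, ∑ l, |C k l| + 1, by positivity, fun M hM hML k l => ?_⟩
    refine (hC k l M ⟨hM, fun k l => abs_le.1 (hML k l)⟩).trans ((le_abs_self _).trans ?_)
    have h4 : |C k l| ≤ ∑ l, |C k l| :=
      Finset.single_le_sum (f := fun l => |C k l|) (fun _ _ => abs_nonneg _) (Finset.mem_univ l)
    have h5 : ∑ l, |C k l| ≤ ∑ k, ∑ l, |C k l| :=
      Finset.single_le_sum (f := fun k => ∑ l, |C k l|) (fun _ _ => by positivity)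
        (Finset.mem_univ k)
    linarith
  choose m hm0 hm using h
  refine ⟨∑ j, m j + 1, add_pos_of_nonneg_of_pos (Finset.sum_nonneg fun j _ => (hm0 j).le) one_pos, fun j M hM hML w l => ?_⟩
  have hdet : IsUnit M.det := (Matrix.isUnit_iff_isUnit_det M).1 ((h𝓔 j).2.2 M hM)
  have hw : w = (M⁻¹)ᵀ *ᵥ (Mᵀ *ᵥ w) := by
    rw [Matrix.mulVec_mulVec, ← Matrix.transpose_mul, Matrix.mul_nonsing_inv M hdet]
    simp
  have h1 : w l = ∑ k, M⁻¹ k l * (Mᵀ *ᵥ w) k := by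
    conv_lhs => rw [hw]
    rfl
  rw [h1, Finset.mul_sum]
  refine (Finset.abs_sum_le_sum_abs _ _).trans (Finset.sum_le_sum fun k _ => ?_)
  rw [abs_mul]
  gcongr
  refine (hm j M hM hML k l).trans ?_
  have : m j ≤ ∑ j, m j :=
    Finset.single_le_sum (f := m) (fun j _ => (hm0 j).le) (Finset.mem_univ j)
  linarith

/-- The adjoint trajectory that is at `ξ` at time `b`. -/
def adjTraj (A : ℝ → Mat n d) (b : ℝ) (ξ : Sp n d) (u : ℝ) : Sp n d := act (Phi A b u)ᵀ ξ

theorem adjTraj_self (hA : IsCurve L 𝓔 A) (b : ℝ) (ξ : Sp n d) : adjTraj A b ξ b = ξ := by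
  rw [adjTraj, phi_self hA.meas hA.bdd, Matrix.transpose_one, act_one]

theorem continuous_adjTraj (hA : IsCurve L 𝓔 A) (b : ℝ) (ξ : Sp n d) :
    Continuous (adjTraj A b ξ) :=
  continuous_act_uncurry.comp (((continuous_phi_right hA.meas hA.bdd b).matrix_transpose).prodMk
    continuous_const)

theorem adjTraj_sub (hA : IsCurve L 𝓔 A) (b : ℝ) (ξ : Sp n d) (a u : ℝ) :
    adjTraj A b ξ a - adjTraj A b ξ u = act (Phi A u a - 1)ᵀ (adjTraj A b ξ u) := by
  rw [adjTraj, adjTraj, ← sub_act, ← Matrix.transpose_sub,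
    phi_sub_phi_right hA.meas hA.bdd, Matrix.transpose_mul, act_mul]

theorem norm_adjTraj_le (hA : IsCurve L 𝓔 A) {b : ℝ} {ξ : Sp n d} (hξ : ‖ξ‖ ≤ 1) {u : ℝ}
    (hu : u ∈ Icc (b - 1 / 2) b) : ‖adjTraj A b ξ u‖ ≤ Real.exp L := by
  have hL := nonneg_of_bdd hA.bdd
  refine (norm_act_le _ _).trans ?_
  rw [norm_transpose]
  have h1 := norm_phi_le hA.meas hA.bdd b u
  have h2 : Real.exp (L * |b - u|) ≤ Real.exp L := by
    apply Real.exp_le_exp.2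
    rw [abs_of_nonneg (by linarith [hu.2])]
    nlinarith [hu.1, hu.2]
  calc _ ≤ Real.exp L * 1 := mul_le_mul (h1.trans h2) hξ (norm_nonneg _) (Real.exp_pos _).le
    _ = _ := mul_one _

theorem exp_le_of_mem (hL : 0 ≤ L) {b u a : ℝ} (hu : u ∈ Icc (b - 1 / 2) b)
    (ha : a ∈ Icc (b - 1 / 2) b) : Real.exp (L * |u - a|) ≤ Real.exp L := by
  apply Real.exp_le_exp.2
  have : |u - a| ≤ 1 := by rw [abs_le]; constructor <;> linarith [hu.1, hu.2, ha.1, ha.2]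
  nlinarith

theorem norm_adjTraj_sub_le (hA : IsCurve L 𝓔 A) {b : ℝ} {ξ : Sp n d} (hξ : ‖ξ‖ ≤ 1) {a u : ℝ}
    (ha : a ∈ Icc (b - 1 / 2) b) (hu : u ∈ Icc (b - 1 / 2) b) :
    ‖adjTraj A b ξ a - adjTraj A b ξ u‖ ≤ L * Real.exp L ^ 2 * |u - a| := by
  have hL := nonneg_of_bdd hA.bdd
  rw [adjTraj_sub hA]
  refine (norm_act_le _ _).trans ?_
  rw [norm_transpose]
  calc _ ≤ (L * Real.exp L * |u - a|) * Real.exp L := by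
        refine mul_le_mul ((norm_phi_sub_one_le hA.meas hA.bdd u a).trans ?_)
          (norm_adjTraj_le hA hξ hu) (norm_nonneg _) (by positivity)
        have := exp_le_of_mem hL hu ha
        gcongr
    _ = _ := by ring

/-- Since `A` is subdiagonal, its transposed integral maps block `m + 1` into block `m`: up to a
quadratic error, the increment of block `m` reveals block `m + 1`. -/
theorem norm_adjTraj_sub_sub_le (hA : IsCurve L 𝓔 A) {b : ℝ} {ξ : Sp n d} (hξ : ‖ξ‖ ≤ 1) {a u : ℝ}
    (ha : a ∈ Icc (b - 1 / 2) b) (hu : u ∈ Icc (b - 1 / 2) b) :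
    ‖adjTraj A b ξ a - adjTraj A b ξ u - act (∫ v in a..u, A v)ᵀ (adjTraj A b ξ u)‖ ≤
      L ^ 2 * Real.exp L ^ 2 * |u - a| ^ 2 := by
  have hL := nonneg_of_bdd hA.bdd
  rw [adjTraj_sub hA, ← sub_act, ← Matrix.transpose_sub]
  refine (norm_act_le _ _).trans ?_
  rw [norm_transpose]
  calc _ ≤ (L ^ 2 * Real.exp L * |u - a| ^ 2) * Real.exp L := by
        refine mul_le_mul ((norm_phi_sub_one_sub_le hA.meas hA.bdd u a).trans ?_)
          (norm_adjTraj_le hA hξ hu) (norm_nonneg _) (by positivity)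
        have := exp_le_of_mem hL hu ha
        gcongr
    _ = _ := by ring

/-- The time averages of a block of a curve stay in the closed convex set. -/
theorem exists_average_mem (h𝓔 : IsNondegenerateFamily 𝓔) (hA : IsCurve L 𝓔 A) {a u : ℝ}
    (hau : a ≠ u) {i j : Fin n} (hij : j.val + 1 = i.val) :
    ∃ M ∈ 𝓔 j, (∀ k l, |M k l| ≤ L) ∧ ∀ k l, (∫ v in a..u, A v) (i, k) (j, l) = (u - a) * M k l := by
  obtain ⟨hc, hconv, -⟩ := h𝓔 j
  have key : ∀ a u : ℝ, a < u → ∃ M ∈ 𝓔 j, (∀ k l, |M k l| ≤ L) ∧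
      ∀ k l, (∫ v in a..u, A v) (i, k) (j, l) = (u - a) * M k l := by
    intro a u hau
    set P : Mat n d →L[ℝ] Matrix (Fin d) (Fin d) ℝ := LinearMap.toContinuousLinearMap
      { toFun := fun M => Matrix.of fun k l => M (i, k) (j, l)
        map_add' := fun M M' => by ext; simp
        map_smul' := fun c M => by ext; simp } with hP
    have hPa : ∀ M k l, P M k l = M (i, k) (j, l) := fun M k l => rfl
    have hi : IntegrableOn A (Ioc a u) := (hA.intervalIntegrable a u).1
    have hvol : volume (Ioc a u) ≠ 0 := by simp [hau]
    -- An average lies in every closed convex set that contains the values; here also in a ball, so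
    -- that the entries of the average remain bounded by `L`.
    have h1 : (⨍ v in Ioc a u, A v) ∈ {M : Mat n d | P M ∈ 𝓔 j ∧ ‖M‖ ≤ L} := by
      refine Convex.set_average_mem (μ := volume) ?_ ?_ hvol (by simp)
        (ae_of_all _ fun v => ⟨hA.nondeg v i j hij, hA.bdd v⟩) hi
      · have h2 := (hconv.linear_preimage (P : Mat n d →ₗ[ℝ] _)).inter
          (convex_closedBall (0 : Mat n d) L)
        have h3 : {M : Mat n d | P M ∈ 𝓔 j ∧ ‖M‖ ≤ L} = (P : Mat n d →ₗ[ℝ] _) ⁻¹' 𝓔 j ∩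
            Metric.closedBall 0 L := by
          refine Set.ext fun M => ?_
          rw [mem_inter_iff, mem_closedBall_zero_iff]
          rfl
        rwa [h3]
      · exact (hc.preimage P.continuous).inter (isClosed_le continuous_norm continuous_const)
    have h3 : ∫ v in a..u, A v = (u - a) • ⨍ v in Ioc a u, A v := by
      rw [setAverage_eq, intervalIntegral.integral_of_le hau.le, smul_smul]
      simp [hau.le, sub_ne_zero.2 hau.ne']
    refine ⟨P (⨍ v in Ioc a u, A v), h1.1, fun k l => ?_, fun k l => ?_⟩
    · rw [hPa]
      exact (abs_apply_le _ _ _).trans h1.2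
    · rw [h3, hPa, Matrix.smul_apply, smul_eq_mul]
  rcases lt_or_gt_of_ne hau with h | h
  · exact key a u h
  · obtain ⟨M, hM, hML, hMe⟩ := key u a h
    refine ⟨M, hM, hML, fun k l => ?_⟩
    rw [intervalIntegral.integral_symm, Matrix.neg_apply, hMe]
    ring

/-- The window has length `1 / 2`, so at least one side of `u` has room for a step `h ≤ 1 / 4`. -/
theorem exists_mem_Icc_dist {b u h : ℝ} (hu : u ∈ Icc (b - 1 / 2) b) (h0 : 0 < h) (h1 : h ≤ 1 / 4) :
    ∃ a ∈ Icc (b - 1 / 2) b, |u - a| = h := by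
  rcases le_total u (b - 1 / 4) with hu' | hu'
  · refine ⟨u + h, ⟨by linarith [hu.1], by linarith⟩, ?_⟩
    rw [sub_add_cancel_left, abs_neg, abs_of_pos h0]
  · refine ⟨u - h, ⟨by linarith, by linarith [hu.2]⟩, ?_⟩
    rw [sub_sub_cancel, abs_of_pos h0]

/-- The energy of the first block of the adjoint trajectory over a time interval of length
`1 / 2`. -/
def energy [NeZero n] (A : ℝ → Mat n d) (b : ℝ) (ξ : Sp n d) : ℝ :=
  ∫ u in (b - 1 / 2)..b, ∑ k, adjTraj A b ξ u (0, k) ^ 2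

/-- Quantitative Kalman condition, by induction on the block. A Lipschitz function with small `L²`
norm is small, which settles block `0`. If block `m` is uniformly small, so are its increments over
a time `h`; they equal `h Mᵀ` times block `m + 1` up to `O(h ^ 2)`, with `M ∈ 𝓔 m` boundedly
invertible. -/
theorem adjTraj_small [NeZero n] (h𝓔 : IsNondegenerateFamily 𝓔) (L : ℝ) (m : ℕ) (hmn : m < n) :
    ∀ ε : ℝ, 0 < ε → ∃ δ : ℝ, 0 < δ ∧ ∀ (A : ℝ → Mat n d) (b : ℝ) (ξ : Sp n d), IsCurve L 𝓔 A →
      ‖ξ‖ ≤ 1 → energy A b ξ ≤ δ → ∀ u ∈ Icc (b - 1 / 2) b, ∀ k, |adjTraj A b ξ u (⟨m, hmn⟩, k)| ≤ ε := by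
  induction m with
  | zero =>
    intro ε hε
    -- Within time `h` the adjoint trajectory moves by at most `ε / 2`.
    obtain ⟨h, h0, h1, h2⟩ : ∃ h : ℝ, 0 < h ∧ h ≤ 1 / 4 ∧ |L| * Real.exp L ^ 2 * h ≤ ε / 2 := by
      have hp : 0 < 2 * (|L| * Real.exp L ^ 2 + 1) := by positivity
      refine ⟨min (1 / 4) (ε / (2 * (|L| * Real.exp L ^ 2 + 1))), by positivity, min_le_left _ _, ?_⟩
      have h3 := min_le_right (1 / 4) (ε / (2 * (|L| * Real.exp L ^ 2 + 1)))
      have h4 : 0 ≤ |L| * Real.exp L ^ 2 := by positivity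
      calc _ ≤ (|L| * Real.exp L ^ 2 + 1) * (ε / (2 * (|L| * Real.exp L ^ 2 + 1))) :=
            mul_le_mul (by linarith) h3 (by positivity) (by positivity)
        _ = ε / 2 := by field_simp
    -- A value above `ε` would keep the coordinate above `ε / 2` during a time `h`, hence produce an
    -- energy of at least `h (ε / 2) ^ 2`, twice the allowed amount.
    refine ⟨h * (ε / 2) ^ 2 / 2, by positivity, fun A b ξ hA hξ he u hu k => ?_⟩
    by_contra! hcon
    have hL := nonneg_of_bdd hA.bdd
    rw [abs_of_nonneg hL] at h2
    set f : ℝ → ℝ := fun u => ∑ k, adjTraj A b ξ u (0, k) ^ 2 with hf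
    have hcoord : ∀ a, Continuous fun u => adjTraj A b ξ u a := fun a =>
      (EuclideanSpace.proj (𝕜 := ℝ) a).continuous.comp (continuous_adjTraj hA b ξ)
    have hfc : Continuous f := continuous_finsetSum _ fun k _ => (hcoord _).pow 2
    have hlow : ∀ v ∈ Icc (b - 1 / 2) b, |u - v| ≤ h → (ε / 2) ^ 2 ≤ f v := by
      intro v hv huv
      have h3 := norm_adjTraj_sub_le hA hξ hv hu
      have h4 := (PiLp.norm_apply_le (adjTraj A b ξ v - adjTraj A b ξ u) (0, k)).trans h3
      have h5 : L * Real.exp L ^ 2 * |u - v| ≤ ε / 2 := le_trans (by gcongr) h2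
      have h6 : ε / 2 ≤ |adjTraj A b ξ v (0, k)| := by
        have h7 : ε < |adjTraj A b ξ u (0, k)| := hcon
        rw [PiLp.sub_apply, Real.norm_eq_abs, abs_sub_comm] at h4
        have := abs_sub_abs_le_abs_sub (adjTraj A b ξ u (0, k)) (adjTraj A b ξ v (0, k))
        linarith
      calc (ε / 2) ^ 2 ≤ adjTraj A b ξ v (0, k) ^ 2 := by
            rw [← sq_abs (adjTraj A b ξ v (0, k))]; gcongr
        _ ≤ f v := Finset.single_le_sum (f := fun k => adjTraj A b ξ v (0, k) ^ 2)
            (fun _ _ => sq_nonneg _) (Finset.mem_univ k)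
    obtain ⟨a, ha, hua⟩ := exists_mem_Icc_dist hu h0 h1
    have hsub : uIcc a u ⊆ Icc (b - 1 / 2) b := by
      rw [uIcc]; exact Icc_subset_Icc (le_min ha.1 hu.1) (max_le ha.2 hu.2)
    have hf0 : ∀ v, 0 ≤ f v := fun v => by positivity
    have h8 : |∫ v in a..u, f v| ≤ |∫ v in (b - 1 / 2)..b, f v| := by
      refine intervalIntegral.abs_integral_mono_interval ?_ (ae_of_all _ hf0)
        (hfc.intervalIntegrable _ _)
      apply uIoc_subset_uIoc_of_uIcc_subset_uIcc
      rwa [uIcc_of_le (by linarith : b - 1 / 2 ≤ b)]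
    have h9 : h * (ε / 2) ^ 2 ≤ |∫ v in a..u, f v| := by
      have h10 : ∀ v ∈ uIcc a u, |u - v| ≤ h := fun v hv => by
        rw [← hua]; exact abs_sub_right_of_mem_uIcc hv
      rcases le_total a u with hau | hau
      · have h11 := intervalIntegral.integral_mono_on hau
          (intervalIntegrable_const (μ := volume) (c := (ε / 2) ^ 2)) (hfc.intervalIntegrable _ _)
          (fun v hv => hlow v (hsub (by rwa [uIcc_of_le hau])) (h10 v (by rwa [uIcc_of_le hau])))
        rw [intervalIntegral.integral_const, smul_eq_mul] at h11
        rw [abs_of_nonneg (by linarith)] at hua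
        rw [← hua]
        exact h11.trans (le_abs_self _)
      · have h11 := intervalIntegral.integral_mono_on hau
          (intervalIntegrable_const (μ := volume) (c := (ε / 2) ^ 2)) (hfc.intervalIntegrable _ _)
          (fun v hv => hlow v (hsub (by rwa [uIcc_of_ge hau])) (h10 v (by rwa [uIcc_of_ge hau])))
        rw [intervalIntegral.integral_const, smul_eq_mul] at h11
        rw [abs_of_nonpos (by linarith)] at hua
        rw [← hua, intervalIntegral.integral_symm, abs_neg, neg_sub]
        exact h11.trans (le_abs_self _)
    have h12 : |∫ v in (b - 1 / 2)..b, f v| = energy A b ξ :=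
      abs_of_nonneg (intervalIntegral.integral_nonneg (by linarith) fun v _ => hf0 v)
    have : 0 < h * (ε / 2) ^ 2 := by positivity
    linarith
  | succ m ih =>
    intro ε hε
    have hmn' : m < n := by omega
    obtain ⟨q, hq0, hq⟩ := exists_inverse_bound h𝓔 L
    set D : ℝ := (d : ℝ) with hD
    have hD0 : (0 : ℝ) ≤ D := Nat.cast_nonneg _
    -- First `h` is fixed so that the quadratic remainder, divided by `h` and amplified by the
    -- inverse, costs at most `ε / 2`. Only then is the preceding block required to be small, to
    -- order `ε h`.
    obtain ⟨h, h0, h1, h2⟩ : ∃ h : ℝ, 0 < h ∧ h ≤ 1 / 4 ∧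
        q * D * (L ^ 2 * Real.exp L ^ 2) * h ≤ ε / 2 := by
      set Q := q * D * (L ^ 2 * Real.exp L ^ 2) with hQ
      have h4 : 0 ≤ Q := by positivity
      refine ⟨min (1 / 4) (ε / (2 * (Q + 1))), by positivity, min_le_left _ _, ?_⟩
      have h3 := min_le_right (1 / 4) (ε / (2 * (Q + 1)))
      calc _ ≤ (Q + 1) * (ε / (2 * (Q + 1))) :=
            mul_le_mul (by linarith) h3 (by positivity) (by positivity)
        _ = ε / 2 := by field_simp
    obtain ⟨δ, hδ0, hδ⟩ := ih hmn' (ε * h / (4 * (q * D + 1))) (by positivity)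
    refine ⟨δ, hδ0, fun A b ξ hA hξ he u hu k => ?_⟩
    have hsm := hδ A b ξ hA hξ he
    obtain ⟨a, ha, hua⟩ := exists_mem_Icc_dist hu h0 h1
    have hau : a ≠ u := by
      rintro rfl
      simp at hua
      linarith
    obtain ⟨M, hM, hML, hMe⟩ := exists_average_mem h𝓔 hA hau (i := ⟨m + 1, hmn⟩) (j := ⟨m, hmn'⟩) rfl
    have hrem := norm_adjTraj_sub_sub_le hA hξ ha hu
    set w : Fin d → ℝ := fun l => adjTraj A b ξ u (⟨m + 1, hmn⟩, l) with hw
    have hIs : IsSubdiag (∫ v in a..u, A v) := by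
      intro x y hxy
      rw [integral_apply (hA.intervalIntegrable _ _)]
      simp [hA.sub _ x y hxy]
    have hact : ∀ l, act (∫ v in a..u, A v)ᵀ (adjTraj A b ξ u) (⟨m, hmn'⟩, l) =
        (u - a) * (Mᵀ *ᵥ w) l := by
      intro l
      rw [act_apply, Fintype.sum_prod_type, Finset.sum_eq_single ⟨m + 1, hmn⟩]
      · simp only [Matrix.transpose_apply, hMe, Matrix.mulVec, dotProduct, Finset.mul_sum, hw]
        exact Finset.sum_congr rfl fun _ _ => by ring
      · intro x _ hx
        refine Finset.sum_eq_zero fun y _ => ?_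
        rw [Matrix.transpose_apply, hIs, zero_mul]
        intro h
        exact hx (Fin.ext h.symm)
      · simp
    have hbd : ∀ l, h * |(Mᵀ *ᵥ w) l| ≤ 2 * (ε * h / (4 * (q * D + 1))) +
        L ^ 2 * Real.exp L ^ 2 * h ^ 2 := by
      intro l
      have h3 := (PiLp.norm_apply_le _ (⟨m, hmn'⟩, l)).trans hrem
      rw [PiLp.sub_apply, PiLp.sub_apply, hact, hua, Real.norm_eq_abs] at h3
      have h4 := hsm u hu l
      have h5 := hsm a ha l
      have h6 : h * |(Mᵀ *ᵥ w) l| = |(u - a) * (Mᵀ *ᵥ w) l| := by rw [abs_mul, hua]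
      rw [h6]
      rw [abs_le] at *
      constructor <;> linarith [h3.1, h3.2, h4.1, h4.2, h5.1, h5.2]
    have h7 := hq _ M hM hML w k
    have h8 : ∑ k, |(Mᵀ *ᵥ w) k| ≤ D * (2 * (ε / (4 * (q * D + 1))) + L ^ 2 * Real.exp L ^ 2 * h) := by
      have : ∀ k ∈ Finset.univ, |(Mᵀ *ᵥ w) k| ≤
          (2 * (ε / (4 * (q * D + 1))) + L ^ 2 * Real.exp L ^ 2 * h) := by
        intro k _
        have := hbd k
        refine le_of_mul_le_mul_left (this.trans (le_of_eq ?_)) h0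
        ring
      refine (Finset.sum_le_card_nsmul _ _ _ this).trans (le_of_eq ?_)
      simp [hD, mul_add]
    change |w k| ≤ ε
    have h9 : q * D * (2 * (ε / (4 * (q * D + 1)))) ≤ ε / 2 := by
      have h10 : 0 ≤ q * D := by positivity
      rw [show q * D * (2 * (ε / (4 * (q * D + 1)))) = (q * D / (q * D + 1)) * (ε / 2) by
        field_simp; ring]
      have : q * D / (q * D + 1) ≤ 1 := by rw [div_le_one (by positivity)]; linarith
      nlinarith
    calc |w k| ≤ q * ∑ k, |(Mᵀ *ᵥ w) k| := h7
      _ ≤ q * (D * (2 * (ε / (4 * (q * D + 1))) + L ^ 2 * Real.exp L ^ 2 * h)) := by gcongr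
      _ = q * D * (2 * (ε / (4 * (q * D + 1)))) + q * D * (L ^ 2 * Real.exp L ^ 2) * h := by ring
      _ ≤ ε := by linarith

/-- At the final time the trajectory is `ξ` itself. Small energy would make every coordinate of `ξ`
at most `1 / (n d + 1)`, which is too small for a unit vector. -/
theorem exists_energy_lower_bound [NeZero n] (h𝓔 : IsNondegenerateFamily 𝓔) (L : ℝ) :
    ∃ c : ℝ, 0 < c ∧ ∀ (A : ℝ → Mat n d) (b : ℝ) (ξ : Sp n d), IsCurve L 𝓔 A → ‖ξ‖ = 1 →
      c ≤ energy A b ξ := by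
  set ε : ℝ := 1 / ((n : ℝ) * d + 1) with hε
  have hε0 : 0 < ε := by positivity
  choose δ hδ0 hδ using fun i : Fin n => adjTraj_small h𝓔 L i.1 i.2 ε hε0
  obtain ⟨c, hc0, hc⟩ := exists_forall_le_of_finite hδ0
  refine ⟨c, hc0, fun A b ξ hA hξ => ?_⟩
  by_contra! hcon
  have h1 : ∀ a : Idx n d, |ξ a| ≤ ε := by
    rintro ⟨i, k⟩
    have := hδ i A b ξ hA hξ.le (hcon.le.trans (hc i)) b ⟨by linarith, le_rfl⟩ k
    rwa [adjTraj_self hA] at this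
  have h2 : ‖ξ‖ ^ 2 ≤ (n * d : ℝ) * ε ^ 2 := by
    rw [EuclideanSpace.norm_sq_eq]
    have : ∀ a ∈ Finset.univ, ‖ξ a‖ ^ 2 ≤ ε ^ 2 := fun a _ => by
      rw [Real.norm_eq_abs]; have := h1 a; gcongr
    refine (Finset.sum_le_card_nsmul _ _ _ this).trans (le_of_eq ?_)
    simp
  rw [hξ, one_pow, hε] at h2
  have h3 : (0 : ℝ) ≤ (n : ℝ) * d := by positivity
  have h4 : (n * d : ℝ) * (1 / ((n : ℝ) * d + 1)) ^ 2 < 1 := by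
    rw [div_pow, one_pow, mul_one_div, div_lt_one (by positivity)]
    nlinarith
  linarith

end Nondegeneracy

/-! ### The diffusion matrix, living in the first block. -/

section Source

theorem stronglyMeasurable_of_entries {f : ℝ → Mat n d} (h : ∀ a b, Measurable fun u => f u a b) :
    StronglyMeasurable f := by
  have h1 : f = fun u => ∑ a, ∑ b, f u a b • Matrix.single a b (1 : ℝ) := by
    funext u
    conv_lhs => rw [Matrix.matrix_eq_sum_single (f u)]
    simp
  rw [h1]
  exact Finset.stronglyMeasurable_fun_sum _ fun a _ => Finset.stronglyMeasurable_fun_sum _ fun b _ =>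
    (h a b).stronglyMeasurable.smul_const _

variable [NeZero n] {lam : ℝ} {ς : ℝ → Matrix (Fin d) (Fin d) ℝ}

/-- The diffusion matrix `B ς(u) B^*`. -/
def src (ς : ℝ → Matrix (Fin d) (Fin d) ℝ) (u : ℝ) : Mat n d :=
  embed n d * ς u * (embed n d)ᵀ

theorem src_apply (ς : ℝ → Matrix (Fin d) (Fin d) ℝ) (u : ℝ) (a b : Idx n d) :
    src ς u a b = if a.1 = 0 ∧ b.1 = 0 then ς u a.2 b.2 else 0 := by
  simp only [src, embed, Matrix.mul_apply, Matrix.of_apply, Matrix.transpose_apply]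
  by_cases ha : a.1 = 0 <;> by_cases hb : b.1 = 0 <;> simp [ha, hb]

theorem DiffusionAssumption.comp_affine (hς : DiffusionAssumption lam ς) (c e : ℝ) :
    DiffusionAssumption lam fun u => ς (c + e * u) where
  meas k l := (hς.meas k l).comp (by fun_prop)
  symm _ := hς.symm _
  lower _ := hς.lower _
  upper _ := hς.upper _

theorem stronglyMeasurable_src (hς : DiffusionAssumption lam ς) :
    StronglyMeasurable (src ς : ℝ → Mat n d) := by
  refine stronglyMeasurable_of_entries fun a b => ?_
  simp_rw [src_apply]
  split_ifs
  · exact hς.meas _ _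
  · exact measurable_const

/-- Polarization: the form is nonnegative at `e_k ± e_l`, and the diagonal entries are at most
`lam`. -/
theorem DiffusionAssumption.abs_le (hς : DiffusionAssumption lam ς) (hlam : 1 ≤ lam) (u : ℝ)
    (k l : Fin d) : |ς u k l| ≤ lam := by
  have hquad : ∀ x y : ℝ, (ς u *ᵥ (x • Pi.single k 1 + y • Pi.single l 1)) ⬝ᵥ
      (x • Pi.single k 1 + y • Pi.single l 1) =
      x * x * ς u k k + 2 * (x * y) * ς u k l + y * y * ς u l l := by
    intro x y
    have := (hς.symm u).apply k l
    simp [Matrix.mulVec_add, Matrix.mulVec_smul, dotProduct_add]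
    rw [this]
    ring
  have hnn : ∀ ξ : Fin d → ℝ, 0 ≤ (ς u *ᵥ ξ) ⬝ᵥ ξ := fun ξ =>
    le_trans (mul_nonneg (by positivity) (Finset.sum_nonneg fun i _ => mul_self_nonneg _))
      (hς.lower u ξ)
  have h1 := hnn ((1 : ℝ) • Pi.single k 1 + (1 : ℝ) • Pi.single l 1)
  have h2 := hnn ((1 : ℝ) • Pi.single k 1 + (-1 : ℝ) • Pi.single l 1)
  rw [hquad] at h1 h2
  have h3 : ∀ k, ς u k k ≤ lam := by
    intro k
    have := hς.upper u (Pi.single k 1)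
    simpa using this
  have h4 := h3 k
  have h5 := h3 l
  rw [_root_.abs_le]
  constructor <;> linarith

theorem norm_src_le (hς : DiffusionAssumption lam ς) (hlam : 1 ≤ lam) (u : ℝ) :
    ‖(src ς u : Mat n d)‖ ≤ (n * d : ℝ) ^ 2 * lam := by
  refine (norm_le_sum_abs _).trans ?_
  have : ∀ a b : Idx n d, |(src ς u : Mat n d) a b| ≤ lam := by
    intro a b
    rw [src_apply]
    split_ifs
    · exact hς.abs_le hlam u _ _
    · simp; linarith
  calc _ ≤ ∑ _a : Idx n d, ∑ _b : Idx n d, lam :=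
        Finset.sum_le_sum fun a _ => Finset.sum_le_sum fun b _ => this a b
    _ = _ := by simp; ring

theorem src_transpose (hς : DiffusionAssumption lam ς) (u : ℝ) :
    (src ς u : Mat n d)ᵀ = src ς u := by
  simp [src, Matrix.mul_assoc, (hς.symm u).eq]

/-- Only the first block is charged, and it has dilation exponent `1` on each side. -/
theorem dil_mul_src_mul_dil (ς : ℝ → Matrix (Fin d) (Fin d) ℝ) (u r : ℝ) :
    (dil r * src ς u * dil r : Mat n d) = r ^ 2 • src ς u := by
  ext a b
  simp only [dil, Matrix.diagonal_mul, Matrix.mul_diagonal, Matrix.smul_apply, smul_eq_mul,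
    src_apply]
  split_ifs with h
  · rw [h.1, h.2]; simp; ring
  · simp

theorem inner_src_ge (hς : DiffusionAssumption lam ς) (u : ℝ) (v : Sp n d) :
    lam⁻¹ * ∑ k, v (0, k) ^ 2 ≤ inner ℝ v (act (src ς u) v) := by
  have h := hς.lower u fun k => v (0, k)
  have h1 : inner ℝ v (act (src ς u) v) =
      (ς u *ᵥ fun k => v (0, k)) ⬝ᵥ fun k => v (0, k) := by
    rw [EuclideanSpace.inner_eq_star_dotProduct, star_trivial]
    simp only [dotProduct, Matrix.mulVec, Fintype.sum_prod_type]
    rw [Finset.sum_eq_single 0]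
    · refine Finset.sum_congr rfl fun k _ => ?_
      rw [act_apply, Fintype.sum_prod_type, Finset.sum_eq_single 0]
      · simp [src_apply]
      · intro i _ hi; simp [src_apply, hi]
      · simp
    · intro i _ hi
      refine Finset.sum_eq_zero fun k _ => ?_
      rw [act_apply]; simp [src_apply, hi]
    · simp
  rw [h1]
  refine le_trans (le_of_eq ?_) h
  simp [dotProduct, sq]

end Source

/-! ### Covariance matrices and their stability on the time window `[-2, 2]`. -/

section Covariance

/-- The covariance matrix associated with a matrix curve `A` and a diffusion matrix `S`. -/
def Cov (A S : ℝ → Mat n d) (s t : ℝ) : Mat n d :=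
  ∫ u in s..t, Phi A t u * S u * (Phi A t u)ᵀ

variable {A A' S S' : ℝ → Mat n d} {L ℓ : ℝ}

/-- After rescaling, all relevant times lie in `[-2, 2]`, so time differences are at most `4`. -/
theorem norm_phi_le_window (hm : StronglyMeasurable A) (hb : ∀ u, ‖A u‖ ≤ L) {t s : ℝ}
    (ht : t ∈ Icc (-2 : ℝ) 2) (hs : s ∈ Icc (-2 : ℝ) 2) : ‖Phi A t s‖ ≤ Real.exp (4 * L) := by
  refine (norm_phi_le hm hb t s).trans (Real.exp_le_exp.2 ?_)
  have : |t - s| ≤ 4 := by rw [abs_le]; constructor <;> linarith [ht.1, ht.2, hs.1, hs.2]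
  nlinarith [nonneg_of_bdd hb]

theorem norm_phi_sub_one_le_window (hm : StronglyMeasurable A) (hb : ∀ u, ‖A u‖ ≤ L) {t s : ℝ}
    (ht : t ∈ Icc (-2 : ℝ) 2) (hs : s ∈ Icc (-2 : ℝ) 2) :
    ‖Phi A t s - 1‖ ≤ L * Real.exp (4 * L) * |t - s| := by
  refine (norm_phi_sub_one_le hm hb t s).trans ?_
  have hL := nonneg_of_bdd hb
  have : |t - s| ≤ 4 := by rw [abs_le]; constructor <;> linarith [ht.1, ht.2, hs.1, hs.2]
  have h2 : Real.exp (L * |t - s|) ≤ Real.exp (4 * L) := Real.exp_le_exp.2 (by nlinarith)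
  gcongr

theorem abs_integral_le_window {f : ℝ → ℝ} (hf : ∀ u, 0 ≤ f u)
    (hi : IntervalIntegrable f volume (-2) 2) {s t : ℝ}
    (ht : t ∈ Icc (-2 : ℝ) 2) (hs : s ∈ Icc (-2 : ℝ) 2) :
    |∫ u in s..t, f u| ≤ ∫ u in (-2)..2, f u := by
  refine (intervalIntegral.abs_integral_mono_interval (c := -2) (d := 2) ?_ (ae_of_all _ hf)
    hi).trans (le_of_eq (abs_of_nonneg (intervalIntegral.integral_nonneg (by norm_num)
      fun u _ => hf u)))
  apply uIoc_subset_uIoc_of_uIcc_subset_uIcc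
  rw [uIcc_of_le (by norm_num : (-2 : ℝ) ≤ 2)]
  exact uIcc_subset_Icc hs ht

/-- The resolvent depends in a Lipschitz way on the times and on the matrix curve. -/
theorem exists_phi_stability (n d : ℕ) (L : ℝ) : ∃ C : ℝ, 0 < C ∧ ∀ A A' : ℝ → Mat n d,
    StronglyMeasurable A → (∀ u, ‖A u‖ ≤ L) → StronglyMeasurable A' → (∀ u, ‖A' u‖ ≤ L) →
    ∀ s ∈ Icc (-2 : ℝ) 2, ∀ t ∈ Icc (-2 : ℝ) 2, ∀ s' ∈ Icc (-2 : ℝ) 2, ∀ t' ∈ Icc (-2 : ℝ) 2,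
      ‖Phi A t s - Phi A' t' s'‖ ≤ C * (|s - s'| + |t - t'| + ∫ u in (-2)..2, ‖A u - A' u‖) := by
  set E := Real.exp (4 * L) with hE
  have hE1 : 0 < E := Real.exp_pos _
  refine ⟨|L| * E ^ 2 + E ^ 2, by positivity, ?_⟩
  intro A A' hm hb hm' hb' s hs t ht s' hs' t' ht'
  have hL := nonneg_of_bdd hb
  rw [abs_of_nonneg hL]
  set I := ∫ u in (-2)..2, ‖A u - A' u‖ with hI
  have hI0 : 0 ≤ I := intervalIntegral.integral_nonneg (by norm_num) fun u _ => norm_nonneg _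
  have h1 : ‖Phi A t s - Phi A' t s‖ ≤ E ^ 2 * I := by
    refine (norm_phi_sub_phi_le hm hb hm' hb' t s).trans ?_
    have h2 : Real.exp (L * |t - s|) ≤ E := Real.exp_le_exp.2 (by
      have : |t - s| ≤ 4 := by rw [abs_le]; constructor <;> linarith [ht.1, ht.2, hs.1, hs.2]
      nlinarith)
    have h3 := abs_integral_le_window (fun u => norm_nonneg (A u - A' u))
      (intervalIntegrable_norm_sub hm hb hm' hb' _ _) ht hs
    exact mul_le_mul (by gcongr) h3 (abs_nonneg _) (by positivity)
  have h2 : ‖Phi A' t s - Phi A' t' s‖ ≤ L * E ^ 2 * |t - t'| := by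
    have e : Phi A' t s - Phi A' t' s = (Phi A' t t' - 1) * Phi A' t' s := by
      rw [sub_mul, phi_mul_phi hm' hb', one_mul]
    rw [e]
    calc _ ≤ (L * E * |t - t'|) * E := (norm_mul_le _ _).trans (mul_le_mul
          (norm_phi_sub_one_le_window hm' hb' ht ht') (norm_phi_le_window hm' hb' ht' hs)
          (norm_nonneg _) (by positivity))
      _ = _ := by ring
  have h3 : ‖Phi A' t' s - Phi A' t' s'‖ ≤ L * E ^ 2 * |s - s'| := by
    rw [phi_sub_phi_right hm' hb']
    calc _ ≤ E * (L * E * |s' - s|) := (norm_mul_le _ _).trans (mul_le_mul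
          (norm_phi_le_window hm' hb' ht' hs') (norm_phi_sub_one_le_window hm' hb' hs' hs)
          (norm_nonneg _) hE1.le)
      _ = _ := by rw [abs_sub_comm]; ring
  -- The coefficients are changed first, then the final time, then the initial time.
  have e : Phi A t s - Phi A' t' s' = (Phi A t s - Phi A' t s) + (Phi A' t s - Phi A' t' s) +
      (Phi A' t' s - Phi A' t' s') := by abel
  rw [e]
  refine (norm_add₃_le).trans ?_
  have h4 : 0 ≤ L * E ^ 2 := by positivity
  have h5 : 0 ≤ E ^ 2 := by positivity
  have a1 := abs_nonneg (s - s')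
  have a2 := abs_nonneg (t - t')
  nlinarith [mul_nonneg h4 hI0, mul_nonneg h5 a1, mul_nonneg h5 a2]

theorem norm_mul_mul_transpose_le {X Y Z : Mat n d} {x y z : ℝ} (hX : ‖X‖ ≤ x) (hY : ‖Y‖ ≤ y)
    (hZ : ‖Z‖ ≤ z) : ‖X * Y * Zᵀ‖ ≤ x * y * z := by
  have hx := (norm_nonneg _).trans hX
  have hy := (norm_nonneg _).trans hY
  rw [← norm_transpose Z] at hZ
  exact (norm_mul_le _ _).trans (mul_le_mul ((norm_mul_le _ _).trans
    (mul_le_mul hX hY (norm_nonneg _) hx)) hZ (norm_nonneg _) (mul_nonneg hx hy))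

theorem stronglyMeasurable_cov_integrand (hm : StronglyMeasurable A) (hb : ∀ u, ‖A u‖ ≤ L)
    (hS : StronglyMeasurable S) (t : ℝ) :
    StronglyMeasurable fun u => Phi A t u * S u * (Phi A t u)ᵀ :=
  have h := (continuous_phi_right hm hb t).stronglyMeasurable
  (h.mul hS).mul h.matrix_transpose

theorem intervalIntegrable_cov (hm : StronglyMeasurable A) (hb : ∀ u, ‖A u‖ ≤ L)
    (hS : StronglyMeasurable S) (hSb : ∀ u, ‖S u‖ ≤ ℓ) (t a b : ℝ) :
    IntervalIntegrable (fun u => Phi A t u * S u * (Phi A t u)ᵀ) volume a b := by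
  have hc : IntervalIntegrable (fun u => Real.exp (L * |t - u|) * ℓ * Real.exp (L * |t - u|))
    volume a b := Continuous.intervalIntegrable (by fun_prop) _ _
  refine hc.mono_fun (stronglyMeasurable_cov_integrand hm hb hS t).aestronglyMeasurable
    (ae_of_all _ fun u => ?_)
  refine le_trans ?_ (le_abs_self _)
  have h1 := norm_phi_le hm hb t u
  exact norm_mul_mul_transpose_le h1 (hSb u) h1

theorem norm_cov_integrand_le (hm : StronglyMeasurable A) (hb : ∀ u, ‖A u‖ ≤ L)
    (hSb : ∀ u, ‖S u‖ ≤ ℓ) {t u : ℝ} (ht : t ∈ Icc (-2 : ℝ) 2) (hu : u ∈ Icc (-2 : ℝ) 2) :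
    ‖Phi A t u * S u * (Phi A t u)ᵀ‖ ≤ Real.exp (4 * L) ^ 2 * ℓ := by
  have h1 := norm_phi_le_window hm hb ht hu
  refine (norm_mul_mul_transpose_le h1 (hSb u) h1).trans (le_of_eq ?_)
  ring

theorem uIoc_subset_window {s t u : ℝ} (ht : t ∈ Icc (-2 : ℝ) 2) (hs : s ∈ Icc (-2 : ℝ) 2)
    (hu : u ∈ uIoc s t) : u ∈ Icc (-2 : ℝ) 2 := uIcc_subset_Icc hs ht (uIoc_subset_uIcc hu)

theorem norm_integral_cov_le (hm : StronglyMeasurable A) (hb : ∀ u, ‖A u‖ ≤ L)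
    (hSb : ∀ u, ‖S u‖ ≤ ℓ) {s t τ : ℝ} (hτ : τ ∈ Icc (-2 : ℝ) 2) (ht : t ∈ Icc (-2 : ℝ) 2)
    (hs : s ∈ Icc (-2 : ℝ) 2) :
    ‖∫ u in s..t, Phi A τ u * S u * (Phi A τ u)ᵀ‖ ≤ Real.exp (4 * L) ^ 2 * ℓ * |t - s| :=
  intervalIntegral.norm_integral_le_of_norm_le_const fun _ hu =>
    norm_cov_integrand_le hm hb hSb hτ (uIoc_subset_window ht hs hu)

theorem norm_conj_sub_conj_le {P P' T T' : Mat n d} {E D ℓ : ℝ} (hP : ‖P‖ ≤ E) (hP' : ‖P'‖ ≤ E)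
    (hT : ‖T‖ ≤ ℓ) (hT' : ‖T'‖ ≤ ℓ) (hD : ‖P - P'‖ ≤ D) :
    ‖P * T * Pᵀ - P' * T' * P'ᵀ‖ ≤ 2 * (E * ℓ * D) + E ^ 2 * ‖T - T'‖ := by
  have e : P * T * Pᵀ - P' * T' * P'ᵀ = (P - P') * T * Pᵀ + P' * (T - T') * Pᵀ +
      P' * T' * (P - P')ᵀ := by
    rw [Matrix.transpose_sub]; noncomm_ring
  rw [e]
  refine norm_add₃_le.trans ?_
  calc _ ≤ _ := add_le_add (add_le_add (norm_mul_mul_transpose_le hD hT hP)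
        (norm_mul_mul_transpose_le hP' le_rfl hP)) (norm_mul_mul_transpose_le hP' hT' hD)
    _ = _ := by ring

/-- The covariance depends in a Lipschitz way on the times and on the coefficients. -/
theorem exists_cov_stability (n d : ℕ) (L ℓ : ℝ) : ∃ C : ℝ, 0 < C ∧ ∀ A A' S S' : ℝ → Mat n d,
    StronglyMeasurable A → (∀ u, ‖A u‖ ≤ L) → StronglyMeasurable A' → (∀ u, ‖A' u‖ ≤ L) →
    StronglyMeasurable S → (∀ u, ‖S u‖ ≤ ℓ) → StronglyMeasurable S' → (∀ u, ‖S' u‖ ≤ ℓ) →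
    ∀ s ∈ Icc (-2 : ℝ) 2, ∀ t ∈ Icc (-2 : ℝ) 2, ∀ s' ∈ Icc (-2 : ℝ) 2, ∀ t' ∈ Icc (-2 : ℝ) 2,
      ‖Cov A S s t - Cov A' S' s' t'‖ ≤ C * (|s - s'| + |t - t'| +
        (∫ u in (-2)..2, ‖A u - A' u‖) + ∫ u in (-2)..2, ‖S u - S' u‖) := by
  obtain ⟨C, hC0, hC⟩ := exists_phi_stability n d L
  set E := Real.exp (4 * L) with hE
  have hE1 : 0 < E := Real.exp_pos _
  refine ⟨8 * (E * |ℓ| * C) + E ^ 2 + E ^ 2 * |ℓ|, by positivity, ?_⟩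
  intro A A' S S' hm hb hm' hb' hS hSb hS' hSb' s hs t ht s' hs' t' ht'
  have hl := nonneg_of_bdd hSb
  rw [abs_of_nonneg hl]
  set I := ∫ u in (-2)..2, ‖A u - A' u‖ with hI
  have hI0 : 0 ≤ I := intervalIntegral.integral_nonneg (by norm_num) fun u _ => norm_nonneg _
  set I' := ∫ u in (-2)..2, ‖S u - S' u‖ with hI'
  have hI0' : 0 ≤ I' := intervalIntegral.integral_nonneg (by norm_num) fun u _ => norm_nonneg _
  have hts : |t - s| ≤ 4 := by rw [abs_le]; constructor <;> linarith [ht.1, ht.2, hs.1, hs.2]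
  have i1 := intervalIntegrable_cov hm hb hS hSb t
  have i2 := intervalIntegrable_cov hm' hb' hS' hSb' t'
  have h1 : ‖∫ u in s..t, (Phi A t u * S u * (Phi A t u)ᵀ - Phi A' t' u * S' u * (Phi A' t' u)ᵀ)‖ ≤
      8 * (E * ℓ * C) * (|t - t'| + I) + E ^ 2 * I' := by
    have hi3 := intervalIntegrable_norm_sub hS hSb hS' hSb'
    have hi4 : ∀ a b, IntervalIntegrable
        (fun u => 2 * (E * ℓ * C) * (|t - t'| + I) + E ^ 2 * ‖S u - S' u‖) volume a b :=
      fun a b => intervalIntegrable_const.add ((hi3 a b).const_mul _)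
    refine (intervalIntegral.norm_integral_le_abs_of_norm_le
      (g := fun u => 2 * (E * ℓ * C) * (|t - t'| + I) + E ^ 2 * ‖S u - S' u‖) ?_ (hi4 s t)).trans ?_
    · refine (ae_restrict_iff' measurableSet_uIoc).2 (ae_of_all _ fun u hu => ?_)
      have hu' := uIoc_subset_window ht hs hu
      have p1 := norm_phi_le_window hm hb ht hu'
      have p2 := norm_phi_le_window hm' hb' ht' hu'
      have p3 := hC A A' hm hb hm' hb' u hu' t ht u hu' t' ht'
      rw [sub_self, abs_zero, zero_add, ← hI] at p3
      refine (norm_conj_sub_conj_le p1 p2 (hSb u) (hSb' u) p3).trans (le_of_eq ?_)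
      ring
    · rw [intervalIntegral.integral_add intervalIntegrable_const ((hi3 _ _).const_mul _),
        intervalIntegral.integral_const, intervalIntegral.integral_const_mul]
      refine (abs_add_le _ _).trans (add_le_add ?_ ?_)
      · rw [smul_eq_mul, abs_mul, abs_of_nonneg (a := 2 * (E * ℓ * C) * (|t - t'| + I))
          (by positivity)]
        calc _ ≤ 4 * (2 * (E * ℓ * C) * (|t - t'| + I)) := by
              apply mul_le_mul_of_nonneg_right hts (by positivity)
          _ = _ := by ring
      · rw [abs_mul, abs_of_nonneg (by positivity : 0 ≤ E ^ 2)]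
        exact mul_le_mul_of_nonneg_left (abs_integral_le_window (fun u => norm_nonneg _)
          (hi3 _ _) ht hs) (by positivity)
  -- The integrands are compared on a common interval; the change of endpoints costs two short
  -- integrals of a bounded function.
  have e : Cov A S s t - Cov A' S' s' t' =
      (∫ u in s..t, (Phi A t u * S u * (Phi A t u)ᵀ - Phi A' t' u * S' u * (Phi A' t' u)ᵀ)) +
      ((∫ u in s..s', Phi A' t' u * S' u * (Phi A' t' u)ᵀ) -
        ∫ u in t..t', Phi A' t' u * S' u * (Phi A' t' u)ᵀ) := by
    rw [intervalIntegral.integral_sub (i1 _ _) (i2 _ _),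
      ← intervalIntegral.integral_interval_sub_interval_comm (i2 _ _) (i2 _ _) (i2 _ _), Cov, Cov]
    abel
  rw [e]
  have h2 := norm_integral_cov_le hm' hb' hSb' ht' hs' hs
  have h3 := norm_integral_cov_le hm' hb' hSb' ht' ht' ht
  refine (norm_add_le _ _).trans ((add_le_add h1 ((norm_sub_le _ _).trans (add_le_add h2 h3))).trans
    ?_)
  rw [abs_sub_comm s' s, abs_sub_comm t' t, ← hE]
  have a1 := abs_nonneg (s - s')
  have a2 := abs_nonneg (t - t')
  have b1 : 0 ≤ E * ℓ * C := by positivity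
  have b2 : 0 ≤ E ^ 2 := by positivity
  have b3 : 0 ≤ E ^ 2 * ℓ := by positivity
  nlinarith [mul_nonneg b1 a1, mul_nonneg b1 hI0', mul_nonneg b2 a1, mul_nonneg b2 a2,
    mul_nonneg b2 hI0, mul_nonneg b3 hI0, mul_nonneg b3 hI0']

end Covariance

/-- Symmetric matrices with given ellipticity constants. -/
structure IsElliptic (c C : ℝ) (K : Mat n d) : Prop where
  symm : Kᵀ = K
  bdd : ‖K‖ ≤ C
  lower : ∀ ξ : Sp n d, c * ‖ξ‖ ^ 2 ≤ inner ℝ ξ (act K ξ)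

/-! ### Scaling and uniform ellipticity of the covariance. -/

section CovarianceBounds

variable [NeZero n] {L lam : ℝ} {𝓔 : Fin n → Set (Matrix (Fin d) (Fin d) ℝ)} {A : ℝ → Mat n d}
  {ς : ℝ → Matrix (Fin d) (Fin d) ℝ}

/-- The dilations act on the diffusion matrix as the factor `r ^ (-2)`, which cancels the Jacobian
`r ^ 2` of the time change. -/
theorem cov_rescale (hA : IsCurve L 𝓔 A) (hς : DiffusionAssumption lam ς) (hlam : 1 ≤ lam)
    {r : ℝ} (hr : 0 < r) (c s t : ℝ) :
    Cov A (src ς) (c + r ^ 2 * s) (c + r ^ 2 * t) =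
      dil r * Cov (fun u => A (c + r ^ 2 * u)) (src fun u => ς (c + r ^ 2 * u)) s t * dil r := by
  have hA' := hA.comp_affine c (r ^ 2)
  have hς' := hς.comp_affine c (r ^ 2)
  have hi := intervalIntegrable_cov hA'.meas hA'.bdd (stronglyMeasurable_src (n := n) hς')
    (norm_src_le hς' hlam) t s t
  have h1 : ∀ u, Phi A (c + r ^ 2 * t) (c + r ^ 2 * u) =
      dil r * Phi (fun u => A (c + r ^ 2 * u)) t u * dil r⁻¹ := by
    intro u
    rw [phi_rescale hA.meas hA.bdd hA.sub hr]
    simp only [mul_assoc, dil_mul_inv hr.ne', mul_one]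
    rw [← mul_assoc, dil_mul_inv hr.ne', one_mul]
  have h2 : ∀ u, Phi A (c + r ^ 2 * t) (c + r ^ 2 * u) * src ς (c + r ^ 2 * u) *
      (Phi A (c + r ^ 2 * t) (c + r ^ 2 * u))ᵀ =
      (r ^ 2)⁻¹ • (dil r * (Phi (fun u => A (c + r ^ 2 * u)) t u * src (fun u => ς (c + r ^ 2 * u)) u *
        (Phi (fun u => A (c + r ^ 2 * u)) t u)ᵀ) * dil r) := by
    intro u
    rw [h1, Matrix.transpose_mul, Matrix.transpose_mul, dil_transpose, dil_transpose]
    have h3 := dil_mul_src_mul_dil (n := n) ς (c + r ^ 2 * u) r⁻¹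
    generalize Phi (fun u => A (c + r ^ 2 * u)) t u = X
    have h4 : dil r * X * dil r⁻¹ * src ς (c + r ^ 2 * u) * (dil r⁻¹ * (Xᵀ * dil r)) =
        dil r * X * (dil r⁻¹ * src ς (c + r ^ 2 * u) * dil r⁻¹) * (Xᵀ * dil r) := by
      simp only [mul_assoc]
    rw [h4, h3, inv_pow, mul_smul_comm, smul_mul_assoc]
    simp only [mul_assoc]
    rfl
  rw [Cov, ← intervalIntegral.smul_integral_comp_add_mul]
  simp_rw [h2]
  rw [intervalIntegral.integral_smul, smul_smul, mul_inv_cancel₀ (by positivity), one_smul,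
    integral_mul_matrix, integral_matrix_mul hi, Cov]
  exact ⟨(ContinuousLinearMap.mul ℝ (Mat n d) (dil r)).integrable_comp hi.1,
        (ContinuousLinearMap.mul ℝ (Mat n d) (dil r)).integrable_comp hi.2⟩

theorem cov_transpose (hA : IsCurve L 𝓔 A) (hς : DiffusionAssumption lam ς) (hlam : 1 ≤ lam)
    (s t : ℝ) : (Cov A (src ς) s t)ᵀ = Cov A (src ς) s t := by
  have hi := intervalIntegrable_cov hA.meas hA.bdd (stronglyMeasurable_src (n := n) hς)
    (norm_src_le hς hlam) t s t
  ext a b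
  rw [Matrix.transpose_apply, Cov, integral_apply hi, integral_apply hi]
  have h : ∀ u, (Phi A t u * src ς u * (Phi A t u)ᵀ)ᵀ = Phi A t u * src ς u * (Phi A t u)ᵀ := by
    intro u
    simp only [Matrix.transpose_mul, Matrix.transpose_transpose, src_transpose hς, mul_assoc]
  refine intervalIntegral.integral_congr fun u _ => ?_
  exact congrFun (congrFun (h u) a) b

/-- The quadratic form of a matrix as a continuous linear functional of the matrix. -/
def quadL (ξ : Sp n d) : Mat n d →L[ℝ] ℝ := LinearMap.toContinuousLinearMap
  { toFun := fun M => inner ℝ ξ (act M ξ)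
    map_add' := fun M M' => by
      rw [← inner_add_right]; congr 1; simp [act, Matrix.add_mulVec]
    map_smul' := fun c M => by simp [smul_act, inner_smul_right] }

/-- The quadratic form of the covariance integrates the diffusion form along the adjoint trajectory.
The integrand is nonnegative, so it suffices to keep the last half unit of time. -/
theorem inner_cov_ge (hA : IsCurve L 𝓔 A) (hς : DiffusionAssumption lam ς) (hlam : 1 ≤ lam)
    {s t : ℝ} (hst : s ≤ t - 1 / 2) (ξ : Sp n d) :
    lam⁻¹ * energy A t ξ ≤ inner ℝ ξ (act (Cov A (src ς) s t) ξ) := by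
  have hi := intervalIntegrable_cov hA.meas hA.bdd (stronglyMeasurable_src (n := n) hς)
    (norm_src_le hς hlam) t
  have hq : ∀ a b, IntervalIntegrable
      (fun u => quadL ξ (Phi A t u * src ς u * (Phi A t u)ᵀ)) volume a b := fun a b =>
    ⟨(quadL ξ).integrable_comp (hi a b).1, (quadL ξ).integrable_comp (hi a b).2⟩
  have h1 : inner ℝ ξ (act (Cov A (src ς) s t) ξ) =
      ∫ u in s..t, quadL ξ (Phi A t u * src ς u * (Phi A t u)ᵀ) :=
    ((quadL ξ).intervalIntegral_comp_comm (hi s t)).symm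
  have h2 : ∀ u, quadL ξ (Phi A t u * src ς u * (Phi A t u)ᵀ) =
      inner ℝ (adjTraj A t ξ u) (act (src ς u) (adjTraj A t ξ u)) := by
    intro u
    change inner ℝ ξ (act _ ξ) = _
    rw [mul_assoc, act_mul, inner_act, act_mul]
    rfl
  have h3 : ∀ u, lam⁻¹ * ∑ k, adjTraj A t ξ u (0, k) ^ 2 ≤
      quadL ξ (Phi A t u * src ς u * (Phi A t u)ᵀ) := fun u => by
    rw [h2]; exact inner_src_ge hς u _
  have h4 : ∀ u, 0 ≤ quadL ξ (Phi A t u * src ς u * (Phi A t u)ᵀ) := fun u =>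
    le_trans (by positivity) (h3 u)
  rw [h1, energy, ← intervalIntegral.integral_const_mul]
  have hc : Continuous fun u => ∑ k, adjTraj A t ξ u (0, k) ^ 2 :=
    continuous_finsetSum _ fun k _ => ((EuclideanSpace.proj (𝕜 := ℝ) (0, k)).continuous.comp
      (continuous_adjTraj hA t ξ)).pow 2
  refine (intervalIntegral.integral_mono_on (by linarith)
    (Continuous.intervalIntegrable (hc.const_mul _) _ _) (hq _ _) fun u _ => h3 u).trans ?_
  exact intervalIntegral.integral_mono_interval hst (by linarith) le_rfl (ae_of_all _ h4) (hq _ _)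

/-- Uniform ellipticity of the covariance over time intervals of length of order one. -/
theorem exists_isElliptic_cov (h𝓔 : IsNondegenerateFamily 𝓔) (L : ℝ) (hlam : 1 ≤ lam) :
    ∃ c C : ℝ, 0 < c ∧ 0 < C ∧ ∀ (A : ℝ → Mat n d) (ς : ℝ → Matrix (Fin d) (Fin d) ℝ),
      IsCurve L 𝓔 A → DiffusionAssumption lam ς → ∀ s ∈ Icc (-2 : ℝ) 2, ∀ t ∈ Icc (-2 : ℝ) 2,
      s ≤ t - 1 / 2 → IsElliptic c C (Cov A (src ς) s t) := by
  obtain ⟨c, hc0, hc⟩ := exists_energy_lower_bound h𝓔 L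
  refine ⟨lam⁻¹ * c, Real.exp (4 * L) ^ 2 * ((n * d : ℝ) ^ 2 * lam) * 4 + 1, by positivity,
    by positivity, fun A ς hA hς s hs t ht hst => ⟨cov_transpose hA hς hlam s t, ?_, fun ξ => ?_⟩⟩
  · refine (norm_integral_cov_le hA.meas hA.bdd (norm_src_le hς hlam) ht ht hs).trans ?_
    have : |t - s| ≤ 4 := by rw [abs_le]; constructor <;> linarith [ht.1, ht.2, hs.1, hs.2]
    have h2 : 0 ≤ Real.exp (4 * L) ^ 2 * ((n * d : ℝ) ^ 2 * lam) := by positivity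
    nlinarith
  · rcases eq_or_ne ξ 0 with rfl | hξ
    · simp
    have hξ' : ‖ξ‖ ≠ 0 := norm_ne_zero_iff.2 hξ
    have h1 := inner_cov_ge hA hς hlam hst (‖ξ‖⁻¹ • ξ)
    have h2 := hc A t (‖ξ‖⁻¹ • ξ) hA (by rw [norm_smul, norm_inv, norm_norm, inv_mul_cancel₀ hξ'])
    rw [act_smul, inner_smul_left, inner_smul_right] at h1
    simp only [conj_trivial] at h1
    have h3 : lam⁻¹ * c ≤ ‖ξ‖⁻¹ * (‖ξ‖⁻¹ * inner ℝ ξ (act (Cov A (src ς) s t) ξ)) :=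
      le_trans (by gcongr) h1
    have h4 := mul_le_mul_of_nonneg_right h3 (sq_nonneg ‖ξ‖)
    refine h4.trans (le_of_eq ?_)
    field_simp

end CovarianceBounds

/-! ### The differentiated Gaussian and its homogeneity. -/

section GaussianKernel

/-- The exponents `2 i + 1` add up to `n ^ 2`, each occurring `d` times: this is the homogeneous
dimension of space. -/
theorem det_dil (r : ℝ) : (dil r : Mat n d).det = r ^ (n ^ 2 * d) := by
  rw [dil, Matrix.det_diagonal, Fintype.prod_prod_type]
  simp only [Finset.prod_const, Finset.card_univ, Fintype.card_fin]
  rw [Finset.prod_pow, Finset.prod_pow_eq_pow_sum, ← pow_mul,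
    Fin.sum_univ_eq_sum_range (fun i => 2 * i + 1) n]
  congr 2
  clear * -
  induction n with
  | zero => rfl
  | succ n ih => rw [Finset.sum_range_succ, ih]; ring

theorem dil_inv_eq {r : ℝ} (hr : r ≠ 0) : (dil r : Mat n d)⁻¹ = dil r⁻¹ :=
  Matrix.inv_eq_right_inv (dil_mul_inv hr)

variable [NeZero n]

/-- The second derivative in the directions `P e_i`, `P e_j` of the centered Gaussian density with
covariance matrix `K`. -/
def gaussKer (i j : Fin d) (K P : Mat n d) (z : Sp n d) : ℝ :=
  ((2 * Real.pi) ^ ((n * d : ℝ) / 2) * Real.sqrt K.det)⁻¹ *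
    Real.exp (-(1 / 2) * inner ℝ z (act K⁻¹ z)) *
    (inner ℝ (act P (basisVec (0, i))) (act K⁻¹ z) * inner ℝ (act P (basisVec (0, j))) (act K⁻¹ z) -
      inner ℝ (act P (basisVec (0, i))) (act K⁻¹ (act P (basisVec (0, j)))))

theorem act_dil_basisVec (r : ℝ) (i : Fin d) :
    act (dil r) (basisVec (0, i) : Sp n d) = r • basisVec (0, i) := by
  ext a
  rw [act_dil_apply]
  by_cases h : a = (0, i)
  · subst h; simp [basisVec]
  · simp [basisVec, h]

/-- The quadratic forms are invariant. The determinant contributes `r ^ (-n ^ 2 d)` and the two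
directions in the first block contribute `r ^ (-1)` each. -/
theorem gaussKer_rescale (i j : Fin d) (K P : Mat n d) (z : Sp n d) {r : ℝ} (hr : 0 < r) :
    gaussKer i j (dil r * K * dil r) (dil r * P * dil r⁻¹) (act (dil r) z) =
      (r ^ (n ^ 2 * d + 2))⁻¹ * gaussKer i j K P z := by
  have hr' := hr.ne'
  have hdet : Real.sqrt (dil r * K * dil r : Mat n d).det = r ^ (n ^ 2 * d) * Real.sqrt K.det := by
    rw [Matrix.det_mul, Matrix.det_mul, det_dil, mul_right_comm, Real.sqrt_mul (by positivity),
      Real.sqrt_mul_self (by positivity)]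
  have hinv : (dil r * K * dil r : Mat n d)⁻¹ = dil r⁻¹ * K⁻¹ * dil r⁻¹ := by
    rw [Matrix.mul_inv_rev, Matrix.mul_inv_rev, dil_inv_eq hr', mul_assoc]
  have hK : ∀ u v : Sp n d, inner ℝ (act (dil r) u) (act (dil r * K * dil r : Mat n d)⁻¹ (act (dil r) v)) =
      inner ℝ u (act K⁻¹ v) := by
    intro u v
    rw [hinv, act_mul, act_dil_inv_dil hr', act_mul, inner_act, dil_transpose, act_dil_inv_dil hr']
  have hP : ∀ i, act (dil r * P * dil r⁻¹) (basisVec (0, i) : Sp n d) =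
      act (dil r) (r⁻¹ • act P (basisVec (0, i))) := by
    intro i
    rw [act_mul, act_mul, act_dil_basisVec, act_smul]
  rw [gaussKer, gaussKer, hdet, hK, hP, hP, hK, hK, hK]
  simp only [inner_smul_left, inner_smul_right, act_smul, conj_trivial]
  rw [pow_add]
  generalize Real.exp (-(1 / 2) * inner ℝ z (act K⁻¹ z)) = e
  generalize Real.sqrt K.det = D
  field_simp

end GaussianKernel

/-! ### Elliptic matrices: inverses and determinants. -/

section Elliptic

variable {c C : ℝ} {K K' : Mat n d}

theorem IsElliptic.posDef (hK : IsElliptic c C K) (hc : 0 < c) : K.PosDef := by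
  refine Matrix.PosDef.of_dotProduct_mulVec_pos ?_ fun x hx => ?_
  · rw [Matrix.IsHermitian, Matrix.conjTranspose_eq_transpose_of_trivial, hK.symm]
  · have h := hK.lower (WithLp.toLp 2 x)
    have h1 : 0 < ‖(WithLp.toLp 2 x : Sp n d)‖ := by
      rw [norm_pos_iff]
      intro h0
      exact hx (congrArg WithLp.ofLp h0)
    rw [EuclideanSpace.inner_eq_star_dotProduct, star_trivial, dotProduct_comm] at h
    rw [star_trivial]
    exact lt_of_lt_of_le (by positivity) h

theorem IsElliptic.det_pos (hK : IsElliptic c C K) (hc : 0 < c) : 0 < K.det := (hK.posDef hc).det_pos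

theorem IsElliptic.mul_inv (hK : IsElliptic c C K) (hc : 0 < c) : K * K⁻¹ = 1 :=
  Matrix.mul_nonsing_inv K (hK.det_pos hc).ne'.isUnit

theorem IsElliptic.inv_mul (hK : IsElliptic c C K) (hc : 0 < c) : K⁻¹ * K = 1 :=
  Matrix.nonsing_inv_mul K (hK.det_pos hc).ne'.isUnit

theorem IsElliptic.inv_transpose (hK : IsElliptic c C K) : K⁻¹ᵀ = K⁻¹ := by
  rw [Matrix.transpose_nonsing_inv, hK.symm]

theorem IsElliptic.norm_inv_le (hK : IsElliptic c C K) (hc : 0 < c) : ‖K⁻¹‖ ≤ c⁻¹ := by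
  rw [Matrix.l2_opNorm_def]
  refine ContinuousLinearMap.opNorm_le_bound _ (by positivity) fun z => ?_
  change ‖act K⁻¹ z‖ ≤ _
  have h := hK.lower (act K⁻¹ z)
  rw [← act_mul, hK.mul_inv hc, act_one] at h
  have h2 := h.trans (real_inner_le_norm _ _)
  rcases (norm_nonneg (act K⁻¹ z)).eq_or_lt with h0 | h0
  · rw [← h0]; positivity
  · rw [← div_eq_inv_mul, le_div_iff₀ hc]
    nlinarith

/-- Ellipticity is applied at `K⁻¹ z`, together with `‖z‖ ≤ C ‖K⁻¹ z‖`. -/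
theorem IsElliptic.inner_inv_ge (hK : IsElliptic c C K) (hc : 0 < c) (hC : 0 < C) (z : Sp n d) :
    c / C ^ 2 * ‖z‖ ^ 2 ≤ inner ℝ z (act K⁻¹ z) := by
  have h := hK.lower (act K⁻¹ z)
  rw [← act_mul, hK.mul_inv hc, act_one, real_inner_comm] at h
  refine le_trans ?_ h
  have h1 : ‖z‖ ≤ C * ‖act K⁻¹ z‖ := by
    have := norm_act_le K (act K⁻¹ z)
    rw [← act_mul, hK.mul_inv hc, act_one] at this
    exact this.trans (by gcongr; exact hK.bdd)
  have h2 : ‖z‖ ^ 2 ≤ C ^ 2 * ‖act K⁻¹ z‖ ^ 2 := by rw [← mul_pow]; gcongr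
  calc c / C ^ 2 * ‖z‖ ^ 2 ≤ c / C ^ 2 * (C ^ 2 * ‖act K⁻¹ z‖ ^ 2) := by gcongr
    _ = _ := by field_simp

theorem IsElliptic.norm_inv_sub_inv_le (hK : IsElliptic c C K) (hK' : IsElliptic c C K')
    (hc : 0 < c) : ‖K⁻¹ - K'⁻¹‖ ≤ c⁻¹ * c⁻¹ * ‖K - K'‖ := by
  have e : K⁻¹ - K'⁻¹ = K⁻¹ * (K' - K) * K'⁻¹ := by
    rw [mul_sub, sub_mul, hK.inv_mul hc, mul_assoc, hK'.mul_inv hc, mul_one, one_mul]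
  rw [e]
  calc _ ≤ c⁻¹ * ‖K' - K‖ * c⁻¹ := (norm_mul_le _ _).trans (mul_le_mul ((norm_mul_le _ _).trans
        (by gcongr; exact hK.norm_inv_le hc)) (hK'.norm_inv_le hc) (norm_nonneg _) (by positivity))
    _ = _ := by rw [norm_sub_rev]; ring

theorem continuous_quad (ξ : Sp n d) : Continuous fun K : Mat n d => inner ℝ ξ (act K ξ) :=
  (continuous_const.inner (continuous_act_uncurry.comp (continuous_id.prodMk continuous_const)))

theorem isCompact_isElliptic (c C : ℝ) : IsCompact {K : Mat n d | IsElliptic c C K} := by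
  have e : {K : Mat n d | IsElliptic c C K} = Metric.closedBall 0 C ∩ ({K | Kᵀ = K} ∩
      ⋂ ξ : Sp n d, {K | c * ‖ξ‖ ^ 2 ≤ inner ℝ ξ (act K ξ)}) := by
    refine Set.ext fun K => ?_
    rw [mem_inter_iff, mem_closedBall_zero_iff, mem_inter_iff, mem_iInter]
    exact ⟨fun h => ⟨IsElliptic.bdd h, IsElliptic.symm h, IsElliptic.lower h⟩,
      fun h => ⟨h.2.1, h.1, h.2.2⟩⟩
  rw [e]
  refine (isCompact_closedBall (0 : Mat n d) C).inter_right (IsClosed.inter ?_ ?_)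
  · exact isClosed_eq continuous_id.matrix_transpose continuous_id
  · exact isClosed_iInter fun ξ => isClosed_le continuous_const (continuous_quad ξ)

theorem contDiff_det : ContDiff ℝ 1 fun K : Mat n d => K.det := by
  simp only [Matrix.det_apply]
  refine ContDiff.sum fun σ _ => ContDiff.const_smul _ (contDiff_prod fun a _ => ?_)
  exact (entryL (σ a) a).contDiff

/-- The normalizing factor of a Gaussian density. -/
def gaussNorm (K : Mat n d) : ℝ := ((2 * Real.pi) ^ ((n * d : ℝ) / 2) * Real.sqrt K.det)⁻¹

theorem contDiffAt_gaussNorm (hK : 0 < K.det) : ContDiffAt ℝ 1 (gaussNorm (n := n) (d := d)) K := by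
  have hpi : 0 < (2 * Real.pi) ^ ((n * d : ℝ) / 2) := by positivity
  refine ContDiffAt.inv (contDiffAt_const.mul ((contDiff_det.contDiffAt).sqrt hK.ne')) ?_
  have := Real.sqrt_pos.2 hK
  positivity

/-- The elliptic matrices form a compact set on which the normalization is `C¹`; a locally Lipschitz
function is Lipschitz on a compact set. -/
theorem exists_gaussNorm_bound (n d : ℕ) {c : ℝ} (C : ℝ) (hc : 0 < c) :
    ∃ Γ : ℝ, 0 < Γ ∧ (∀ K : Mat n d, IsElliptic c C K → |gaussNorm K| ≤ Γ) ∧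
      ∀ K K' : Mat n d, IsElliptic c C K → IsElliptic c C K' →
        |gaussNorm K - gaussNorm K'| ≤ Γ * ‖K - K'‖ := by
  have hcomp := isCompact_isElliptic (n := n) (d := d) c C
  have hat : ∀ K : Mat n d, IsElliptic c C K → ContDiffAt ℝ 1 (gaussNorm (n := n) (d := d)) K :=
    fun K hK => contDiffAt_gaussNorm (hK.det_pos hc)
  obtain ⟨Γ₁, h1⟩ := hcomp.exists_bound_of_continuousOn
    (f := gaussNorm) fun K hK => (hat K hK).continuousAt.continuousWithinAt
  have hl : LocallyLipschitzOn {K : Mat n d | IsElliptic c C K} gaussNorm := by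
    intro K hK
    obtain ⟨k, t, ht, hk⟩ := (hat K hK).exists_lipschitzOnWith
    exact ⟨k, t, mem_nhdsWithin_of_mem_nhds ht, hk⟩
  obtain ⟨Γ₂, h2⟩ := hl.exists_lipschitzOnWith_of_compact hcomp
  refine ⟨|Γ₁| + Γ₂ + 1, by positivity, fun K hK => ?_, fun K K' hK hK' => ?_⟩
  · have := h1 K hK
    rw [Real.norm_eq_abs] at this
    have := le_abs_self Γ₁
    have := Γ₂.2
    have : (0 : ℝ) ≤ Γ₂ := Γ₂.2
    linarith
  · have := h2.dist_le_mul K hK K' hK'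
    rw [Real.dist_eq, dist_eq_norm] at this
    refine this.trans ?_
    have := abs_nonneg Γ₁
    gcongr
    linarith

end Elliptic

/-! ### Decay and Lipschitz dependence of Gaussian kernels. -/

section GaussianBounds

/-- Polynomial decay of any order is more convenient than Gaussian decay: replacing a deviation by a
comparable one only costs a power of the comparison constant. The constant comes from `x - a x ^ 2 ≤
1 / (4 a)` and `(1 + x) ^ M ≤ M! exp (1 + x)`. -/
theorem exists_exp_le (a : ℝ) (ha : 0 < a) (M : ℕ) :
    ∃ D : ℝ, 0 < D ∧ ∀ x : ℝ, 0 ≤ x → Real.exp (-(a * x ^ 2)) ≤ D / (1 + x) ^ M := by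
  refine ⟨M.factorial * Real.exp (1 + 1 / (4 * a)), by positivity, fun x hx => ?_⟩
  rw [le_div_iff₀ (by positivity)]
  have h1 : (1 + x) ^ M ≤ M.factorial * Real.exp (1 + x) := by
    have := Real.pow_div_factorial_le_exp (1 + x) (by positivity) M
    rwa [div_le_iff₀' (by positivity)] at this
  have h2 : x - a * x ^ 2 ≤ 1 / (4 * a) := by
    rw [le_div_iff₀ (by positivity)]
    nlinarith [sq_nonneg (2 * a * x - 1)]
  calc Real.exp (-(a * x ^ 2)) * (1 + x) ^ M
      ≤ Real.exp (-(a * x ^ 2)) * (M.factorial * Real.exp (1 + x)) := by gcongr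
    _ = M.factorial * Real.exp (-(a * x ^ 2) + (1 + x)) := by rw [Real.exp_add (-(a * x ^ 2))]; ring
    _ ≤ _ := mul_le_mul_of_nonneg_left (Real.exp_le_exp.2 (by linarith)) (by positivity)

theorem abs_exp_sub_exp_le (a b : ℝ) :
    |Real.exp a - Real.exp b| ≤ |a - b| * (Real.exp a + Real.exp b) := by
  have key : ∀ a b : ℝ, a ≤ b → |Real.exp a - Real.exp b| ≤ |a - b| * (Real.exp a + Real.exp b) := by
    intro a b hab
    rw [abs_of_nonpos (sub_nonpos.2 (Real.exp_le_exp.2 hab)), abs_of_nonpos (sub_nonpos.2 hab)]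
    have h1 := Real.add_one_le_exp (a - b)
    have h2 : Real.exp a = Real.exp b * Real.exp (a - b) := by rw [← Real.exp_add]; ring_nf
    have h3 := Real.exp_pos b
    have h4 := Real.exp_pos a
    nlinarith
  rcases le_total a b with h | h
  · exact key a b h
  · rw [abs_sub_comm, abs_sub_comm a b, add_comm]; exact key b a h

theorem abs_inner_act_le (J : Mat n d) (u v : Sp n d) : |inner ℝ u (act J v)| ≤ ‖u‖ * ‖J‖ * ‖v‖ := by
  refine (abs_real_inner_le_norm _ _).trans ?_
  rw [mul_assoc]
  gcongr
  exact norm_act_le J v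

theorem abs_inner_act_sub_le (J J' : Mat n d) (u v u' v' : Sp n d) :
    |inner ℝ u (act J v) - inner ℝ u' (act J' v')| ≤
      ‖u - u'‖ * ‖J‖ * ‖v‖ + ‖u'‖ * ‖J - J'‖ * ‖v‖ + ‖u'‖ * ‖J'‖ * ‖v - v'‖ := by
  have e : inner ℝ u (act J v) - inner ℝ u' (act J' v') = inner ℝ (u - u') (act J v) +
      inner ℝ u' (act (J - J') v) + inner ℝ u' (act J' (v - v')) := by
    rw [inner_sub_left, sub_act, inner_sub_right, act_sub, inner_sub_right]; ring
  rw [e]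
  refine (abs_add_three _ _ _).trans ?_
  gcongr <;> exact abs_inner_act_le _ _ _

/-- The polynomial factor of the second derivative of a Gaussian. -/
def gaussPoly (J : Mat n d) (p q z : Sp n d) : ℝ :=
  inner ℝ p (act J z) * inner ℝ q (act J z) - inner ℝ p (act J q)

theorem abs_gaussPoly_le {J : Mat n d} {p q z : Sp n d} {Γ S : ℝ} (hΓ : 1 ≤ Γ) (hJ : ‖J‖ ≤ Γ)
    (hp : ‖p‖ ≤ Γ) (hq : ‖q‖ ≤ Γ) (hz : ‖z‖ ≤ S) (hS : 1 ≤ S) :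
    |gaussPoly J p q z| ≤ 2 * Γ ^ 4 * S ^ 2 := by
  have h1 : |inner ℝ p (act J z)| ≤ Γ * Γ * S := (abs_inner_act_le J p z).trans (by gcongr)
  have h2 : |inner ℝ q (act J z)| ≤ Γ * Γ * S := (abs_inner_act_le J q z).trans (by gcongr)
  have h3 : |inner ℝ p (act J q)| ≤ Γ * Γ * Γ := (abs_inner_act_le J p q).trans (by gcongr)
  calc |gaussPoly J p q z| ≤ (Γ * Γ * S) * (Γ * Γ * S) + Γ * Γ * Γ := by
        refine (abs_sub _ _).trans (add_le_add ?_ h3)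
        rw [abs_mul]; gcongr
    _ ≤ _ := by
        have h4 : Γ * Γ * Γ ≤ Γ ^ 4 * S ^ 2 := by
          calc Γ * Γ * Γ = Γ ^ 3 * 1 := by ring
            _ ≤ Γ ^ 4 * S ^ 2 := by
              gcongr
              · norm_num
              · exact one_le_pow₀ hS
        nlinarith

theorem abs_gaussPoly_sub_le {J J' : Mat n d} {p q z p' q' z' : Sp n d} {Γ S δ : ℝ} (hΓ : 1 ≤ Γ)
    (hJ : ‖J‖ ≤ Γ) (hp : ‖p‖ ≤ Γ) (hq : ‖q‖ ≤ Γ) (hz : ‖z‖ ≤ S) (hS : 1 ≤ S)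
    (hJ' : ‖J'‖ ≤ Γ) (hp' : ‖p'‖ ≤ Γ) (hz' : ‖z'‖ ≤ S) (hδ : 0 ≤ δ) (hq' : ‖q'‖ ≤ Γ)
    (dJ : ‖J - J'‖ ≤ Γ * δ) (dp : ‖p - p'‖ ≤ Γ * δ) (dq : ‖q - q'‖ ≤ Γ * δ) (dz : ‖z - z'‖ ≤ δ) :
    |gaussPoly J p q z - gaussPoly J' p' q' z'| ≤ 9 * Γ ^ 5 * S ^ 2 * δ := by
  have hS0 : 0 ≤ S := by linarith
  have hΓ0 : 0 ≤ Γ := by linarith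
  have lin : ∀ u u' : Sp n d, ‖u'‖ ≤ Γ → ‖u - u'‖ ≤ Γ * δ →
      |inner ℝ u (act J z) - inner ℝ u' (act J' z')| ≤ 3 * Γ ^ 2 * S * δ := by
    intro u u' hu' du
    refine (abs_inner_act_sub_le J J' u z u' z').trans ?_
    calc _ ≤ (Γ * δ) * Γ * S + Γ * (Γ * δ) * S + Γ * Γ * δ := by gcongr
      _ ≤ _ := by nlinarith [mul_nonneg (mul_nonneg hΓ0 hΓ0) hδ]
  have b1 : |inner ℝ p (act J z)| ≤ Γ ^ 2 * S :=
    (abs_inner_act_le J p z).trans (by rw [sq]; gcongr)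
  have b2 : |inner ℝ q' (act J' z')| ≤ Γ ^ 2 * S :=
    (abs_inner_act_le J' q' z').trans (by rw [sq]; gcongr)
  have h1 := lin p p' hp' dp
  have h2 := lin q q' hq' dq
  have h3 : |inner ℝ p (act J q) - inner ℝ p' (act J' q')| ≤ 3 * Γ ^ 3 * δ := by
    refine (abs_inner_act_sub_le J J' p q p' q').trans ?_
    calc _ ≤ (Γ * δ) * Γ * Γ + Γ * (Γ * δ) * Γ + Γ * Γ * (Γ * δ) := by gcongr
      _ = _ := by ring
  have e : gaussPoly J p q z - gaussPoly J' p' q' z' =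
      inner ℝ p (act J z) * (inner ℝ q (act J z) - inner ℝ q' (act J' z')) +
      (inner ℝ p (act J z) - inner ℝ p' (act J' z')) * inner ℝ q' (act J' z') -
      (inner ℝ p (act J q) - inner ℝ p' (act J' q')) := by
    rw [gaussPoly, gaussPoly]; ring
  rw [e]
  calc _ ≤ (Γ ^ 2 * S) * (3 * Γ ^ 2 * S * δ) + (3 * Γ ^ 2 * S * δ) * (Γ ^ 2 * S) + 3 * Γ ^ 3 * δ := by
        refine (abs_sub _ _).trans (add_le_add ((abs_add_le _ _).trans ?_) h3)
        rw [abs_mul, abs_mul]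
        gcongr
    _ = 6 * (Γ ^ 4 * S ^ 2) * δ + 3 * (Γ ^ 3 * 1) * δ := by ring
    _ ≤ 6 * (Γ ^ 5 * S ^ 2) * δ + 3 * (Γ ^ 5 * S ^ 2) * δ := by
        have h5 : Γ ^ 4 ≤ Γ ^ 5 := pow_le_pow_right₀ hΓ (by norm_num)
        have h6 : Γ ^ 3 ≤ Γ ^ 5 := pow_le_pow_right₀ hΓ (by norm_num)
        have h7 : 1 ≤ S ^ 2 := one_le_pow₀ hS
        gcongr
    _ = _ := by ring

theorem abs_quad_sub_le {J J' : Mat n d} {z z' : Sp n d} {Γ S δ : ℝ} (hS : 1 ≤ S) (hJ : ‖J‖ ≤ Γ)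
    (hJ' : ‖J'‖ ≤ Γ) (hz : ‖z‖ ≤ S) (hz' : ‖z'‖ ≤ S) (hδ : 0 ≤ δ) (dJ : ‖J - J'‖ ≤ Γ * δ)
    (dz : ‖z - z'‖ ≤ δ) :
    |inner ℝ z (act J z) - inner ℝ z' (act J' z')| ≤ 3 * Γ * S ^ 2 * δ := by
  have hS0 : 0 ≤ S := by linarith
  have hΓ0 : 0 ≤ Γ := (norm_nonneg _).trans hJ
  refine (abs_inner_act_sub_le J J' z z z' z').trans ?_
  calc _ ≤ δ * Γ * S + S * (Γ * δ) * S + S * Γ * δ := by gcongr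
    _ = Γ * δ * (2 * S + S ^ 2) := by ring
    _ ≤ Γ * δ * (3 * S ^ 2) := mul_le_mul_of_nonneg_left (by nlinarith) (by positivity)
    _ = _ := by ring

theorem abs_product_sub_le {g g' e e' Q Q' G δ T Γ S : ℝ} (hΓ : 1 ≤ Γ) (hS : 1 ≤ S) (hG : 0 ≤ G)
    (hδ : 0 ≤ δ) (hT : 0 ≤ T) (g1 : |g'| ≤ G) (g2 : |g - g'| ≤ G * δ) (e0 : 0 ≤ e) (e1 : e ≤ T)
    (e0' : 0 ≤ e') (e1' : e' ≤ T) (e2 : |e - e'| ≤ 3 * Γ * S ^ 2 * δ * T)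
    (q1 : |Q| ≤ 2 * Γ ^ 4 * S ^ 2) (q2 : |Q - Q'| ≤ 9 * Γ ^ 5 * S ^ 2 * δ) :
    |g * e * Q - g' * e' * Q'| ≤ 20 * G * δ * T * Γ ^ 5 * S ^ 4 := by
  have ee : g * e * Q - g' * e' * Q' = (g - g') * e * Q + g' * (e - e') * Q +
      g' * e' * (Q - Q') := by ring
  rw [ee]
  have t1 : |(g - g') * e * Q| ≤ (G * δ) * T * (2 * Γ ^ 4 * S ^ 2) := by
    rw [abs_mul, abs_mul, abs_of_nonneg e0]; gcongr
  have t2 : |g' * (e - e') * Q| ≤ G * (3 * Γ * S ^ 2 * δ * T) * (2 * Γ ^ 4 * S ^ 2) := by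
    rw [abs_mul, abs_mul]; gcongr
  have t3 : |g' * e' * (Q - Q')| ≤ G * T * (9 * Γ ^ 5 * S ^ 2 * δ) := by
    rw [abs_mul, abs_mul, abs_of_nonneg e0']; gcongr
  have h1 : Γ ^ 4 ≤ Γ ^ 5 := pow_le_pow_right₀ hΓ (by norm_num)
  have h2 : S ^ 2 ≤ S ^ 4 := pow_le_pow_right₀ hS (by norm_num)
  have h3 : 0 ≤ Γ := by linarith
  calc _ ≤ (G * δ) * T * (2 * Γ ^ 4 * S ^ 2) + G * (3 * Γ * S ^ 2 * δ * T) * (2 * Γ ^ 4 * S ^ 2) +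
        G * T * (9 * Γ ^ 5 * S ^ 2 * δ) :=
        (abs_add_three _ _ _).trans (add_le_add (add_le_add t1 t2) t3)
    _ = G * δ * T * (2 * (Γ ^ 4 * S ^ 2) + 6 * (Γ ^ 5 * S ^ 4) + 9 * (Γ ^ 5 * S ^ 2)) := by ring
    _ ≤ G * δ * T * (2 * (Γ ^ 5 * S ^ 4) + 6 * (Γ ^ 5 * S ^ 4) + 9 * (Γ ^ 5 * S ^ 4)) := by
        gcongr
    _ ≤ G * δ * T * (20 * (Γ ^ 5 * S ^ 4)) := by
        have h4 : 0 ≤ Γ ^ 5 * S ^ 4 := by positivity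
        refine mul_le_mul_of_nonneg_left ?_ (by positivity)
        linarith
    _ = _ := by ring

theorem norm_basisVec (a : Idx n d) : ‖(basisVec a : Sp n d)‖ = 1 := by simp [basisVec]

theorem norm_act_basisVec_le (P : Mat n d) (a : Idx n d) : ‖act P (basisVec a)‖ ≤ ‖P‖ := by
  simpa [norm_basisVec] using norm_act_le P (basisVec a)

variable [NeZero n]

theorem gaussKer_eq (i j : Fin d) (K P : Mat n d) (z : Sp n d) :
    gaussKer i j K P z = gaussNorm K * Real.exp (-(1 / 2) * inner ℝ z (act K⁻¹ z)) *
      gaussPoly K⁻¹ (act P (basisVec (0, i))) (act P (basisVec (0, j))) z := rfl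

/-- Rapid decay of the differentiated Gaussian kernels. -/
theorem exists_gaussKer_bound (n d : ℕ) [NeZero n] {c C : ℝ} (hc : 0 < c) (hC : 0 < C) (E : ℝ)
    (M : ℕ) : ∃ D : ℝ, 0 < D ∧ ∀ (i j : Fin d) (K P : Mat n d) (z : Sp n d), IsElliptic c C K →
      ‖P‖ ≤ E → |gaussKer i j K P z| ≤ D / (1 + ‖z‖) ^ M := by
  obtain ⟨G, hG0, hG, -⟩ := exists_gaussNorm_bound n d C hc
  -- Two additional powers of decay pay for the quadratic polynomial factor.
  obtain ⟨D, hD0, hD⟩ := exists_exp_le (1 / 2 * (c / C ^ 2)) (by positivity) (M + 2)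
  set Γ := max 1 (max c⁻¹ E) with hΓ
  have hΓ1 : 1 ≤ Γ := le_max_left _ _
  have hΓc : c⁻¹ ≤ Γ := (le_max_left _ _).trans (le_max_right _ _)
  have hΓE : E ≤ Γ := (le_max_right _ _).trans (le_max_right _ _)
  refine ⟨G * D * (2 * Γ ^ 4), by positivity, fun i j K P z hK hP => ?_⟩
  have hz : 0 ≤ ‖z‖ := norm_nonneg z
  have h1 := abs_gaussPoly_le (z := z) (S := 1 + ‖z‖) hΓ1 ((hK.norm_inv_le hc).trans hΓc)
    ((norm_act_basisVec_le P (0, i)).trans (hP.trans hΓE))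
    ((norm_act_basisVec_le P (0, j)).trans (hP.trans hΓE)) (by linarith) (by linarith)
  have h2 : Real.exp (-(1 / 2) * inner ℝ z (act K⁻¹ z)) ≤ D / (1 + ‖z‖) ^ (M + 2) := by
    refine le_trans (Real.exp_le_exp.2 ?_) (hD _ hz)
    have := hK.inner_inv_ge hc hC z
    linarith
  rw [gaussKer_eq, abs_mul, abs_mul, abs_of_pos (Real.exp_pos _)]
  calc _ ≤ G * (D / (1 + ‖z‖) ^ (M + 2)) * (2 * Γ ^ 4 * (1 + ‖z‖) ^ 2) := by
        gcongr
        exact hG K hK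
    _ = _ := by rw [pow_add]; field_simp

/-- Lipschitz dependence, with rapid decay, of the differentiated Gaussian kernels on all their
parameters. -/
theorem exists_gaussKer_lipschitz (n d : ℕ) [NeZero n] {c C : ℝ} (hc : 0 < c) (hC : 0 < C) (E : ℝ)
    {B : ℝ} (hB : 1 ≤ B) (M : ℕ) : ∃ D : ℝ, 0 < D ∧ ∀ (i j : Fin d) (K P K' P' : Mat n d)
      (z z' : Sp n d), IsElliptic c C K → IsElliptic c C K' → ‖P‖ ≤ E → ‖P'‖ ≤ E →
      1 + ‖z‖ ≤ B * (1 + ‖z'‖) → 1 + ‖z'‖ ≤ B * (1 + ‖z‖) →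
      |gaussKer i j K P z - gaussKer i j K' P' z'| ≤
        D * (‖K - K'‖ + ‖P - P'‖ + ‖z - z'‖) / (1 + ‖z‖) ^ M := by
  obtain ⟨G, hG0, hG, hGl⟩ := exists_gaussNorm_bound n d C hc
  -- Four additional powers of decay pay for the factor `S ^ 4` of `abs_product_sub_le`.
  obtain ⟨D₀, hD0, hD⟩ := exists_exp_le (1 / 2 * (c / C ^ 2)) (by positivity) (M + 4)
  -- `Γ` dominates the inverse covariances, the matrices `P`, and the Lipschitz constant of matrix
  -- inversion.
  set Γ := max 1 (max c⁻¹ (max E (c⁻¹ * c⁻¹))) with hΓ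
  have hΓ1 : 1 ≤ Γ := le_max_left _ _
  have hΓc : c⁻¹ ≤ Γ := (le_max_left _ _).trans (le_max_right _ _)
  have hΓE : E ≤ Γ := (le_max_left _ _).trans ((le_max_right _ _).trans (le_max_right _ _))
  have hΓd : c⁻¹ * c⁻¹ ≤ Γ := (le_max_right _ _).trans ((le_max_right _ _).trans (le_max_right _ _))
  have hΓ0 : 0 < Γ := by linarith
  have hB0 : 0 < B := by linarith
  set D := D₀ * B ^ (M + 4) with hDdef
  refine ⟨G * D * (20 * Γ ^ 5) * (1 + B) ^ 4, by positivity,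
    fun i j K P K' P' z z' hK hK' hP hP' hzz' hz'z => ?_⟩
  have hz := norm_nonneg z
  have hz' := norm_nonneg z'
  set δ := ‖K - K'‖ + ‖P - P'‖ + ‖z - z'‖ with hδ
  have dK : ‖K - K'‖ ≤ δ := by have := norm_nonneg (P - P'); have := norm_nonneg (z - z'); linarith
  have dP : ‖P - P'‖ ≤ δ := by have := norm_nonneg (K - K'); have := norm_nonneg (z - z'); linarith
  have dz : ‖z - z'‖ ≤ δ := by have := norm_nonneg (K - K'); have := norm_nonneg (P - P'); linarith
  have hδ0 : 0 ≤ δ := (norm_nonneg _).trans dK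
  -- By comparability, `S` dominates both `‖z‖` and `‖z'‖`, so the final bound involves `z` alone.
  set S := (1 + B) * (1 + ‖z‖) with hS
  have hS1 : 1 ≤ S := by nlinarith
  have zS : ‖z‖ ≤ S := by nlinarith
  have zS' : ‖z'‖ ≤ S := by nlinarith
  have dJ : ‖K⁻¹ - K'⁻¹‖ ≤ Γ * δ :=
    (hK.norm_inv_sub_inv_le hK' hc).trans (mul_le_mul hΓd dK (norm_nonneg _) hΓ0.le)
  have hJ := (hK.norm_inv_le hc).trans hΓc
  have hJ' := (hK'.norm_inv_le hc).trans hΓc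
  have dp : ∀ a : Idx n d, ‖act P (basisVec a) - act P' (basisVec a)‖ ≤ Γ * δ := fun a => by
    rw [← sub_act]
    exact (norm_act_basisVec_le _ a).trans (dP.trans (le_mul_of_one_le_left hδ0 hΓ1))
  have hp : ∀ a, ‖act P (basisVec a)‖ ≤ Γ := fun a => (norm_act_basisVec_le P a).trans (hP.trans hΓE)
  have hp' : ∀ a, ‖act P' (basisVec a)‖ ≤ Γ := fun a =>
    (norm_act_basisVec_le P' a).trans (hP'.trans hΓE)
  set Q := gaussPoly K⁻¹ (act P (basisVec (0, i))) (act P (basisVec (0, j))) z with hQ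
  set Q' := gaussPoly K'⁻¹ (act P' (basisVec (0, i))) (act P' (basisVec (0, j))) z' with hQ'
  have q1 : |Q| ≤ 2 * Γ ^ 4 * S ^ 2 := abs_gaussPoly_le hΓ1 hJ (hp _) (hp _) zS hS1
  have q2 : |Q - Q'| ≤ 9 * Γ ^ 5 * S ^ 2 * δ := abs_gaussPoly_sub_le hΓ1 hJ (hp _) (hp _) zS hS1 hJ'
    (hp' _) zS' hδ0 (hp' _) dJ (dp _) (dp _) dz
  set T := D / (1 + ‖z‖) ^ (M + 4) with hT
  have hT0 : 0 ≤ T := by positivity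
  set e := Real.exp (-(1 / 2) * inner ℝ z (act K⁻¹ z)) with he
  set e' := Real.exp (-(1 / 2) * inner ℝ z' (act K'⁻¹ z')) with he'
  have e0 : 0 < e := Real.exp_pos _
  have e0' : 0 < e' := Real.exp_pos _
  have e1 : e ≤ T := by
    have h1 : e ≤ D₀ / (1 + ‖z‖) ^ (M + 4) := by
      refine le_trans (Real.exp_le_exp.2 ?_) (hD _ hz)
      have := hK.inner_inv_ge hc hC z
      linarith
    refine h1.trans ?_
    rw [hT, hDdef]
    gcongr
    exact le_mul_of_one_le_right hD0.le (one_le_pow₀ hB)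
  have e1' : e' ≤ T := by
    have h1 : e' ≤ D₀ / (1 + ‖z'‖) ^ (M + 4) := by
      refine le_trans (Real.exp_le_exp.2 ?_) (hD _ hz')
      have := hK'.inner_inv_ge hc hC z'
      linarith
    refine h1.trans ?_
    rw [hT, hDdef, div_le_div_iff₀ (by positivity) (by positivity), mul_assoc, ← mul_pow]
    gcongr
  have e2 : |e - e'| ≤ 3 * Γ * S ^ 2 * δ * T := by
    refine (abs_exp_sub_exp_le _ _).trans ?_
    have h1 : |inner ℝ z (act K⁻¹ z) - inner ℝ z' (act K'⁻¹ z')| ≤ 3 * Γ * S ^ 2 * δ :=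
      abs_quad_sub_le hS1 hJ hJ' zS zS' hδ0 dJ dz
    have h2 : |(-(1 / 2) * inner ℝ z (act K⁻¹ z)) - (-(1 / 2) * inner ℝ z' (act K'⁻¹ z'))| =
        1 / 2 * |inner ℝ z (act K⁻¹ z) - inner ℝ z' (act K'⁻¹ z')| := by
      rw [← mul_sub, abs_mul]; norm_num
    rw [h2]
    calc _ ≤ 1 / 2 * (3 * Γ * S ^ 2 * δ) * (T + T) := by gcongr
      _ = _ := by ring
  have g1 := hG K hK
  have g1' := hG K' hK'
  have g2 : |gaussNorm K - gaussNorm K'| ≤ G * δ := (hGl K K' hK hK').trans (by gcongr)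
  rw [gaussKer_eq, gaussKer_eq, ← hQ, ← hQ', ← he, ← he']
  refine (abs_product_sub_le hΓ1 hS1 hG0.le hδ0 hT0 g1' g2 e0.le e1 e0'.le e1' e2 q1 q2).trans
    (le_of_eq ?_)
  rw [hT, hS, pow_add, mul_pow]
  field_simp

end GaussianBounds

/-! ### Derivatives and vanishing integrals of Gaussians. -/

section Calculus

theorem integrable_one_div_pow {M : ℕ} (hM : n * d < M) :
    Integrable (fun z : Sp n d => 1 / (1 + ‖z‖) ^ M) := by
  have h := integrable_one_add_norm (E := Sp n d) (μ := volume) (r := M) (by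
    rw [finrank_euclideanSpace]; simp only [Fintype.card_prod, Fintype.card_fin]; exact_mod_cast hM)
  refine h.congr (ae_of_all _ fun z => ?_)
  simp only [one_div]
  rw [Real.rpow_neg (by positivity), Real.rpow_natCast]

variable {J : Mat n d}

theorem hasDerivAt_gauss (hJ : Jᵀ = J) (z p : Sp n d) :
    HasDerivAt (fun s : ℝ => Real.exp (-(1 / 2) * inner ℝ (z + s • p) (act J (z + s • p))))
      (-inner ℝ p (act J z) * Real.exp (-(1 / 2) * inner ℝ z (act J z))) 0 := by
  have hsym : inner ℝ z (act J p) = inner ℝ p (act J z) := by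
    rw [inner_act, hJ, real_inner_comm]
  have e : ∀ s : ℝ, inner ℝ (z + s • p) (act J (z + s • p)) =
      inner ℝ z (act J z) + 2 * inner ℝ p (act J z) * s + inner ℝ p (act J p) * s ^ 2 := by
    intro s
    simp only [act_add, act_smul, inner_add_left, inner_add_right, inner_smul_left,
      inner_smul_right, conj_trivial, hsym]
    ring
  simp_rw [e]
  have h1 : HasDerivAt (fun s : ℝ => -(1 / 2) * (inner ℝ z (act J z) + 2 * inner ℝ p (act J z) * s +
      inner ℝ p (act J p) * s ^ 2)) (-(1 / 2) * (2 * inner ℝ p (act J z) * 1 +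
        inner ℝ p (act J p) * (2 * (0 : ℝ) ^ 1 * 1))) 0 := by
    have h2 := ((hasDerivAt_id' (0 : ℝ)).const_mul (2 * inner ℝ p (act J z))).const_add
      (inner ℝ z (act J z))
    have h3 := ((hasDerivAt_id' (0 : ℝ)).fun_pow 2).const_mul (inner ℝ p (act J p))
    exact (h2.fun_add h3).const_mul _
  refine h1.exp.congr_deriv ?_
  simp
  ring

theorem hasDerivAt_gauss_deriv (hJ : Jᵀ = J) (z p q : Sp n d) :
    HasDerivAt (fun s : ℝ => -inner ℝ q (act J (z + s • p)) *
        Real.exp (-(1 / 2) * inner ℝ (z + s • p) (act J (z + s • p))))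
      (Real.exp (-(1 / 2) * inner ℝ z (act J z)) * gaussPoly J p q z) 0 := by
  have h1 : HasDerivAt (fun s : ℝ => -inner ℝ q (act J (z + s • p))) (-inner ℝ q (act J p)) 0 := by
    have e : ∀ s : ℝ, -inner ℝ q (act J (z + s • p)) =
        -inner ℝ q (act J z) + -inner ℝ q (act J p) * s := by
      intro s
      simp only [act_add, act_smul, inner_add_right, inner_smul_right]
      ring
    simp_rw [e]
    simpa using ((hasDerivAt_id' (0 : ℝ)).const_mul (-inner ℝ q (act J p))).const_add
      (-inner ℝ q (act J z))
  refine (h1.mul (hasDerivAt_gauss hJ z p)).congr_deriv ?_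
  have hsym : inner ℝ q (act J p) = inner ℝ p (act J q) := by
    rw [inner_act, hJ, real_inner_comm]
  simp only [zero_smul, add_zero, gaussPoly, hsym]
  ring

variable [NeZero n] {c C : ℝ} {K : Mat n d}

theorem continuousAt_gaussKer (i j : Fin d) {x : Mat n d × Mat n d × Sp n d} (hx : 0 < x.1.det) :
    ContinuousAt (fun x : Mat n d × Mat n d × Sp n d => gaussKer i j x.1 x.2.1 x.2.2) x := by
  have hinv : ContinuousAt (fun x : Mat n d × Mat n d × Sp n d => x.1⁻¹) x := by
    simp only [Matrix.inv_def, Ring.inverse_eq_inv']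
    have h1 : ContinuousAt (fun x : Mat n d × Mat n d × Sp n d => x.1.det) x :=
      continuous_fst.matrix_det.continuousAt
    exact (h1.inv₀ hx.ne').smul continuous_fst.matrix_adjugate.continuousAt
  have hg : ContinuousAt (fun x : Mat n d × Mat n d × Sp n d => gaussNorm x.1) x :=
    (contDiffAt_gaussNorm hx).continuousAt.comp continuousAt_fst
  have hz : ContinuousAt (fun x : Mat n d × Mat n d × Sp n d => x.2.2) x := by fun_prop
  have hact : ∀ {f : Mat n d × Mat n d × Sp n d → Mat n d} {g : Mat n d × Mat n d × Sp n d → Sp n d},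
      ContinuousAt f x → ContinuousAt g x → ContinuousAt (fun x => act (f x) (g x)) x :=
    fun hf hg => continuous_act_uncurry.continuousAt.comp (hf.prodMk hg)
  have hP : ∀ a, ContinuousAt (fun x : Mat n d × Mat n d × Sp n d => act x.2.1 (basisVec a)) x :=
    fun a => hact (by fun_prop) continuousAt_const
  simp only [gaussKer_eq, gaussPoly]
  exact (hg.mul ((continuousAt_const.mul (hz.inner (hact hinv hz))).rexp)).mul
    ((((hP _).inner (hact hinv hz)).mul ((hP _).inner (hact hinv hz))).sub
      ((hP _).inner (hact hinv (hP _))))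

theorem integrable_gaussKer (hK : IsElliptic c C K) (hc : 0 < c) (hC : 0 < C) (i j : Fin d)
    (P : Mat n d) : Integrable (gaussKer i j K P) := by
  obtain ⟨D, hD0, hD⟩ := exists_gaussKer_bound n d hc hC ‖P‖ (n * d + 1)
  refine ((integrable_one_div_pow (n := n) (d := d) (Nat.lt_succ_self _)).const_mul D).mono' ?_
    (ae_of_all _ fun z => ?_)
  · refine Continuous.aestronglyMeasurable (continuous_iff_continuousAt.2 fun z => ?_)
    exact (continuousAt_gaussKer i j (x := (K, P, z)) (hK.det_pos hc)).comp
      (f := fun z => (K, P, z)) (by fun_prop)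
  · rw [mul_one_div]
    exact hD i j K P z hK le_rfl

/-- The differentiated Gaussian kernels have vanishing integral. -/
theorem integral_gaussKer (hK : IsElliptic c C K) (hc : 0 < c) (hC : 0 < C) (i j : Fin d)
    (P : Mat n d) : ∫ z, gaussKer i j K P z = 0 := by
  set p := act P (basisVec (0, i)) with hp
  set q := act P (basisVec (0, j)) with hq
  -- `f` is the derivative of the Gaussian in direction `q`, so the kernel is the derivative of `f`
  -- in direction `p`.
  set f : Sp n d → ℝ := fun z => gaussNorm K * (-inner ℝ q (act K⁻¹ z) *
    Real.exp (-(1 / 2) * inner ℝ z (act K⁻¹ z))) with hf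
  have hline : ∀ z, HasLineDerivAt ℝ f (gaussKer i j K P z) z p := by
    intro z
    refine ((hasDerivAt_gauss_deriv hK.inv_transpose z p q).const_mul (gaussNorm K)).congr_deriv ?_
    rw [gaussKer_eq, mul_assoc]
  have hfi : Integrable f := by
    obtain ⟨D, hD0, hD⟩ := exists_exp_le (1 / 2 * (c / C ^ 2)) (by positivity) (n * d + 2)
    refine ((integrable_one_div_pow (n := n) (d := d) (Nat.lt_succ_self _)).const_mul
      (|gaussNorm K| * ((‖q‖ * ‖K⁻¹‖) * D))).mono' ?_ (ae_of_all _ fun z => ?_)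
    · refine Continuous.aestronglyMeasurable ?_
      have := continuous_act K⁻¹
      fun_prop
    · rw [Real.norm_eq_abs, hf, abs_mul, abs_mul, abs_neg, abs_of_pos (Real.exp_pos _), mul_one_div,
        mul_div_assoc]
      refine mul_le_mul_of_nonneg_left ?_ (abs_nonneg _)
      have h1 : Real.exp (-(1 / 2) * inner ℝ z (act K⁻¹ z)) ≤ D / (1 + ‖z‖) ^ (n * d + 2) := by
        refine le_trans (Real.exp_le_exp.2 ?_) (hD _ (norm_nonneg z))
        have := hK.inner_inv_ge hc hC z
        linarith
      calc _ ≤ (‖q‖ * ‖K⁻¹‖ * (1 + ‖z‖)) * (D / (1 + ‖z‖) ^ (n * d + 2)) := by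
            refine mul_le_mul ((abs_inner_act_le _ _ _).trans ?_) h1 (Real.exp_pos _).le
              (by positivity)
            gcongr
            linarith
        _ = _ := by rw [pow_succ (1 + ‖z‖) (n * d + 1)]; field_simp
  have hgi := integrable_gaussKer hK hc hC i j P
  -- Integration by parts against the constant function `1`.
  have h := integral_bilinear_hasLineDerivAt_right_eq_neg_left_of_integrable (μ := volume)
    (f := fun _ : Sp n d => (1 : ℝ)) (f' := fun _ => 0) (g := f) (g' := gaussKer i j K P) (v := p)
    (B := ContinuousLinearMap.mul ℝ ℝ) (by simp) (by simpa using hgi) (by simpa using hfi)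
    (fun z _ => hasDerivAt_const _ _) (fun z _ => hline z)
  simpa using h

end Calculus

/-! ### Linear changes of variables. -/

section ChangeOfVariables

theorem map_act_volume {X : Mat n d} (hX : X.det ≠ 0) :
    Measure.map (act X) (volume : Measure (Sp n d)) = ENNReal.ofReal |X.det|⁻¹ • volume := by
  have hdet : LinearMap.det (Matrix.toEuclideanLin X) = X.det := by
    rw [Matrix.toEuclideanLin_eq_toLin_orthonormal, LinearMap.det_toLin]
  have h := Measure.map_linearMap_addHaar_eq_smul_addHaar (volume : Measure (Sp n d))
    (f := Matrix.toEuclideanLin X) (by rwa [hdet])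
  rw [hdet, abs_inv] at h
  exact h

theorem measurableEmbedding_act {X : Mat n d} (hX : X.det ≠ 0) : MeasurableEmbedding (act X) := by
  have hu : IsUnit X.det := hX.isUnit
  refine (continuous_act X).measurableEmbedding (Function.LeftInverse.injective (g := act X⁻¹) ?_)
  exact fun x => by rw [← act_mul, Matrix.nonsing_inv_mul X hu, act_one]

theorem integral_comp_act {X : Mat n d} (hX : X.det ≠ 0) (f : Sp n d → ℝ) :
    ∫ w, f (act X w) = |X.det|⁻¹ * ∫ z, f z := by
  rw [← (measurableEmbedding_act hX).integral_map, map_act_volume hX, integral_smul_measure,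
    ENNReal.toReal_ofReal (by positivity), smul_eq_mul]

end ChangeOfVariables

/-! ### The flow of the drift. -/

section Flow

variable {η κ : ℝ} {𝓔 : Fin n → Set (Matrix (Fin d) (Fin d) ℝ)} {F : ℝ → Sp n d → Sp n d}

theorem DriftAssumption.continuous (hF : DriftAssumption η κ 𝓔 F) (t : ℝ) : Continuous (F t) := by
  refine (LipschitzWith.of_dist_le_mul (K := Real.toNNReal κ) fun x y => ?_).continuous
  rw [dist_eq_norm, dist_eq_norm]
  exact (hF.lip t x y).trans (by gcongr; exact Real.le_coe_toNNReal κ)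

theorem isCaratheodory_drift (hF : DriftAssumption η κ 𝓔 F) : ∃ M, IsCaratheodory F κ M := by
  obtain ⟨M, hM⟩ := hF.bdd 0
  refine ⟨M, fun φ hφ => ?_, hF.lip, hM⟩
  have h := stronglyMeasurable_uncurry_of_continuous_of_stronglyMeasurable
    (u := fun (x : Sp n d) (t : ℝ) => F t x) hF.continuous fun x => (hF.meas x).stronglyMeasurable
  exact h.comp_measurable (hφ.measurable.prodMk measurable_id)

/-- `φ` is a trajectory of the field `F`. -/
def IsTraj (F : ℝ → Sp n d → Sp n d) (φ : ℝ → Sp n d) : Prop :=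
  Continuous φ ∧ ∀ s t, φ t = φ s + ∫ u in s..t, F u (φ u)

theorem intervalIntegrable_drift (hF : DriftAssumption η κ 𝓔 F) {φ : ℝ → Sp n d}
    (hφ : Continuous φ) (a b : ℝ) : IntervalIntegrable (fun u => F u (φ u)) volume a b := by
  obtain ⟨M, hM⟩ := isCaratheodory_drift hF
  exact hM.intervalIntegrable hφ a b

theorem flow_spec (hF : DriftAssumption η κ 𝓔 F) (s : ℝ) (x : Sp n d) :
    IsIntegralCurveFrom F s x fun t => flow F t s x := by
  obtain ⟨M, hM⟩ := isCaratheodory_drift hF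
  exact Classical.epsilon_spec (hM.exists_solution s x)

theorem flow_self (hF : DriftAssumption η κ 𝓔 F) (s : ℝ) (x : Sp n d) : flow F s s x = x := by
  simpa using (flow_spec hF s x).2 s

theorem continuous_flow_left (hF : DriftAssumption η κ 𝓔 F) (s : ℝ) (x : Sp n d) :
    Continuous fun t => flow F t s x := (flow_spec hF s x).1

theorem isTraj_flow (hF : DriftAssumption η κ 𝓔 F) (s : ℝ) (x : Sp n d) :
    IsTraj F fun t => flow F t s x := by
  have h := flow_spec hF s x
  refine ⟨h.1, fun a b => ?_⟩
  have hi := intervalIntegrable_drift hF h.1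
  rw [h.2 b, h.2 a, add_assoc, intervalIntegral.integral_add_adjacent_intervals (hi _ _) (hi _ _)]

theorem IsTraj.eq_flow (hF : DriftAssumption η κ 𝓔 F) (hκ : 0 ≤ κ) {φ : ℝ → Sp n d}
    (hφ : IsTraj F φ) (s t : ℝ) : φ t = flow F t s (φ s) := by
  obtain ⟨M, hM⟩ := isCaratheodory_drift hF
  have h := flow_spec hF s (φ s)
  exact congrFun (hM.unique hκ hφ.1 h.1 (hφ.2 s) h.2) t

theorem flow_flow (hF : DriftAssumption η κ 𝓔 F) (hκ : 0 ≤ κ) (t u s : ℝ) (x : Sp n d) :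
    flow F t u (flow F u s x) = flow F t s x :=
  ((isTraj_flow hF s x).eq_flow hF hκ u t).symm

/-- The Lipschitz bound for trajectories. -/
theorem norm_traj_sub_le (hF : DriftAssumption η κ 𝓔 F) (hκ : 0 ≤ κ) {φ ψ : ℝ → Sp n d}
    (hφ : IsTraj F φ) (hψ : IsTraj F ψ) (s t : ℝ) :
    ‖φ t - ψ t‖ ≤ ‖φ s - ψ s‖ * Real.exp (κ * |t - s|) := by
  refine gronwall (f := fun u => ‖φ u - ψ u‖) (hφ.1.sub hψ.1).norm hκ (fun u _ => ?_)
    fun _ => norm_nonneg _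
  have h1 := intervalIntegrable_drift hF hφ.1
  have h2 := intervalIntegrable_drift hF hψ.1
  have e : φ u - ψ u = (φ s - ψ s) + ∫ v in s..u, (F v (φ v) - F v (ψ v)) := by
    rw [intervalIntegral.integral_sub (h1 _ _) (h2 _ _), hφ.2 s u, hψ.2 s u]; abel
  change ‖φ u - ψ u‖ ≤ _
  rw [e]
  refine (norm_add_le _ _).trans ?_
  refine add_le_add le_rfl ((intervalIntegral.norm_integral_le_abs_of_norm_le
    (g := fun v => κ * ‖φ v - ψ v‖) (ae_of_all _ fun v => hF.lip v _ _)
    (Continuous.intervalIntegrable (continuous_const.mul (hφ.1.sub hψ.1).norm) _ _)).trans ?_)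
  rw [intervalIntegral.integral_const_mul, abs_mul, abs_of_nonneg hκ]

theorem norm_flow_sub_flow_le (hF : DriftAssumption η κ 𝓔 F) (hκ : 0 ≤ κ) (t s : ℝ) (x y : Sp n d) :
    ‖flow F t s x - flow F t s y‖ ≤ ‖x - y‖ * Real.exp (κ * |t - s|) := by
  have := norm_traj_sub_le hF hκ (isTraj_flow hF s x) (isTraj_flow hF s y) s t
  rwa [flow_self hF, flow_self hF] at this

/-- The trajectory through the varying starting point is compared, at its starting time, with the
trajectory through the fixed one. -/
theorem continuous_flow (hF : DriftAssumption η κ 𝓔 F) (hκ : 0 ≤ κ) (s : ℝ) :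
    Continuous fun q : ℝ × Sp n d => flow F s q.1 q.2 := by
  refine continuous_iff_continuousAt.2 fun q₀ => ?_
  obtain ⟨t₀, y₀⟩ := q₀
  rw [ContinuousAt, tendsto_iff_norm_sub_tendsto_zero]
  have hc := continuous_flow_left hF t₀ y₀
  have hb : Continuous fun q : ℝ × Sp n d =>
      ‖q.2 - flow F q.1 t₀ y₀‖ * Real.exp (κ * |s - q.1|) := by
    have := hc.comp (continuous_fst (X := ℝ) (Y := Sp n d))
    exact (continuous_snd.sub this).norm.mul (by fun_prop)
  have hlim := hb.tendsto (t₀, y₀)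
  simp only [flow_self hF, sub_self, norm_zero, zero_mul] at hlim
  refine squeeze_zero (fun _ => norm_nonneg _) (fun q => ?_) hlim
  have := norm_flow_sub_flow_le hF hκ s q.1 q.2 (flow F q.1 t₀ y₀)
  rwa [flow_flow hF hκ] at this

end Flow

/-! ### The subdiagonal gradient of the drift. -/

section Gradient

variable {η κ : ℝ} {𝓔 : Fin n → Set (Matrix (Fin d) (Fin d) ℝ)} {F : ℝ → Sp n d → Sp n d}

theorem inject_single (j : Fin n) (l : Fin d) :
    inject j (EuclideanSpace.single l 1) = (basisVec (j, l) : Sp n d) := by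
  ext ⟨a, b⟩
  by_cases h : a = j <;> by_cases h' : b = l <;> simp [inject, basisVec, h, h']

theorem inject_smul (j : Fin n) (c : ℝ) (v : EuclideanSpace ℝ (Fin d)) :
    (inject j (c • v) : Sp n d) = c • inject j v := by
  ext ⟨a, b⟩
  by_cases h : a = j <;> simp [inject, h]

/-- Differentiability holds jointly in the variables of the block, so directional derivatives are
linear and given by the partial derivatives in `blockGrad`. -/
theorem DriftAssumption.hasDerivAt (hF : DriftAssumption η κ 𝓔 F) (t : ℝ) (x : Sp n d)
    {i j : Fin n} (hij : j.val + 1 = i.val) (v : EuclideanSpace ℝ (Fin d)) (k : Fin d) :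
    HasDerivAt (fun s : ℝ => F t (x + s • inject j v) (i, k))
      (∑ l, blockGrad F t x i j k l * v l) 0 := by
  set g : EuclideanSpace ℝ (Fin d) → EuclideanSpace ℝ (Fin d) :=
    fun v => block (F t (x + inject j v)) i with hg
  have hd := (hF.diff t x i j hij).hasFDerivAt
  set D := fderiv ℝ g 0 with hD
  have key : ∀ v, HasDerivAt (fun s : ℝ => F t (x + s • inject j v) (i, k)) (D v k) 0 := by
    intro v
    have h1 : HasDerivAt (fun s : ℝ => s • v) v 0 := by
      simpa using (hasDerivAt_id' (0 : ℝ)).smul_const v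
    have hd' : HasFDerivAt g D ((0 : ℝ) • v) := by rwa [zero_smul]
    have h2 := ((EuclideanSpace.proj (𝕜 := ℝ) k).hasFDerivAt.comp_hasDerivAt (0 : ℝ)
      (hd'.comp_hasDerivAt (0 : ℝ) h1))
    refine (h2.congr_of_eventuallyEq (Eventually.of_forall fun s => ?_))
    simp [hg, block, inject_smul]
  have hgrad : ∀ l, blockGrad F t x i j k l = D (EuclideanSpace.single l 1) k := by
    intro l
    have := (key (EuclideanSpace.single l 1)).deriv
    rw [inject_single] at this
    exact this
  refine (key v).congr_deriv ?_
  have hv : v = ∑ l, v l • EuclideanSpace.single l (1 : ℝ) := by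
    ext m; simp [Finset.sum_apply, Pi.single_apply]
  conv_lhs => rw [hv, map_sum]
  simp only [map_smul, WithLp.ofLp_sum, Finset.sum_apply, PiLp.smul_apply, smul_eq_mul, hgrad]
  exact Finset.sum_congr rfl fun l _ => mul_comm _ _

theorem DriftAssumption.hasDerivAt_basisVec (hF : DriftAssumption η κ 𝓔 F) (t : ℝ) (x : Sp n d)
    {i j : Fin n} (hij : j.val + 1 = i.val) (k l : Fin d) :
    HasDerivAt (fun s : ℝ => F t (x + s • basisVec (j, l)) (i, k)) (blockGrad F t x i j k l) 0 := by
  have := hF.hasDerivAt t x hij (EuclideanSpace.single l 1) k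
  rw [inject_single] at this
  simpa using this

theorem DriftAssumption.abs_blockGrad_le (hF : DriftAssumption η κ 𝓔 F) (hκ : 0 ≤ κ) (t : ℝ)
    (x : Sp n d) (i j : Fin n) (k l : Fin d) : |blockGrad F t x i j k l| ≤ κ := by
  have h := norm_lineDeriv_le_of_lipschitz ℝ (f := fun z => F t z (i, k)) (x₀ := x)
    (v := basisVec (j, l)) (C := Real.toNNReal κ) (LipschitzWith.of_dist_le_mul fun z z' => ?_)
  · rwa [norm_basisVec, mul_one, Real.coe_toNNReal _ hκ] at h
  · rw [Real.coe_toNNReal _ hκ, Real.dist_eq, dist_eq_norm]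
    exact (PiLp.norm_apply_le (F t z - F t z') (i, k)).trans (hF.lip t z z')

/-- A pointwise limit of difference quotients along a sequence of increments. -/
theorem DriftAssumption.measurable_blockGrad (hF : DriftAssumption η κ 𝓔 F) (x : Sp n d)
    {i j : Fin n} (hij : j.val + 1 = i.val) (k l : Fin d) :
    Measurable fun t => blockGrad F t x i j k l := by
  set h : ℕ → ℝ := fun m => 1 / ((m : ℝ) + 1) with hh
  have hlim : Tendsto h atTop (𝓝[≠] 0) := by
    rw [tendsto_nhdsWithin_iff]
    exact ⟨tendsto_one_div_add_atTop_nhds_zero_nat,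
      Eventually.of_forall fun m => ne_of_gt (by positivity)⟩
  refine measurable_of_tendsto_metrizable (f := fun (m : ℕ) t =>
    (h m)⁻¹ * (F t (x + h m • basisVec (j, l)) (i, k) - F t x (i, k))) (fun m => ?_) ?_
  · have hc : ∀ z, Measurable fun t => F t z (i, k) := fun z =>
      (EuclideanSpace.proj (𝕜 := ℝ) (i, k)).continuous.measurable.comp (hF.meas z)
    exact ((hc _).sub (hc _)).const_mul _
  · rw [tendsto_pi_nhds]
    intro t
    have h1 := (hF.hasDerivAt_basisVec t x hij k l).tendsto_slope_zero.comp hlim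
    simpa [Function.comp_def] using h1

theorem subGrad_apply_of_eq (F : ℝ → Sp n d → Sp n d) (t : ℝ) (x : Sp n d) {i j : Fin n}
    (hij : j.val + 1 = i.val) (k l : Fin d) :
    subGrad F t x (i, k) (j, l) = blockGrad F t x i j k l := by
  simp [subGrad, hij]

theorem norm_subGrad_sub_le (hκ : 0 ≤ κ) (hF : DriftAssumption η κ 𝓔 F) (t : ℝ)
    (x x' : Sp n d) :
    ‖subGrad F t x - subGrad F t x'‖ ≤ (n * d : ℝ) ^ 2 * κ * ‖x - x'‖ ^ η := by
  refine (norm_le_sum_abs _).trans ?_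
  have : ∀ a b : Idx n d, |(subGrad F t x - subGrad F t x') a b| ≤ κ * ‖x - x'‖ ^ η := by
    intro a b
    simp only [Matrix.sub_apply, subGrad, Matrix.of_apply]
    split_ifs with h
    · exact hF.holder t x x' a.1 b.1 h _ _
    · simp; positivity
  calc _ ≤ ∑ _a : Idx n d, ∑ _b : Idx n d, κ * ‖x - x'‖ ^ η :=
        Finset.sum_le_sum fun a _ => Finset.sum_le_sum fun b _ => this a b
    _ = _ := by simp; ring

/-- The linearization of the drift along a continuous path is a nondegenerate matrix curve. -/
theorem isCurve_subGrad (hη : 0 < η) (hκ : 0 ≤ κ) (hF : DriftAssumption η κ 𝓔 F) {φ : ℝ → Sp n d}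
    (hφ : Continuous φ) : IsCurve ((n * d : ℝ) ^ 2 * κ) 𝓔 fun u => subGrad F u (φ u) where
  meas := by
    refine stronglyMeasurable_of_entries fun a b => ?_
    simp only [subGrad, Matrix.of_apply]
    split_ifs with h
    · have hc : ∀ t, Continuous fun x => blockGrad F t x a.1 b.1 a.2 b.2 := by
        intro t
        refine continuous_iff_continuousAt.2 fun x₀ => ?_
        rw [ContinuousAt, tendsto_iff_norm_sub_tendsto_zero]
        have hb : Tendsto (fun x => κ * ‖x - x₀‖ ^ η) (𝓝 x₀) (𝓝 0) := by
          have : Continuous fun x : Sp n d => κ * ‖x - x₀‖ ^ η :=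
            continuous_const.mul ((continuous_id.sub continuous_const).norm.rpow_const
              fun _ => Or.inr hη.le)
          simpa [Real.zero_rpow hη.ne'] using this.tendsto x₀
        exact squeeze_zero (fun _ => norm_nonneg _) (fun x => hF.holder t x x₀ _ _ h _ _) hb
      have h1 := stronglyMeasurable_uncurry_of_continuous_of_stronglyMeasurable
        (u := fun (x : Sp n d) (t : ℝ) => blockGrad F t x a.1 b.1 a.2 b.2) hc
        fun x => (hF.measurable_blockGrad x h _ _).stronglyMeasurable
      exact (h1.comp_measurable (hφ.measurable.prodMk measurable_id)).measurable
    · exact measurable_const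
  bdd u := by
    refine (norm_le_sum_abs _).trans ?_
    have : ∀ a b : Idx n d, |subGrad F u (φ u) a b| ≤ κ := by
      intro a b
      simp only [subGrad, Matrix.of_apply]
      split_ifs with h
      · exact hF.abs_blockGrad_le hκ _ _ _ _ _ _
      · simpa using hκ
    calc _ ≤ ∑ _a : Idx n d, ∑ _b : Idx n d, κ :=
          Finset.sum_le_sum fun a _ => Finset.sum_le_sum fun b _ => this a b
      _ = _ := by simp; ring
  sub u a b h := by simp [subGrad, h]
  nondeg u i j h := by
    have : (Matrix.of fun k l => subGrad F u (φ u) (i, k) (j, l)) = blockGrad F u (φ u) i j := by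
      ext k l; simp [subGrad, h]
    rw [this]
    exact hF.nondeg u _ i j h

end Gradient

/-! ### The linearized flow and the closed form of the kernel. -/

section Linearization

variable {η κ : ℝ} {𝓔 : Fin n → Set (Matrix (Fin d) (Fin d) ℝ)} {F : ℝ → Sp n d → Sp n d}

theorem isCaratheodory_act {A : ℝ → Mat n d} {L : ℝ} (hm : StronglyMeasurable A)
    (hb : ∀ u, ‖A u‖ ≤ L) : IsCaratheodory (fun u (z : Sp n d) => act (A u) z) L 0 where
  meas φ hφ := continuous_act_uncurry.comp_stronglyMeasurable (hm.prodMk hφ.stronglyMeasurable)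
  lip u x y := by
    rw [← act_sub]
    exact (norm_act_le _ _).trans (by gcongr; exact hb u)
  bdd u := by simp [act_zero]

/-- Evaluation of matrices at a vector as a continuous linear map. -/
def actR (v : Sp n d) : Mat n d →L[ℝ] Sp n d := LinearMap.toContinuousLinearMap
  { toFun := fun M => act M v
    map_add' := fun M M' => by simp [act, Matrix.add_mulVec]
    map_smul' := fun c M => by simp [smul_act] }

theorem act_phi_eq {A : ℝ → Mat n d} {L : ℝ} (hm : StronglyMeasurable A) (hb : ∀ u, ‖A u‖ ≤ L)
    (s t : ℝ) (v : Sp n d) :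
    act (Phi A t s) v = v + ∫ u in s..t, act (A u) (act (Phi A u s) v) := by
  have h1 := (actR v).intervalIntegral_comp_comm (intervalIntegrable_mul_phi hm hb s s t)
  have h2 : act (Phi A t s) v = actR v (1 + ∫ u in s..t, A u * Phi A u s) := by
    rw [← (phi_spec hm hb s).2 t]; rfl
  rw [h2, map_add, ← h1]
  congr 1
  · exact act_one v
  · exact intervalIntegral.integral_congr fun u _ => act_mul _ _ _

theorem continuous_act_phi {A : ℝ → Mat n d} {L : ℝ} (hm : StronglyMeasurable A)
    (hb : ∀ u, ‖A u‖ ≤ L) (s : ℝ) (v : Sp n d) : Continuous fun t => act (Phi A t s) v :=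
  continuous_act_uncurry.comp ((continuous_phi hm hb s).prodMk continuous_const)

/-- The deviation of the affine flow from the trajectory it linearizes solves the homogeneous linear
system. -/
theorem linFlow_sub (hη : 0 < η) (hκ : 0 ≤ κ) (hF : DriftAssumption η κ 𝓔 F) (τ : ℝ) (y : Sp n d)
    (t s : ℝ) (x : Sp n d) :
    linFlow F τ y t s x - flow F t τ y = act (resolvent F τ y t s) (x - flow F s τ y) := by
  set θ : ℝ → Sp n d := fun u => flow F u τ y with hθ
  have hθc : Continuous θ := continuous_flow_left hF τ y
  have hA := isCurve_subGrad hη hκ hF hθc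
  set A : ℝ → Mat n d := fun u => subGrad F u (θ u) with hAdef
  have hLin := isCaratheodory_act hA.meas hA.bdd
  have hFi := intervalIntegrable_drift hF hθc
  have hsplit : ∀ φ : ℝ → Sp n d, Continuous φ → ∀ a b : ℝ, ∫ u in a..b, frozenDrift F τ y u (φ u) =
      (θ b - θ a) + ∫ u in a..b, act (A u) (φ u - θ u) := by
    intro φ hφ a b
    have h1 : θ b - θ a = ∫ u in a..b, F u (θ u) := by
      have h := (isTraj_flow hF τ y).2 a b
      change θ b = θ a + _ at h
      rw [h]
      abel
    rw [h1, ← intervalIntegral.integral_add (hFi a b)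
      (hLin.intervalIntegrable (φ := fun u => φ u - θ u) (hφ.sub hθc) a b)]
    rfl
  -- The flow is defined by choice, so a solution has to be exhibited before its equation may be
  -- used.
  have hex : ∃ φ, IsIntegralCurveFrom (frozenDrift F τ y) s x φ := by
    have hc := continuous_act_phi hA.meas hA.bdd s (x - θ s)
    refine ⟨fun u => θ u + act (Phi A u s) (x - θ s), hθc.add hc, fun t => ?_⟩
    rw [hsplit (fun u => θ u + act (Phi A u s) (x - θ s)) (hθc.add hc)]
    simp only [add_sub_cancel_left]
    rw [act_phi_eq hA.meas hA.bdd s t (x - θ s)]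
    abel
  have hspec : IsIntegralCurveFrom (frozenDrift F τ y) s x fun t => linFlow F τ y t s x :=
    Classical.epsilon_spec hex
  have huniq := hLin.unique (nonneg_of_bdd hA.bdd) (s := s) (x := x - θ s)
    (φ := fun u => linFlow F τ y u s x - θ u) (ψ := fun u => act (Phi A u s) (x - θ s))
    (hspec.1.sub hθc) (continuous_act_phi hA.meas hA.bdd s (x - θ s)) (fun t => ?_)
    (act_phi_eq hA.meas hA.bdd s · (x - θ s))
  · exact congrFun huniq t
  · have h1 := hspec.2 t
    rw [hsplit _ hspec.1] at h1
    change linFlow F τ y t s x = _ at h1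
    change linFlow F τ y t s x - θ t = _
    rw [h1]
    abel

/-- The matrix curve obtained by linearizing the drift along the trajectory through `(τ, y)`. -/
def linCurve (F : ℝ → Sp n d → Sp n d) (τ : ℝ) (y : Sp n d) (u : ℝ) : Mat n d :=
  subGrad F u (flow F u τ y)

theorem isCurve_linCurve (hη : 0 < η) (hκ : 0 ≤ κ) (hF : DriftAssumption η κ 𝓔 F) (τ : ℝ)
    (y : Sp n d) : IsCurve ((n * d : ℝ) ^ 2 * κ) 𝓔 (linCurve F τ y) :=
  isCurve_subGrad hη hκ hF (continuous_flow_left hF τ y)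

theorem resolvent_eq (F : ℝ → Sp n d → Sp n d) (τ : ℝ) (y : Sp n d) (t s : ℝ) :
    resolvent F τ y t s = Phi (linCurve F τ y) t s := rfl

variable [NeZero n] {lam : ℝ} {ς : ℝ → Matrix (Fin d) (Fin d) ℝ}

theorem cov_eq (hη : 0 < η) (hκ : 0 ≤ κ) (hF : DriftAssumption η κ 𝓔 F)
    (hς : DiffusionAssumption lam ς) (hlam : 1 ≤ lam) (y : Sp n d) (s t : ℝ) :
    cov F ς y s t = Cov (linCurve F t y) (src ς) s t := by
  have hA := isCurve_linCurve hη hκ hF t y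
  ext a b
  rw [Cov, integral_apply (intervalIntegrable_cov hA.meas hA.bdd (stronglyMeasurable_src hς)
    (norm_src_le hς hlam) t s t)]
  refine intervalIntegral.integral_congr fun u _ => ?_
  simp only [resolvent_eq, src, Matrix.mul_assoc]

/-- The singular kernel in closed form, for a general matrix curve. -/
def curveKer (i j : Fin d) (A : ℝ → Mat n d) (ς : ℝ → Matrix (Fin d) (Fin d) ℝ) (s t : ℝ)
    (v : Sp n d) : ℝ := gaussKer i j (Cov A (src ς) s t) (Phi A t s) v

/-- The coefficients are frozen along the trajectory through `(t, y)`, so `x` enters only through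
the affine map `x ↦ P (x - θ_{s,t}(y))`, and both derivatives can be computed. -/
theorem kKer_eq (hη : 0 < η) (hκ : 0 ≤ κ) (hF : DriftAssumption η κ 𝓔 F)
    (hς : DiffusionAssumption lam ς) (hlam : 1 ≤ lam) (i j : Fin d) {s t : ℝ} (hst : s < t)
    (x y : Sp n d) :
    kKer F ς i j s t x y = curveKer i j (linCurve F t y) ς s t
      (act (Phi (linCurve F t y) t s) (x - flow F s t y)) := by
  have hA := isCurve_linCurve hη hκ hF t y
  set A := linCurve F t y with hAdef
  set K := Cov A (src ς) s t with hK
  set P := Phi A t s with hP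
  have hKs : K⁻¹ᵀ = K⁻¹ := by rw [Matrix.transpose_nonsing_inv, cov_transpose hA hς hlam]
  have hq : ∀ w, qKer F ς s t w y = gaussNorm K *
      Real.exp (-(1 / 2) * inner ℝ (act P (w - flow F s t y)) (act K⁻¹ (act P (w - flow F s t y)))) := by
    intro w
    have h1 : linFlow F t y t s w - y = act P (w - flow F s t y) := by
      have := linFlow_sub hη hκ hF t y t s w
      rwa [flow_self hF] at this
    rw [qKer, h1, cov_eq hη hκ hF hς hlam, EuclideanSpace.inner_eq_star_dotProduct, star_trivial]
    rfl
  have hshift : ∀ (w : Sp n d) (h : ℝ) (e : Sp n d), act P (w + h • e - flow F s t y) =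
      act P (w - flow F s t y) + h • act P e := by
    intro w h e
    rw [add_sub_right_comm, act_add, act_smul]
  have h1 : ∀ w, lineDeriv ℝ (fun w => qKer F ς s t w y) w (basisVec (0, j)) =
      gaussNorm K * (-inner ℝ (act P (basisVec (0, j))) (act K⁻¹ (act P (w - flow F s t y))) *
        Real.exp (-(1 / 2) * inner ℝ (act P (w - flow F s t y))
          (act K⁻¹ (act P (w - flow F s t y))))) := by
    intro w
    rw [lineDeriv]
    simp_rw [hq, hshift]
    exact ((hasDerivAt_gauss hKs _ _).const_mul _).deriv
  rw [kKer, if_pos hst]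
  simp_rw [h1]
  rw [lineDeriv]
  simp_rw [hshift]
  rw [((hasDerivAt_gauss_deriv hKs _ _ _).const_mul _).deriv, curveKer, gaussKer_eq, mul_assoc]

end Linearization

/-! ### Norm bounds for dilations. -/

section Dilation

theorem norm_le_of_abs_le {x y : Sp n d} {c : ℝ} (hc : 0 ≤ c) (h : ∀ a, |x a| ≤ c * |y a|) :
    ‖x‖ ≤ c * ‖y‖ := by
  refine le_of_sq_le_sq ?_ (by positivity)
  rw [mul_pow, EuclideanSpace.real_norm_sq_eq, EuclideanSpace.real_norm_sq_eq, Finset.mul_sum]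
  refine Finset.sum_le_sum fun a _ => ?_
  rw [← sq_abs, ← sq_abs (y a), ← mul_pow]
  exact pow_le_pow_left₀ (abs_nonneg _) (h a) 2

theorem norm_le_of_forall_abs_le {x : Sp n d} {b : ℝ} (h : ∀ a, |x a| ≤ b) :
    ‖x‖ ≤ (n * d : ℝ) * b := by
  have h1 : ‖x‖ ≤ ∑ a, |x a| := by
    have : x = ∑ a, x a • EuclideanSpace.single a (1 : ℝ) := by
      ext m; simp [Finset.sum_apply, Pi.single_apply]
    conv_lhs => rw [this]
    refine (norm_sum_le _ _).trans (Finset.sum_le_sum fun a _ => ?_)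
    simp [norm_smul]
  refine h1.trans ((Finset.sum_le_sum fun a _ => h a).trans ?_)
  simp

theorem abs_coord_le (x : Sp n d) (a : Idx n d) : |x a| ≤ ‖x‖ := PiLp.norm_apply_le x a

/-- Scales `r ≤ 2` suffice, because times in the strip differ by at most `2`. The factor `4 ^ n`
then absorbs the surplus even powers of `r`. -/
theorem pow_le_four_pow {r : ℝ} (h0 : 0 ≤ r) (h2 : r ≤ 2) (m : Fin n) :
    r ^ (2 * m.val + 1) ≤ r * 4 ^ n := by
  have h1 : r ^ (2 * m.val + 1) = r * (r ^ 2) ^ m.val := by rw [← pow_mul]; ring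
  have h3 : (r ^ 2) ^ m.val ≤ 4 ^ m.val := pow_le_pow_left₀ (sq_nonneg r) (by nlinarith) _
  have h4 : (4 : ℝ) ^ m.val ≤ 4 ^ n := pow_le_pow_right₀ (by norm_num) m.2.le
  rw [h1]
  exact mul_le_mul_of_nonneg_left (h3.trans h4) h0

theorem norm_act_dil_le {r : ℝ} (h0 : 0 ≤ r) (h2 : r ≤ 2) (x : Sp n d) :
    ‖act (dil r) x‖ ≤ r * 4 ^ n * ‖x‖ := by
  refine norm_le_of_abs_le (by positivity) fun a => ?_
  rw [act_dil_apply, abs_mul, abs_of_nonneg (by positivity)]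
  exact mul_le_mul_of_nonneg_right (pow_le_four_pow h0 h2 a.1) (abs_nonneg _)

theorem block_act_dil (r : ℝ) (x : Sp n d) (i : Fin n) :
    block (act (dil r) x) i = r ^ (2 * i.val + 1) • block x i := by
  ext k; simp [block, act_dil_apply]

theorem norm_block_le (x : Sp n d) (i : Fin n) : ‖block x i‖ ≤ ‖x‖ := by
  refine le_of_sq_le_sq ?_ (norm_nonneg _)
  rw [EuclideanSpace.real_norm_sq_eq, EuclideanSpace.real_norm_sq_eq, Fintype.sum_prod_type]
  exact Finset.single_le_sum (f := fun i => ∑ k, x (i, k) ^ 2)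
    (fun i _ => Finset.sum_nonneg fun k _ => sq_nonneg _) (Finset.mem_univ i)

end Dilation

/-! ### Invariance of the drift class under parabolic rescaling. -/

section Scaling

variable {η κ : ℝ} {𝓔 : Fin n → Set (Matrix (Fin d) (Fin d) ℝ)} {F : ℝ → Sp n d → Sp n d}

/-- The drift in the parabolic coordinates of scale `r` around time `c`. -/
def scaled (F : ℝ → Sp n d → Sp n d) (c r : ℝ) (u : ℝ) (x : Sp n d) : Sp n d :=
  r ^ 2 • act (dil r⁻¹) (F (c + r ^ 2 * u) (act (dil r) x))

/-- The factor by which rescaling may increase the constant of the drift. -/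
def scaleConst (n d : ℕ) : ℝ := 2 * (n * d + 1) * 4 ^ n

theorem scaleConst_nonneg : 0 ≤ scaleConst n d := by unfold scaleConst; positivity

theorem scaled_apply (F : ℝ → Sp n d → Sp n d) (c r u : ℝ) (x : Sp n d) (a : Idx n d) :
    scaled F c r u x a =
      r ^ 2 * r⁻¹ ^ (2 * a.1.val + 1) * F (c + r ^ 2 * u) (act (dil r) x) a := by
  simp [scaled, act_dil_apply]; ring

/-- Componentwise Lipschitz bound that only sees the coordinates on which the component depends. -/
theorem DriftAssumption.abs_sub_le (hF : DriftAssumption η κ 𝓔 F) (hκ : 0 ≤ κ) (t : ℝ)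
    (a : Idx n d) {z z' w : Sp n d} {b : ℝ} (hb : 0 ≤ b)
    (h : ∀ e : Idx n d, a.1.val ≤ e.1.val + 1 → |z e - z' e| ≤ b * |w e|) :
    |F t z a - F t z' a| ≤ κ * (b * ‖w‖) := by
  -- The coordinates that this component does not see are overwritten with those of `z'`; this
  -- leaves its value unchanged and makes the points as close as possible.
  set z'' : Sp n d := WithLp.toLp 2 fun e => if a.1.val ≤ e.1.val + 1 then z e else z' e with hz
  have h1 : F t z a = F t z'' a := by
    have := hF.struct t a.1 z z'' fun j hj => by
      ext k; simp [block, hz, hj]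
    exact congrArg (fun v => v.ofLp a.2) this
  rw [h1]
  refine (abs_coord_le (F t z'' - F t z') a).trans ((hF.lip t z'' z').trans ?_)
  refine mul_le_mul_of_nonneg_left (norm_le_of_abs_le hb fun e => ?_) hκ
  by_cases he : a.1.val ≤ e.1.val + 1
  · simpa [hz, he] using h e he
  · simp [hz, he]; positivity

/-- Component `i` reacts to block `j` with weight `r ^ (2 (j + 1 - i))`. The exponent is nonnegative
because `F_i` sees only blocks `j ≥ i - 1`, and it is at least `2` if the subdiagonal block is left
out. The integer `m` counts this gain. -/
theorem pow_mul_le_of_le {r : ℝ} (h0 : 0 < r) (h2 : r ≤ 2) {i j m : ℕ} (hj : j < n)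
    (h : i + m ≤ j + 1) : r ^ 2 * r⁻¹ ^ (2 * i + 1) * r ^ (2 * j + 1) ≤ r ^ (2 * m) * 4 ^ n := by
  obtain ⟨l, hl⟩ := Nat.exists_eq_add_of_le h
  have h1 : r ^ 2 * r⁻¹ ^ (2 * i + 1) * r ^ (2 * j + 1) = r ^ (2 * m) * (r ^ 2) ^ l := by
    have e : r ^ 2 * r ^ (2 * j + 1) = r ^ (2 * i + 1) * (r ^ (2 * m) * (r ^ 2) ^ l) := by
      rw [← pow_mul, ← pow_add, ← pow_add, ← pow_add]
      congr 1
      omega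
    rw [inv_pow, mul_right_comm, e]
    field_simp
  rw [h1]
  have h3 : (r ^ 2) ^ l ≤ 4 ^ l := pow_le_pow_left₀ (sq_nonneg r) (by nlinarith) _
  have h4 : (4 : ℝ) ^ l ≤ 4 ^ n := pow_le_pow_right₀ (by norm_num) (by omega)
  exact mul_le_mul_of_nonneg_left (h3.trans h4) (by positivity)

/-- Componentwise Lipschitz bound for the rescaled drift, with a gain of `r ^ 2` if the points only
differ in the coordinates of the same or higher blocks. -/
theorem abs_scaled_sub_le (hF : DriftAssumption η κ 𝓔 F) (hκ : 0 ≤ κ) (c : ℝ) {r : ℝ} (h0 : 0 < r)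
    (h2 : r ≤ 2) (u : ℝ) (a : Idx n d) (m : ℕ) {x x' : Sp n d}
    (h : ∀ e : Idx n d, a.1.val ≤ e.1.val + 1 → e.1.val + 1 < a.1.val + m → x e = x' e) :
    |scaled F c r u x a - scaled F c r u x' a| ≤ κ * (r ^ (2 * m) * 4 ^ n * ‖x - x'‖) := by
  have hq : 0 < r ^ 2 * r⁻¹ ^ (2 * a.1.val + 1) := by positivity
  rw [scaled_apply, scaled_apply, ← mul_sub, abs_mul, abs_of_pos hq]
  have h1 := hF.abs_sub_le hκ (c + r ^ 2 * u) a (z := act (dil r) x) (z' := act (dil r) x')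
    (w := x - x') (b := (r ^ 2 * r⁻¹ ^ (2 * a.1.val + 1))⁻¹ * (r ^ (2 * m) * 4 ^ n))
    (by positivity) fun e he => by
      rw [act_dil_apply, act_dil_apply, ← mul_sub, abs_mul, abs_of_pos (by positivity)]
      change _ ≤ _ * |x e - x' e|
      by_cases hm : e.1.val + 1 < a.1.val + m
      · rw [h e he hm]; simp
      · refine mul_le_mul_of_nonneg_right ?_ (abs_nonneg _)
        rw [le_inv_mul_iff₀ hq]
        exact pow_mul_le_of_le h0 h2 e.1.2 (by omega)
  calc _ ≤ r ^ 2 * r⁻¹ ^ (2 * a.1.val + 1) * (κ * ((r ^ 2 * r⁻¹ ^ (2 * a.1.val + 1))⁻¹ *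
        (r ^ (2 * m) * 4 ^ n) * ‖x - x'‖)) := mul_le_mul_of_nonneg_left h1 hq.le
    _ = _ := by
      generalize r ^ 2 * r⁻¹ ^ (2 * a.1.val + 1) = q at hq
      field_simp

theorem act_dil_add_basisVec (r h : ℝ) (x : Sp n d) (b : Idx n d) :
    act (dil r) (x + h • basisVec b) =
      act (dil r) x + (h * r ^ (2 * b.1.val + 1)) • basisVec b := by
  ext e
  by_cases he : e = b
  · subst he; simp [act_dil_apply, basisVec]; ring
  · simp [act_dil_apply, basisVec, he]

/-- On the subdiagonal the weights cancel exactly, so the gradient blocks are transported without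
any factor and keep their values in `𝓔`. -/
theorem DriftAssumption.hasDerivAt_scaled (hF : DriftAssumption η κ 𝓔 F) (c : ℝ) {r : ℝ}
    (h0 : 0 < r) (u : ℝ) (x : Sp n d) {i j : Fin n} (hij : j.val + 1 = i.val) (k l : Fin d) :
    HasDerivAt (fun s : ℝ => scaled F c r u (x + s • basisVec (j, l)) (i, k))
      (blockGrad F (c + r ^ 2 * u) (act (dil r) x) i j k l) 0 := by
  have h1 : HasDerivAt (fun s : ℝ => s * r ^ (2 * j.val + 1)) (r ^ (2 * j.val + 1)) 0 := by
    simpa using (hasDerivAt_id' (0 : ℝ)).mul_const (r ^ (2 * j.val + 1))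
  have h2 := hF.hasDerivAt_basisVec (c + r ^ 2 * u) (act (dil r) x) hij k l
  rw [← zero_mul (r ^ (2 * j.val + 1))] at h2
  have h3 := (h2.comp (0 : ℝ) h1).const_mul (r ^ 2 * r⁻¹ ^ (2 * i.val + 1))
  simp only [scaled_apply, act_dil_add_basisVec]
  refine h3.congr_deriv ?_
  have e : r ^ 2 * r⁻¹ ^ (2 * i.val + 1) * r ^ (2 * j.val + 1) = 1 := by
    rw [← hij, inv_pow]
    field_simp
    ring
  rw [mul_comm (blockGrad F _ _ i j k l), ← mul_assoc, e, one_mul]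

theorem blockGrad_scaled (hF : DriftAssumption η κ 𝓔 F) (c : ℝ) {r : ℝ} (h0 : 0 < r) (u : ℝ)
    (x : Sp n d) {i j : Fin n} (hij : j.val + 1 = i.val) :
    blockGrad (scaled F c r) u x i j = blockGrad F (c + r ^ 2 * u) (act (dil r) x) i j := by
  ext k l
  exact (hF.hasDerivAt_scaled c h0 u x hij k l).deriv

theorem subGrad_scaled (hF : DriftAssumption η κ 𝓔 F) (c : ℝ) {r : ℝ} (h0 : 0 < r) (u : ℝ)
    (x : Sp n d) : subGrad (scaled F c r) u x = subGrad F (c + r ^ 2 * u) (act (dil r) x) := by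
  ext a b
  simp only [subGrad, Matrix.of_apply]
  split_ifs with h
  · rw [blockGrad_scaled hF c h0 u x h]
  · rfl

/-- The dilation shrinks distances by at least a multiple of `r`. The resulting `r ^ η` is the gain
that makes the freezing error in the cancellation integrable. -/
theorem holder_scaled (hF : DriftAssumption η κ 𝓔 F) (hη : 0 < η) (hη1 : η ≤ 1) (hκ : 0 ≤ κ)
    (c : ℝ) {r : ℝ} (h0 : 0 < r) (h2 : r ≤ 2) (u : ℝ) (x x' : Sp n d) {i j : Fin n}
    (hij : j.val + 1 = i.val) (k l : Fin d) :
    |blockGrad (scaled F c r) u x i j k l - blockGrad (scaled F c r) u x' i j k l| ≤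
      4 ^ n * κ * r ^ η * ‖x - x'‖ ^ η := by
  rw [blockGrad_scaled hF c h0 u x hij, blockGrad_scaled hF c h0 u x' hij]
  refine (hF.holder _ _ _ i j hij k l).trans ?_
  have h1 : ‖act (dil r) x - act (dil r) x'‖ ^ η ≤ (r * 4 ^ n * ‖x - x'‖) ^ η := by
    rw [← act_sub]
    exact Real.rpow_le_rpow (norm_nonneg _) (norm_act_dil_le h0.le h2 _) hη.le
  have h3 : ((4 : ℝ) ^ n) ^ η ≤ 4 ^ n := by
    conv_rhs => rw [← Real.rpow_one ((4 : ℝ) ^ n)]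
    exact Real.rpow_le_rpow_of_exponent_le (one_le_pow₀ (by norm_num)) hη1
  rw [Real.mul_rpow (by positivity) (norm_nonneg _), Real.mul_rpow h0.le (by positivity)] at h1
  calc _ ≤ κ * (r ^ η * ((4 : ℝ) ^ n) ^ η * ‖x - x'‖ ^ η) := mul_le_mul_of_nonneg_left h1 hκ
    _ ≤ κ * (r ^ η * (4 : ℝ) ^ n * ‖x - x'‖ ^ η) := by gcongr
    _ = _ := by ring

theorem scaled_block_eq (F : ℝ → Sp n d → Sp n d) (c r u : ℝ) (x : Sp n d) (i : Fin n) :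
    block (scaled F c r u x) i =
      (r ^ 2 * r⁻¹ ^ (2 * i.val + 1)) • block (F (c + r ^ 2 * u) (act (dil r) x)) i := by
  ext k
  exact scaled_apply F c r u x (i, k)

/-- The class of drifts is invariant under parabolic rescaling. -/
theorem DriftAssumption.scaled (hF : DriftAssumption η κ 𝓔 F) (hη : 0 < η) (hη1 : η ≤ 1)
    (hκ : 0 ≤ κ) (c : ℝ) {r : ℝ} (h0 : 0 < r) (h2 : r ≤ 2) :
    DriftAssumption η (scaleConst n d * κ) 𝓔 (scaled F c r) where
  struct t i x x' h := by
    rw [scaled_block_eq, scaled_block_eq, hF.struct _ i _ (act (dil r) x') fun j hj => ?_]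
    rw [block_act_dil, block_act_dil, h j hj]
  meas x := by
    have h1 : Measurable fun u : ℝ => F (c + r ^ 2 * u) (act (dil r) x) :=
      (hF.meas _).comp (by fun_prop)
    exact ((continuous_act (dil r⁻¹)).measurable.comp h1).const_smul (r ^ 2)
  bdd x := by
    obtain ⟨M, hM⟩ := hF.bdd (act (dil r) x)
    refine ⟨r ^ 2 * (‖(dil r⁻¹ : Mat n d)‖ * M), fun t => ?_⟩
    rw [DegenerateCZ.scaled, norm_smul, Real.norm_of_nonneg (by positivity)]
    refine mul_le_mul_of_nonneg_left ((norm_act_le _ _).trans ?_) (by positivity)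
    exact mul_le_mul_of_nonneg_left (hM _) (norm_nonneg _)
  lip t x x' := by
    refine (norm_le_of_forall_abs_le fun a => abs_scaled_sub_le hF hκ c h0 h2 t a 0
      fun e h h' => by omega).trans ?_
    have : 0 ≤ κ * 4 ^ n * ‖x - x'‖ := by positivity
    have h3 : (0 : ℝ) ≤ n * d := by positivity
    unfold scaleConst
    simp only [mul_zero, pow_zero]
    nlinarith
  diff t x i j hij := by
    have h1 : (fun v : EuclideanSpace ℝ (Fin d) =>
        block (DegenerateCZ.scaled F c r t (x + inject j v)) i) = fun v =>
        (r ^ 2 * r⁻¹ ^ (2 * i.val + 1)) • block (F (c + r ^ 2 * t)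
          (act (dil r) x + inject j (r ^ (2 * j.val + 1) • v))) i := by
      funext v
      rw [scaled_block_eq, act_add]
      congr 4
      ext e
      by_cases he : e.1 = j
      · subst he; simp [act_dil_apply, inject]
      · simp [act_dil_apply, inject, he]
    rw [h1]
    refine DifferentiableAt.fun_const_smul ?_ _
    have h3 := hF.diff (c + r ^ 2 * t) (act (dil r) x) i j hij
    rw [← smul_zero (r ^ (2 * j.val + 1))] at h3
    exact DifferentiableAt.comp (0 : EuclideanSpace ℝ (Fin d))
      (g := fun v => block (F (c + r ^ 2 * t) (act (dil r) x + inject j v)) i) h3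
      (differentiableAt_fun_id.fun_const_smul (r ^ (2 * j.val + 1)))
  holder t x x' i j hij k l := by
    refine (holder_scaled hF hη hη1 hκ c h0 h2 t x x' hij k l).trans ?_
    have h3 : r ^ η ≤ 2 := by
      refine (Real.rpow_le_rpow h0.le h2 hη.le).trans ?_
      conv_rhs => rw [← Real.rpow_one 2]
      exact Real.rpow_le_rpow_of_exponent_le (by norm_num) hη1
    refine mul_le_mul_of_nonneg_right ?_ (by positivity)
    have h4 : 0 ≤ (4 : ℝ) ^ n * κ := by positivity
    have h5 : (0 : ℝ) ≤ n * d := by positivity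
    unfold scaleConst
    nlinarith [mul_nonneg h4 h5]
  nondeg t x i j hij := by
    rw [blockGrad_scaled hF c h0 t x hij]
    exact hF.nondeg _ _ i j hij

theorem flow_scaled (hF : DriftAssumption η κ 𝓔 F) (hη : 0 < η) (hη1 : η ≤ 1) (hκ : 0 ≤ κ) (c : ℝ)
    {r : ℝ} (h0 : 0 < r) (h2 : r ≤ 2) (t s : ℝ) (x : Sp n d) :
    flow (scaled F c r) t s x =
      act (dil r⁻¹) (flow F (c + r ^ 2 * t) (c + r ^ 2 * s) (act (dil r) x)) := by
  have hS := hF.scaled hη hη1 hκ c h0 h2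
  set φ : ℝ → Sp n d := fun v => flow F v (c + r ^ 2 * s) (act (dil r) x) with hφ
  have hφt : IsTraj F φ := isTraj_flow hF _ _
  have hT : IsTraj (scaled F c r) fun u => act (dil r⁻¹) (φ (c + r ^ 2 * u)) := by
    refine ⟨(continuous_act _).comp (hφt.1.comp (by fun_prop)), fun a b => ?_⟩
    have h3 := hφt.2 (c + r ^ 2 * a) (c + r ^ 2 * b)
    rw [← intervalIntegral.smul_integral_comp_add_mul] at h3
    beta_reduce
    rw [h3, act_add, act_smul]
    congr 1
    have h4 : ∀ u, scaled F c r u (act (dil r⁻¹) (φ (c + r ^ 2 * u))) =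
        r ^ 2 • actL (dil r⁻¹) (F (c + r ^ 2 * u) (φ (c + r ^ 2 * u))) := by
      intro u
      rw [scaled, act_dil_dil_inv h0.ne', actL_apply]
    simp_rw [h4]
    rw [intervalIntegral.integral_smul, ← actL_apply, ← ContinuousLinearMap.intervalIntegral_comp_comm]
    have h5 := intervalIntegrable_drift hF hφt.1 (c + r ^ 2 * a) (c + r ^ 2 * b)
    have h6 := (h5.comp_add_left c).comp_mul_left (c := r ^ 2)
    simpa [h0.ne'] using h6
  have h := hT.eq_flow hS (mul_nonneg scaleConst_nonneg hκ) s t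
  rw [h]
  simp only [hφ, flow_self hF, act_dil_inv_dil h0.ne']

theorem act_dil_flow_scaled (hF : DriftAssumption η κ 𝓔 F) (hη : 0 < η) (hη1 : η ≤ 1) (hκ : 0 ≤ κ)
    (c : ℝ) {r : ℝ} (h0 : 0 < r) (h2 : r ≤ 2) (t s : ℝ) (x : Sp n d) :
    act (dil r) (flow (scaled F c r) t s x) =
      flow F (c + r ^ 2 * t) (c + r ^ 2 * s) (act (dil r) x) := by
  rw [flow_scaled hF hη hη1 hκ c h0 h2, act_dil_dil_inv h0.ne']

theorem linCurve_scaled (hF : DriftAssumption η κ 𝓔 F) (hη : 0 < η) (hη1 : η ≤ 1) (hκ : 0 ≤ κ)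
    (c : ℝ) {r : ℝ} (h0 : 0 < r) (h2 : r ≤ 2) (t : ℝ) (y : Sp n d) :
    linCurve (scaled F c r) t y =
      fun u => linCurve F (c + r ^ 2 * t) (act (dil r) y) (c + r ^ 2 * u) := by
  funext u
  rw [linCurve, subGrad_scaled hF c h0, act_dil_flow_scaled hF hη hη1 hκ c h0 h2]
  rfl

theorem rho_scaled {r : ℝ} (h0 : 0 < r) (t : ℝ) (x : Sp n d) :
    rho (r ^ 2 * t) (act (dil r) x) = r * rho t x := by
  unfold rho
  rw [mul_add, Finset.mul_sum, abs_mul, abs_of_pos (by positivity),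
    Real.mul_rpow (by positivity) (abs_nonneg _)]
  congr 1
  · rw [← Real.sqrt_eq_rpow, Real.sqrt_sq h0.le]
  · refine Finset.sum_congr rfl fun i _ => ?_
    rw [block_act_dil, norm_smul, Real.norm_of_nonneg (by positivity),
      Real.mul_rpow (by positivity) (norm_nonneg _)]
    congr 1
    rw [← Real.rpow_natCast, ← Real.rpow_mul h0.le]
    have : ((2 * i.val + 1 : ℕ) : ℝ) * (1 / (2 * (i.val : ℝ) + 1)) = 1 := by
      push_cast; field_simp
    rw [this, Real.rpow_one]

theorem qdist_scaled (hF : DriftAssumption η κ 𝓔 F) (hη : 0 < η) (hη1 : η ≤ 1) (hκ : 0 ≤ κ) (c : ℝ)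
    {r : ℝ} (h0 : 0 < r) (h2 : r ≤ 2) (s t : ℝ) (x y : Sp n d) :
    qdist F (c + r ^ 2 * s, act (dil r) x) (c + r ^ 2 * t, act (dil r) y) =
      r * qdist (scaled F c r) (s, x) (t, y) := by
  unfold qdist
  rw [← rho_scaled h0]
  congr 1
  · simp only; ring
  · rw [act_sub, act_dil_flow_scaled hF hη hη1 hκ c h0 h2]

variable [NeZero n] {lam : ℝ} {ς : ℝ → Matrix (Fin d) (Fin d) ℝ}

theorem curveKer_scaled {L : ℝ} {A : ℝ → Mat n d} (hA : IsCurve L 𝓔 A)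
    (hς : DiffusionAssumption lam ς) (hlam : 1 ≤ lam) (i j : Fin d) (c : ℝ) {r : ℝ} (h0 : 0 < r)
    (s t : ℝ) (v : Sp n d) :
    curveKer i j A ς (c + r ^ 2 * s) (c + r ^ 2 * t) (act (dil r) v) = (r ^ (n ^ 2 * d + 2))⁻¹ *
      curveKer i j (fun u => A (c + r ^ 2 * u)) (fun u => ς (c + r ^ 2 * u)) s t v := by
  unfold curveKer
  rw [← gaussKer_rescale i j _ _ _ h0, cov_rescale hA hς hlam h0,
    phi_rescale hA.meas hA.bdd hA.sub h0]
  congr 1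
  simp only [mul_assoc, dil_mul_inv h0.ne', mul_one]
  rw [← mul_assoc, dil_mul_inv h0.ne', one_mul]

/-- This identity carries the unit-scale estimates to all scales. -/
theorem kKer_scaled (hF : DriftAssumption η κ 𝓔 F) (hη : 0 < η) (hη1 : η ≤ 1) (hκ : 0 ≤ κ)
    (hς : DiffusionAssumption lam ς) (hlam : 1 ≤ lam) (i j : Fin d) (c : ℝ) {r : ℝ} (h0 : 0 < r)
    (h2 : r ≤ 2) (s t : ℝ) (x y : Sp n d) :
    kKer F ς i j (c + r ^ 2 * s) (c + r ^ 2 * t) (act (dil r) x) (act (dil r) y) =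
      (r ^ (n ^ 2 * d + 2))⁻¹ * kKer (scaled F c r) (fun u => ς (c + r ^ 2 * u)) i j s t x y := by
  have hr2 : 0 < r ^ 2 := by positivity
  by_cases hst : s < t
  · have hst' : c + r ^ 2 * s < c + r ^ 2 * t := by nlinarith
    have hA := isCurve_linCurve hη hκ hF (c + r ^ 2 * t) (act (dil r) y)
    rw [kKer_eq hη hκ hF hς hlam i j hst', kKer_eq hη (mul_nonneg scaleConst_nonneg hκ)
      (hF.scaled hη hη1 hκ c h0 h2) (hς.comp_affine c (r ^ 2)) hlam i j hst,
      linCurve_scaled hF hη hη1 hκ c h0 h2, ← curveKer_scaled hA hς hlam i j c h0]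
    congr 1
    rw [phi_rescale hA.meas hA.bdd hA.sub h0, ← act_dil_flow_scaled hF hη hη1 hκ c h0 h2, ← act_sub,
      act_mul, act_mul, act_dil_dil_inv h0.ne']
  · have hst' : ¬ c + r ^ 2 * s < c + r ^ 2 * t := by
      rw [not_lt] at hst ⊢; nlinarith
    simp [kKer, hst, hst']

end Scaling

/-! ### First order expansion of the drift and of the flow. -/

section Taylor

variable {η κ : ℝ} {𝓔 : Fin n → Set (Matrix (Fin d) (Fin d) ℝ)} {F : ℝ → Sp n d → Sp n d}

theorem norm_inject (j : Fin n) (v : EuclideanSpace ℝ (Fin d)) : ‖(inject j v : Sp n d)‖ ≤ ‖v‖ := by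
  refine le_of_sq_le_sq ?_ (norm_nonneg _)
  rw [EuclideanSpace.real_norm_sq_eq, EuclideanSpace.real_norm_sq_eq, Fintype.sum_prod_type,
    Finset.sum_eq_single j]
  · simp [inject]
  · intro b _ hb; simp [inject, hb]
  · simp

/-- Mean value estimate in the direction of the block below the diagonal. -/
theorem DriftAssumption.abs_taylor_inject_le (hF : DriftAssumption η κ 𝓔 F) (hη : 0 < η) {h : ℝ}
    (hh : 0 ≤ h) (t : ℝ) {i j : Fin n} (hij : j.val + 1 = i.val) (k : Fin d)
    (hol : ∀ x x' l, |blockGrad F t x i j k l - blockGrad F t x' i j k l| ≤ h * ‖x - x'‖ ^ η)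
    (x : Sp n d) (v : EuclideanSpace ℝ (Fin d)) :
    |F t (x + inject j v) (i, k) - F t x (i, k) - ∑ l, blockGrad F t x i j k l * v l| ≤
      d * h * ‖v‖ ^ η * ‖v‖ := by
  set D : ℝ := ∑ l, blockGrad F t x i j k l * v l with hD
  -- With the linear part removed, the derivative of `f` is a difference of gradients, controlled by
  -- Hölder continuity.
  set f : ℝ → ℝ := fun s => F t (x + s • inject j v) (i, k) - s * D with hf
  have hder : ∀ s, HasDerivAt f
      (∑ l, (blockGrad F t (x + s • inject j v) i j k l - blockGrad F t x i j k l) * v l) s := by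
    intro s
    have h1 := hF.hasDerivAt t (x + s • inject j v) hij v k
    rw [← sub_self s] at h1
    have h2 := h1.comp_sub_const (x := s) (a := s)
    have h3 : (fun u : ℝ => F t (x + s • inject j v + (u - s) • inject j v) (i, k)) =
        fun u => F t (x + u • inject j v) (i, k) := by
      funext u
      rw [add_assoc, ← add_smul, add_sub_cancel]
    rw [h3] at h2
    refine (h2.fun_sub ((hasDerivAt_id' s).mul_const D)).congr_deriv ?_
    rw [one_mul, hD, ← Finset.sum_sub_distrib]
    exact Finset.sum_congr rfl fun l _ => by ring
  have hbound : ∀ s ∈ Ico (0 : ℝ) 1,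
      ‖∑ l, (blockGrad F t (x + s • inject j v) i j k l - blockGrad F t x i j k l) * v l‖ ≤
        d * h * ‖v‖ ^ η * ‖v‖ := by
    intro s hs
    refine (norm_sum_le _ _).trans ?_
    have h1 : ∀ l ∈ (Finset.univ : Finset (Fin d)),
        ‖(blockGrad F t (x + s • inject j v) i j k l - blockGrad F t x i j k l) * v l‖ ≤
        h * ‖v‖ ^ η * ‖v‖ := by
      intro l _
      rw [norm_mul]
      refine mul_le_mul ((hol _ _ l).trans ?_) (PiLp.norm_apply_le v l) (norm_nonneg _)
        (by positivity)
      refine mul_le_mul_of_nonneg_left (Real.rpow_le_rpow (norm_nonneg _) ?_ hη.le) hh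
      rw [add_sub_cancel_left, norm_smul, Real.norm_of_nonneg hs.1]
      exact (mul_le_of_le_one_left (norm_nonneg _) hs.2.le).trans (norm_inject j v)
    refine (Finset.sum_le_sum h1).trans (le_of_eq ?_)
    simp; ring
  have := norm_image_sub_le_of_norm_deriv_le_segment_01' (f := f)
    (fun s _ => (hder s).hasDerivWithinAt) hbound
  simpa [hf, Real.norm_eq_abs, sub_right_comm] using this

/-- First order expansion of the rescaled drift along the subdiagonal. -/
theorem norm_scaled_taylor_le (hF : DriftAssumption η κ 𝓔 F) (hη : 0 < η) (hη1 : η ≤ 1)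
    (hκ : 0 ≤ κ) (c : ℝ) {r : ℝ} (h0 : 0 < r) (h2 : r ≤ 2) (u : ℝ) (x x' : Sp n d) :
    ‖scaled F c r u x - scaled F c r u x' - act (subGrad (scaled F c r) u x') (x - x')‖ ≤
      (n * d : ℝ) * ((d + 4) * 4 ^ n * κ) * r ^ η * (1 + ‖x - x'‖) ^ 2 := by
  have hS := hF.scaled hη hη1 hκ c h0 h2
  set G := scaled F c r with hG
  -- The gain `r ^ 2` of the other blocks is better than the Hölder gain and is absorbed by it.
  have hrη : r ^ 2 ≤ 4 * r ^ η := by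
    rw [show r ^ 2 = r ^ (2 - η) * r ^ η by
      rw [← Real.rpow_add h0, sub_add_cancel]; exact (Real.rpow_natCast r 2).symm]
    refine mul_le_mul_of_nonneg_right ?_ (by positivity)
    calc r ^ (2 - η) ≤ 2 ^ (2 - η) := Real.rpow_le_rpow h0.le h2 (by linarith)
      _ ≤ 2 ^ (2 : ℝ) := Real.rpow_le_rpow_of_exponent_le (by norm_num) (by linarith)
      _ = 4 := by norm_num
  have hw : ∀ w : ℝ, 0 ≤ w → w ^ η ≤ 1 + w := fun w hw => by
    rcases le_total w 1 with h | h
    · have := Real.rpow_le_one hw h hη.le; linarith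
    · have := Real.rpow_le_rpow_of_exponent_le h hη1
      rw [Real.rpow_one] at this; linarith
  rw [mul_assoc, mul_assoc]
  refine norm_le_of_forall_abs_le fun a => ?_
  obtain ⟨i, k⟩ := a
  set N := ‖x - x'‖ with hN
  have hN0 : 0 ≤ N := norm_nonneg _
  change |G u x (i, k) - G u x' (i, k) - act (subGrad G u x') (x - x') (i, k)| ≤ _
  have hκ4 : 0 ≤ 4 ^ n * κ := by positivity
  have hrη0 : 0 ≤ r ^ η := by positivity
  by_cases hi : ∃ j : Fin n, j.val + 1 = i.val
  · obtain ⟨j, hij⟩ := hi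
    set v := block (x - x') j with hv
    have h1 : act (subGrad G u x') (x - x') (i, k) = ∑ l, blockGrad G u x' i j k l * v l := by
      rw [act_apply, Fintype.sum_prod_type, Finset.sum_eq_single j]
      · refine Finset.sum_congr rfl fun l _ => ?_
        rw [subGrad_apply_of_eq _ _ _ hij]; rfl
      · intro b _ hb
        refine Finset.sum_eq_zero fun l _ => ?_
        have : b.val + 1 ≠ i.val := fun h => hb (Fin.ext (by omega))
        simp [subGrad, this]
      · simp
    have h3 := hS.abs_taylor_inject_le hη (h := 4 ^ n * κ * r ^ η) (by positivity) u hij k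
      (fun z z' l => holder_scaled hF hη hη1 hκ c h0 h2 u z z' hij k l) x' v
    have hvN : ‖v‖ ≤ N := norm_block_le _ _
    -- The intermediate point agrees with `x` on the subdiagonal block `j`; the remaining blocks
    -- that matter are the same or higher ones and gain `r ^ 2`.
    have h4 : |G u x (i, k) - G u (x' + inject j v) (i, k)| ≤
        κ * (r ^ (2 * 1) * 4 ^ n * ‖x - (x' + inject j v)‖) :=
      abs_scaled_sub_le hF hκ c h0 h2 u (i, k) 1 fun e he he' => by
        have : e.1 = j := Fin.ext (by dsimp only at he he'; omega)
        obtain ⟨e1, e2⟩ := e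
        subst this
        simp [inject, hv, block]
    have h5 : ‖x - (x' + inject j v)‖ ≤ 1 * N := by
      refine norm_le_of_abs_le zero_le_one fun e => ?_
      obtain ⟨e1, e2⟩ := e
      by_cases he : e1 = j
      · subst he; simp [inject, hv, block]
      · simp [inject, he]
    have h6 : d * (4 ^ n * κ * r ^ η) * ‖v‖ ^ η * ‖v‖ ≤ d * (4 ^ n * κ * r ^ η) * (1 + N) * N := by
      have := (Real.rpow_le_rpow (norm_nonneg v) hvN hη.le).trans (hw N hN0)
      gcongr
    rw [h1]
    calc |G u x (i, k) - G u x' (i, k) - ∑ l, blockGrad G u x' i j k l * v l|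
        = |(G u x (i, k) - G u (x' + inject j v) (i, k)) + (G u (x' + inject j v) (i, k) -
          G u x' (i, k) - ∑ l, blockGrad G u x' i j k l * v l)| := by congr 1; ring
      _ ≤ κ * (r ^ (2 * 1) * 4 ^ n * (1 * N)) + d * (4 ^ n * κ * r ^ η) * (1 + N) * N := by
        refine (abs_add_le _ _).trans (add_le_add (h4.trans ?_) (h3.trans h6))
        gcongr
      _ = (4 ^ n * κ) * N * r ^ 2 + d * (4 ^ n * κ * r ^ η) * (1 + N) * N := by ring
      _ ≤ (4 ^ n * κ) * N * (4 * r ^ η) + d * (4 ^ n * κ * r ^ η) * (1 + N) * N := by gcongr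
      _ = (4 ^ n * κ * r ^ η) * (4 * N + d * ((1 + N) * N)) := by ring
      _ ≤ (4 ^ n * κ * r ^ η) * (4 * (1 + N) ^ 2 + d * (1 + N) ^ 2) := by
        gcongr <;> nlinarith
      _ = _ := by ring
  -- The first block has no block above it: there is no gradient to subtract, and every coordinate
  -- already gains `r ^ 2`.
  · have h1 : act (subGrad G u x') (x - x') (i, k) = 0 := by
      rw [act_apply]
      refine Finset.sum_eq_zero fun b _ => ?_
      have : ¬ b.1.val + 1 = i.val := fun h => hi ⟨b.1, h⟩
      simp [subGrad, this]
    rw [h1, sub_zero]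
    refine (abs_scaled_sub_le hF hκ c h0 h2 u (i, k) 1 fun e he he' =>
      absurd ⟨e.1, by dsimp only at he he'; omega⟩ hi).trans ?_
    calc κ * (r ^ (2 * 1) * 4 ^ n * N) = (4 ^ n * κ) * N * r ^ 2 := by ring
      _ ≤ (4 ^ n * κ) * (1 + N) ^ 2 * (4 * r ^ η) := by gcongr; nlinarith
      _ ≤ (4 ^ n * κ) * (1 + N) ^ 2 * (4 * r ^ η) + d * (4 ^ n * κ * r ^ η) * (1 + N) ^ 2 := by
        have : 0 ≤ d * (4 ^ n * κ * r ^ η) * (1 + N) ^ 2 := by positivity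
        linarith
      _ = _ := by ring

/-- First order expansion of the flow: trajectories of `G` stay close to their linearization. -/
theorem norm_traj_taylor_le {G : ℝ → Sp n d → Sp n d} (hη : 0 < η) (hκ : 0 ≤ κ)
    (hG : DriftAssumption η κ 𝓔 G) {h : ℝ} (hh : 0 ≤ h)
    (ht : ∀ u x x', ‖G u x - G u x' - act (subGrad G u x') (x - x')‖ ≤ h * (1 + ‖x - x'‖) ^ 2)
    {φ ψ : ℝ → Sp n d} (hφ : IsTraj G φ) (hψ : IsTraj G ψ) (s t : ℝ) :
    ‖φ t - ψ t - act (Phi (fun u => subGrad G u (ψ u)) t s) (φ s - ψ s)‖ ≤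
      h * (1 + Real.exp (κ * |t - s|) * ‖φ s - ψ s‖) ^ 2 * |t - s| *
        Real.exp ((n * d : ℝ) ^ 2 * κ * |t - s|) := by
  have hA := isCurve_subGrad hη hκ hG hψ.1
  set A : ℝ → Mat n d := fun u => subGrad G u (ψ u) with hAdef
  set w := φ s - ψ s with hw
  have hLin := isCaratheodory_act hA.meas hA.bdd
  have hc : Continuous fun u => φ u - ψ u - act (Phi A u s) w :=
    (hφ.1.sub hψ.1).sub (continuous_act_phi hA.meas hA.bdd s w)
  set B := h * (1 + Real.exp (κ * |t - s|) * ‖w‖) ^ 2 with hB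
  have hB0 : 0 ≤ B := by positivity
  refine gronwall (f := fun u => ‖φ u - ψ u - act (Phi A u s) w‖) hc.norm (nonneg_of_bdd hA.bdd)
    (fun u hu => ?_) fun _ => norm_nonneg _
  have hus : |u - s| ≤ |t - s| := abs_sub_left_of_mem_uIcc hu
  have i1 := intervalIntegrable_drift hG hφ.1 s u
  have i2 := intervalIntegrable_drift hG hψ.1 s u
  have i3 := hLin.intervalIntegrable (φ := fun v => act (Phi A v s) w)
    (continuous_act_phi hA.meas hA.bdd s w) s u
  -- The error solves the linearized equation with the Taylor remainder of the field as forcing, so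
  -- Gronwall's inequality applies.
  have e : φ u - ψ u - act (Phi A u s) w =
      ∫ v in s..u, (G v (φ v) - G v (ψ v) - act (A v) (act (Phi A v s) w)) := by
    rw [intervalIntegral.integral_sub (i1.sub i2) i3, intervalIntegral.integral_sub i1 i2,
      act_phi_eq hA.meas hA.bdd s u w, hφ.2 s u, hψ.2 s u, hw]
    abel
  beta_reduce
  rw [e]
  have ic : IntervalIntegrable (fun v => B + (n * d : ℝ) ^ 2 * κ *
      ‖φ v - ψ v - act (Phi A v s) w‖) volume s u :=
    (continuous_const.add (continuous_const.mul hc.norm)).intervalIntegrable _ _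
  refine (intervalIntegral.norm_integral_le_abs_of_norm_le
    (g := fun v => B + (n * d : ℝ) ^ 2 * κ * ‖φ v - ψ v - act (Phi A v s) w‖) ?_ ic).trans ?_
  · refine (ae_restrict_iff' measurableSet_uIoc).2 (ae_of_all _ fun v hv => ?_)
    have hvt : |v - s| ≤ |t - s| :=
      (abs_sub_left_of_mem_uIcc (uIoc_subset_uIcc hv)).trans hus
    have e2 : G v (φ v) - G v (ψ v) - act (A v) (act (Phi A v s) w) =
        (G v (φ v) - G v (ψ v) - act (A v) (φ v - ψ v)) +
          act (A v) (φ v - ψ v - act (Phi A v s) w) := by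
      rw [act_sub (A v) (φ v - ψ v)]; abel
    rw [e2]
    refine (norm_add_le _ _).trans (add_le_add ((ht v _ _).trans ?_) ((norm_act_le _ _).trans ?_))
    · rw [hB]
      have h1 := norm_traj_sub_le hG hκ hφ hψ s v
      have h2 : Real.exp (κ * |v - s|) ≤ Real.exp (κ * |t - s|) :=
        Real.exp_le_exp.2 (mul_le_mul_of_nonneg_left hvt hκ)
      have h3 : ‖φ v - ψ v‖ ≤ Real.exp (κ * |t - s|) * ‖w‖ := by
        rw [mul_comm]
        exact h1.trans (mul_le_mul_of_nonneg_left h2 (norm_nonneg _))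
      refine mul_le_mul_of_nonneg_left (pow_le_pow_left₀ (by positivity) ?_ 2) hh
      linarith
    · exact mul_le_mul_of_nonneg_right (hA.bdd v) (norm_nonneg _)
  · have ic2 : IntervalIntegrable (fun v => (n * d : ℝ) ^ 2 * κ *
        ‖φ v - ψ v - act (Phi A v s) w‖) volume s u :=
      (continuous_const.mul hc.norm).intervalIntegrable _ _
    rw [intervalIntegral.integral_add intervalIntegrable_const ic2, intervalIntegral.integral_const,
      intervalIntegral.integral_const_mul]
    refine (abs_add_le _ _).trans (add_le_add ?_ (le_of_eq ?_))
    · rw [smul_eq_mul, abs_mul, abs_of_nonneg hB0, mul_comm]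
      exact mul_le_mul_of_nonneg_left hus hB0
    · rw [abs_mul, abs_of_nonneg (by positivity)]

end Taylor

/-! ### Uniform estimates for kernels attached to matrix curves. -/

section CurveKernel

variable [NeZero n] {lam : ℝ} {𝓔 : Fin n → Set (Matrix (Fin d) (Fin d) ℝ)}

/-- Pairs of times in the unit window with a lower bound on their distance. -/
def Sep (s t : ℝ) : Prop := s ∈ Icc (-2 : ℝ) 2 ∧ t ∈ Icc (-2 : ℝ) 2 ∧ s ≤ t - 1 / 2

theorem exists_curveKer_bound (h𝓔 : IsNondegenerateFamily 𝓔) (hlam : 1 ≤ lam) (L : ℝ) (M : ℕ) :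
    ∃ D : ℝ, 0 < D ∧ ∀ (A : ℝ → Mat n d) (ς : ℝ → Matrix (Fin d) (Fin d) ℝ), IsCurve L 𝓔 A →
      DiffusionAssumption lam ς → ∀ (i j : Fin d) (s t : ℝ) (v : Sp n d), Sep s t →
      |curveKer i j A ς s t v| ≤ D / (1 + ‖v‖) ^ M := by
  obtain ⟨c, C, hc, hC, hell⟩ := exists_isElliptic_cov h𝓔 L hlam
  obtain ⟨D, hD, h⟩ := exists_gaussKer_bound n d hc hC (Real.exp (4 * L)) M
  exact ⟨D, hD, fun A ς hA hς i j s t v hst => h i j _ _ v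
    (hell A ς hA hς s hst.1 t hst.2.1 hst.2.2) (norm_phi_le_window hA.meas hA.bdd hst.2.1 hst.1)⟩

/-- The curves enter through the resolvent and the covariance only, and both are Lipschitz for the
`L¹` distance on the window. -/
theorem exists_curveKer_lipschitz (h𝓔 : IsNondegenerateFamily 𝓔) (hlam : 1 ≤ lam) (L : ℝ) {B : ℝ}
    (hB : 1 ≤ B) (M : ℕ) :
    ∃ D : ℝ, 0 < D ∧ ∀ (A A' : ℝ → Mat n d) (ς : ℝ → Matrix (Fin d) (Fin d) ℝ), IsCurve L 𝓔 A →
      IsCurve L 𝓔 A' → DiffusionAssumption lam ς → ∀ (i j : Fin d) (s t s' t' : ℝ) (v v' : Sp n d),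
      Sep s t → Sep s' t' → 1 + ‖v‖ ≤ B * (1 + ‖v'‖) → 1 + ‖v'‖ ≤ B * (1 + ‖v‖) →
      |curveKer i j A ς s t v - curveKer i j A' ς s' t' v'| ≤
        D * (|s - s'| + |t - t'| + (∫ u in (-2)..2, ‖A u - A' u‖) + ‖v - v'‖) / (1 + ‖v‖) ^ M := by
  obtain ⟨c, C, hc, hC, hell⟩ := exists_isElliptic_cov h𝓔 L hlam
  obtain ⟨D, hD, h⟩ := exists_gaussKer_lipschitz n d hc hC (Real.exp (4 * L)) hB M
  obtain ⟨C₁, hC1, h1⟩ := exists_phi_stability n d L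
  obtain ⟨C₂, hC2, h2⟩ := exists_cov_stability n d L ((n * d : ℝ) ^ 2 * lam)
  refine ⟨D * (C₁ + C₂ + 1), by positivity, fun A A' ς hA hA' hς i j s t s' t' v v' hst hst' hv hv' => ?_⟩
  have k1 := h1 A A' hA.meas hA.bdd hA'.meas hA'.bdd s hst.1 t hst.2.1 s' hst'.1 t' hst'.2.1
  have k2 := h2 A A' (src ς) (src ς) hA.meas hA.bdd hA'.meas hA'.bdd (stronglyMeasurable_src hς)
    (norm_src_le hς hlam) (stronglyMeasurable_src hς) (norm_src_le hς hlam) s hst.1 t hst.2.1 s'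
    hst'.1 t' hst'.2.1
  simp only [sub_self, norm_zero, intervalIntegral.integral_zero, add_zero] at k2
  have hI : 0 ≤ ∫ u in (-2 : ℝ)..2, ‖A u - A' u‖ :=
    intervalIntegral.integral_nonneg (by norm_num) fun u _ => norm_nonneg _
  refine (h i j _ _ _ _ v v' (hell A ς hA hς s hst.1 t hst.2.1 hst.2.2)
    (hell A' ς hA' hς s' hst'.1 t' hst'.2.1 hst'.2.2)
    (norm_phi_le_window hA.meas hA.bdd hst.2.1 hst.1)
    (norm_phi_le_window hA'.meas hA'.bdd hst'.2.1 hst'.1) hv hv').trans ?_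
  refine div_le_div_of_nonneg_right ?_ (by positivity)
  rw [mul_assoc]
  refine mul_le_mul_of_nonneg_left ?_ hD.le
  set X := |s - s'| + |t - t'| + ∫ u in (-2 : ℝ)..2, ‖A u - A' u‖ with hX
  have hX0 : 0 ≤ X := by positivity
  have := norm_nonneg (v - v')
  nlinarith [mul_nonneg hC1.le this, mul_nonneg hC2.le this]

theorem div_pow_le_div_pow {D E a b : ℝ} (hD : 0 ≤ D) (ha : 0 ≤ a) (hb : 0 ≤ b)
    (h : 1 + a ≤ E * (1 + b)) (k : ℕ) : D / (1 + b) ^ k ≤ D * E ^ k / (1 + a) ^ k := by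
  rw [div_le_div_iff₀ (by positivity) (by positivity), mul_assoc, ← mul_pow]
  exact mul_le_mul_of_nonneg_left (pow_le_pow_left₀ (by positivity) h k) hD

/-- The parameters may differ by a quantity growing like `(1 + ‖w‖) ^ m`, which is absorbed by
asking for decay of order `M + m`. The vector `w` is the deviation in which the final bound is
expressed. -/
theorem exists_curveKer_compare (h𝓔 : IsNondegenerateFamily 𝓔) (hlam : 1 ≤ lam) (L : ℝ) {E : ℝ}
    (hE : 1 ≤ E) {Q : ℝ} (hQ : 0 ≤ Q) (m M : ℕ) :
    ∃ D : ℝ, 0 < D ∧ ∀ (A A' : ℝ → Mat n d) (ς : ℝ → Matrix (Fin d) (Fin d) ℝ), IsCurve L 𝓔 A →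
      IsCurve L 𝓔 A' → DiffusionAssumption lam ς →
      ∀ (i j : Fin d) (s t s' t' : ℝ) (v v' w : Sp n d) (e : ℝ), 0 ≤ e →
      Sep s t → Sep s' t' → 1 + ‖w‖ ≤ E * (1 + ‖v‖) → 1 + ‖v‖ ≤ E * (1 + ‖v'‖) →
      1 + ‖v'‖ ≤ E * (1 + ‖v‖) →
      |s - s'| + |t - t'| + (∫ u in (-2)..2, ‖A u - A' u‖) + ‖v - v'‖ ≤ Q * e * (1 + ‖w‖) ^ m →
      |curveKer i j A ς s t v - curveKer i j A' ς s' t' v'| ≤ D * e / (1 + ‖w‖) ^ M := by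
  obtain ⟨D, hD, h⟩ := exists_curveKer_lipschitz (n := n) h𝓔 hlam L hE (M + m)
  refine ⟨D * Q * E ^ (M + m) + 1, by positivity, ?_⟩
  intro A A' ς hA hA' hς i j s t s' t' v v' w e he hst hst' hw hv hv' hb
  refine (h A A' ς hA hA' hς i j s t s' t' v v' hst hst' hv hv').trans ?_
  have h1 : D * (|s - s'| + |t - t'| + (∫ u in (-2)..2, ‖A u - A' u‖) + ‖v - v'‖) ≤
      D * (Q * e * (1 + ‖w‖) ^ m) := mul_le_mul_of_nonneg_left hb hD.le
  refine (div_le_div_of_nonneg_right h1 (by positivity)).trans ?_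
  refine (div_pow_le_div_pow (by positivity) (norm_nonneg w) (norm_nonneg _) hw (M + m)).trans ?_
  have h3 : D * (Q * e * (1 + ‖w‖) ^ m) * E ^ (M + m) / (1 + ‖w‖) ^ (M + m) =
      D * Q * E ^ (M + m) * e / (1 + ‖w‖) ^ M := by
    rw [pow_add (1 + ‖w‖)]
    have : (1 + ‖w‖) ≠ 0 := by positivity
    field_simp
  rw [h3]
  refine div_le_div_of_nonneg_right (mul_le_mul_of_nonneg_right ?_ he) (by positivity)
  linarith

end CurveKernel

/-! ### Flows and kernel decay at unit scale. -/

section UnitScale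

variable {η κ : ℝ} {𝓔 : Fin n → Set (Matrix (Fin d) (Fin d) ℝ)} {F : ℝ → Sp n d → Sp n d}

/-- A constant that bounds flows and resolvents on the unit window. -/
def flowConst (n d : ℕ) (κ : ℝ) : ℝ := Real.exp (4 * (κ + (n * d : ℝ) ^ 2 * κ))

theorem one_le_flowConst (hκ : 0 ≤ κ) : 1 ≤ flowConst n d κ := Real.one_le_exp (by positivity)

theorem abs_sub_le_four {s t : ℝ} (hs : s ∈ Icc (-2 : ℝ) 2) (ht : t ∈ Icc (-2 : ℝ) 2) :
    |t - s| ≤ 4 := by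
  rw [abs_le]; constructor <;> linarith [ht.1, ht.2, hs.1, hs.2]

theorem exp_le_flowConst (hκ : 0 ≤ κ) {s t : ℝ} (hs : s ∈ Icc (-2 : ℝ) 2) (ht : t ∈ Icc (-2 : ℝ) 2) :
    Real.exp (κ * |t - s|) ≤ flowConst n d κ := by
  refine Real.exp_le_exp.2 ?_
  have h1 := abs_sub_le_four hs ht
  have h2 : 0 ≤ (n * d : ℝ) ^ 2 * κ := by positivity
  nlinarith [abs_nonneg (t - s)]

theorem norm_traj_sub_le_window (hF : DriftAssumption η κ 𝓔 F) (hκ : 0 ≤ κ) {φ ψ : ℝ → Sp n d}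
    (hφ : IsTraj F φ) (hψ : IsTraj F ψ) {s t : ℝ} (hs : s ∈ Icc (-2 : ℝ) 2)
    (ht : t ∈ Icc (-2 : ℝ) 2) : ‖φ t - ψ t‖ ≤ flowConst n d κ * ‖φ s - ψ s‖ := by
  refine (norm_traj_sub_le hF hκ hφ hψ s t).trans ?_
  rw [mul_comm]
  exact mul_le_mul_of_nonneg_right (exp_le_flowConst hκ hs ht) (norm_nonneg _)

theorem norm_phi_le_flowConst (hκ : 0 ≤ κ) {A : ℝ → Mat n d}
    (hA : IsCurve ((n * d : ℝ) ^ 2 * κ) 𝓔 A) {s t : ℝ} (hs : s ∈ Icc (-2 : ℝ) 2)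
    (ht : t ∈ Icc (-2 : ℝ) 2) : ‖Phi A t s‖ ≤ flowConst n d κ := by
  refine (norm_phi_le_window hA.meas hA.bdd ht hs).trans (Real.exp_le_exp.2 ?_)
  linarith

theorem norm_act_phi_le (hκ : 0 ≤ κ) {A : ℝ → Mat n d} (hA : IsCurve ((n * d : ℝ) ^ 2 * κ) 𝓔 A)
    {s t : ℝ} (hs : s ∈ Icc (-2 : ℝ) 2) (ht : t ∈ Icc (-2 : ℝ) 2) (w : Sp n d) :
    ‖act (Phi A t s) w‖ ≤ flowConst n d κ * ‖w‖ :=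
  (norm_act_le _ _).trans
    (mul_le_mul_of_nonneg_right (norm_phi_le_flowConst hκ hA hs ht) (norm_nonneg _))

theorem norm_le_act_phi (hκ : 0 ≤ κ) {A : ℝ → Mat n d} (hA : IsCurve ((n * d : ℝ) ^ 2 * κ) 𝓔 A)
    {s t : ℝ} (hs : s ∈ Icc (-2 : ℝ) 2) (ht : t ∈ Icc (-2 : ℝ) 2) (w : Sp n d) :
    ‖w‖ ≤ flowConst n d κ * ‖act (Phi A t s) w‖ := by
  have h := norm_act_phi_le hκ hA ht hs (act (Phi A t s) w)
  rwa [← act_mul, phi_mul_phi hA.meas hA.bdd, phi_self hA.meas hA.bdd, act_one] at h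

theorem one_add_le_mul {E a b : ℝ} (hE : 1 ≤ E) (h : a ≤ E * b) : 1 + a ≤ E * (1 + b) := by
  rw [mul_add, mul_one]; linarith

theorem norm_traj_increment_le (hF : DriftAssumption η κ 𝓔 F) (hκ : 0 ≤ κ) {φ ψ : ℝ → Sp n d}
    (hφ : IsTraj F φ) (hψ : IsTraj F ψ) {s t : ℝ} (hs : s ∈ Icc (-2 : ℝ) 2)
    (ht : t ∈ Icc (-2 : ℝ) 2) :
    ‖(φ t - ψ t) - (φ s - ψ s)‖ ≤ κ * flowConst n d κ * ‖φ s - ψ s‖ * |t - s| := by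
  have h1 := intervalIntegrable_drift hF hφ.1 s t
  have h2 := intervalIntegrable_drift hF hψ.1 s t
  have e : (φ t - ψ t) - (φ s - ψ s) = ∫ v in s..t, (F v (φ v) - F v (ψ v)) := by
    rw [intervalIntegral.integral_sub h1 h2, hφ.2 s t, hψ.2 s t]; abel
  rw [e]
  refine intervalIntegral.norm_integral_le_of_norm_le_const fun v hv => ?_
  refine (hF.lip v _ _).trans ?_
  rw [mul_assoc]
  refine mul_le_mul_of_nonneg_left (norm_traj_sub_le_window hF hκ hφ hψ hs ?_) hκ
  exact uIoc_subset_window ht hs hv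

variable [NeZero n] {lam : ℝ}

/-- The linearized deviation and the deviations measured at either time are comparable. The forward
and the backward form correspond to the two quasi-distances. -/
theorem exists_kKer_bound (h𝓔 : IsNondegenerateFamily 𝓔) (hlam : 1 ≤ lam) (hη : 0 < η) (hκ : 0 ≤ κ)
    (M : ℕ) : ∃ D : ℝ, 0 < D ∧ ∀ (F : ℝ → Sp n d → Sp n d) (ς : ℝ → Matrix (Fin d) (Fin d) ℝ),
      DriftAssumption η κ 𝓔 F → DiffusionAssumption lam ς → ∀ (i j : Fin d) (x y : Sp n d),
      |kKer F ς i j 0 1 x y| ≤ D / (1 + ‖flow F 1 0 x - y‖) ^ M ∧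
      |kKer F ς i j 0 1 x y| ≤ D / (1 + ‖x - flow F 0 1 y‖) ^ M := by
  obtain ⟨D, hD, h⟩ := exists_curveKer_bound (n := n) h𝓔 hlam ((n * d : ℝ) ^ 2 * κ) M
  set E := flowConst n d κ with hE
  have hE1 : 1 ≤ E := one_le_flowConst hκ
  have w0 : (0 : ℝ) ∈ Icc (-2 : ℝ) 2 := by norm_num
  have w1 : (1 : ℝ) ∈ Icc (-2 : ℝ) 2 := by norm_num
  have hE0 : 0 < E := by positivity
  refine ⟨D * E ^ M * E ^ M, by positivity, fun F ς hF hς i j x y => ?_⟩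
  have hA := isCurve_linCurve hη hκ hF 1 y
  rw [kKer_eq hη hκ hF hς hlam i j zero_lt_one]
  have hb := h _ ς hA hς i j 0 1 (act (Phi (linCurve F 1 y) 1 0) (x - flow F 0 1 y))
    ⟨w0, w1, by norm_num⟩
  have h1 := norm_le_act_phi hκ hA w0 w1 (x - flow F 0 1 y)
  have h2 := norm_traj_sub_le_window hF hκ (isTraj_flow hF 0 x) (isTraj_flow hF 1 y) w0 w1
  rw [flow_self hF, flow_self hF] at h2
  have k1 := hb.trans (div_pow_le_div_pow hD.le (norm_nonneg _) (norm_nonneg _)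
    (one_add_le_mul hE1 h1) M)
  refine ⟨k1.trans (div_pow_le_div_pow (by positivity) (norm_nonneg _) (norm_nonneg _)
    (one_add_le_mul hE1 h2) M), k1.trans ?_⟩
  exact div_le_div_of_nonneg_right (le_mul_of_one_le_right (by positivity) (one_le_pow₀ hE1))
    (by positivity)

end UnitScale

/-! ### Perturbation of the kernel at unit scale. -/

section UnitComparison

variable {η κ : ℝ} {𝓔 : Fin n → Set (Matrix (Fin d) (Fin d) ℝ)} {F : ℝ → Sp n d → Sp n d}

theorem act_sub_act (P P' : Mat n d) (w w' : Sp n d) :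
    act P w - act P' w' = act (P - P') w + act P' (w - w') := by
  rw [sub_act, act_sub]; abel

theorem one_add_le_of_close {E v v' w w' : ℝ} (hE : 1 ≤ E) (h1 : v ≤ E * w) (h2 : w ≤ w' + E)
    (h3 : w' ≤ E * v') (h0 : 0 ≤ v') : 1 + v ≤ (E ^ 2 + E ^ 2 + 1) * (1 + v') := by
  have h4 : E * w ≤ E * (E * v' + E) := mul_le_mul_of_nonneg_left (by linarith) (by linarith)
  nlinarith [mul_nonneg (sq_nonneg E) h0]

theorem zero_mem_window : (0 : ℝ) ∈ Icc (-2 : ℝ) 2 := by norm_num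

theorem one_mem_window : (1 : ℝ) ∈ Icc (-2 : ℝ) 2 := by norm_num

theorem neg_one_mem_window : (-1 : ℝ) ∈ Icc (-2 : ℝ) 2 := by norm_num

theorem mem_window_of_abs_le {σ : ℝ} (hσ : |σ| ≤ 1 / 4) : σ ∈ Icc (-2 : ℝ) 2 := by
  obtain ⟨h1, h2⟩ := abs_le.1 hσ
  exact ⟨by linarith, by linarith⟩

/-- Comparison of the linearized deviations for two nearby first points. -/
theorem norm_first_sub_le (hκ : 0 ≤ κ) (hF : DriftAssumption η κ 𝓔 F) {A : ℝ → Mat n d}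
    (hA : IsCurve ((n * d : ℝ) ^ 2 * κ) 𝓔 A) {C e σ : ℝ}
    (hσ : |σ| ≤ 1 / 4) (hσe : |σ| ≤ e) {x y ξ : Sp n d}
    (hP : ‖Phi A 1 0 - Phi A 1 σ‖ ≤ C * |σ|) (hC : 0 ≤ C) (hξ : ‖flow F σ 0 x - ξ‖ ≤ e) :
    ‖act (Phi A 1 0) (x - flow F 0 1 y) - act (Phi A 1 σ) (ξ - flow F σ 1 y)‖ ≤
      (C + flowConst n d κ * (1 + κ * flowConst n d κ)) * e * (1 + ‖x - flow F 0 1 y‖) := by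
  have hE0 : 0 < flowConst n d κ := Real.exp_pos _
  have he0 : 0 ≤ e := (abs_nonneg _).trans hσe
  have wσ := mem_window_of_abs_le hσ
  have hinc := norm_traj_increment_le hF hκ (isTraj_flow hF 0 x) (isTraj_flow hF 1 y)
    zero_mem_window wσ
  simp only [flow_self hF, sub_zero] at hinc
  have hPE := norm_act_phi_le hκ hA wσ one_mem_window
  -- The change of the deviation splits into its evolution during time `σ` and the displacement of
  -- `ξ` from the trajectory through `x`.
  have e0 : ξ - flow F σ 1 y - (x - flow F 0 1 y) =
      (flow F σ 0 x - flow F σ 1 y - (x - flow F 0 1 y)) - (flow F σ 0 x - ξ) := by abel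
  generalize x - flow F 0 1 y = w at *
  generalize ξ - flow F σ 1 y = w' at *
  generalize flowConst n d κ = E at *
  have hww : ‖w - w'‖ ≤ e * (1 + κ * E * ‖w‖) := by
    rw [norm_sub_rev, e0]
    refine (norm_sub_le _ _).trans ?_
    have : κ * E * ‖w‖ * |σ| ≤ κ * E * ‖w‖ * e := mul_le_mul_of_nonneg_left hσe (by positivity)
    linarith
  rw [act_sub_act]
  refine (norm_add_le _ _).trans ((add_le_add (norm_act_le _ _) (hPE _)).trans ?_)
  have h1 : ‖Phi A 1 0 - Phi A 1 σ‖ * ‖w‖ ≤ C * e * ‖w‖ :=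
    mul_le_mul_of_nonneg_right (hP.trans (mul_le_mul_of_nonneg_left hσe hC)) (norm_nonneg _)
  have h2 : E * ‖w - w'‖ ≤ E * (e * (1 + κ * E * ‖w‖)) := mul_le_mul_of_nonneg_left hww hE0.le
  have h3 : 0 ≤ C * e + E * e * (κ * E) + E * e * ‖w‖ := by positivity
  linarith

/-- Comparability of the linearized deviations for two nearby first points. -/
theorem one_add_norm_first_le (hκ : 0 ≤ κ) (hF : DriftAssumption η κ 𝓔 F) {A : ℝ → Mat n d}
    (hA : IsCurve ((n * d : ℝ) ^ 2 * κ) 𝓔 A) {σ : ℝ} (hσ : |σ| ≤ 1 / 4) {x y ξ : Sp n d}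
    (hξ : ‖flow F σ 0 x - ξ‖ ≤ 1) :
    1 + ‖act (Phi A 1 0) (x - flow F 0 1 y)‖ ≤
      (1 + flowConst n d κ ^ 3) * (1 + ‖act (Phi A 1 σ) (ξ - flow F σ 1 y)‖) := by
  have hE1 : 1 ≤ flowConst n d κ := one_le_flowConst hκ
  have wσ := mem_window_of_abs_le hσ
  have hback := norm_traj_sub_le_window hF hκ (isTraj_flow hF 0 x) (isTraj_flow hF 1 y) wσ
    zero_mem_window
  simp only [flow_self hF] at hback
  have hvw := norm_act_phi_le hκ hA zero_mem_window one_mem_window (x - flow F 0 1 y)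
  have hwv' := norm_le_act_phi hκ hA wσ one_mem_window (ξ - flow F σ 1 y)
  have h1 : ‖flow F σ 0 x - flow F σ 1 y‖ ≤ 1 + ‖ξ - flow F σ 1 y‖ := by
    have e1 : flow F σ 0 x - flow F σ 1 y = (flow F σ 0 x - ξ) + (ξ - flow F σ 1 y) := by abel
    rw [e1]
    exact (norm_add_le _ _).trans (by linarith)
  generalize ‖act (Phi A 1 0) (x - flow F 0 1 y)‖ = v at *
  have hv' := norm_nonneg (act (Phi A 1 σ) (ξ - flow F σ 1 y))
  generalize ‖act (Phi A 1 σ) (ξ - flow F σ 1 y)‖ = v' at *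
  generalize flowConst n d κ = E at *
  have hE0 : 0 ≤ E := by linarith
  have h2 : v ≤ E * (E * (1 + E * v')) := hvw.trans (mul_le_mul_of_nonneg_left
    (hback.trans (mul_le_mul_of_nonneg_left (h1.trans (by linarith)) hE0)) hE0)
  have h3 : E * E ≤ E ^ 3 := by nlinarith [mul_nonneg hE0 hE0]
  nlinarith

theorem integral_norm_sub_le_window {A A' : ℝ → Mat n d} {b : ℝ}
    (h : ∀ u ∈ Icc (-2 : ℝ) 2, ‖A u - A' u‖ ≤ b) : ∫ u in (-2)..2, ‖A u - A' u‖ ≤ 4 * b := by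
  have := intervalIntegral.norm_integral_le_of_norm_le_const (a := (-2 : ℝ)) (b := 2) (C := b)
    (f := fun u => ‖A u - A' u‖) fun u hu => by
      rw [norm_norm]
      rw [uIoc_of_le (by norm_num : (-2 : ℝ) ≤ 2)] at hu
      exact h u (Ioc_subset_Icc_self hu)
  refine (le_abs_self _).trans (this.trans (le_of_eq ?_))
  rw [show |(2 : ℝ) - -2| = 4 by norm_num, mul_comm]

/-- The linearizations along two trajectories. -/
theorem integral_linCurve_sub_le (hη : 0 < η) (hη1 : η ≤ 1) (hκ : 0 ≤ κ)
    (hF : DriftAssumption η κ 𝓔 F) {h : ℝ} (hh : 0 ≤ h)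
    (hol : ∀ u x x', ‖subGrad F u x - subGrad F u x'‖ ≤ h * ‖x - x'‖ ^ η) {s t σ : ℝ}
    (hσ : σ ∈ Icc (-2 : ℝ) 2) (x y : Sp n d) :
    ∫ u in (-2)..2, ‖linCurve F s x u - linCurve F t y u‖ ≤
      4 * (h * (flowConst n d κ * ‖flow F σ s x - flow F σ t y‖ ^ η)) := by
  have hE1 : 1 ≤ flowConst n d κ := one_le_flowConst hκ
  refine integral_norm_sub_le_window fun u hu => (hol u _ _).trans ?_
  refine mul_le_mul_of_nonneg_left ?_ hh
  have h1 := norm_traj_sub_le_window hF hκ (isTraj_flow hF s x) (isTraj_flow hF t y) hσ hu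
  refine (Real.rpow_le_rpow (norm_nonneg _) h1 hη.le).trans ?_
  rw [Real.mul_rpow (by positivity) (norm_nonneg _)]
  refine mul_le_mul_of_nonneg_right ?_ (by positivity)
  conv_rhs => rw [← Real.rpow_one (flowConst n d κ)]
  exact Real.rpow_le_rpow_of_exponent_le hE1 hη1

variable [NeZero n] {lam : ℝ}

/-- Lipschitz dependence of the kernel on its first point at unit scale. -/
theorem exists_kKer_sub_first (h𝓔 : IsNondegenerateFamily 𝓔) (hlam : 1 ≤ lam) (hη : 0 < η)
    (hκ : 0 ≤ κ) (M : ℕ) : ∃ D : ℝ, 0 < D ∧ ∀ (F : ℝ → Sp n d → Sp n d)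
      (ς : ℝ → Matrix (Fin d) (Fin d) ℝ), DriftAssumption η κ 𝓔 F → DiffusionAssumption lam ς →
      ∀ (i j : Fin d) (x y ξ : Sp n d) (σ e : ℝ), |σ| ≤ 1 / 4 → |σ| ≤ e → e ≤ 1 →
      ‖flow F σ 0 x - ξ‖ ≤ e →
      |kKer F ς i j 0 1 x y - kKer F ς i j σ 1 ξ y| ≤ D * e / (1 + ‖x - flow F 0 1 y‖) ^ M := by
  have hE1 : 1 ≤ flowConst n d κ := one_le_flowConst hκ
  obtain ⟨C, hC, hP⟩ := exists_phi_stability n d ((n * d : ℝ) ^ 2 * κ)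
  obtain ⟨Q, hQ⟩ : ∃ Q, Q = C + flowConst n d κ * (1 + κ * flowConst n d κ) := ⟨_, rfl⟩
  have hQ0 : 0 < Q := by rw [hQ]; positivity
  obtain ⟨B, hB⟩ : ∃ B, B = 1 + flowConst n d κ ^ 3 + flowConst n d κ + Q * flowConst n d κ :=
    ⟨_, rfl⟩
  have hB1 : 1 ≤ B := by
    have : 0 ≤ flowConst n d κ ^ 3 + flowConst n d κ + Q * flowConst n d κ := by positivity
    linarith
  obtain ⟨D, hD, h⟩ := exists_curveKer_compare (n := n) h𝓔 hlam ((n * d : ℝ) ^ 2 * κ) hB1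
    (Q := 1 + Q) (by positivity) 1 M
  refine ⟨D, hD, ?_⟩
  intro F ς hF hς i j x y ξ σ e hσ hσe he hξ
  have he0 : 0 ≤ e := (abs_nonneg _).trans hσe
  have wσ := mem_window_of_abs_le hσ
  obtain ⟨hσ1, hσ2⟩ := abs_le.1 hσ
  have hA := isCurve_linCurve hη hκ hF 1 y
  rw [kKer_eq hη hκ hF hς hlam i j zero_lt_one, kKer_eq hη hκ hF hς hlam i j (by linarith : σ < 1)]
  have hPs := hP _ _ hA.meas hA.bdd hA.meas hA.bdd 0 zero_mem_window 1 one_mem_window σ wσ 1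
    one_mem_window
  simp only [sub_self, norm_zero, intervalIntegral.integral_zero, add_zero, zero_sub, abs_neg,
    abs_zero] at hPs
  have hv := norm_first_sub_le hκ hF hA (y := y) hσ hσe hPs hC.le hξ
  have c1 := one_add_norm_first_le hκ hF hA (y := y) hσ (hξ.trans he)
  have hwv := norm_le_act_phi hκ hA zero_mem_window one_mem_window (x - flow F 0 1 y)
  rw [← hQ] at hv
  -- Both kernels are linearized along the trajectory through `(1, y)`: the curve does not change
  -- and the dependence is Lipschitz.
  refine h _ _ ς hA hA hς i j 0 1 σ 1 _ _ (x - flow F 0 1 y) e he0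
    ⟨zero_mem_window, one_mem_window, by norm_num⟩ ⟨wσ, one_mem_window, by linarith⟩
    ?_ (c1.trans ?_) ?_ ?_
  · refine (one_add_le_mul hE1 hwv).trans (mul_le_mul_of_nonneg_right ?_ (by positivity))
    have : 0 ≤ 1 + flowConst n d κ ^ 3 + Q * flowConst n d κ := by positivity
    linarith
  · refine mul_le_mul_of_nonneg_right ?_ (by positivity)
    have : 0 ≤ flowConst n d κ + Q * flowConst n d κ := by positivity
    linarith
  · generalize act (Phi (linCurve F 1 y) 1 0) (x - flow F 0 1 y) = v at *
    generalize act (Phi (linCurve F 1 y) 1 σ) (ξ - flow F σ 1 y) = v' at *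
    generalize x - flow F 0 1 y = w at *
    generalize flowConst n d κ = E at *
    have h1 : ‖v'‖ ≤ ‖v‖ + Q * e * (1 + ‖w‖) := by
      have e1 : v' = v - (v - v') := by abel
      rw [e1]
      exact (norm_sub_le _ _).trans (by linarith)
    have h2 : Q * e * (1 + ‖w‖) ≤ Q * 1 * (E * (1 + ‖v‖)) := by
      have := one_add_le_mul hE1 hwv
      gcongr
    have h5 : 0 ≤ (E ^ 3 + E) * (1 + ‖v‖) := by positivity
    rw [hB]
    linarith
  · simp only [sub_self, norm_zero, intervalIntegral.integral_zero, add_zero, zero_sub, abs_neg,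
      abs_zero, pow_one]
    have h1 : 0 ≤ e * ‖x - flow F 0 1 y‖ := by positivity
    linarith

/-- Hölder dependence of the kernel on its second point at unit scale. -/
theorem exists_kKer_sub_second (h𝓔 : IsNondegenerateFamily 𝓔) (hlam : 1 ≤ lam) (hη : 0 < η)
    (hη1 : η ≤ 1) (hκ : 0 ≤ κ) (M : ℕ) : ∃ D : ℝ, 0 < D ∧ ∀ (F : ℝ → Sp n d → Sp n d)
      (ς : ℝ → Matrix (Fin d) (Fin d) ℝ), DriftAssumption η κ 𝓔 F → DiffusionAssumption lam ς →
      ∀ (i j : Fin d) (x y ξ : Sp n d) (σ e : ℝ), |σ| ≤ 1 / 4 → |σ| ≤ e → e ≤ 1 →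
      ‖flow F σ 0 x - ξ‖ ≤ e →
      |kKer F ς i j (-1) 0 y x - kKer F ς i j (-1) σ y ξ| ≤
        D * e ^ η / (1 + ‖y - flow F (-1) 0 x‖) ^ M := by
  have hE1 : 1 ≤ flowConst n d κ := one_le_flowConst hκ
  obtain ⟨E, hE⟩ : ∃ E, E = flowConst n d κ := ⟨_, rfl⟩
  rw [← hE] at hE1
  obtain ⟨L, hL⟩ : ∃ L, L = (n * d : ℝ) ^ 2 * κ := ⟨_, rfl⟩
  have hL0 : 0 ≤ L := by rw [hL]; positivity
  obtain ⟨C, hC, hP⟩ := exists_phi_stability n d L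
  obtain ⟨Q, hQ⟩ : ∃ Q, Q = 1 + 4 * (L * E) + C * (1 + 4 * (L * E)) + E * E := ⟨_, rfl⟩
  have hQ0 : 0 < Q := by rw [hQ]; positivity
  obtain ⟨B, hB⟩ : ∃ B, B = E ^ 2 + E ^ 2 + 1 := ⟨_, rfl⟩
  have hB1 : 1 ≤ B := by rw [hB]; nlinarith
  obtain ⟨D, hD, h⟩ := exists_curveKer_compare (n := n) h𝓔 hlam L hB1 hQ0.le 1 M
  refine ⟨D, hD, ?_⟩
  intro F ς hF hς i j x y ξ σ e hσ hσe he hξ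
  have he0 : 0 ≤ e := (abs_nonneg _).trans hσe
  have heη : e ≤ e ^ η := by
    conv_lhs => rw [← Real.rpow_one e]
    rcases he0.eq_or_lt with h0 | h0
    · rw [← h0, Real.zero_rpow one_ne_zero, Real.zero_rpow hη.ne']
    · exact Real.rpow_le_rpow_of_exponent_ge h0 he hη1
  have wσ := mem_window_of_abs_le hσ
  obtain ⟨hσ1, hσ2⟩ := abs_le.1 hσ
  have hA := isCurve_linCurve hη hκ hF 0 x
  have hA' := isCurve_linCurve hη hκ hF σ ξ
  have hI := integral_linCurve_sub_le hη hη1 hκ hF (h := L) hL0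
    (fun u z z' => hL ▸ norm_subGrad_sub_le hκ hF u z z') (s := 0) (t := σ) wσ x ξ
  rw [flow_self hF, ← hE] at hI
  have hξη : ‖flow F σ 0 x - ξ‖ ^ η ≤ e ^ η := Real.rpow_le_rpow (norm_nonneg _) hξ hη.le
  -- Moving the second point moves the linearization, and `DF` is only Hölder continuous. This is
  -- what degrades `e` to `e ^ η`.
  have hI' : ∫ u in (-2)..2, ‖linCurve F 0 x u - linCurve F σ ξ u‖ ≤ 4 * (L * E) * e ^ η := by
    refine hI.trans ?_
    have : L * E * ‖flow F σ 0 x - ξ‖ ^ η ≤ L * E * e ^ η :=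
      mul_le_mul_of_nonneg_left hξη (by positivity)
    linarith
  rw [kKer_eq hη hκ hF hς hlam i j (by norm_num : (-1 : ℝ) < 0),
    kKer_eq hη hκ hF hς hlam i j (by linarith : -1 < σ)]
  have hPs := hP _ _ hA.meas (hL ▸ hA.bdd) hA'.meas (hL ▸ hA'.bdd) (-1) neg_one_mem_window 0
    zero_mem_window (-1) neg_one_mem_window σ wσ
  simp only [sub_self, zero_sub, abs_neg, abs_zero, zero_add] at hPs
  have hww := norm_traj_sub_le_window hF hκ (isTraj_flow hF 0 x) (isTraj_flow hF σ ξ) wσ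
    neg_one_mem_window
  rw [flow_self hF, ← hE] at hww
  have p1 := norm_act_phi_le hκ hA neg_one_mem_window zero_mem_window (y - flow F (-1) 0 x)
  have p2 := norm_le_act_phi hκ hA neg_one_mem_window zero_mem_window (y - flow F (-1) 0 x)
  have p3 := norm_act_phi_le hκ hA' neg_one_mem_window wσ
  have p4 := norm_le_act_phi hκ hA' neg_one_mem_window wσ (y - flow F (-1) σ ξ)
  simp only [← hE] at p1 p2 p3 p4
  have hd : ‖(y - flow F (-1) 0 x) - (y - flow F (-1) σ ξ)‖ ≤ E * e := by
    rw [sub_sub_sub_cancel_left, norm_sub_rev]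
    exact hww.trans (mul_le_mul_of_nonneg_left hξ (by linarith))
  have hd' : ‖(y - flow F (-1) 0 x) - (y - flow F (-1) σ ξ)‖ ≤ E :=
    hd.trans (mul_le_of_le_one_right (by linarith) he)
  have hsep : Sep (-1) 0 := ⟨neg_one_mem_window, zero_mem_window, by norm_num⟩
  have hsep' : Sep (-1) σ := ⟨neg_one_mem_window, wσ, by linarith⟩
  have hIn : 0 ≤ ∫ u in (-2 : ℝ)..2, ‖linCurve F 0 x u - linCurve F σ ξ u‖ :=
    intervalIntegral.integral_nonneg (by norm_num) fun u _ => norm_nonneg _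
  have hfin := h _ _ ς (hL ▸ hA) (hL ▸ hA') hς i j (-1) 0 (-1) σ
    (act (Phi (linCurve F 0 x) 0 (-1)) (y - flow F (-1) 0 x))
    (act (Phi (linCurve F σ ξ) σ (-1)) (y - flow F (-1) σ ξ)) (y - flow F (-1) 0 x) (e ^ η)
    (by positivity) hsep hsep'
  have p5 := p3 ((y - flow F (-1) 0 x) - (y - flow F (-1) σ ξ))
  have p3' := p3 (y - flow F (-1) σ ξ)
  refine hfin ?_ ?_ ?_ ?_
  · refine (one_add_le_mul hE1 p2).trans (mul_le_mul_of_nonneg_right ?_ (by positivity))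
    rw [hB]; nlinarith
  · rw [hB]
    refine one_add_le_of_close hE1 p1 ?_ p4 (norm_nonneg _)
    exact (norm_le_norm_add_norm_sub' _ _).trans (add_le_add le_rfl hd')
  · rw [hB]
    refine one_add_le_of_close hE1 p3' ?_ p2 (norm_nonneg _)
    refine (norm_le_norm_add_norm_sub' _ (y - flow F (-1) 0 x)).trans (add_le_add le_rfl ?_)
    rw [norm_sub_rev]
    exact hd'
  · rw [act_sub_act]
    simp only [sub_self, zero_sub, abs_neg, abs_zero, zero_add, pow_one]
    have t1 := (norm_add_le (act (Phi (linCurve F 0 x) 0 (-1) - Phi (linCurve F σ ξ) σ (-1))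
      (y - flow F (-1) 0 x)) (act (Phi (linCurve F σ ξ) σ (-1))
        ((y - flow F (-1) 0 x) - (y - flow F (-1) σ ξ)))).trans
      (add_le_add (norm_act_le _ _) p5)
    have hw := norm_nonneg (y - flow F (-1) 0 x)
    generalize act (Phi (linCurve F 0 x) 0 (-1) - Phi (linCurve F σ ξ) σ (-1))
      (y - flow F (-1) 0 x) + act (Phi (linCurve F σ ξ) σ (-1))
      ((y - flow F (-1) 0 x) - (y - flow F (-1) σ ξ)) = V at *
    generalize ‖(y - flow F (-1) 0 x) - (y - flow F (-1) σ ξ)‖ = δ at *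
    generalize ‖y - flow F (-1) 0 x‖ = w at *
    generalize ‖Phi (linCurve F 0 x) 0 (-1) - Phi (linCurve F σ ξ) σ (-1)‖ = p at *
    generalize (∫ u in (-2 : ℝ)..2, ‖linCurve F 0 x u - linCurve F σ ξ u‖) = I at *
    have t2 : p * w ≤ C * (1 + 4 * (L * E)) * e ^ η * w := by
      refine mul_le_mul_of_nonneg_right (hPs.trans ?_) hw
      rw [mul_assoc]
      exact mul_le_mul_of_nonneg_left (by linarith) hC.le
    have t3 : E * δ ≤ E * E * e ^ η := by
      rw [mul_assoc]
      exact mul_le_mul_of_nonneg_left (hd.trans (mul_le_mul_of_nonneg_left heη (by linarith)))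
        (by linarith)
    have t4 : |σ| ≤ e ^ η := hσe.trans heη
    rw [hQ]
    have t5 : 0 ≤ e ^ η := by positivity
    have t6 : 0 ≤ (1 + 4 * (L * E) + E * E) * e ^ η * w := by positivity
    have t7 : 0 ≤ C * (1 + 4 * (L * E)) * e ^ η := by positivity
    linarith

/-- Comparison of the kernel with the kernel frozen at its first point, at unit scale. -/
theorem exists_kKer_sub_frozen (h𝓔 : IsNondegenerateFamily 𝓔) (hlam : 1 ≤ lam) (hη : 0 < η)
    (hη1 : η ≤ 1) (hκ : 0 ≤ κ) (M : ℕ) : ∃ D : ℝ, 0 < D ∧ ∀ (F : ℝ → Sp n d → Sp n d)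
      (ς : ℝ → Matrix (Fin d) (Fin d) ℝ), DriftAssumption η κ 𝓔 F → DiffusionAssumption lam ς →
      ∀ h : ℝ, 0 ≤ h → (∀ u x x', ‖subGrad F u x - subGrad F u x'‖ ≤ h * ‖x - x'‖ ^ η) →
      (∀ u x x', ‖F u x - F u x' - act (subGrad F u x') (x - x')‖ ≤ h * (1 + ‖x - x'‖) ^ 2) →
      ∀ (i j : Fin d) (x y : Sp n d),
      |kKer F ς i j 0 1 x y - curveKer i j (linCurve F 0 x) ς 0 1 (flow F 1 0 x - y)| ≤
        D * h / (1 + ‖flow F 1 0 x - y‖) ^ M := by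
  have hE1 : 1 ≤ flowConst n d κ := one_le_flowConst hκ
  obtain ⟨E, hE⟩ : ∃ E, E = flowConst n d κ := ⟨_, rfl⟩
  rw [← hE] at hE1
  have hE0 : 0 < E := by linarith
  obtain ⟨L, hL⟩ : ∃ L, L = (n * d : ℝ) ^ 2 * κ := ⟨_, rfl⟩
  obtain ⟨Q, hQ⟩ : ∃ Q, Q = 4 * E + (1 + E * E) ^ 2 * E := ⟨_, rfl⟩
  have hQ0 : 0 < Q := by rw [hQ]; positivity
  have hB1 : 1 ≤ E ^ 2 := one_le_pow₀ hE1
  -- Here `m = 2`, since the Taylor remainder of the flow grows quadratically in the deviation.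
  obtain ⟨D, hD, hcmp⟩ := exists_curveKer_compare (n := n) h𝓔 hlam L hB1 hQ0.le 2 M
  refine ⟨D, hD, ?_⟩
  intro F ς hF hς h hh hol htay i j x y
  have hA := isCurve_linCurve hη hκ hF 1 y
  have hA' := isCurve_linCurve hη hκ hF 0 x
  have hI := integral_linCurve_sub_le hη hη1 hκ hF hh hol (s := 1) (t := 0) one_mem_window y x
  rw [flow_self hF, ← hE, norm_sub_rev] at hI
  -- The frozen kernel is evaluated at the true deviation, the kernel itself at the linearized one;
  -- they differ by the Taylor remainder of the flow.
  have hT := norm_traj_taylor_le hη hκ hF hh htay (isTraj_flow hF 0 x) (isTraj_flow hF 1 y) 0 1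
  simp only [flow_self hF, sub_zero, abs_one, mul_one] at hT
  have hexp1 : Real.exp κ ≤ E := by
    have := exp_le_flowConst (n := n) (d := d) hκ zero_mem_window one_mem_window
    simpa [hE] using this
  have hexp2 : Real.exp ((n * d : ℝ) ^ 2 * κ) ≤ E := by
    rw [hE]
    refine Real.exp_le_exp.2 ?_
    have : 0 ≤ (n * d : ℝ) ^ 2 * κ := by positivity
    linarith
  have f1 := norm_traj_sub_le_window hF hκ (isTraj_flow hF 0 x) (isTraj_flow hF 1 y) zero_mem_window
    one_mem_window
  have f2 := norm_traj_sub_le_window hF hκ (isTraj_flow hF 0 x) (isTraj_flow hF 1 y) one_mem_window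
    zero_mem_window
  simp only [flow_self hF, ← hE] at f1 f2
  have p1 := norm_act_phi_le hκ hA zero_mem_window one_mem_window (x - flow F 0 1 y)
  have p2 := norm_le_act_phi hκ hA zero_mem_window one_mem_window (x - flow F 0 1 y)
  simp only [← hE] at p1 p2
  rw [kKer_eq hη hκ hF hς hlam i j zero_lt_one]
  have hsep : Sep 0 1 := ⟨zero_mem_window, one_mem_window, by norm_num⟩
  change ‖flow F 1 0 x - y - act (Phi (linCurve F 1 y) 1 0) (x - flow F 0 1 y)‖ ≤ _ at hT
  rw [norm_sub_rev] at hT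
  have k1 : ‖flow F 1 0 x - y‖ ≤ E ^ 2 * ‖act (Phi (linCurve F 1 y) 1 0) (x - flow F 0 1 y)‖ := by
    rw [sq, mul_assoc]
    exact f1.trans (mul_le_mul_of_nonneg_left p2 hE0.le)
  have k2 : ‖act (Phi (linCurve F 1 y) 1 0) (x - flow F 0 1 y)‖ ≤ E ^ 2 * ‖flow F 1 0 x - y‖ := by
    rw [sq, mul_assoc]
    exact p1.trans (mul_le_mul_of_nonneg_left f2 hE0.le)
  refine hcmp _ _ ς (hL ▸ hA) (hL ▸ hA') hς i j 0 1 0 1 _ _ (flow F 1 0 x - y) h hh hsep hsep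
    (one_add_le_mul hB1 k1) (one_add_le_mul hB1 k2) (one_add_le_mul hB1 k1) ?_
  simp only [sub_self, abs_zero, zero_add]
  have hw0 : 0 ≤ ‖flow F 1 0 x - y‖ := norm_nonneg _
  have hx0 : 0 ≤ ‖x - flow F 0 1 y‖ := norm_nonneg _
  generalize ‖flow F 1 0 x - y‖ = w at *
  generalize ‖x - flow F 0 1 y‖ = z at *
  have t1 : w ^ η ≤ (1 + w) ^ 2 := by
    rcases le_total w 1 with h1 | h1
    · have := Real.rpow_le_one hw0 h1 hη.le; nlinarith
    · have := Real.rpow_le_rpow_of_exponent_le h1 hη1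
      rw [Real.rpow_one] at this; nlinarith
  have t2 : 4 * (h * (E * w ^ η)) ≤ 4 * (h * (E * (1 + w) ^ 2)) := by gcongr
  have t3 : h * (1 + Real.exp κ * z) ^ 2 * Real.exp ((n * d : ℝ) ^ 2 * κ) ≤
      h * ((1 + E * E) * (1 + w)) ^ 2 * E := by
    have t4 : 1 + Real.exp κ * z ≤ (1 + E * E) * (1 + w) := by
      have : Real.exp κ * z ≤ E * (E * w) := mul_le_mul hexp1 f2 hx0 hE0.le
      nlinarith [mul_pos hE0 hE0]
    gcongr
  rw [hQ]
  refine (add_le_add (hI.trans t2) (hT.trans t3)).trans (le_of_eq ?_)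
  ring

end UnitComparison

/-! ### The homogeneous norm compared with the Euclidean norm. -/

section HomogeneousNorm

theorem rho_nonneg (t : ℝ) (x : Sp n d) : 0 ≤ rho t x :=
  add_nonneg (by positivity) (Finset.sum_nonneg fun i _ => by positivity)

theorem abs_le_of_rho_le {t R : ℝ} {x : Sp n d} (h : rho t x ≤ R) : |t| ≤ R ^ 2 := by
  have h1 : √|t| ≤ R := by
    rw [Real.sqrt_eq_rpow]
    refine le_trans ?_ h
    exact le_add_of_nonneg_right (Finset.sum_nonneg fun i _ => by positivity)
  exact (Real.sqrt_le_left ((Real.sqrt_nonneg _).trans h1)).1 h1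

theorem norm_block_le_of_rho_le {t R : ℝ} {x : Sp n d} (h : rho t x ≤ R) (i : Fin n) :
    ‖block x i‖ ≤ R ^ (2 * i.val + 1) := by
  have h1 : ‖block x i‖ ^ (1 / (2 * (i.val : ℝ) + 1)) ≤ R := by
    refine le_trans (le_trans ?_ (le_add_of_nonneg_left (by positivity))) h
    exact Finset.single_le_sum (f := fun i : Fin n => ‖block x i‖ ^ (1 / (2 * (i.val : ℝ) + 1)))
      (fun i _ => by positivity) (Finset.mem_univ i)
  have h2 := pow_le_pow_left₀ (by positivity) h1 (2 * i.val + 1)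
  rw [← Real.rpow_natCast, ← Real.rpow_mul (norm_nonneg _)] at h2
  have : (1 / (2 * (i.val : ℝ) + 1)) * ((2 * i.val + 1 : ℕ) : ℝ) = 1 := by push_cast; field_simp
  rwa [this, Real.rpow_one] at h2

theorem abs_le_norm_block (x : Sp n d) (a : Idx n d) : |x a| ≤ ‖block x a.1‖ :=
  PiLp.norm_apply_le (block x a.1) a.2

theorem norm_le_of_rho_le {t R : ℝ} {x : Sp n d} (hR : R ≤ 1) (h : rho t x ≤ R) :
    ‖x‖ ≤ (n * d : ℝ) * R := by
  have hR0 : 0 ≤ R := (rho_nonneg t x).trans h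
  refine norm_le_of_forall_abs_le fun a => ?_
  refine (abs_le_norm_block x a).trans ((norm_block_le_of_rho_le h a.1).trans ?_)
  exact pow_le_of_le_one hR0 hR (by omega)

theorem rho_le {t : ℝ} (ht : |t| ≤ 1) (x : Sp n d) : rho t x ≤ (n + 1) * (1 + ‖x‖) := by
  have h1 : |t| ^ (1 / 2 : ℝ) ≤ 1 := Real.rpow_le_one (abs_nonneg _) ht (by norm_num)
  have h2 : ∀ i : Fin n, ‖block x i‖ ^ (1 / (2 * (i.val : ℝ) + 1)) ≤ 1 + ‖x‖ := by
    intro i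
    have hx := norm_block_le x i
    rcases le_total ‖block x i‖ 1 with h | h
    · have := Real.rpow_le_one (norm_nonneg (block x i)) h
        (by positivity : 0 ≤ 1 / (2 * (i.val : ℝ) + 1))
      linarith [norm_nonneg x]
    · have := Real.rpow_le_rpow_of_exponent_le h (y := 1 / (2 * (i.val : ℝ) + 1)) (z := 1)
        (by rw [div_le_one (by positivity)]; linarith [Nat.cast_nonneg (α := ℝ) i.val])
      rw [Real.rpow_one] at this
      linarith
  have h3 := Finset.sum_le_sum fun i (_ : i ∈ (Finset.univ : Finset (Fin n))) => h2 i
  simp only [Finset.sum_const, Finset.card_univ, Fintype.card_fin, nsmul_eq_mul] at h3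
  unfold rho
  linarith [norm_nonneg x]

theorem rho_le_scaled {t r : ℝ} (h0 : 0 < r) (ht : |t| ≤ r ^ 2) (x : Sp n d) :
    rho t x ≤ (n + 1) * (r * (1 + ‖act (dil r⁻¹) x‖)) := by
  have h1 := rho_scaled h0 (t / r ^ 2) (act (dil r⁻¹) x)
  rw [act_dil_dil_inv h0.ne', mul_div_cancel₀ _ (by positivity)] at h1
  rw [h1]
  have h2 : |t / r ^ 2| ≤ 1 := by
    rw [abs_div, abs_of_pos (by positivity : 0 < r ^ 2), div_le_one (by positivity)]
    exact ht
  have := mul_le_mul_of_nonneg_left (rho_le h2 (act (dil r⁻¹) x)) h0.le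
  linarith

end HomogeneousNorm

/-! ### Transfer of the unit-scale estimates to all scales. -/

section AllScales

variable {η κ : ℝ} {𝓔 : Fin n → Set (Matrix (Fin d) (Fin d) ℝ)}

theorem exists_eq_act_dil {r : ℝ} (h0 : 0 < r) (x : Sp n d) : ∃ x', x = act (dil r) x' :=
  ⟨act (dil r⁻¹) x, (act_dil_dil_inv h0.ne' x).symm⟩

theorem qdist_nonneg (F : ℝ → Sp n d → Sp n d) (p q : ℝ × Sp n d) : 0 ≤ qdist F p q := rho_nonneg _ _

/-- The scale, relative to the distance of the perturbed points, at which kernels are compared. -/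
def gapConst (n d : ℕ) : ℝ := 2 * (n * d + 1)

theorem gapConst_pos : 0 < gapConst n d := by unfold gapConst; positivity

theorem two_le_gapConst : 2 ≤ gapConst n d := by
  unfold gapConst
  have : (0 : ℝ) ≤ n * d := by positivity
  linarith

/-- Since `gapConst ≥ 2`, the hypothesis gives `e ≤ 1 / 2`, so the perturbed time moves by at most
`1 / 4` and stays separated from the other time. -/
theorem perturbation_bounds {F : ℝ → Sp n d → Sp n d} {x ξ : Sp n d} {σ e : ℝ}
    (h : qdist F (0, x) (σ, ξ) ≤ e) (he : gapConst n d * e ≤ 1) :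
    |σ| ≤ 1 / 4 ∧ |σ| ≤ gapConst n d * e ∧ ‖flow F σ 0 x - ξ‖ ≤ gapConst n d * e := by
  have e0 : 0 ≤ e := (rho_nonneg _ _).trans h
  have hb := two_le_gapConst (n := n) (d := d)
  have he2 : e ≤ 1 / 2 := by nlinarith
  have h1 := abs_le_of_rho_le h
  have h2 := norm_le_of_rho_le (by linarith) h
  rw [sub_zero] at h1
  refine ⟨by nlinarith, by nlinarith, h2.trans ?_⟩
  refine mul_le_mul_of_nonneg_right ?_ e0
  unfold gapConst
  have : (0 : ℝ) ≤ n * d := by positivity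
  linarith

theorem norm_subGrad_scaled_sub_le {F : ℝ → Sp n d → Sp n d} (hF : DriftAssumption η κ 𝓔 F)
    (hη : 0 < η) (hη1 : η ≤ 1) (hκ : 0 ≤ κ) (c : ℝ) {r : ℝ} (h0 : 0 < r) (h2 : r ≤ 2) (u : ℝ)
    (x x' : Sp n d) : ‖subGrad (scaled F c r) u x - subGrad (scaled F c r) u x'‖ ≤
      (n * d : ℝ) ^ 2 * (4 ^ n * κ) * r ^ η * ‖x - x'‖ ^ η := by
  refine (norm_le_sum_abs _).trans ?_
  have : ∀ a b : Idx n d, |(subGrad (scaled F c r) u x - subGrad (scaled F c r) u x') a b| ≤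
      4 ^ n * κ * r ^ η * ‖x - x'‖ ^ η := by
    intro a b
    simp only [Matrix.sub_apply, subGrad, Matrix.of_apply]
    split_ifs with h
    · exact holder_scaled hF hη hη1 hκ c h0 h2 u x x' h _ _
    · simp; positivity
  calc _ ≤ ∑ _a : Idx n d, ∑ _b : Idx n d, 4 ^ n * κ * r ^ η * ‖x - x'‖ ^ η :=
        Finset.sum_le_sum fun a _ => Finset.sum_le_sum fun b _ => this a b
    _ = _ := by simp; ring

variable [NeZero n] {lam : ℝ}

/-- The decay of the kernel at scale `r`. -/
theorem exists_kKer_le (h𝓔 : IsNondegenerateFamily 𝓔) (hlam : 1 ≤ lam) (hη : 0 < η) (hη1 : η ≤ 1)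
    (hκ : 0 ≤ κ) (M : ℕ) : ∃ D : ℝ, 0 < D ∧ ∀ (F : ℝ → Sp n d → Sp n d)
      (ς : ℝ → Matrix (Fin d) (Fin d) ℝ), DriftAssumption η κ 𝓔 F → DiffusionAssumption lam ς →
      ∀ (i j : Fin d) (s r : ℝ) (x y : Sp n d), 0 < r → r ≤ 2 →
      |kKer F ς i j s (s + r ^ 2) x y| ≤ (r ^ (n ^ 2 * d + 2))⁻¹ *
        (D / (1 + ‖act (dil r⁻¹) (flow F (s + r ^ 2) s x - y)‖) ^ M) ∧
      |kKer F ς i j s (s + r ^ 2) x y| ≤ (r ^ (n ^ 2 * d + 2))⁻¹ *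
        (D / (1 + ‖act (dil r⁻¹) (x - flow F s (s + r ^ 2) y)‖) ^ M) := by
  obtain ⟨D, hD, h⟩ := exists_kKer_bound (n := n) h𝓔 hlam hη
    (mul_nonneg (scaleConst_nonneg (n := n) (d := d)) hκ) M
  refine ⟨D, hD, fun F ς hF hς i j s r x y h0 h2 => ?_⟩
  obtain ⟨x, rfl⟩ := exists_eq_act_dil h0 x
  obtain ⟨y, rfl⟩ := exists_eq_act_dil h0 y
  have hS := hF.scaled hη hη1 hκ s h0 h2
  have hk := kKer_scaled hF hη hη1 hκ hς hlam i j s h0 h2 0 1 x y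
  have f1 := act_dil_flow_scaled hF hη hη1 hκ s h0 h2 1 0 x
  have f2 := act_dil_flow_scaled hF hη hη1 hκ s h0 h2 0 1 y
  simp only [mul_zero, add_zero, mul_one] at hk f1 f2
  have hb := h _ _ hS (hς.comp_affine s (r ^ 2)) i j x y
  rw [hk, ← f1, ← f2, ← act_sub, ← act_sub, act_dil_inv_dil h0.ne', act_dil_inv_dil h0.ne', abs_mul,
    abs_of_pos (by positivity)]
  exact ⟨mul_le_mul_of_nonneg_left hb.1 (by positivity),
    mul_le_mul_of_nonneg_left hb.2 (by positivity)⟩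

/-- In the coordinates of scale `r` around time `s`, the perturbation has size `𝐝 / r`, and the
hypothesis makes it admissible at unit scale. -/
theorem exists_kKer_first (h𝓔 : IsNondegenerateFamily 𝓔) (hlam : 1 ≤ lam) (hη : 0 < η) (hη1 : η ≤ 1)
    (hκ : 0 ≤ κ) (M : ℕ) : ∃ D : ℝ, 0 < D ∧ ∀ (F : ℝ → Sp n d → Sp n d)
      (ς : ℝ → Matrix (Fin d) (Fin d) ℝ), DriftAssumption η κ 𝓔 F → DiffusionAssumption lam ς →
      ∀ (i j : Fin d) (s r σ : ℝ) (x y ξ : Sp n d), 0 < r → r ≤ 2 →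
      gapConst n d * qdist F (s, x) (σ, ξ) ≤ r →
      |kKer F ς i j s (s + r ^ 2) x y - kKer F ς i j σ (s + r ^ 2) ξ y| ≤
        (r ^ (n ^ 2 * d + 2))⁻¹ * (D * (qdist F (s, x) (σ, ξ) / r) /
          (1 + ‖act (dil r⁻¹) (x - flow F s (s + r ^ 2) y)‖) ^ M) := by
  obtain ⟨D, hD, h⟩ := exists_kKer_sub_first (n := n) h𝓔 hlam hη
    (mul_nonneg (scaleConst_nonneg (n := n) (d := d)) hκ) M
  refine ⟨D * gapConst n d, mul_pos hD gapConst_pos, fun F ς hF hς i j s r σ x y ξ h0 h2 hgap => ?_⟩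
  obtain ⟨x, rfl⟩ := exists_eq_act_dil h0 x
  obtain ⟨y, rfl⟩ := exists_eq_act_dil h0 y
  obtain ⟨ξ, rfl⟩ := exists_eq_act_dil h0 ξ
  obtain ⟨σ, rfl⟩ : ∃ σ', σ = s + r ^ 2 * σ' := ⟨(σ - s) / r ^ 2, by field_simp; ring⟩
  have hS := hF.scaled hη hη1 hκ s h0 h2
  have hk := kKer_scaled hF hη hη1 hκ hς hlam i j s h0 h2 0 1 x y
  have hk' := kKer_scaled hF hη hη1 hκ hς hlam i j s h0 h2 σ 1 ξ y
  have f2 := act_dil_flow_scaled hF hη hη1 hκ s h0 h2 0 1 y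
  have hq := qdist_scaled hF hη hη1 hκ s h0 h2 0 σ x ξ
  simp only [mul_zero, add_zero, mul_one] at hk f2 hk' hq
  rw [hq] at hgap ⊢
  rw [hk, hk', ← f2, ← act_sub, act_dil_inv_dil h0.ne', ← mul_sub, abs_mul, abs_of_pos (by positivity),
    mul_div_cancel_left₀ _ h0.ne']
  have hgap' : gapConst n d * qdist (scaled F s r) (0, x) (σ, ξ) ≤ 1 := by
    refine le_of_mul_le_mul_left ?_ h0
    linarith
  obtain ⟨p1, p2, p3⟩ := perturbation_bounds le_rfl hgap'
  refine mul_le_mul_of_nonneg_left ?_ (by positivity)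
  rw [mul_assoc D]
  exact h _ _ hS (hς.comp_affine s (r ^ 2)) i j x y ξ σ _ p1 p2 hgap' p3

theorem exists_kKer_second (h𝓔 : IsNondegenerateFamily 𝓔) (hlam : 1 ≤ lam) (hη : 0 < η)
    (hη1 : η ≤ 1) (hκ : 0 ≤ κ) (M : ℕ) : ∃ D : ℝ, 0 < D ∧ ∀ (F : ℝ → Sp n d → Sp n d)
      (ς : ℝ → Matrix (Fin d) (Fin d) ℝ), DriftAssumption η κ 𝓔 F → DiffusionAssumption lam ς →
      ∀ (i j : Fin d) (s r σ : ℝ) (x y ξ : Sp n d), 0 < r → r ≤ 2 →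
      gapConst n d * qdist F (s, x) (σ, ξ) ≤ r →
      |kKer F ς i j (s - r ^ 2) s y x - kKer F ς i j (s - r ^ 2) σ y ξ| ≤
        (r ^ (n ^ 2 * d + 2))⁻¹ * (D * (qdist F (s, x) (σ, ξ) / r) ^ η /
          (1 + ‖act (dil r⁻¹) (y - flow F (s - r ^ 2) s x)‖) ^ M) := by
  obtain ⟨D, hD, h⟩ := exists_kKer_sub_second (n := n) h𝓔 hlam hη hη1
    (mul_nonneg (scaleConst_nonneg (n := n) (d := d)) hκ) M
  refine ⟨D * gapConst n d ^ η, mul_pos hD (Real.rpow_pos_of_pos gapConst_pos _),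
    fun F ς hF hς i j s r σ x y ξ h0 h2 hgap => ?_⟩
  obtain ⟨x, rfl⟩ := exists_eq_act_dil h0 x
  obtain ⟨y, rfl⟩ := exists_eq_act_dil h0 y
  obtain ⟨ξ, rfl⟩ := exists_eq_act_dil h0 ξ
  obtain ⟨σ, rfl⟩ : ∃ σ', σ = s + r ^ 2 * σ' := ⟨(σ - s) / r ^ 2, by field_simp; ring⟩
  have hS := hF.scaled hη hη1 hκ s h0 h2
  have hk := kKer_scaled hF hη hη1 hκ hς hlam i j s h0 h2 (-1) 0 y x
  have hk' := kKer_scaled hF hη hη1 hκ hς hlam i j s h0 h2 (-1) σ y ξ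
  have f2 := act_dil_flow_scaled hF hη hη1 hκ s h0 h2 (-1) 0 x
  have hq := qdist_scaled hF hη hη1 hκ s h0 h2 0 σ x ξ
  simp only [mul_zero, add_zero, mul_neg, mul_one, ← sub_eq_add_neg] at hk f2 hk' hq
  rw [hq] at hgap ⊢
  rw [hk, hk', ← f2, ← act_sub, act_dil_inv_dil h0.ne', ← mul_sub, abs_mul, abs_of_pos (by positivity),
    mul_div_cancel_left₀ _ h0.ne']
  have hgap' : gapConst n d * qdist (scaled F s r) (0, x) (σ, ξ) ≤ 1 := by
    refine le_of_mul_le_mul_left ?_ h0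
    linarith
  obtain ⟨p1, p2, p3⟩ := perturbation_bounds le_rfl hgap'
  refine mul_le_mul_of_nonneg_left ?_ (by positivity)
  rw [mul_assoc D, ← Real.mul_rpow gapConst_pos.le (qdist_nonneg _ _ _)]
  exact h _ _ hS (hς.comp_affine s (r ^ 2)) i j x y ξ σ _ p1 p2 hgap' p3

theorem exists_kKer_frozen (h𝓔 : IsNondegenerateFamily 𝓔) (hlam : 1 ≤ lam) (hη : 0 < η)
    (hη1 : η ≤ 1) (hκ : 0 ≤ κ) (M : ℕ) : ∃ D : ℝ, 0 < D ∧ ∀ (F : ℝ → Sp n d → Sp n d)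
      (ς : ℝ → Matrix (Fin d) (Fin d) ℝ), DriftAssumption η κ 𝓔 F → DiffusionAssumption lam ς →
      ∀ (i j : Fin d) (s r : ℝ) (x y : Sp n d), 0 < r → r ≤ 2 →
      |kKer F ς i j s (s + r ^ 2) x y -
          curveKer i j (linCurve F s x) ς s (s + r ^ 2) (flow F (s + r ^ 2) s x - y)| ≤
        (r ^ (n ^ 2 * d + 2))⁻¹ * (D * r ^ η /
          (1 + ‖act (dil r⁻¹) (flow F (s + r ^ 2) s x - y)‖) ^ M) := by
  obtain ⟨D, hD, h⟩ := exists_kKer_sub_frozen (n := n) h𝓔 hlam hη hη1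
    (mul_nonneg (scaleConst_nonneg (n := n) (d := d)) hκ) M
  -- At scale `r` both the Hölder constant of the gradient and the Taylor constant of the field are
  -- multiples of `r ^ η`; `H` dominates the two factors.
  obtain ⟨H, hH⟩ : ∃ H, H = (n * d : ℝ) * ((d + 4) * 4 ^ n * κ) + (n * d : ℝ) ^ 2 * (4 ^ n * κ) :=
    ⟨_, rfl⟩
  have t1 : 0 ≤ (n * d : ℝ) * ((d + 4) * 4 ^ n * κ) := by positivity
  have t2 : 0 ≤ (n * d : ℝ) ^ 2 * (4 ^ n * κ) := by positivity
  refine ⟨D * (H + 1), mul_pos hD (by linarith), fun F ς hF hς i j s r x y h0 h2 => ?_⟩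
  obtain ⟨x, rfl⟩ := exists_eq_act_dil h0 x
  obtain ⟨y, rfl⟩ := exists_eq_act_dil h0 y
  have hr : 0 ≤ r ^ η := by positivity
  have hS := hF.scaled hη hη1 hκ s h0 h2
  have hk := kKer_scaled hF hη hη1 hκ hς hlam i j s h0 h2 0 1 x y
  have f1 := act_dil_flow_scaled hF hη hη1 hκ s h0 h2 1 0 x
  have hA := isCurve_linCurve hη hκ hF s (act (dil r) x)
  have hc := curveKer_scaled hA hς hlam i j s h0 0 1 (flow (scaled F s r) 1 0 x - y)
  have hl := linCurve_scaled hF hη hη1 hκ s h0 h2 0 x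
  rw [act_sub] at hc
  simp only [mul_zero, add_zero, mul_one] at hk f1 hc hl
  rw [← hl] at hc
  rw [hk, ← f1, hc, ← act_sub, act_dil_inv_dil h0.ne', ← mul_sub, abs_mul, abs_of_pos (by positivity)]
  refine mul_le_mul_of_nonneg_left ?_ (by positivity)
  rw [mul_assoc D]
  refine h _ _ hS (hς.comp_affine s (r ^ 2)) ((H + 1) * r ^ η) (mul_nonneg (by linarith) hr) (fun u z z' => ?_)
    (fun u z z' => ?_) i j x y
  · refine (norm_subGrad_scaled_sub_le hF hη hη1 hκ s h0 h2 u z z').trans ?_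
    refine mul_le_mul_of_nonneg_right (mul_le_mul_of_nonneg_right ?_ hr) (by positivity)
    linarith
  · refine (norm_scaled_taylor_le hF hη hη1 hκ s h0 h2 u z z').trans ?_
    refine mul_le_mul_of_nonneg_right (mul_le_mul_of_nonneg_right ?_ hr) (by positivity)
    linarith

end AllScales

/-! ### From decay at scale `r` to powers of the quasi-distance. -/

section RealBounds

/-- A Lipschitz gain is at least as good as a Hölder gain when the ratio is at most one. -/
theorem div_le_rpow_div {η a b : ℝ} (hη : 0 < η) (hη1 : η ≤ 1) (ha : 0 ≤ a) (hb : 0 < b)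
    (hab : a ≤ b) (N : ℕ) : a / b ^ (N + 1) ≤ a ^ η / b ^ ((N : ℝ) + η) := by
  have h1 : a / b ≤ (a / b) ^ η := by
    have h0 : 0 ≤ a / b := by positivity
    have h2 : a / b ≤ 1 := (div_le_one hb).2 hab
    rcases h0.eq_or_lt with h | h
    · rw [← h, Real.zero_rpow hη.ne']
    · conv_lhs => rw [← Real.rpow_one (a / b)]
      exact Real.rpow_le_rpow_of_exponent_ge h h2 hη1
  have e1 : a / b ^ (N + 1) = a / b / b ^ N := by rw [div_div, ← pow_succ']
  have e2 : a ^ η / b ^ ((N : ℝ) + η) = (a / b) ^ η / b ^ N := by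
    rw [Real.div_rpow ha hb.le, Real.rpow_add hb, Real.rpow_natCast, div_div, mul_comm]
  rw [e1, e2]
  exact div_le_div_of_nonneg_right h1 (by positivity)

/-- The distance is at most `G r (1 + w)`, so `N + 1 ≥ N + η` powers of decay in `w` turn `r ^ (-(N
+ η))` into a power of the distance. -/
theorem scaled_decay_le {η D G a b r w : ℝ} (hη1 : η ≤ 1) (hη : 0 < η) (hD : 0 ≤ D)
    (hG : 1 ≤ G) (ha : 0 ≤ a) (hb : 0 < b) (hr : 0 < r) (hw : 0 ≤ w) (h : b ≤ G * (r * (1 + w)))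
    (N : ℕ) : (r ^ N)⁻¹ * (D * (a / r) ^ η / (1 + w) ^ (N + 1)) ≤
      D * G ^ (N + 1) * (a ^ η / b ^ ((N : ℝ) + η)) := by
  have hG0 : 0 < G := by linarith
  have hNη : 0 ≤ (N : ℝ) + η := by positivity
  have h1 : b ^ ((N : ℝ) + η) ≤ G ^ (N + 1) * (r ^ N * r ^ η * (1 + w) ^ (N + 1)) := by
    have e0 : ∀ z : ℝ, 1 ≤ z → z ^ ((N : ℝ) + η) ≤ z ^ (N + 1) := fun z hz => by
      rw [← Real.rpow_natCast z (N + 1)]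
      exact Real.rpow_le_rpow_of_exponent_le hz (by push_cast; linarith)
    calc b ^ ((N : ℝ) + η) ≤ (G * (r * (1 + w))) ^ ((N : ℝ) + η) := Real.rpow_le_rpow hb.le h hNη
      _ = G ^ ((N : ℝ) + η) * (r ^ N * r ^ η * (1 + w) ^ ((N : ℝ) + η)) := by
        rw [Real.mul_rpow hG0.le (by positivity), Real.mul_rpow hr.le (by positivity),
          Real.rpow_add hr, Real.rpow_natCast]
      _ ≤ _ := by
        have := e0 G hG
        have := e0 (1 + w) (by linarith)
        gcongr
  rw [Real.div_rpow ha hr.le]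
  have e1 : (r ^ N)⁻¹ * (D * (a ^ η / r ^ η) / (1 + w) ^ (N + 1)) =
      D * a ^ η / (r ^ N * r ^ η * (1 + w) ^ (N + 1)) := by
    field_simp
  have e2 : D * G ^ (N + 1) * (a ^ η / b ^ ((N : ℝ) + η)) =
      D * a ^ η * G ^ (N + 1) / b ^ ((N : ℝ) + η) := by ring
  rw [e1, e2, div_le_div_iff₀ (by positivity) (by positivity), mul_assoc (D * a ^ η)]
  exact mul_le_mul_of_nonneg_left h1 (by positivity)

/-- The surplus factor `r / b` is kept: it is small when the time gap is short compared with the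
distance. -/
theorem scaled_decay_le' {D G b r w : ℝ} (hD : 0 ≤ D) (hb : 0 < b)
    (hr : 0 < r) (hw : 0 ≤ w) (h : b ≤ G * (r * (1 + w))) (N : ℕ) :
    (r ^ N)⁻¹ * (D / (1 + w) ^ (N + 1)) ≤ D * G ^ (N + 1) * (r / b ^ (N + 1)) := by
  have e1 : (r ^ N)⁻¹ * (D / (1 + w) ^ (N + 1)) = D * r / (r * (1 + w)) ^ (N + 1) := by
    rw [mul_pow, pow_succ r]; field_simp
  have e2 : D * G ^ (N + 1) * (r / b ^ (N + 1)) = D * r * G ^ (N + 1) / b ^ (N + 1) := by ring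
  rw [e1, e2, div_le_div_iff₀ (by positivity) (by positivity), mul_assoc (D * r), ← mul_pow]
  exact mul_le_mul_of_nonneg_left (pow_le_pow_left₀ hb.le h _) (by positivity)

end RealBounds

/-! ### Boundedness and Lipschitz continuity of the cut-off. -/

section Cutoff

variable {δ : ℝ} {χ : ℝ × Sp n d → ℝ}

theorem IsCutoff.hasCompactSupport (hχ : IsCutoff δ χ) (hδ : 0 < δ) : HasCompactSupport χ := by
  refine HasCompactSupport.of_support_subset_isCompact
    (isCompact_closedBall (0 : ℝ × Sp n d) (max ((2 * δ) ^ 2) ((n * d : ℝ) * (1 + 2 * δ) ^ (2 * n))))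
    fun p hp => ?_
  have h : rho p.1 p.2 ≤ 2 * δ := by
    by_contra hc
    exact hp (hχ.eq_zero p (not_le.1 hc).le)
  rw [mem_closedBall_zero_iff, Prod.norm_def]
  refine max_le_max (abs_le_of_rho_le h) (norm_le_of_forall_abs_le fun a => ?_)
  refine (abs_le_norm_block p.2 a).trans ((norm_block_le_of_rho_le h a.1).trans ?_)
  refine (pow_le_pow_left₀ (by positivity) (by linarith : 2 * δ ≤ 1 + 2 * δ) _).trans ?_
  exact pow_le_pow_right₀ (by linarith) (by omega)

theorem IsCutoff.exists_bounds (hχ : IsCutoff δ χ) (hδ : 0 < δ) : ∃ X : ℝ, 0 < X ∧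
    (∀ p, |χ p| ≤ X) ∧ ∀ p p', |χ p - χ p'| ≤ X * (|p.1 - p'.1| + ‖p.2 - p'.2‖) := by
  have hs := hχ.hasCompactSupport hδ
  obtain ⟨B, hB⟩ := hs.exists_bound_of_continuous hχ.smooth.continuous
  obtain ⟨L, hL⟩ := hχ.smooth.lipschitzWith_of_hasCompactSupport hs (by simp)
  refine ⟨|B| + L + 1, by positivity, fun p => ?_, fun p p' => ?_⟩
  · have := (hB p).trans (le_abs_self B)
    rw [Real.norm_eq_abs] at this
    have : (0 : ℝ) ≤ L := L.2
    linarith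
  · have h1 := hL.dist_le_mul p p'
    rw [Real.dist_eq] at h1
    have h2 : dist p p' ≤ |p.1 - p'.1| + ‖p.2 - p'.2‖ := by
      rw [Prod.dist_eq, Real.dist_eq, dist_eq_norm]
      exact max_le_add_of_nonneg (abs_nonneg _) (norm_nonneg _)
    have h3 : 0 ≤ |p.1 - p'.1| + ‖p.2 - p'.2‖ := by positivity
    refine h1.trans ((mul_le_mul_of_nonneg_left h2 L.coe_nonneg).trans
      (mul_le_mul_of_nonneg_right ?_ h3))
    have := abs_nonneg B
    linarith

end Cutoff

/-! ### The geometry of the quasi-distance. -/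

section Geometry

variable {η κ : ℝ} {𝓔 : Fin n → Set (Matrix (Fin d) (Fin d) ℝ)} {F : ℝ → Sp n d → Sp n d}

theorem sqrt_le_rho (t : ℝ) (x : Sp n d) : √|t| ≤ rho t x := by
  rw [Real.sqrt_eq_rpow]
  exact le_add_of_nonneg_right (Finset.sum_nonneg fun i _ => by positivity)

/-- The Lipschitz constant of the flow in parabolic coordinates. -/
def scaledFlowConst (n d : ℕ) (κ : ℝ) : ℝ := flowConst n d (scaleConst n d * κ)

theorem one_le_scaledFlowConst (hκ : 0 ≤ κ) : 1 ≤ scaledFlowConst n d κ :=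
  one_le_flowConst (mul_nonneg scaleConst_nonneg hκ)

/-- In rescaled coordinates the flow over unit time is bi-Lipschitz, so forward and backward
deviations are comparable. Hence one decay estimate serves `𝐝` and `𝐝^*`. -/
theorem norm_dil_flow_sub_le (hF : DriftAssumption η κ 𝓔 F) (hη : 0 < η) (hη1 : η ≤ 1) (hκ : 0 ≤ κ)
    {r : ℝ} (h0 : 0 < r) (h2 : r ≤ 2) {s t : ℝ} (hst : |t - s| ≤ r ^ 2) (x y : Sp n d) :
    ‖act (dil r⁻¹) (flow F t s x - y)‖ ≤
      scaledFlowConst n d κ * ‖act (dil r⁻¹) (x - flow F s t y)‖ := by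
  obtain ⟨x, rfl⟩ := exists_eq_act_dil h0 x
  obtain ⟨y, rfl⟩ := exists_eq_act_dil h0 y
  obtain ⟨t, rfl⟩ : ∃ t', t = s + r ^ 2 * t' := ⟨(t - s) / r ^ 2, by field_simp; ring⟩
  have hS := hF.scaled hη hη1 hκ s h0 h2
  have f1 := act_dil_flow_scaled hF hη hη1 hκ s h0 h2 t 0 x
  have f2 := act_dil_flow_scaled hF hη hη1 hκ s h0 h2 0 t y
  simp only [mul_zero, add_zero] at f1 f2
  rw [← f1, ← f2, ← act_sub, ← act_sub, act_dil_inv_dil h0.ne', act_dil_inv_dil h0.ne']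
  have ht : |t| ≤ 1 := by
    rw [add_sub_cancel_left, abs_mul, abs_of_pos (by positivity : 0 < r ^ 2)] at hst
    exact le_of_mul_le_mul_left (by linarith) (by positivity : 0 < r ^ 2)
  obtain ⟨t1, t2⟩ := abs_le.1 ht
  have := norm_traj_sub_le_window hS (mul_nonneg scaleConst_nonneg hκ) (isTraj_flow hS 0 x)
    (isTraj_flow hS t y) zero_mem_window (t := t) ⟨by linarith, by linarith⟩
  rwa [flow_self hS, flow_self hS] at this

theorem norm_act_sub_comm (A : Mat n d) (x y : Sp n d) : ‖act A (x - y)‖ = ‖act A (y - x)‖ := by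
  rw [← neg_sub, act_neg, norm_neg]

/-- A constant that bounds the quasi-distance by the deviation in parabolic coordinates. -/
def distConst (n d : ℕ) (κ : ℝ) : ℝ := (n + 1) * scaledFlowConst n d κ

theorem one_le_distConst (hκ : 0 ≤ κ) : 1 ≤ distConst n d κ := by
  have h1 := one_le_scaledFlowConst (n := n) (d := d) hκ
  have h2 : (0 : ℝ) ≤ n := Nat.cast_nonneg n
  unfold distConst
  nlinarith

theorem qdist_le (hκ : 0 ≤ κ) {r : ℝ} (h0 : 0 < r) {p q : ℝ × Sp n d} (hst : |q.1 - p.1| ≤ r ^ 2) :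
    qdist F p q ≤ distConst n d κ * (r * (1 + ‖act (dil r⁻¹) (flow F q.1 p.1 p.2 - q.2)‖)) := by
  refine (rho_le_scaled h0 hst _).trans (mul_le_mul_of_nonneg_right ?_ (by positivity))
  have h1 := one_le_scaledFlowConst (n := n) (d := d) hκ
  exact le_mul_of_one_le_right (by positivity) h1

theorem qdist_le_back (hF : DriftAssumption η κ 𝓔 F) (hη : 0 < η) (hη1 : η ≤ 1) (hκ : 0 ≤ κ) {r : ℝ}
    (h0 : 0 < r) (h2 : r ≤ 2) {p q : ℝ × Sp n d} (hst : |q.1 - p.1| ≤ r ^ 2) :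
    qdist F p q ≤ distConst n d κ * (r * (1 + ‖act (dil r⁻¹) (p.2 - flow F p.1 q.1 q.2)‖)) := by
  refine (rho_le_scaled h0 hst _).trans ?_
  have h1 := one_add_le_mul (one_le_scaledFlowConst (n := n) (d := d) hκ)
    (norm_dil_flow_sub_le hF hη hη1 hκ h0 h2 hst p.2 q.2)
  unfold distConst
  calc _ ≤ (n + 1) * (r * (scaledFlowConst n d κ *
        (1 + ‖act (dil r⁻¹) (p.2 - flow F p.1 q.1 q.2)‖))) := by gcongr
    _ = _ := by ring

/-- The quasi-triangle inequality, at scales at most one. -/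
theorem exists_qdist_triangle (𝓔 : Fin n → Set (Matrix (Fin d) (Fin d) ℝ)) (hη : 0 < η)
    (hη1 : η ≤ 1) (hκ : 0 ≤ κ) : ∃ G : ℝ, 1 ≤ G ∧ ∀ F : ℝ → Sp n d → Sp n d,
      DriftAssumption η κ 𝓔 F → ∀ (p p' q : ℝ × Sp n d) (R : ℝ), 0 < R → R ≤ 1 →
      qdist F p p' ≤ R → qdist F p' q ≤ R → qdist F p q ≤ G * R := by
  obtain ⟨E, hE⟩ : ∃ E, E = scaledFlowConst n d κ := ⟨_, rfl⟩
  have hE1 : 1 ≤ E := hE ▸ one_le_scaledFlowConst hκ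
  refine ⟨2 * ((n + 1) * (1 + (E * (n * d) + n * d))), ?_, ?_⟩
  · have h1 : 0 ≤ E * (n * d : ℝ) + n * d := by positivity
    have h2 : (0 : ℝ) ≤ n := Nat.cast_nonneg n
    nlinarith
  rintro F hF ⟨s, x⟩ ⟨σ, ξ⟩ ⟨t, y⟩ R h0 hR1 hd1 hd2
  have h2 : R ≤ 2 := by linarith
  -- Rescaling by `R` around the time of the middle point reduces the claim to distances at most
  -- one, where it follows from the Lipschitz bound for the flow.
  obtain ⟨x, rfl⟩ := exists_eq_act_dil h0 x
  obtain ⟨y, rfl⟩ := exists_eq_act_dil h0 y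
  obtain ⟨ξ, rfl⟩ := exists_eq_act_dil h0 ξ
  obtain ⟨t, rfl⟩ : ∃ t', t = σ + R ^ 2 * t' := ⟨(t - σ) / R ^ 2, by field_simp; ring⟩
  obtain ⟨s, rfl⟩ : ∃ s', s = σ + R ^ 2 * s' := ⟨(s - σ) / R ^ 2, by field_simp; ring⟩
  have hS := hF.scaled hη hη1 hκ σ h0 h2
  have q1 := qdist_scaled hF hη hη1 hκ σ h0 h2 s 0 x ξ
  have q2 := qdist_scaled hF hη hη1 hκ σ h0 h2 0 t ξ y
  have q3 := qdist_scaled hF hη hη1 hκ σ h0 h2 s t x y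
  simp only [mul_zero, add_zero] at q1 q2
  rw [q1] at hd1
  rw [q2] at hd2
  rw [q3, mul_comm]
  refine mul_le_mul_of_nonneg_right ?_ h0.le
  generalize scaled F σ R = G at *
  have hd1' : rho (0 - s) (flow G 0 s x - ξ) ≤ 1 :=
    le_of_mul_le_mul_left (hd1.trans_eq (mul_one R).symm) h0
  have hd2' : rho (t - 0) (flow G t 0 ξ - y) ≤ 1 :=
    le_of_mul_le_mul_left (hd2.trans_eq (mul_one R).symm) h0
  have a1 := abs_le_of_rho_le hd1'
  have a2 := abs_le_of_rho_le hd2'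
  have b1 := norm_le_of_rho_le le_rfl hd1'
  have b2 := norm_le_of_rho_le le_rfl hd2'
  rw [zero_sub, abs_neg, one_pow, abs_le] at a1
  rw [sub_zero, one_pow, abs_le] at a2
  have f := norm_traj_sub_le_window hS (mul_nonneg scaleConst_nonneg hκ) (isTraj_flow hS s x)
    (isTraj_flow hS 0 ξ) zero_mem_window (t := t) ⟨by linarith, by linarith⟩
  rw [flow_self hS] at f
  have hn : ‖flow G t s x - y‖ ≤ E * (n * d) + n * d := by
    have e1 : flow G t s x - y = (flow G t s x - flow G t 0 ξ) + (flow G t 0 ξ - y) := by abel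
    rw [e1]
    refine (norm_add_le _ _).trans (add_le_add (f.trans ?_) (by linarith))
    change scaledFlowConst n d κ * _ ≤ _
    rw [← hE]
    exact mul_le_mul_of_nonneg_left (by linarith) (by linarith)
  have hr := rho_le_scaled (r := 2) (by norm_num) (t := t - s) (abs_le.2 ⟨by linarith, by linarith⟩)
    (flow G t s x - y)
  have hdil : ‖act (dil (2 : ℝ)⁻¹) (flow G t s x - y)‖ ≤ 1 * ‖flow G t s x - y‖ := by
    refine norm_le_of_abs_le zero_le_one fun a => ?_
    rw [act_dil_apply, abs_mul, abs_of_pos (by positivity)]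
    exact mul_le_mul_of_nonneg_right (pow_le_one₀ (by norm_num) (by norm_num)) (abs_nonneg _)
  refine hr.trans ?_
  calc ((n : ℝ) + 1) * (2 * (1 + ‖act (dil (2 : ℝ)⁻¹) (flow G t s x - y)‖))
      ≤ (n + 1) * (2 * (1 + (E * (n * d) + n * d))) := by gcongr; linarith
    _ = _ := by ring

theorem eq_of_qdist_eq_zero (hF : DriftAssumption η κ 𝓔 F) {p q : ℝ × Sp n d} (h : qdist F p q = 0) :
    p = q := by
  have h1 := abs_le_of_rho_le h.le
  have h2 := norm_le_of_rho_le zero_le_one h.le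
  have e1 : q.1 = p.1 := by
    have : |q.1 - p.1| ≤ 0 := by simpa using h1
    linarith [abs_nonpos_iff.1 this]
  rw [e1, flow_self hF, mul_zero] at h2
  exact Prod.ext e1.symm (sub_eq_zero.1 (norm_le_zero_iff.1 h2))

end Geometry

/-! ### The size estimates. -/

section Size

variable {η κ : ℝ} {𝓔 : Fin n → Set (Matrix (Fin d) (Fin d) ℝ)}

theorem sqrt_le_qdist {F : ℝ → Sp n d → Sp n d} {p q : ℝ × Sp n d} (h : p.1 < q.1) :
    √(q.1 - p.1) ≤ qdist F p q ∧ √(q.1 - p.1) ≤ qdist F q p := by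
  have h1 := sqrt_le_rho (q.1 - p.1) (flow F q.1 p.1 p.2 - q.2)
  have h2 := sqrt_le_rho (p.1 - q.1) (flow F p.1 q.1 q.2 - p.2)
  rw [abs_of_pos (by linarith)] at h1
  rw [abs_sub_comm, abs_of_pos (by linarith)] at h2
  exact ⟨h1, h2⟩

theorem qdist_pos {F : ℝ → Sp n d → Sp n d} {p q : ℝ × Sp n d} (h : p.1 < q.1) :
    0 < qdist F p q ∧ 0 < qdist F q p :=
  have h0 : 0 < √(q.1 - p.1) := Real.sqrt_pos.2 (by linarith)
  ⟨h0.trans_le (sqrt_le_qdist h).1, h0.trans_le (sqrt_le_qdist h).2⟩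

theorem div_pow_succ_le {r b : ℝ} (hb : 0 < b) (h : r ≤ b) (N : ℕ) : r / b ^ (N + 1) ≤ 1 / b ^ N := by
  rw [div_le_div_iff₀ (by positivity) (by positivity), one_mul, pow_succ']
  exact mul_le_mul_of_nonneg_right h (by positivity)

theorem sub_le_two {T : ℝ} (hT : T ≤ 1) {p q : ℝ × Sp n d} (hp : p ∈ strip n d T)
    (hq : q ∈ strip n d T) : q.1 - p.1 ≤ 2 := by
  linarith [hp.1.1, hq.1.2]

variable [NeZero n] {lam : ℝ}

/-- The decay of the kernel in terms of the quasi-distances. -/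
theorem exists_kKer_le_qdist (h𝓔 : IsNondegenerateFamily 𝓔) (hlam : 1 ≤ lam) (hη : 0 < η)
    (hη1 : η ≤ 1) (hκ : 0 ≤ κ) : ∃ D : ℝ, 0 < D ∧ ∀ (F : ℝ → Sp n d → Sp n d)
      (ς : ℝ → Matrix (Fin d) (Fin d) ℝ), DriftAssumption η κ 𝓔 F → DiffusionAssumption lam ς →
      ∀ (i j : Fin d) (p q : ℝ × Sp n d), p.1 < q.1 → q.1 - p.1 ≤ 2 →
      |kKer F ς i j p.1 q.1 p.2 q.2| ≤ D * (√(q.1 - p.1) / qdist F p q ^ (n ^ 2 * d + 2 + 1)) ∧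
      |kKer F ς i j p.1 q.1 p.2 q.2| ≤ D * (√(q.1 - p.1) / qdist F q p ^ (n ^ 2 * d + 2 + 1)) := by
  obtain ⟨D, hD, h⟩ := exists_kKer_le (n := n) h𝓔 hlam hη hη1 hκ (n ^ 2 * d + 2 + 1)
  have hG := one_le_distConst (n := n) (d := d) hκ
  refine ⟨D * distConst n d κ ^ (n ^ 2 * d + 2 + 1), by positivity, ?_⟩
  rintro F ς hF hς i j ⟨s, x⟩ ⟨t, y⟩ hst ht2
  dsimp only at hst ht2 ⊢
  obtain ⟨r, hr⟩ : ∃ r, r = √(t - s) := ⟨_, rfl⟩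
  have h0 : 0 < r := hr ▸ Real.sqrt_pos.2 (by linarith)
  have hr2 : r ^ 2 = t - s := by rw [hr]; exact Real.sq_sqrt (by linarith)
  have h2 : r ≤ 2 := by nlinarith
  obtain rfl : t = s + r ^ 2 := by linarith
  rw [← hr]
  have hb := (h F ς hF hς i j s r x y h0 h2).1
  have habs : |s + r ^ 2 - s| ≤ r ^ 2 := by rw [add_sub_cancel_left, abs_of_nonneg (by positivity)]
  have habs' : |s - (s + r ^ 2)| ≤ r ^ 2 := by rw [abs_sub_comm]; exact habs
  have q1 := qdist_le (F := F) hκ h0 (p := (s, x)) (q := (s + r ^ 2, y)) habs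
  have q2 := qdist_le_back hF hη hη1 hκ h0 h2 (p := (s + r ^ 2, y)) (q := (s, x)) habs'
  dsimp only at q1 q2
  rw [norm_act_sub_comm] at q2
  have hsq : ∀ z : ℝ × Sp n d, √|r ^ 2| = r := fun _ => by
    rw [abs_of_nonneg (by positivity), Real.sqrt_sq h0.le]
  have p1 : 0 < qdist F (s, x) (s + r ^ 2, y) := by
    have := sqrt_le_rho (s + r ^ 2 - s) (flow F (s + r ^ 2) s x - y)
    rw [add_sub_cancel_left, hsq 0] at this
    refine h0.trans_le (this.trans (le_of_eq ?_))
    simp [qdist]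
  have p2 : 0 < qdist F (s + r ^ 2, y) (s, x) := by
    have := sqrt_le_rho (s - (s + r ^ 2)) (flow F s (s + r ^ 2) y - x)
    rw [abs_sub_comm, add_sub_cancel_left, hsq 0] at this
    exact h0.trans_le this
  exact ⟨hb.trans (scaled_decay_le' hD.le p1 h0 (norm_nonneg _) q1 _),
    hb.trans (scaled_decay_le' hD.le p2 h0 (norm_nonneg _) q2 _)⟩

theorem kLoc_eq_zero {F : ℝ → Sp n d → Sp n d} {ς : ℝ → Matrix (Fin d) (Fin d) ℝ}
    {χ : ℝ × Sp n d → ℝ} {i j : Fin d} {p q : ℝ × Sp n d} (h : q.1 ≤ p.1) :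
    kLoc F ς χ i j p q = 0 := by
  simp [kLoc, kKer, not_lt.2 h]

theorem exists_kLoc_le (h𝓔 : IsNondegenerateFamily 𝓔) (hlam : 1 ≤ lam) (hη : 0 < η)
    (hη1 : η ≤ 1) (hκ : 0 ≤ κ) {δ : ℝ} (hδ : 0 < δ) {χ : ℝ × Sp n d → ℝ} (hχ : IsCutoff δ χ) :
    ∃ D : ℝ, 0 < D ∧ ∀ (F : ℝ → Sp n d → Sp n d)
      (ς : ℝ → Matrix (Fin d) (Fin d) ℝ), DriftAssumption η κ 𝓔 F → DiffusionAssumption lam ς →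
      ∀ (i j : Fin d) (p q : ℝ × Sp n d), p.1 < q.1 → q.1 - p.1 ≤ 2 →
      |kLoc F ς χ i j p q| ≤ D * (√(q.1 - p.1) / qdist F p q ^ (n ^ 2 * d + 2 + 1)) ∧
      |kLoc F ς χ i j p q| ≤ D * (√(q.1 - p.1) / qdist F q p ^ (n ^ 2 * d + 2 + 1)) := by
  obtain ⟨D, hD, h⟩ := exists_kKer_le_qdist (n := n) h𝓔 hlam hη hη1 hκ
  obtain ⟨X, hX0, hX, -⟩ := hχ.exists_bounds hδ
  refine ⟨X * D, by positivity, fun F ς hF hς i j p q hpq hq2 => ?_⟩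
  have hb := h F ς hF hς i j p q hpq hq2
  unfold kLoc
  rw [abs_mul, mul_assoc X, mul_assoc X]
  exact ⟨mul_le_mul (hX _) hb.1 (abs_nonneg _) hX0.le, mul_le_mul (hX _) hb.2 (abs_nonneg _) hX0.le⟩

theorem exists_sizeEstimate (h𝓔 : IsNondegenerateFamily 𝓔) (hlam : 1 ≤ lam) (hη : 0 < η)
    (hη1 : η ≤ 1) (hκ : 0 ≤ κ) {δ : ℝ} (hδ : 0 < δ) {χ : ℝ × Sp n d → ℝ} (hχ : IsCutoff δ χ) :
    ∃ D : ℝ, 0 < D ∧ ∀ (F : ℝ → Sp n d → Sp n d)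
      (ς : ℝ → Matrix (Fin d) (Fin d) ℝ), DriftAssumption η κ 𝓔 F → DiffusionAssumption lam ς →
      ∀ (i j : Fin d) (T : ℝ), T ≤ 1 →
      SizeEstimate F T D (kLoc F ς χ i j) ∧ SizeEstimate F T D (kLocAdj F ς χ i j) := by
  obtain ⟨D, hD, h⟩ := exists_kLoc_le (n := n) h𝓔 hlam hη hη1 hκ hδ hχ
  refine ⟨D, hD, fun F ς hF hς i j T hT => ⟨fun p hp q hq => ?_, fun p hp q hq => ?_⟩⟩
  · rcases lt_or_ge p.1 q.1 with hpq | hpq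
    · refine ((h F ς hF hς i j p q hpq (sub_le_two hT hp hq)).1).trans ?_
      rw [div_eq_mul_one_div D]
      exact mul_le_mul_of_nonneg_left
        (div_pow_succ_le (qdist_pos hpq).1 (sqrt_le_qdist hpq).1 _) hD.le
    -- The kernel vanishes for nonpositive time gaps. On the diagonal the right-hand side is a
    -- division by zero, hence `0`, which encodes the vanishing required there.
    · rw [kLoc_eq_zero hpq, abs_zero]
      have := qdist_nonneg F p q
      positivity
  · rcases lt_or_ge q.1 p.1 with hpq | hpq
    · refine ((h F ς hF hς i j q p hpq (sub_le_two hT hq hp)).2).trans ?_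
      rw [div_eq_mul_one_div D]
      exact mul_le_mul_of_nonneg_left
        (div_pow_succ_le (qdist_pos hpq).2 (sqrt_le_qdist hpq).2 _) hD.le
    · rw [kLocAdj, kLoc_eq_zero hpq, abs_zero]
      have := qdist_nonneg F p q
      positivity

end Size

/-! ### Perturbation of the cut-off factor. -/

section Smoothness

variable {η κ : ℝ} {𝓔 : Fin n → Set (Matrix (Fin d) (Fin d) ℝ)}

/-- The common right-hand side of the smoothness estimates. -/
theorem smoothness_rhs_le {η a b D : ℝ} (hD : 0 ≤ D) (hb : 0 ≤ b) (n d : ℕ) :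
    D * (a ^ η / b ^ (((n ^ 2 * d + 2 : ℕ) : ℝ) + η)) ≤
      D * (a ^ η / b ^ ((n : ℝ) ^ 2 * d + 2 + η) + 1 / b ^ ((n : ℝ) ^ 2 * d + 2 - η)) := by
  refine mul_le_mul_of_nonneg_left ?_ hD
  push_cast
  exact le_add_of_nonneg_right (by positivity)

/-- The perturbation of the cut-off in the first point. -/
theorem cutoff_sub_first_le {F : ℝ → Sp n d → Sp n d} (hF : DriftAssumption η κ 𝓔 F) (hκ : 0 ≤ κ)
    {χ : ℝ × Sp n d → ℝ} {X : ℝ} (hX0 : 0 ≤ X)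
    (hX : ∀ p p', |χ p - χ p'| ≤ X * (|p.1 - p'.1| + ‖p.2 - p'.2‖)) {p p' q : ℝ × Sp n d}
    (hp' : p'.1 ∈ Icc (-2 : ℝ) 2) (hq : q.1 ∈ Icc (-2 : ℝ) 2) (hd : qdist F p p' ≤ 1) :
    |χ (q.1 - p.1, flow F q.1 p.1 p.2 - q.2) - χ (q.1 - p'.1, flow F q.1 p'.1 p'.2 - q.2)| ≤
      X * (1 + flowConst n d κ * (n * d)) * qdist F p p' := by
  refine (hX _ _).trans ?_
  rw [mul_assoc]
  refine mul_le_mul_of_nonneg_left ?_ hX0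
  dsimp only
  rw [sub_sub_sub_cancel_left, sub_sub_sub_cancel_right, add_mul, one_mul]
  have h0 := qdist_nonneg F p p'
  refine add_le_add ?_ ?_
  · refine (abs_le_of_rho_le (le_refl (qdist F p p'))).trans ?_
    nlinarith
  · have h1 := norm_traj_sub_le_window hF hκ (isTraj_flow hF p.1 p.2) (isTraj_flow hF p'.1 p'.2)
      hp' hq
    rw [flow_self hF] at h1
    have h2 := norm_le_of_rho_le hd (le_refl (qdist F p p'))
    refine h1.trans ?_
    rw [mul_assoc]
    exact mul_le_mul_of_nonneg_left h2 (Real.exp_pos _).le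

/-- The perturbation of the cut-off in the second point. -/
theorem cutoff_sub_second_le {F : ℝ → Sp n d → Sp n d} (hF : DriftAssumption η κ 𝓔 F) (hκ : 0 ≤ κ)
    {χ : ℝ × Sp n d → ℝ} {X : ℝ} (hX0 : 0 ≤ X)
    (hX : ∀ p p', |χ p - χ p'| ≤ X * (|p.1 - p'.1| + ‖p.2 - p'.2‖)) {p p' q : ℝ × Sp n d}
    (hp : p.1 ∈ Icc (-2 : ℝ) 2) (hp' : p'.1 ∈ Icc (-2 : ℝ) 2) (hq : q.1 ∈ Icc (-2 : ℝ) 2)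
    (hd : qdist F p p' ≤ 1) (hpq : qdist F p q ≤ 1) :
    |χ (p.1 - q.1, flow F p.1 q.1 q.2 - p.2) - χ (p'.1 - q.1, flow F p'.1 q.1 q.2 - p'.2)| ≤
      X * (1 + κ * flowConst n d κ * (flowConst n d κ * (n * d)) + n * d) * qdist F p p' := by
  refine (hX _ _).trans ?_
  rw [mul_assoc]
  refine mul_le_mul_of_nonneg_left ?_ hX0
  dsimp only
  have h0 := qdist_nonneg F p p'
  have hE : 0 ≤ flowConst n d κ := (Real.exp_pos _).le
  have ht := abs_le_of_rho_le (le_refl (qdist F p p'))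
  have hsq : qdist F p p' ^ 2 ≤ qdist F p p' := by nlinarith
  rw [sub_sub_sub_cancel_right, add_mul, add_mul, one_mul, add_assoc]
  refine add_le_add ?_ ?_
  · rw [abs_sub_comm]
    exact ht.trans hsq
  · have h1 := norm_traj_increment_le hF hκ (isTraj_flow hF p.1 p.2) (isTraj_flow hF q.1 q.2) hp hp'
    have h3 := norm_traj_sub_le_window hF hκ (isTraj_flow hF p.1 p.2) (isTraj_flow hF q.1 q.2) hq hp
    have h2 := norm_le_of_rho_le hd (le_refl (qdist F p p'))
    have h4 := norm_le_of_rho_le le_rfl hpq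
    rw [flow_self hF] at h1 h3
    rw [flow_self hF] at h3
    have e1 : flow F p.1 q.1 q.2 - p.2 - (flow F p'.1 q.1 q.2 - p'.2) =
        (flow F p'.1 p.1 p.2 - flow F p'.1 q.1 q.2 - (p.2 - flow F p.1 q.1 q.2)) -
          (flow F p'.1 p.1 p.2 - p'.2) := by abel
    rw [e1]
    refine (norm_sub_le _ _).trans (add_le_add (h1.trans ?_) h2)
    refine mul_le_mul (mul_le_mul_of_nonneg_left (h3.trans ?_) (by positivity)) (ht.trans hsq)
      (abs_nonneg _) (by positivity)
    exact mul_le_mul_of_nonneg_left (by linarith) hE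

end Smoothness

/-! ### The smoothness estimates. -/

section SmoothnessEstimates

variable {η κ : ℝ} {𝓔 : Fin n → Set (Matrix (Fin d) (Fin d) ℝ)}

/-- If the root `r` of the time gap is at most a multiple of the perturbation `a`, the surplus
factor `r / x` in the size bound already gives the gain `a / b`; no comparison of kernels is needed.
-/
theorem far_le {v D r x a b B m : ℝ} (hD : 0 ≤ D) (hb : 0 < b) (ha : 0 ≤ a) (hB : 0 ≤ B)
    {N : ℕ} (hv : v ≤ D * (r / x ^ (N + 1))) (hr : r ≤ B * a) (hx : 0 < x) (hbm : b ≤ m * x) :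
    v ≤ D * B * m ^ (N + 1) * (a / b ^ (N + 1)) := by
  refine hv.trans ?_
  have h1 : r / x ^ (N + 1) ≤ B * a / x ^ (N + 1) := div_le_div_of_nonneg_right hr (by positivity)
  have h2 : B * a / x ^ (N + 1) ≤ B * a * m ^ (N + 1) / b ^ (N + 1) := by
    rw [div_le_div_iff₀ (by positivity) (by positivity), mul_assoc (B * a), ← mul_pow]
    exact mul_le_mul_of_nonneg_left (pow_le_pow_left₀ hb.le hbm _) (by positivity)
  calc D * (r / x ^ (N + 1)) ≤ D * (B * a * m ^ (N + 1) / b ^ (N + 1)) :=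
        mul_le_mul_of_nonneg_left (h1.trans h2) hD
    _ = _ := by ring

/-- If `q` were too close to `p'`, the quasi-triangle inequality with `R = 𝐝(p, q) / (2 G)` would
give `𝐝(p, q) ≤ 𝐝(p, q) / 2`. This is the origin of the choice `c = 2 G`. -/
theorem qdist_le_two_mul {F : ℝ → Sp n d → Sp n d} {G : ℝ} (hG : 1 ≤ G) {p p' q : ℝ × Sp n d}
    (h : ∀ R : ℝ, 0 < R → R ≤ 1 → qdist F p p' ≤ R → qdist F p' q ≤ R → qdist F p q ≤ G * R)
    (hpos : 0 < qdist F p q) (h1 : qdist F p q ≤ 1) (hc : 2 * G * qdist F p p' ≤ qdist F p q) :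
    qdist F p q ≤ 2 * G * qdist F p' q := by
  by_contra hcon
  rw [not_le] at hcon
  have h2G : 0 < 2 * G := by linarith
  have := h (qdist F p q / (2 * G)) (by positivity)
    (by rw [div_le_one h2G]; linarith) (by rw [le_div_iff₀ h2G]; linarith)
    (by rw [le_div_iff₀ h2G]; linarith)
  have e : G * (qdist F p q / (2 * G)) = qdist F p q / 2 := by field_simp
  linarith

theorem sqrt_le_of_far {s t σ a b : ℝ} (hb : 1 ≤ b) (ha : 0 ≤ a) (h : t - s ≤ (b * a) ^ 2)
    (hσ : |σ - s| ≤ a ^ 2) : √(t - s) ≤ 2 * b * a ∧ √(t - σ) ≤ 2 * b * a := by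
  have h0 : 0 ≤ b * a := by positivity
  have h1 : a ^ 2 ≤ (b * a) ^ 2 := pow_le_pow_left₀ ha (by nlinarith) 2
  constructor
  · refine Real.sqrt_le_iff.2 ⟨by linarith, ?_⟩
    nlinarith
  · refine Real.sqrt_le_iff.2 ⟨by linarith, ?_⟩
    have := (abs_le.1 hσ).1
    nlinarith

variable [NeZero n] {lam : ℝ}

theorem abs_mul_sub_mul_le {a a' k k' X Y Z : ℝ} (ha' : |a'| ≤ X) (hk : |k - k'| ≤ Y)
    (hX : 0 ≤ X) (hak : |a - a'| * |k| ≤ Z) : |a * k - a' * k'| ≤ X * Y + Z := by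
  have e : a * k - a' * k' = a' * (k - k') + (a - a') * k := by ring
  rw [e]
  refine (abs_add_le _ _).trans (add_le_add ?_ ?_)
  · rw [abs_mul]; exact mul_le_mul ha' hk (abs_nonneg _) hX
  · rwa [abs_mul]

theorem cutoff_term_le {c k X D a b r : ℝ} {N : ℕ} (hc : c ≤ X * a) (hk0 : 0 ≤ k)
    (hk : k ≤ D * (r / b ^ (N + 1))) (ha : 0 ≤ a) (hX : 0 ≤ X) (hD : 0 ≤ D) (hb : 0 < b)
    (hb1 : b ≤ 1) (hrb : r ≤ b) : c * k ≤ X * D * (a / b ^ (N + 1)) := by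
  have h1 : r / b ^ (N + 1) ≤ 1 / b ^ (N + 1) :=
    div_le_div_of_nonneg_right (hrb.trans hb1) (by positivity)
  calc c * k ≤ X * a * (D * (1 / b ^ (N + 1))) :=
        mul_le_mul hc (hk.trans (mul_le_mul_of_nonneg_left h1 hD)) hk0 (by positivity)
    _ = _ := by ring

/-- Two regimes, according to the time gap compared with `(b 𝐝(p, p')) ^ 2`. For a short gap both
kernels obey the size bound with its surplus factor. For a long gap the kernels are compared at
scale `√(t - s)`, and the variation of the cut-off is added by the product rule. -/
theorem exists_smoothnessEstimate (h𝓔 : IsNondegenerateFamily 𝓔) (hlam : 1 ≤ lam) (hη : 0 < η)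
    (hη1 : η ≤ 1) (hκ : 0 ≤ κ) {G : ℝ} (hG : 1 ≤ G) (hGt : ∀ F : ℝ → Sp n d → Sp n d,
      DriftAssumption η κ 𝓔 F → ∀ (p p' q : ℝ × Sp n d) (R : ℝ), 0 < R → R ≤ 1 →
      qdist F p p' ≤ R → qdist F p' q ≤ R → qdist F p q ≤ G * R)
    {δ : ℝ} (hδ : 0 < δ) {χ : ℝ × Sp n d → ℝ} (hχ : IsCutoff δ χ) :
    ∃ C : ℝ, 0 < C ∧ ∀ (F : ℝ → Sp n d → Sp n d)
      (ς : ℝ → Matrix (Fin d) (Fin d) ℝ), DriftAssumption η κ 𝓔 F → DiffusionAssumption lam ς →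
      ∀ (i j : Fin d) (T : ℝ), T ≤ 1 → SmoothnessEstimate F η T 1 (2 * G) C (kLoc F ς χ i j) := by
  obtain ⟨D, hD, hfar⟩ := exists_kLoc_le (n := n) h𝓔 hlam hη hη1 hκ hδ hχ
  obtain ⟨D₀, hD0, hsize⟩ := exists_kKer_le_qdist (n := n) h𝓔 hlam hη hη1 hκ
  obtain ⟨D₁, hD1, hnear⟩ := exists_kKer_first (n := n) h𝓔 hlam hη hη1 hκ (n ^ 2 * d + 2 + 1)
  obtain ⟨X, hX0, hX, hXl⟩ := hχ.exists_bounds hδ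
  have hK := one_le_distConst (n := n) (d := d) hκ
  have hbp := two_le_gapConst (n := n) (d := d)
  obtain ⟨b, hb⟩ : ∃ b, b = gapConst n d := ⟨_, rfl⟩
  obtain ⟨X₁, hX1⟩ : ∃ X₁, X₁ = X * (1 + flowConst n d κ * (n * d)) := ⟨_, rfl⟩
  have hX10 : 0 ≤ X₁ := by
    have : 0 ≤ flowConst n d κ := (Real.exp_pos _).le
    rw [hX1]; positivity
  rw [← hb] at hbp
  have hb0 : 0 < b := by linarith
  obtain ⟨C₁, hC1⟩ : ∃ C, C = X * (D₁ * distConst n d κ ^ (n ^ 2 * d + 2 + 1)) + X₁ * D₀ := ⟨_, rfl⟩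
  obtain ⟨C₂, hC2⟩ : ∃ C, C = D * (2 * b) * 1 ^ (n ^ 2 * d + 2 + 1) +
    D * (2 * b) * (2 * G) ^ (n ^ 2 * d + 2 + 1) := ⟨_, rfl⟩
  have hC10 : 0 < C₁ := by rw [hC1]; positivity
  have hC20 : 0 < C₂ := by rw [hC2]; positivity
  refine ⟨C₁ + C₂, by positivity, fun F ς hF hς i j T hT p hp p' hp' q hq hc hΛ => ?_⟩
  have hd0 := qdist_nonneg F p p'
  -- If `𝐝(p, q) = 0`, the hypothesis forces `p' = p` and there is nothing to compare.
  rcases (qdist_nonneg F p q).eq_or_lt with hz | hpos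
  · have : qdist F p p' = 0 := by
      refine le_antisymm ?_ hd0
      nlinarith
    rw [eq_of_qdist_eq_zero hF this, sub_self, abs_zero]
    have := qdist_nonneg F p' q
    have := qdist_nonneg F p' p'
    positivity
  have hle : qdist F p p' ≤ qdist F p q := by nlinarith
  have hmain := div_le_rpow_div hη hη1 hd0 hpos hle (n ^ 2 * d + 2)
  refine le_trans ?_ (smoothness_rhs_le (by positivity) hpos.le n d)
  have hτ := abs_le_of_rho_le (le_refl (qdist F p p'))
  have hq0 : 0 ≤ qdist F p p' ^ η / qdist F p q ^ (((n ^ 2 * d + 2 : ℕ) : ℝ) + η) := by positivity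
  by_cases hcase : q.1 - p.1 ≤ (b * qdist F p p') ^ 2
  · obtain ⟨s1, s2⟩ := sqrt_le_of_far (by linarith) hd0 hcase hτ
    have t1 : |kLoc F ς χ i j p q| ≤ D * (2 * b) * 1 ^ (n ^ 2 * d + 2 + 1) *
        (qdist F p p' / qdist F p q ^ (n ^ 2 * d + 2 + 1)) := by
      rcases lt_or_ge p.1 q.1 with hlt | hge
      · exact far_le hD.le hpos hd0 (by positivity)
          (hfar F ς hF hς i j p q hlt (sub_le_two hT hp hq)).1 s1 hpos (by linarith)
      · rw [kLoc_eq_zero hge, abs_zero]; positivity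
    have t2 : |kLoc F ς χ i j p' q| ≤ D * (2 * b) * (2 * G) ^ (n ^ 2 * d + 2 + 1) *
        (qdist F p p' / qdist F p q ^ (n ^ 2 * d + 2 + 1)) := by
      rcases lt_or_ge p'.1 q.1 with hlt | hge
      · exact far_le hD.le hpos hd0 (by positivity)
          (hfar F ς hF hς i j p' q hlt (sub_le_two hT hp' hq)).1 s2 (qdist_pos hlt).1
          (qdist_le_two_mul hG (hGt F hF p p' q) hpos hΛ hc)
      · rw [kLoc_eq_zero hge, abs_zero]; positivity
    refine (abs_sub _ _).trans ((add_le_add t1 t2).trans ?_)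
    rw [← add_mul, ← hC2]
    exact mul_le_mul (by linarith) hmain (by positivity) (by positivity)
  · rw [not_le] at hcase
    have hst : p.1 < q.1 := by nlinarith [sq_nonneg (b * qdist F p p')]
    obtain ⟨r, hr⟩ : ∃ r, r = √(q.1 - p.1) := ⟨_, rfl⟩
    have h0 : 0 < r := hr ▸ Real.sqrt_pos.2 (by linarith)
    have hr2 : r ^ 2 = q.1 - p.1 := by rw [hr]; exact Real.sq_sqrt (by linarith)
    have h2 : r ≤ 2 := by nlinarith [sub_le_two hT hp hq]
    have hgap : b * qdist F p p' ≤ r := by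
      rw [← hr2] at hcase
      exact (lt_of_pow_lt_pow_left₀ 2 h0.le hcase).le
    have hq1 : q.1 = p.1 + r ^ 2 := by linarith
    have hk := hnear F ς hF hς i j p.1 r p'.1 p.2 q.2 p'.2 h0 h2 (hb ▸ hgap)
    rw [← hq1] at hk
    have habs : |q.1 - p.1| ≤ r ^ 2 := by rw [hr2, abs_of_pos (by linarith)]
    have hqd := qdist_le_back hF hη hη1 hκ h0 h2 (p := p) (q := q) habs
    -- The Lipschitz bound in the first point is weakened to the Hölder form common to both
    -- estimates.
    have hratio : qdist F p p' / r ≤ (qdist F p p' / r) ^ η := by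
      have := div_le_rpow_div hη hη1 hd0 h0 (by nlinarith) 0
      rwa [zero_add, pow_one, Nat.cast_zero, zero_add, ← Real.div_rpow hd0 h0.le] at this
    have hk2 : |kKer F ς i j p.1 q.1 p.2 q.2 - kKer F ς i j p'.1 q.1 p'.2 q.2| ≤
        D₁ * distConst n d κ ^ (n ^ 2 * d + 2 + 1) *
          (qdist F p p' ^ η / qdist F p q ^ (((n ^ 2 * d + 2 : ℕ) : ℝ) + η)) := by
      refine le_trans ?_ (scaled_decay_le hη1 hη hD1.le hK hd0 hpos h0 (norm_nonneg _) hqd _)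
      refine hk.trans (mul_le_mul_of_nonneg_left ?_ (by positivity))
      exact div_le_div_of_nonneg_right (mul_le_mul_of_nonneg_left hratio hD1.le) (by positivity)
    have hwin : ∀ z ∈ strip n d T, z.1 ∈ Icc (-2 : ℝ) 2 := fun z hz =>
      ⟨by linarith [hz.1.1], by linarith [hz.1.2]⟩
    have hχ1 := cutoff_sub_first_le hF hκ hX0.le hXl (p := p) (hwin p' hp') (hwin q hq)
      (hle.trans hΛ)
    rw [← hX1] at hχ1
    have hz := cutoff_term_le hχ1 (abs_nonneg _)
      (hsize F ς hF hς i j p q hst (sub_le_two hT hp hq)).1 hd0 hX10 hD0.le hpos hΛ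
      (sqrt_le_qdist hst).1
    refine (abs_mul_sub_mul_le (hX _) hk2 hX0.le (hz.trans
      (mul_le_mul_of_nonneg_left hmain (by positivity)))).trans ?_
    rw [← mul_assoc X, ← add_mul, ← hC1]
    exact mul_le_mul_of_nonneg_right (by linarith) hq0

/-- The perturbed point is now the second argument of the original kernel, the one that carries the
linearization; the comparison is Hölder from the outset. -/
theorem exists_smoothnessEstimate_adj (h𝓔 : IsNondegenerateFamily 𝓔) (hlam : 1 ≤ lam) (hη : 0 < η)
    (hη1 : η ≤ 1) (hκ : 0 ≤ κ) {G : ℝ} (hG : 1 ≤ G) (hGt : ∀ F : ℝ → Sp n d → Sp n d,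
      DriftAssumption η κ 𝓔 F → ∀ (p p' q : ℝ × Sp n d) (R : ℝ), 0 < R → R ≤ 1 →
      qdist F p p' ≤ R → qdist F p' q ≤ R → qdist F p q ≤ G * R)
    {δ : ℝ} (hδ : 0 < δ) {χ : ℝ × Sp n d → ℝ} (hχ : IsCutoff δ χ) :
    ∃ C : ℝ, 0 < C ∧ ∀ (F : ℝ → Sp n d → Sp n d)
      (ς : ℝ → Matrix (Fin d) (Fin d) ℝ), DriftAssumption η κ 𝓔 F → DiffusionAssumption lam ς →
      ∀ (i j : Fin d) (T : ℝ), T ≤ 1 →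
      SmoothnessEstimate F η T 1 (2 * G) C (kLocAdj F ς χ i j) := by
  obtain ⟨D, hD, hfar⟩ := exists_kLoc_le (n := n) h𝓔 hlam hη hη1 hκ hδ hχ
  obtain ⟨D₀, hD0, hsize⟩ := exists_kKer_le_qdist (n := n) h𝓔 hlam hη hη1 hκ
  obtain ⟨D₁, hD1, hnear⟩ := exists_kKer_second (n := n) h𝓔 hlam hη hη1 hκ (n ^ 2 * d + 2 + 1)
  obtain ⟨X, hX0, hX, hXl⟩ := hχ.exists_bounds hδ
  have hK := one_le_distConst (n := n) (d := d) hκ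
  have hbp := two_le_gapConst (n := n) (d := d)
  obtain ⟨b, hb⟩ : ∃ b, b = gapConst n d := ⟨_, rfl⟩
  obtain ⟨X₁, hX1⟩ : ∃ X₁, X₁ = X * (1 + κ * flowConst n d κ * (flowConst n d κ * (n * d)) + n * d) :=
    ⟨_, rfl⟩
  have hX10 : 0 ≤ X₁ := by
    have : 0 ≤ flowConst n d κ := (Real.exp_pos _).le
    rw [hX1]; positivity
  rw [← hb] at hbp
  have hb0 : 0 < b := by linarith
  obtain ⟨C₁, hC1⟩ : ∃ C, C = X * (D₁ * distConst n d κ ^ (n ^ 2 * d + 2 + 1)) + X₁ * D₀ := ⟨_, rfl⟩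
  obtain ⟨C₂, hC2⟩ : ∃ C, C = D * (2 * b) * 1 ^ (n ^ 2 * d + 2 + 1) +
    D * (2 * b) * (2 * G) ^ (n ^ 2 * d + 2 + 1) := ⟨_, rfl⟩
  have hC10 : 0 < C₁ := by rw [hC1]; positivity
  have hC20 : 0 < C₂ := by rw [hC2]; positivity
  refine ⟨C₁ + C₂, by positivity, fun F ς hF hς i j T hT p hp p' hp' q hq hc hΛ => ?_⟩
  have hd0 := qdist_nonneg F p p'
  rcases (qdist_nonneg F p q).eq_or_lt with hz | hpos
  · have : qdist F p p' = 0 := by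
      refine le_antisymm ?_ hd0
      nlinarith
    rw [eq_of_qdist_eq_zero hF this, sub_self, abs_zero]
    have := qdist_nonneg F p' q
    have := qdist_nonneg F p' p'
    positivity
  have hle : qdist F p p' ≤ qdist F p q := by nlinarith
  have hmain := div_le_rpow_div hη hη1 hd0 hpos hle (n ^ 2 * d + 2)
  refine le_trans ?_ (smoothness_rhs_le (by positivity) hpos.le n d)
  have hτ := abs_le_of_rho_le (le_refl (qdist F p p'))
  have hq0 : 0 ≤ qdist F p p' ^ η / qdist F p q ^ (((n ^ 2 * d + 2 : ℕ) : ℝ) + η) := by positivity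
  unfold kLocAdj
  by_cases hcase : p.1 - q.1 ≤ (b * qdist F p p') ^ 2
  -- The order of times is reversed, so the lemma is applied to the negated times.
  · obtain ⟨s1, s2⟩ := sqrt_le_of_far (s := -p.1) (t := -q.1) (σ := -p'.1) (b := b) (by linarith) hd0
      (by linarith) (by rwa [neg_sub_neg, abs_sub_comm])
    rw [neg_sub_neg] at s1 s2
    have t1 : |kLoc F ς χ i j q p| ≤ D * (2 * b) * 1 ^ (n ^ 2 * d + 2 + 1) *
        (qdist F p p' / qdist F p q ^ (n ^ 2 * d + 2 + 1)) := by
      rcases lt_or_ge q.1 p.1 with hlt | hge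
      · exact far_le hD.le hpos hd0 (by positivity)
          (hfar F ς hF hς i j q p hlt (sub_le_two hT hq hp)).2 s1 hpos (by linarith)
      · rw [kLoc_eq_zero hge, abs_zero]; positivity
    have t2 : |kLoc F ς χ i j q p'| ≤ D * (2 * b) * (2 * G) ^ (n ^ 2 * d + 2 + 1) *
        (qdist F p p' / qdist F p q ^ (n ^ 2 * d + 2 + 1)) := by
      rcases lt_or_ge q.1 p'.1 with hlt | hge
      · exact far_le hD.le hpos hd0 (by positivity)
          (hfar F ς hF hς i j q p' hlt (sub_le_two hT hq hp')).2 s2 (qdist_pos hlt).2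
          (qdist_le_two_mul hG (hGt F hF p p' q) hpos hΛ hc)
      · rw [kLoc_eq_zero hge, abs_zero]; positivity
    refine (abs_sub _ _).trans ((add_le_add t1 t2).trans ?_)
    rw [← add_mul, ← hC2]
    exact mul_le_mul (by linarith) hmain (by positivity) (by positivity)
  · rw [not_le] at hcase
    have hst : q.1 < p.1 := by nlinarith [sq_nonneg (b * qdist F p p')]
    obtain ⟨r, hr⟩ : ∃ r, r = √(p.1 - q.1) := ⟨_, rfl⟩
    have h0 : 0 < r := hr ▸ Real.sqrt_pos.2 (by linarith)
    have hr2 : r ^ 2 = p.1 - q.1 := by rw [hr]; exact Real.sq_sqrt (by linarith)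
    have h2 : r ≤ 2 := by nlinarith [sub_le_two hT hq hp]
    have hgap : b * qdist F p p' ≤ r := by
      rw [← hr2] at hcase
      exact (lt_of_pow_lt_pow_left₀ 2 h0.le hcase).le
    have hq1 : q.1 = p.1 - r ^ 2 := by linarith
    have hk := hnear F ς hF hς i j p.1 r p'.1 p.2 q.2 p'.2 h0 h2 (hb ▸ hgap)
    rw [← hq1] at hk
    have habs : |q.1 - p.1| ≤ r ^ 2 := by rw [hr2, abs_sub_comm, abs_of_pos (by linarith)]
    have hqd := qdist_le (F := F) hκ h0 (p := p) (q := q) habs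
    rw [norm_act_sub_comm] at hqd
    have hk2 : |kKer F ς i j q.1 p.1 q.2 p.2 - kKer F ς i j q.1 p'.1 q.2 p'.2| ≤
        D₁ * distConst n d κ ^ (n ^ 2 * d + 2 + 1) *
          (qdist F p p' ^ η / qdist F p q ^ (((n ^ 2 * d + 2 : ℕ) : ℝ) + η)) :=
      hk.trans (scaled_decay_le hη1 hη hD1.le hK hd0 hpos h0 (norm_nonneg _) hqd _)
    have hwin : ∀ z ∈ strip n d T, z.1 ∈ Icc (-2 : ℝ) 2 := fun z hz =>
      ⟨by linarith [hz.1.1], by linarith [hz.1.2]⟩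
    have hχ1 := cutoff_sub_second_le hF hκ hX0.le hXl (p := p) (q := q) (hwin p hp) (hwin p' hp')
      (hwin q hq) (hle.trans hΛ) hΛ
    rw [← hX1] at hχ1
    have hz := cutoff_term_le hχ1 (abs_nonneg _)
      (hsize F ς hF hς i j q p hst (sub_le_two hT hq hp)).2 hd0 hX10 hD0.le hpos hΛ
      (sqrt_le_qdist hst).2
    refine (abs_mul_sub_mul_le (hX _) hk2 hX0.le (hz.trans
      (mul_le_mul_of_nonneg_left hmain (by positivity)))).trans ?_
    rw [← mul_assoc X, ← add_mul, ← hC1]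
    exact mul_le_mul_of_nonneg_right (by linarith) hq0

end SmoothnessEstimates

/-! ### Majorants and integration over the strip. -/

section Majorant

/-- The majorant of the kernel at scale `r` around `z`. -/
def maj (M : ℕ) (r : ℝ) (z y : Sp n d) : ℝ :=
  (r ^ (n ^ 2 * d + 2))⁻¹ * (1 / (1 + ‖act (dil r⁻¹) (y - z)‖) ^ M)

/-- The mass of the unit majorant. -/
def majMass (n d M : ℕ) : ℝ := ∫ z : Sp n d, 1 / (1 + ‖z‖) ^ M

theorem majMass_nonneg (M : ℕ) : 0 ≤ majMass n d M := integral_nonneg fun z => by positivity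

theorem maj_nonneg (M : ℕ) {r : ℝ} (hr : 0 ≤ r) (z y : Sp n d) : 0 ≤ maj M r z y := by
  unfold maj; positivity

theorem det_dil_inv_ne {r : ℝ} (hr : 0 < r) : (dil r⁻¹ : Mat n d).det ≠ 0 := by
  rw [det_dil]; positivity

theorem integrable_comp_dil {r : ℝ} (hr : 0 < r) {f : Sp n d → ℝ} (hf : Integrable f) (z : Sp n d) :
    Integrable fun y => f (act (dil r⁻¹) (y - z)) := by
  have h1 : Integrable f (Measure.map (act (dil r⁻¹ : Mat n d)) volume) := by
    rw [map_act_volume (det_dil_inv_ne hr)]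
    exact hf.smul_measure ENNReal.ofReal_ne_top
  rw [(measurableEmbedding_act (det_dil_inv_ne hr)).integrable_map_iff] at h1
  exact h1.comp_sub_right z

theorem integral_comp_dil {r : ℝ} (hr : 0 < r) (f : Sp n d → ℝ) (z : Sp n d) :
    ∫ y, f (act (dil r⁻¹) (y - z)) = r ^ (n ^ 2 * d) * ∫ w, f w := by
  rw [integral_sub_right_eq_self (fun y => f (act (dil r⁻¹) y)) z,
    integral_comp_act (det_dil_inv_ne hr), det_dil, inv_pow, abs_inv, inv_inv,
    abs_of_pos (by positivity)]

theorem integrable_maj {M : ℕ} (hM : n * d < M) {r : ℝ} (hr : 0 < r) (z : Sp n d) :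
    Integrable (maj M r z) :=
  (integrable_comp_dil hr (integrable_one_div_pow hM) z).const_mul _

/-- The volume `r ^ (n ^ 2 d)` leaves `r ^ (-2) = |t - s|⁻¹`, which just fails to be integrable in
time: any gain of a power suffices, and without gain cancellation is needed. -/
theorem integral_maj {M : ℕ} {r : ℝ} (hr : 0 < r) (z : Sp n d) :
    ∫ y, maj M r z y = (r ^ 2)⁻¹ * majMass n d M := by
  unfold maj
  rw [integral_const_mul, integral_comp_dil hr (fun w => 1 / (1 + ‖w‖) ^ M), ← mul_assoc, pow_add]
  congr 1
  field_simp

theorem intervalIntegrable_abs_rpow {γ : ℝ} (hγ : -1 < γ) (a b : ℝ) :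
    IntervalIntegrable (fun u : ℝ => |u| ^ γ) volume a b := by
  have h1 : ∀ c : ℝ, 0 ≤ c → IntervalIntegrable (fun u : ℝ => |u| ^ γ) volume 0 c := by
    intro c hc
    refine (intervalIntegral.intervalIntegrable_rpow' hγ (a := 0) (b := c)).congr fun u hu => ?_
    rw [uIoc_of_le hc] at hu
    simp only [abs_of_pos hu.1]
  have h2 : ∀ c : ℝ, IntervalIntegrable (fun u : ℝ => |u| ^ γ) volume 0 c := by
    intro c
    rcases le_total 0 c with hc | hc
    · exact h1 c hc
    · have := (h1 (-c) (by linarith)).comp_mul_left (c := -1)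
      simpa using this
  exact (h2 a).symm.trans (h2 b)

/-- The mass of the time singularity on the unit window. -/
def timeMass (γ : ℝ) : ℝ := ∫ u in Icc (-2 : ℝ) 2, |u| ^ γ

theorem timeMass_nonneg (γ : ℝ) : 0 ≤ timeMass γ := integral_nonneg fun u => by positivity

theorem integrableOn_abs_rpow {γ : ℝ} (hγ : -1 < γ) : IntegrableOn (fun u : ℝ => |u| ^ γ) (Icc (-2) 2) := by
  rw [integrableOn_Icc_iff_integrableOn_Ioc]
  exact (intervalIntegrable_abs_rpow hγ (-2) 2).1

theorem integrableOn_time {γ : ℝ} (hγ : -1 < γ) {T s : ℝ} (hT : T ≤ 1) (hs : s ∈ Icc (-T) T) :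
    IntegrableOn (fun t => |t - s| ^ γ) (Icc (-T) T) ∧
      ∫ t in Icc (-T) T, |t - s| ^ γ ≤ timeMass γ := by
  have hmp : MeasurePreserving (fun t : ℝ => t - s) volume volume := measurePreserving_sub_right _ s
  have hme : MeasurableEmbedding fun t : ℝ => t - s := measurableEmbedding_subRight s
  have h1 : IntegrableOn (fun t => |t - s| ^ γ) ((fun t : ℝ => t - s) ⁻¹' Icc (-2) 2) :=
    (hmp.integrableOn_comp_preimage hme).2 (integrableOn_abs_rpow hγ)
  have hsub : Icc (-T) T ⊆ (fun t : ℝ => t - s) ⁻¹' Icc (-2) 2 := fun t ht =>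
    ⟨by linarith [ht.1, hs.2], by linarith [ht.2, hs.1]⟩
  refine ⟨h1.mono_set hsub, ?_⟩
  refine (setIntegral_mono_set h1 (ae_of_all _ fun t => by positivity) hsub.eventuallyLE).trans ?_
  exact (hmp.setIntegral_preimage_emb hme (fun u => |u| ^ γ) _).le

/-- Lebesgue measure on the strip. -/
def stripMeasure (n d : ℕ) (T : ℝ) : Measure (ℝ × Sp n d) :=
  (volume.restrict (Icc (-T) T)).prod volume

theorem restrict_strip (n d : ℕ) (T : ℝ) : volume.restrict (strip n d T) = stripMeasure n d T := by
  rw [strip, stripMeasure, Measure.volume_eq_prod, ← Measure.prod_restrict, Measure.restrict_univ]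

theorem rpow_half_mul_inv {a β : ℝ} (ha : 0 < a) : a ^ (β / 2) * (√a ^ 2)⁻¹ = a ^ (β / 2 - 1) := by
  rw [Real.sq_sqrt ha.le, Real.rpow_sub ha, Real.rpow_one, ← div_eq_mul_inv]

/-- A gain `|t - s| ^ (β / 2)` lowers the time singularity to `|t - s| ^ (β / 2 - 1)`, which is
integrable for `β > 0`. -/
theorem slice_le {β B : ℝ} {M : ℕ} (hM : n * d < M) {s t : ℝ} (hts : t ≠ s)
    {z : Sp n d} {f : Sp n d → ℝ} (hf : AEStronglyMeasurable f volume)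
    (hb : ∀ y, |f y| ≤ B * |t - s| ^ (β / 2) * maj M √|t - s| z y) :
    Integrable f ∧ ∫ y, |f y| ≤ B * majMass n d M * |t - s| ^ (β / 2 - 1) := by
  have ha : 0 < |t - s| := abs_pos.2 (sub_ne_zero.2 hts)
  have hr : 0 < √|t - s| := Real.sqrt_pos.2 ha
  have hi := (integrable_maj hM hr z).const_mul (B * |t - s| ^ (β / 2))
  have h1 : Integrable f := hi.mono' hf (ae_of_all _ fun y => hb y)
  refine ⟨h1, (integral_mono h1.abs hi hb).trans (le_of_eq ?_)⟩
  rw [integral_const_mul, integral_maj hr, ← rpow_half_mul_inv ha]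
  ring

theorem ae_ne_time (T s : ℝ) : ∀ᵐ t ∂(volume.restrict (Icc (-T) T)), t ∈ Icc (-T) T ∧ t ≠ s :=
  (ae_restrict_mem measurableSet_Icc).and (ae_restrict_of_ae (Measure.ae_ne volume s))

/-- Functions dominated by the majorant with a gain of `r ^ β` are integrable. -/
theorem integrable_of_maj {T s β B : ℝ} (hT : T ≤ 1) (hs : s ∈ Icc (-T) T) (hβ : 0 < β) (hB : 0 ≤ B)
    {M : ℕ} (hM : n * d < M) {θ : ℝ → Sp n d} {f : ℝ × Sp n d → ℝ}
    (hf : AEStronglyMeasurable f (stripMeasure n d T))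
    (hb : ∀ t ∈ Icc (-T) T, t ≠ s → ∀ y,
      |f (t, y)| ≤ B * |t - s| ^ (β / 2) * maj M √|t - s| (θ t) y) :
    Integrable f (stripMeasure n d T) ∧
      |∫ q, f q ∂(stripMeasure n d T)| ≤ B * majMass n d M * timeMass (β / 2 - 1) := by
  have hγ : -1 < β / 2 - 1 := by linarith
  obtain ⟨ht1, ht2⟩ := integrableOn_time hγ hT hs
  have hslice : ∀ᵐ t ∂(volume.restrict (Icc (-T) T)), Integrable (fun y => f (t, y)) ∧
      ∫ y, |f (t, y)| ≤ B * majMass n d M * |t - s| ^ (β / 2 - 1) := by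
    filter_upwards [ae_ne_time T s, hf.prodMk_left] with t ht hm
    exact slice_le hM ht.2 hm (hb t ht.1 ht.2)
  have hi : Integrable f (stripMeasure n d T) := by
    refine (integrable_prod_iff hf).2 ⟨hslice.mono fun t h => h.1, ?_⟩
    refine (ht1.const_mul (B * majMass n d M)).mono' hf.norm.integral_prod_right' ?_
    filter_upwards [hslice] with t h
    rw [Real.norm_of_nonneg (integral_nonneg fun y => norm_nonneg _)]
    exact h.2
  refine ⟨hi, (abs_integral_le_integral_abs).trans ?_⟩
  have e := integral_prod (μ := volume.restrict (Icc (-T) T)) (ν := (volume : Measure (Sp n d)))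
    (fun q => |f q|) hi.abs
  change ∫ q, |f q| ∂((volume.restrict (Icc (-T) T)).prod volume) ≤ _
  rw [e]
  refine (integral_mono_ae hi.abs.integral_prod_left (ht1.const_mul (B * majMass n d M))
    (hslice.mono fun t h => h.2)).trans ?_
  rw [integral_const_mul]
  exact mul_le_mul_of_nonneg_left ht2 (mul_nonneg hB (majMass_nonneg M))

end Majorant

/-! ### Cancellation for abstract kernels. -/

section AbstractCancellation

/-- A kernel `k` around the curve `θ` through time `s` that is, up to an integrable error, a kernel
`k₀` with vanishing space integrals, together with a gauge `ρ`. -/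
structure IsCancelling (T s D G η : ℝ) (M : ℕ) (θ : ℝ → Sp n d) (ρ k k₀ : ℝ × Sp n d → ℝ) : Prop where
  meas : AEStronglyMeasurable k (stripMeasure n d T)
  meas₀ : AEStronglyMeasurable k₀ (stripMeasure n d T)
  gauge_meas : Measurable ρ
  le_gauge : ∀ t y, √|t - s| ≤ ρ (t, y)
  gauge_le : ∀ t ∈ Icc (-T) T, t ≠ s → ∀ y,
    ρ (t, y) ≤ G * (√|t - s| * (1 + ‖act (dil (√|t - s|)⁻¹) (y - θ t)‖))
  le₀ : ∀ t ∈ Icc (-T) T, t ≠ s → ∀ y, |k₀ (t, y)| ≤ D * maj (M + 1) √|t - s| (θ t) y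
  sub_le : ∀ t ∈ Icc (-T) T, t ≠ s → ∀ y,
    |k (t, y) - k₀ (t, y)| ≤ D * |t - s| ^ (η / 2) * maj M √|t - s| (θ t) y
  integral_eq_zero : ∀ t ∈ Icc (-T) T, t ≠ s → ∫ y, k₀ (t, y) = 0

variable {T s D G η : ℝ} {M : ℕ} {θ : ℝ → Sp n d} {ρ k k₀ : ℝ × Sp n d → ℝ}

/-- The space integral of the truncated kernel `k₀`. -/
def sliceInt (ρ k₀ : ℝ × Sp n d → ℝ) (ε t : ℝ) : ℝ :=
  ∫ y, indicator {q | ε < ρ q} k₀ (t, y)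

/-- Where the truncation is active, `ε < ρ ≤ G r (1 + w)`, so one may multiply by `G r (1 + w) / ε ≥
1`. One power of decay is spent for a factor `r / ε`; hence the order `M + 1` in the bound for `k₀`.
-/
theorem IsCancelling.abs_indicator_le (h : IsCancelling T s D G η M θ ρ k k₀) (hD : 0 ≤ D) {ε : ℝ}
    (hε : 0 < ε) {t : ℝ} (ht : t ∈ Icc (-T) T) (hts : t ≠ s) (y : Sp n d) :
    |indicator {q | ε < ρ q} k₀ (t, y)| ≤
      (D * G / ε) * |t - s| ^ ((1 : ℝ) / 2) * maj M √|t - s| (θ t) y := by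
  have hg := h.gauge_le t ht hts y
  have h0 := h.le₀ t ht hts y
  rw [← Real.sqrt_eq_rpow]
  have hr : 0 < √|t - s| := Real.sqrt_pos.2 (abs_pos.2 (sub_ne_zero.2 hts))
  unfold maj at *
  generalize √|t - s| = r at *
  have hw : 0 ≤ ‖act (dil r⁻¹) (y - θ t)‖ := norm_nonneg _
  generalize ‖act (dil r⁻¹) (y - θ t)‖ = w at *
  have hG0 : 0 ≤ G * (r * (1 + w)) := ((Real.sqrt_nonneg _).trans (h.le_gauge t y)).trans hg
  have hG : 0 ≤ G := nonneg_of_mul_nonneg_left hG0 (by positivity)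
  by_cases hq : (t, y) ∈ {q | ε < ρ q}
  · rw [indicator_of_mem hq]
    refine h0.trans ?_
    have h1 : 1 ≤ G * (r * (1 + w)) / ε := by
      rw [one_le_div hε]
      exact (le_of_lt hq).trans hg
    have e : D * G / ε * r * ((r ^ (n ^ 2 * d + 2))⁻¹ * (1 / (1 + w) ^ M)) =
        D * ((r ^ (n ^ 2 * d + 2))⁻¹ * (1 / (1 + w) ^ (M + 1))) * (G * (r * (1 + w)) / ε) := by
      rw [pow_succ (1 + w) M]
      field_simp
    rw [e]
    exact le_mul_of_one_le_right (by positivity) h1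
  · rw [indicator_of_notMem hq, abs_zero]
    positivity

theorem IsCancelling.measurableSet_trunc (h : IsCancelling T s D G η M θ ρ k k₀) (ε : ℝ) :
    MeasurableSet {q | ε < ρ q} := measurableSet_lt measurable_const h.gauge_meas

theorem IsCancelling.integrable₀ (h : IsCancelling T s D G η M θ ρ k k₀) (hD : 0 ≤ D) (hG : 0 ≤ G)
    (hT : T ≤ 1) (hs : s ∈ Icc (-T) T) (hM : n * d < M) {ε : ℝ} (hε : 0 < ε) :
    Integrable (indicator {q | ε < ρ q} k₀) (stripMeasure n d T) :=
  (integrable_of_maj hT hs (β := 1) zero_lt_one (by positivity) hM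
    (h.meas₀.indicator (h.measurableSet_trunc ε))
    fun t ht hts y => h.abs_indicator_le hD hε ht hts y).1

theorem IsCancelling.integrable_sub (h : IsCancelling T s D G η M θ ρ k k₀) (hD : 0 ≤ D)
    (hT : T ≤ 1) (hs : s ∈ Icc (-T) T) (hM : n * d < M) (hη : 0 < η) :
    Integrable (fun q => k q - k₀ q) (stripMeasure n d T) ∧
      ∀ A, MeasurableSet A → |∫ q, indicator A (fun q => k q - k₀ q) q ∂(stripMeasure n d T)| ≤
        D * majMass n d M * timeMass (η / 2 - 1) := by
  have hm := h.meas.sub h.meas₀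
  refine ⟨(integrable_of_maj (θ := θ) hT hs hη hD hM hm fun t ht hts y => h.sub_le t ht hts y).1,
    fun A hA => (integrable_of_maj (θ := θ) hT hs hη hD hM (hm.indicator hA) fun t ht hts y => ?_).2⟩
  refine le_trans ?_ (h.sub_le t ht hts y)
  by_cases hq : (t, y) ∈ A
  · rw [indicator_of_mem hq]; rfl
  · rw [indicator_of_notMem hq, abs_zero]; positivity

theorem IsCancelling.integrableOn (h : IsCancelling T s D G η M θ ρ k k₀) (hD : 0 ≤ D) (hG : 0 ≤ G)
    (hT : T ≤ 1) (hs : s ∈ Icc (-T) T) (hM : n * d < M) (hη : 0 < η) {ε : ℝ} (hε : 0 < ε) :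
    IntegrableOn k {q | ε < ρ q} (stripMeasure n d T) ∧
      ∫ q in {q | ε < ρ q}, k q ∂(stripMeasure n d T) =
        (∫ q, indicator {q | ε < ρ q} (fun q => k q - k₀ q) q ∂(stripMeasure n d T)) +
          ∫ q, indicator {q | ε < ρ q} k₀ q ∂(stripMeasure n d T) := by
  have hA := h.measurableSet_trunc ε
  have h1 := (h.integrable_sub hD hT hs hM hη).1.indicator hA
  have h2 := h.integrable₀ hD hG hT hs hM hε
  have e : indicator {q | ε < ρ q} k = fun q => indicator {q | ε < ρ q} (fun q => k q - k₀ q) q +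
      indicator {q | ε < ρ q} k₀ q := by
    funext q
    by_cases hq : q ∈ {q | ε < ρ q} <;> simp [hq]
  constructor
  · rw [← integrable_indicator_iff hA, e]
    exact h1.add h2
  · rw [← integral_indicator hA, e]
    exact integral_add h1 h2

/-- The gauge is at least `√|t - s|`, so at these times the truncation removes nothing and the full
integral vanishes. -/
theorem IsCancelling.sliceInt_eq_zero (h : IsCancelling T s D G η M θ ρ k k₀) {ε : ℝ} (hε : 0 < ε)
    {t : ℝ} (ht : t ∈ Icc (-T) T) (hts : ε ^ 2 < |t - s|) : sliceInt ρ k₀ ε t = 0 := by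
  have hne : t ≠ s := by
    rintro rfl
    rw [sub_self, abs_zero] at hts
    nlinarith
  rw [← h.integral_eq_zero t ht hne]
  refine integral_congr_ae (ae_of_all _ fun y => indicator_of_mem ?_ _)
  exact ((Real.lt_sqrt hε.le).2 hts).trans_le (h.le_gauge t y)

/-- The rescaled space integral of the truncated kernel. -/
def scaledSlice (T s : ℝ) (ρ k₀ : ℝ × Sp n d → ℝ) (ε a : ℝ) : ℝ :=
  ε ^ 2 * indicator (Icc (-T) T) (sliceInt ρ k₀ ε) (s + ε ^ 2 * a)

/-- The loss `1 / ε` from the truncation and the singularity `|t - s| ^ (-1/2)`, with `|t - s| = ε ^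
2 |a|`, exactly consume the Jacobian `ε ^ 2`. The bound is independent of `ε` and integrable in `a`.
-/
theorem IsCancelling.abs_scaledSlice_le (h : IsCancelling T s D G η M θ ρ k k₀) (hD : 0 ≤ D)
    (hG : 0 ≤ G) (hM : n * d < M) (hm : Measurable k₀) {ε : ℝ} (hε : 0 < ε) {a : ℝ} (ha : a ≠ 0) :
    |scaledSlice T s ρ k₀ ε a| ≤ D * G * majMass n d M * |a| ^ (-(1 / 2) : ℝ) := by
  have hε2 : 0 < ε ^ 2 := by positivity
  have ha0 : 0 < |a| := abs_pos.2 ha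
  have hnn : 0 ≤ D * G * majMass n d M * |a| ^ (-(1 / 2) : ℝ) :=
    mul_nonneg (mul_nonneg (mul_nonneg hD hG) (majMass_nonneg M)) (by positivity)
  unfold scaledSlice
  by_cases ht : s + ε ^ 2 * a ∈ Icc (-T) T
  · rw [indicator_of_mem ht, abs_mul, abs_of_pos hε2]
    have hts : s + ε ^ 2 * a ≠ s := by
      intro hc
      have : ε ^ 2 * a = 0 := by linarith
      simp [hε.ne', ha] at this
    have hmf : Measurable fun y => indicator {q | ε < ρ q} k₀ (s + ε ^ 2 * a, y) :=
      (hm.indicator (h.measurableSet_trunc ε)).comp measurable_prodMk_left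
    have hsl := (slice_le hM hts hmf.aestronglyMeasurable
      fun y => h.abs_indicator_le hD hε ht hts y).2
    have hab : |s + ε ^ 2 * a - s| = ε ^ 2 * |a| := by
      rw [add_sub_cancel_left, abs_mul, abs_of_pos hε2]
    have hpow : (ε ^ 2 * |a|) ^ ((1 : ℝ) / 2 - 1) = ε⁻¹ * |a| ^ (-(1 / 2) : ℝ) := by
      rw [Real.mul_rpow hε2.le ha0.le]
      norm_num
      rw [Real.rpow_neg hε2.le, ← Real.sqrt_eq_rpow, Real.sqrt_sq hε.le]
      exact Or.inl rfl
    rw [hab, hpow] at hsl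
    refine (mul_le_mul_of_nonneg_left (abs_integral_le_integral_abs.trans hsl) hε2.le).trans
      (le_of_eq ?_)
    field_simp
  · rw [indicator_of_notMem ht, mul_zero, abs_zero]
    exact hnn

/-- The substitution is `t = s + ε ^ 2 a`. The slices vanish for `|a| > 1`, so the fixed window
`[-2, 2]` captures the whole integral. -/
theorem IsCancelling.integral_trunc (h : IsCancelling T s D G η M θ ρ k k₀) (hD : 0 ≤ D) (hG : 0 ≤ G)
    (hT : T ≤ 1) (hs : s ∈ Icc (-T) T) (hM : n * d < M) {ε : ℝ} (hε : 0 < ε) :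
    Integrable (scaledSlice T s ρ k₀ ε) ∧
    ∫ q, indicator {q | ε < ρ q} k₀ q ∂(stripMeasure n d T) =
      ∫ a in Icc (-2 : ℝ) 2, scaledSlice T s ρ k₀ ε a := by
  have hi := h.integrable₀ hD hG hT hs hM hε
  have hε2 : ε ^ 2 ≠ 0 := by positivity
  have h1 : Integrable (indicator (Icc (-T) T) (sliceInt ρ k₀ ε)) := by
    rw [integrable_indicator_iff measurableSet_Icc]
    exact hi.integral_prod_left
  have h2 : Integrable (scaledSlice T s ρ k₀ ε) :=
    ((h1.comp_add_left s).comp_mul_left' hε2).const_mul _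
  refine ⟨h2, ?_⟩
  have e1 : ∫ q, indicator {q | ε < ρ q} k₀ q ∂(stripMeasure n d T) =
      ∫ t, indicator (Icc (-T) T) (sliceInt ρ k₀ ε) t := by
    rw [integral_indicator measurableSet_Icc]
    exact integral_prod _ hi
  have e2 : ∫ a, scaledSlice T s ρ k₀ ε a = ∫ t, indicator (Icc (-T) T) (sliceInt ρ k₀ ε) t := by
    unfold scaledSlice
    rw [integral_const_mul,
      Measure.integral_comp_mul_left (fun v => indicator (Icc (-T) T) (sliceInt ρ k₀ ε) (s + v)),
      integral_add_left_eq_self, abs_inv, abs_of_pos (by positivity), smul_eq_mul, ← mul_assoc,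
      mul_inv_cancel₀ hε2, one_mul]
  rw [e1, ← e2]
  refine (setIntegral_eq_integral_of_forall_compl_eq_zero fun a ha => ?_).symm
  unfold scaledSlice
  by_cases ht : s + ε ^ 2 * a ∈ Icc (-T) T
  · have : 1 < |a| := by
      by_contra hc
      rw [not_lt, abs_le] at hc
      exact ha ⟨by linarith [hc.1], by linarith [hc.2]⟩
    rw [indicator_of_mem ht, h.sliceInt_eq_zero hε ht, mul_zero]
    rw [add_sub_cancel_left, abs_mul, abs_of_pos (by positivity)]
    nlinarith [sq_pos_of_pos hε]
  · rw [indicator_of_notMem ht, mul_zero]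

theorem ae_ne_zero_window : ∀ᵐ a ∂(volume.restrict (Icc (-2 : ℝ) 2)), a ≠ 0 :=
  ae_restrict_of_ae (Measure.ae_ne volume 0)

/-- Truncated integrals of a cancelling kernel are bounded. -/
theorem IsCancelling.abs_integral_le (h : IsCancelling T s D G η M θ ρ k k₀) (hD : 0 ≤ D)
    (hG : 0 ≤ G) (hT : T ≤ 1) (hs : s ∈ Icc (-T) T) (hM : n * d < M) (hη : 0 < η)
    (hm : Measurable k₀) {ε : ℝ} (hε : 0 < ε) :
    |∫ q in {q | ε < ρ q}, k q ∂(stripMeasure n d T)| ≤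
      D * majMass n d M * timeMass (η / 2 - 1) + D * G * majMass n d M * timeMass (-(1 / 2)) := by
  rw [(h.integrableOn hD hG hT hs hM hη hε).2]
  refine (abs_add_le _ _).trans (add_le_add
    ((h.integrable_sub hD hT hs hM hη).2 _ (h.measurableSet_trunc ε)) ?_)
  obtain ⟨hi, he⟩ := h.integral_trunc hD hG hT hs hM hε
  rw [he, timeMass, ← integral_const_mul]
  refine abs_integral_le_integral_abs.trans (integral_mono_ae hi.abs.integrableOn
    ((integrableOn_abs_rpow (by norm_num)).const_mul _) ?_)
  filter_upwards [ae_ne_zero_window] with a ha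
  exact h.abs_scaledSlice_le hD hG hM hm hε ha

/-- Truncated integrals of a cancelling kernel converge if its rescaled slices do. -/
theorem IsCancelling.exists_tendsto (h : IsCancelling T s D G η M θ ρ k k₀) (hD : 0 ≤ D) (hG : 0 ≤ G)
    (hT : T ≤ 1) (hs : s ∈ Ioo (-T) T) (hM : n * d < M) (hη : 0 < η) (hm : Measurable k₀)
    (hlim : ∀ᵐ a ∂(volume.restrict (Icc (-2 : ℝ) 2)), ∃ ℓ : ℝ,
      Tendsto (fun ε => ε ^ 2 * sliceInt ρ k₀ ε (s + ε ^ 2 * a)) (𝓝[>] 0) (𝓝 ℓ)) :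
    ∃ ℓ : ℝ, Tendsto (fun ε => ∫ q in {q | ε < ρ q}, k q ∂(stripMeasure n d T)) (𝓝[>] 0) (𝓝 ℓ) := by
  have hs' : s ∈ Icc (-T) T := Ioo_subset_Icc_self hs
  have hpos : ∀ᶠ ε : ℝ in 𝓝[>] 0, 0 < ε := self_mem_nhdsWithin
  have hsub := (h.integrable_sub hD hT hs' hM hη).1
  -- The error `k - k₀` is integrable, so its truncated integrals converge by dominated convergence.
  have l1 : Tendsto (fun ε => ∫ q, indicator {q | ε < ρ q} (fun q => k q - k₀ q) q
      ∂(stripMeasure n d T)) (𝓝[>] 0)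
      (𝓝 (∫ q, indicator {q | 0 < ρ q} (fun q => k q - k₀ q) q ∂(stripMeasure n d T))) := by
    refine tendsto_integral_filter_of_dominated_convergence (fun q => |k q - k₀ q|)
      (Eventually.of_forall fun ε =>
        hsub.aestronglyMeasurable.indicator (h.measurableSet_trunc ε))
      (Eventually.of_forall fun ε => ae_of_all _ fun q => norm_indicator_le_norm_self _ _) hsub.abs
      (ae_of_all _ fun q => ?_)
    by_cases hq : 0 < ρ q
    · refine tendsto_const_nhds.congr' ?_
      filter_upwards [Ioo_mem_nhdsGT hq] with ε hε
      rw [indicator_of_mem (by exact hq), indicator_of_mem (by exact hε.2)]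
    · refine tendsto_const_nhds.congr' ?_
      filter_upwards [hpos] with ε hε
      rw [indicator_of_notMem (by exact hq),
        indicator_of_notMem (fun hc => hq (hε.trans (by exact hc)))]
  -- For the model kernel, dominated convergence is applied to the rescaled slices with the majorant
  -- `|a| ^ (-1/2)`.
  have l2 : ∃ ℓ : ℝ, Tendsto (fun ε => ∫ a in Icc (-2 : ℝ) 2, scaledSlice T s ρ k₀ ε a) (𝓝[>] 0)
      (𝓝 ℓ) := by
    refine ⟨∫ a in Icc (-2 : ℝ) 2,
      limUnder (𝓝[>] 0) fun ε => ε ^ 2 * sliceInt ρ k₀ ε (s + ε ^ 2 * a), ?_⟩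
    refine tendsto_integral_filter_of_dominated_convergence
      (fun a => D * G * majMass n d M * |a| ^ (-(1 / 2) : ℝ)) ?_ ?_
      ((integrableOn_abs_rpow (by norm_num)).const_mul _) ?_
    · filter_upwards [hpos] with ε hε
      exact (h.integral_trunc hD hG hT hs' hM hε).1.aestronglyMeasurable.restrict
    · filter_upwards [hpos] with ε hε
      filter_upwards [ae_ne_zero_window] with a ha
      exact h.abs_scaledSlice_le hD hG hM hm hε ha
    · filter_upwards [hlim] with a ha
      refine (tendsto_nhds_limUnder ha).congr' ?_
      have hc : Tendsto (fun ε : ℝ => s + ε ^ 2 * a) (𝓝[>] 0) (𝓝 s) := by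
        have : Continuous fun ε : ℝ => s + ε ^ 2 * a := by fun_prop
        have h1 := this.tendsto 0
        simp only [ne_eq, OfNat.ofNat_ne_zero, not_false_eq_true, zero_pow, zero_mul, add_zero] at h1
        exact h1.mono_left nhdsWithin_le_nhds
      filter_upwards [hc (Icc_mem_nhds hs.1 hs.2)] with ε hε
      rw [scaledSlice, indicator_of_mem (by exact hε)]
  obtain ⟨ℓ, l2⟩ := l2
  refine ⟨_, (l1.add l2).congr' ?_⟩
  filter_upwards [hpos] with ε hε
  rw [(h.integrableOn hD hG hT hs' hM hη hε).2, (h.integral_trunc hD hG hT hs' hM hε).2]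

end AbstractCancellation

/-! ### Convergence of rescaled slices. -/

section SliceLimit

variable {T s D G η : ℝ} {M : ℕ} {θ : ℝ → Sp n d} {ρ k k₀ : ℝ × Sp n d → ℝ}

/-- The majorant is exactly invariant under the blow-up and so dominates all the rescaled slices at
once. -/
theorem maj_blowup {ε a : ℝ} (hε : 0 < ε) (M : ℕ) (z w : Sp n d) :
    ε ^ (n ^ 2 * d + 2) * maj M √|ε ^ 2 * a| z (z + act (dil ε) w) = maj M √|a| 0 w := by
  have h1 : √|ε ^ 2 * a| = ε * √|a| := by
    rw [abs_mul, abs_of_pos (by positivity), Real.sqrt_mul (by positivity), Real.sqrt_sq hε.le]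
  unfold maj
  rw [h1, add_sub_cancel_left, sub_zero, ← act_mul, dil_mul_dil, mul_inv, mul_right_comm,
    inv_mul_cancel₀ hε.ne', one_mul, mul_pow, mul_inv]
  field_simp

theorem tendsto_add_sq_mul (s a : ℝ) : Tendsto (fun ε : ℝ => s + ε ^ 2 * a) (𝓝[>] 0) (𝓝 s) := by
  have : Continuous fun ε : ℝ => s + ε ^ 2 * a := by fun_prop
  have h1 := this.tendsto 0
  simp only [ne_eq, OfNat.ofNat_ne_zero, not_false_eq_true, zero_pow, zero_mul, add_zero] at h1
  exact h1.mono_left nhdsWithin_le_nhds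

/-- The rescaled slices of a cancelling kernel converge if the kernel and the gauge have blow-ups. -/
theorem IsCancelling.exists_tendsto_slice (h : IsCancelling T s D G η M θ ρ k k₀)
    (hs : s ∈ Ioo (-T) T) (hM : n * d < M) (hm : Measurable k₀) {a : ℝ} (ha : a ≠ 0)
    {ρ₀ : Sp n d → ℝ}
    (hk : ∀ w, ∃ ℓ : ℝ, Tendsto (fun ε => ε ^ (n ^ 2 * d + 2) *
      k₀ (s + ε ^ 2 * a, θ (s + ε ^ 2 * a) + act (dil ε) w)) (𝓝[>] 0) (𝓝 ℓ))
    (hρ : ∀ w, Tendsto (fun ε => ρ (s + ε ^ 2 * a, θ (s + ε ^ 2 * a) + act (dil ε) w) / ε)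
      (𝓝[>] 0) (𝓝 (ρ₀ w)))
    (hρ₀ : ∀ᵐ w, ρ₀ w ≠ 1) :
    ∃ ℓ : ℝ, Tendsto (fun ε => ε ^ 2 * sliceInt ρ k₀ ε (s + ε ^ 2 * a)) (𝓝[>] 0) (𝓝 ℓ) := by
  have hpos : ∀ᶠ ε : ℝ in 𝓝[>] 0, 0 < ε := self_mem_nhdsWithin
  choose ℓ hℓ using hk
  -- The limit is the blow-up of the kernel, truncated by the blow-up of the gauge; the indicators
  -- converge off the level set `ρ₀ = 1`.
  refine ⟨∫ w, indicator {w | 1 < ρ₀ w} ℓ w, ?_⟩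
  have key : ∀ᶠ ε : ℝ in 𝓝[>] 0, ∫ w, ε ^ (n ^ 2 * d + 2) * indicator {q | ε < ρ q} k₀
      (s + ε ^ 2 * a, θ (s + ε ^ 2 * a) + act (dil ε) w) =
        ε ^ 2 * sliceInt ρ k₀ ε (s + ε ^ 2 * a) := by
    filter_upwards [hpos] with ε hε
    have h1 := integral_comp_dil hε (fun w => indicator {q | ε < ρ q} k₀
      (s + ε ^ 2 * a, θ (s + ε ^ 2 * a) + act (dil ε) w)) (θ (s + ε ^ 2 * a))
    simp only [act_dil_dil_inv hε.ne', add_sub_cancel] at h1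
    rw [sliceInt, h1, integral_const_mul, pow_add]
    ring
  refine Tendsto.congr' key ?_
  refine tendsto_integral_filter_of_dominated_convergence
    (fun w => D * maj (M + 1) √|a| 0 w) ?_ ?_ ?_ ?_
  · refine Eventually.of_forall fun ε => Measurable.aestronglyMeasurable ?_
    refine ((hm.indicator (h.measurableSet_trunc ε)).comp
      (measurable_const.prodMk ?_)).const_mul _
    exact ((continuous_act (dil ε)).measurable).const_add _
  · filter_upwards [hpos, tendsto_add_sq_mul s a (Icc_mem_nhds hs.1 hs.2)] with ε hε ht
    refine ae_of_all _ fun w => ?_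
    have hts : s + ε ^ 2 * a ≠ s := by
      intro hc
      have : ε ^ 2 * a = 0 := by linarith
      simp [hε.ne', ha] at this
    have h1 := h.le₀ _ ht hts (θ (s + ε ^ 2 * a) + act (dil ε) w)
    rw [add_sub_cancel_left] at h1
    rw [← maj_blowup hε (M + 1) (θ (s + ε ^ 2 * a)) w, norm_mul, Real.norm_eq_abs,
      abs_of_pos (by positivity), mul_left_comm D]
    refine mul_le_mul_of_nonneg_left ((norm_indicator_le_norm_self _ _).trans h1) (by positivity)
  · exact (integrable_maj (by omega) (Real.sqrt_pos.2 (abs_pos.2 ha)) 0).const_mul D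
  · filter_upwards [hρ₀] with w hw
    rcases lt_or_gt_of_ne hw with hlt | hlt
    · rw [indicator_of_notMem (by simpa using hlt.le)]
      refine tendsto_const_nhds.congr' ?_
      filter_upwards [hpos, (hρ w).eventually_lt_const hlt] with ε hε h1
      rw [div_lt_one hε] at h1
      rw [indicator_of_notMem (by simpa using h1.le), mul_zero]
    · rw [indicator_of_mem (by simpa using hlt)]
      refine (hℓ w).congr' ?_
      filter_upwards [hpos, (hρ w).eventually_const_lt hlt] with ε hε h1
      rw [one_lt_div hε] at h1
      rw [indicator_of_mem (by simpa using h1)]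

end SliceLimit

/-! ### Level sets of the homogeneous norm. -/

section GaugeLevels

theorem continuous_block (i : Fin n) : Continuous fun x : Sp n d => block x i := by
  unfold block
  fun_prop

theorem continuous_rho : Continuous fun p : ℝ × Sp n d => rho p.1 p.2 := by
  unfold rho
  refine ((continuous_abs.comp continuous_fst).rpow_const fun _ => Or.inr (by norm_num)).add
    (continuous_finsetSum _ fun i _ => ?_)
  exact (((continuous_block i).comp continuous_snd).norm).rpow_const fun _ => Or.inr (by positivity)

theorem rho_eq_sqrt_add (t : ℝ) (x : Sp n d) : rho t x = √|t| + rho 0 x := by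
  unfold rho
  rw [abs_zero, Real.zero_rpow (by norm_num), zero_add, Real.sqrt_eq_rpow]

/-- Almost all unit spheres of the homogeneous norm are null sets. -/
theorem ae_rho_ne_one (n d : ℕ) : ∀ᵐ a : ℝ, ∀ P : Mat n d, P.det ≠ 0 → ∀ᵐ w : Sp n d,
    rho (-a) (act P w) ≠ 1 := by
  have hg : Measurable fun x : Sp n d => rho 0 x :=
    (continuous_rho.comp (continuous_const.prodMk continuous_id)).measurable
  -- Only countably many level sets of `rho 0` have positive measure. Since `rho (-a) = √|a| + rho
  -- 0`, the bad values of `a` are countable, and an invertible linear map does not affect null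
  -- sets, so one exceptional set serves all `P`.
  have hB := Measure.countable_meas_level_set_pos (μ := (volume : Measure (Sp n d))) hg
  set B := {t : ℝ | 0 < volume {x : Sp n d | rho 0 x = t}} with hBdef
  have hnull : ∀ᵐ a : ℝ, a ∉ (fun b => (1 - b) ^ 2) '' B ∪ (fun b => -(1 - b) ^ 2) '' B :=
    ((hB.image _).union (hB.image _)).ae_notMem volume
  filter_upwards [hnull] with a ha P hP
  have hb : 1 - √|a| ∉ B := by
    intro hb
    refine ha ?_
    rcases le_total 0 a with h | h
    · refine Or.inl ⟨_, hb, ?_⟩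
      simp only [sub_sub_cancel]
      rw [Real.sq_sqrt (abs_nonneg _), abs_of_nonneg h]
    · refine Or.inr ⟨_, hb, ?_⟩
      simp only [sub_sub_cancel]
      rw [Real.sq_sqrt (abs_nonneg _), abs_of_nonpos h, neg_neg]
  have hz : volume {x : Sp n d | rho 0 x = 1 - √|a|} = 0 := by
    by_contra hc
    exact hb (pos_iff_ne_zero.2 hc)
  have hz' : volume (act P ⁻¹' {x : Sp n d | rho 0 x = 1 - √|a|}) = 0 := by
    rw [← (measurableEmbedding_act hP).map_apply, map_act_volume hP, Measure.smul_apply, hz,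
      smul_zero]
  filter_upwards [measure_eq_zero_iff_ae_notMem.1 hz'] with w hw hc
  rw [rho_eq_sqrt_add, abs_neg] at hc
  exact hw (by simp only [mem_preimage, Set.mem_ofPred_eq]; linarith)

end GaugeLevels

/-! ### Blow-up at Lebesgue points in time. -/

section Blowup

/-- The time `s` is a Lebesgue point of `f`, in rescaled form. -/
def IsBlowup {E : Type*} [NormedAddCommGroup E] (f : ℝ → E) (s : ℝ) (e : E) : Prop :=
  Tendsto (fun ε : ℝ => ∫ u in (-2)..2, ‖f (s + ε ^ 2 * u) - e‖) (𝓝[>] 0) (𝓝 0)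

/-- Lebesgue's differentiation theorem on the intervals of radius `2 ε ^ 2` around `s`. -/
theorem ae_isBlowup {E : Type*} [NormedAddCommGroup E] {f : ℝ → E} {L : ℝ} (hf : StronglyMeasurable f)
    (hb : ∀ u, ‖f u‖ ≤ L) : ∀ᵐ s, IsBlowup f s (f s) := by
  have hloc : LocallyIntegrable f volume := fun x =>
    ⟨Icc (x - 1) (x + 1), Icc_mem_nhds (by linarith) (by linarith),
      Measure.integrableOn_of_bounded (M := L) (by simp) hf.aestronglyMeasurable
        (ae_of_all _ fun u => hb u)⟩
  filter_upwards [IsUnifLocDoublingMeasure.ae_tendsto_average_norm_sub volume hloc 1] with s hs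
  have hδ : Tendsto (fun ε : ℝ => 2 * ε ^ 2) (𝓝[>] 0) (𝓝[>] 0) := by
    refine tendsto_nhdsWithin_iff.2 ⟨?_, ?_⟩
    · have : Continuous fun ε : ℝ => 2 * ε ^ 2 := by fun_prop
      have h1 := this.tendsto 0
      simp only [ne_eq, OfNat.ofNat_ne_zero, not_false_eq_true, zero_pow, mul_zero] at h1
      exact h1.mono_left nhdsWithin_le_nhds
    · filter_upwards [self_mem_nhdsWithin] with ε hε
      have : (0 : ℝ) < ε := hε
      exact mem_Ioi.2 (by positivity)
  have h1 := (hs (fun _ : ℝ => s) (fun ε => 2 * ε ^ 2) hδ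
    (Eventually.of_forall fun ε => Metric.mem_closedBall_self (by positivity))).const_mul 4
  rw [mul_zero] at h1
  refine h1.congr' ?_
  filter_upwards [self_mem_nhdsWithin] with ε hε
  have hε : (0 : ℝ) < ε := hε
  rw [intervalIntegral.integral_comp_add_mul (fun v => ‖f v - f s‖) (by positivity : ε ^ 2 ≠ 0),
    setAverage_eq, Real.closedBall_eq_Icc, integral_Icc_eq_integral_Ioc,
    intervalIntegral.integral_of_le (by nlinarith [sq_pos_of_pos hε])]
  have e1 : s + ε ^ 2 * -2 = s - 2 * ε ^ 2 := by ring
  have e2 : s + ε ^ 2 * 2 = s + 2 * ε ^ 2 := by ring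
  rw [e1, e2, Real.volume_real_Icc_of_le (by nlinarith [sq_pos_of_pos hε]), smul_eq_mul, smul_eq_mul]
  field_simp
  ring

variable {η κ : ℝ} {𝓔 : Fin n → Set (Matrix (Fin d) (Fin d) ℝ)} {F : ℝ → Sp n d → Sp n d}

/-- The null set must not depend on `x`. A countable dense set of points is treated first; Hölder
continuity in space, uniform in time, reaches all the others. -/
theorem ae_isBlowup_subGrad (hη : 0 < η) (hκ : 0 ≤ κ) (hF : DriftAssumption η κ 𝓔 F) :
    ∀ᵐ s, ∀ x, IsBlowup (fun u => subGrad F u x) s (subGrad F s x) := by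
  have hA : ∀ x, IsCurve ((n * d : ℝ) ^ 2 * κ) 𝓔 fun u => subGrad F u x := fun x =>
    isCurve_subGrad hη hκ hF continuous_const
  have hall : ∀ᵐ s, ∀ m : ℕ, IsBlowup (fun u => subGrad F u (TopologicalSpace.denseSeq (Sp n d) m)) s
      (subGrad F s (TopologicalSpace.denseSeq (Sp n d) m)) :=
    ae_all_iff.2 fun m => ae_isBlowup (hA _).meas (hA _).bdd
  filter_upwards [hall] with s hs x
  set L := (n * d : ℝ) ^ 2 * κ with hL
  have hL0 : 0 ≤ L := by positivity
  have hlip := fun t z z' => norm_subGrad_sub_le hκ hF t z z'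
  refine tendsto_order.2 ⟨fun b hb => Eventually.of_forall fun ε => hb.trans_le
    (intervalIntegral.integral_nonneg (by norm_num) fun u _ => norm_nonneg _), fun b hb => ?_⟩
  -- Replacing `x` by `z` at the two times costs `2 L ‖x - z‖ ^ η`, integrated over a window of
  -- length `4`.
  have hc : Continuous fun z : Sp n d => 8 * L * ‖x - z‖ ^ η :=
    ((continuous_const.sub continuous_id).norm.rpow_const fun _ => Or.inr hη.le).const_mul _
  have hopen : IsOpen {z : Sp n d | 8 * L * ‖x - z‖ ^ η < b / 2} := isOpen_lt hc continuous_const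
  obtain ⟨m, hm⟩ := (TopologicalSpace.denseRange_denseSeq (Sp n d)).exists_mem_open hopen
    ⟨x, by simp only [Set.mem_ofPred_eq, sub_self, norm_zero, Real.zero_rpow hη.ne', mul_zero]; positivity⟩
  have hs' := hs m
  generalize TopologicalSpace.denseSeq (Sp n d) m = z at hs' hm
  filter_upwards [(tendsto_order.1 hs').2 (b / 2) (by positivity)] with ε hε
  have hi : ∀ z, IntervalIntegrable
      (fun u => ‖subGrad F (s + ε ^ 2 * u) z - subGrad F s z‖) volume (-2) 2 := fun z =>
    intervalIntegrable_norm_sub ((hA z).comp_affine s (ε ^ 2)).meas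
      ((hA z).comp_affine s (ε ^ 2)).bdd stronglyMeasurable_const (fun _ => (hA z).bdd s) _ _
  have hle : ∫ u in (-2)..2, ‖subGrad F (s + ε ^ 2 * u) x - subGrad F s x‖ ≤
      ∫ u in (-2)..2, (‖subGrad F (s + ε ^ 2 * u) z - subGrad F s z‖ + 2 * L * ‖x - z‖ ^ η) := by
    refine intervalIntegral.integral_mono_on (by norm_num) (hi x)
      ((hi z).add intervalIntegrable_const) fun u _ => ?_
    have h1 := hlip (s + ε ^ 2 * u) x z
    have h2 := hlip s x z
    have e : subGrad F (s + ε ^ 2 * u) x - subGrad F s x =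
        (subGrad F (s + ε ^ 2 * u) x - subGrad F (s + ε ^ 2 * u) z) +
          (subGrad F (s + ε ^ 2 * u) z - subGrad F s z) - (subGrad F s x - subGrad F s z) := by abel
    rw [e]
    refine (norm_sub_le _ _).trans ?_
    have := norm_add_le (subGrad F (s + ε ^ 2 * u) x - subGrad F (s + ε ^ 2 * u) z)
      (subGrad F (s + ε ^ 2 * u) z - subGrad F s z)
    linarith
  rw [intervalIntegral.integral_add (hi z) intervalIntegrable_const,
    intervalIntegral.integral_const, smul_eq_mul] at hle
  have hm' : 8 * L * ‖x - z‖ ^ η < b / 2 := hm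
  linarith

/-- Over times of order `ε ^ 2` the trajectory stays close to `x`, so `DF` along it has the same
blow-up as at the fixed point `x`. -/
theorem isBlowup_linCurve (hη : 0 < η) (hκ : 0 ≤ κ) (hF : DriftAssumption η κ 𝓔 F) {s : ℝ}
    {x : Sp n d} (h : IsBlowup (fun u => subGrad F u x) s (subGrad F s x)) :
    IsBlowup (linCurve F s x) s (subGrad F s x) := by
  have hA := isCurve_subGrad hη hκ hF (continuous_const (y := x))
  have hA' := isCurve_linCurve hη hκ hF s x
  set L := (n * d : ℝ) ^ 2 * κ with hL
  have hc2 : Continuous fun p : ℝ × ℝ => L * ‖flow F (s + p.1 ^ 2 * p.2) s x - x‖ ^ η :=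
    ((((continuous_flow_left hF s x).comp (by fun_prop : Continuous fun p : ℝ × ℝ =>
      s + p.1 ^ 2 * p.2)).sub continuous_const).norm.rpow_const fun _ => Or.inr hη.le).const_mul _
  have hc := intervalIntegral.continuous_parametric_intervalIntegral_of_continuous'
    (f := fun ε u : ℝ => L * ‖flow F (s + ε ^ 2 * u) s x - x‖ ^ η) (μ := volume) hc2 (-2) 2
  have h0 := (hc.tendsto 0).mono_left (nhdsWithin_le_nhds (s := Ioi 0))
  simp only [ne_eq, OfNat.ofNat_ne_zero, not_false_eq_true, zero_pow, zero_mul, add_zero,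
    flow_self hF, sub_self, norm_zero, Real.zero_rpow hη.ne', mul_zero,
    intervalIntegral.integral_zero] at h0
  have hsum := h0.add h
  rw [add_zero] at hsum
  refine squeeze_zero (fun ε => intervalIntegral.integral_nonneg (by norm_num)
    fun u _ => norm_nonneg _) (fun ε => ?_) hsum
  have hi : IntervalIntegrable
      (fun u => ‖subGrad F (s + ε ^ 2 * u) x - subGrad F s x‖) volume (-2) 2 :=
    intervalIntegrable_norm_sub (hA.comp_affine s (ε ^ 2)).meas
      (hA.comp_affine s (ε ^ 2)).bdd stronglyMeasurable_const (fun _ => hA.bdd s) _ _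
  have hi' : IntervalIntegrable
      (fun u => ‖linCurve F s x (s + ε ^ 2 * u) - subGrad F s x‖) volume (-2) 2 :=
    intervalIntegrable_norm_sub (hA'.comp_affine s (ε ^ 2)).meas
      (hA'.comp_affine s (ε ^ 2)).bdd stronglyMeasurable_const (fun _ => hA.bdd s) _ _
  have hi2 : IntervalIntegrable (fun u => L * ‖flow F (s + ε ^ 2 * u) s x - x‖ ^ η) volume (-2) 2 :=
    (hc2.comp (continuous_const.prodMk continuous_id)).intervalIntegrable _ _
  rw [← intervalIntegral.integral_add hi2 hi]
  refine intervalIntegral.integral_mono_on (by norm_num) hi' (hi2.add hi) fun u _ => ?_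
  refine (norm_sub_le_norm_sub_add_norm_sub _ (subGrad F (s + ε ^ 2 * u) x) _).trans
    (add_le_add_left ?_ _)
  exact norm_subGrad_sub_le hκ hF _ _ _

end Blowup

/-! ### Blow-ups of resolvents, covariances, kernels and the quasi-distance. -/

section KernelBlowup

variable {η κ L lam : ℝ} {𝓔 : Fin n → Set (Matrix (Fin d) (Fin d) ℝ)} {F : ℝ → Sp n d → Sp n d}
  {A : ℝ → Mat n d} {ς : ℝ → Matrix (Fin d) (Fin d) ℝ}

theorem IsCurve.const (hA : IsCurve L 𝓔 A) (s : ℝ) : IsCurve L 𝓔 fun _ => A s where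
  meas := stronglyMeasurable_const
  bdd _ := hA.bdd s
  sub _ := hA.sub s
  nondeg _ := hA.nondeg s

theorem DiffusionAssumption.const (hς : DiffusionAssumption lam ς) (s : ℝ) :
    DiffusionAssumption lam fun _ => ς s where
  meas _ _ := measurable_const
  symm _ := hς.symm s
  lower _ := hς.lower s
  upper _ := hς.upper s

theorem det_phi_ne_zero (hA : IsCurve L 𝓔 A) (t s : ℝ) : (Phi A t s).det ≠ 0 := by
  have h : (Phi A s t * Phi A t s).det = 1 := by
    rw [phi_mul_phi hA.meas hA.bdd, phi_self hA.meas hA.bdd, Matrix.det_one]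
  rw [Matrix.det_mul] at h
  exact right_ne_zero_of_mul_eq_one h

theorem tendsto_phi_blowup (hA : IsCurve L 𝓔 A) {s : ℝ} {A₀ : Mat n d} (hA₀ : ‖A₀‖ ≤ L)
    (h : IsBlowup A s A₀) {a b : ℝ} (ha : a ∈ Icc (-2 : ℝ) 2) (hb : b ∈ Icc (-2 : ℝ) 2) :
    Tendsto (fun ε : ℝ => Phi (fun u => A (s + ε ^ 2 * u)) b a) (𝓝[>] 0)
      (𝓝 (Phi (fun _ => A₀) b a)) := by
  obtain ⟨C, -, hC⟩ := exists_phi_stability n d L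
  rw [tendsto_iff_norm_sub_tendsto_zero]
  have h1 := Tendsto.const_mul C h
  rw [mul_zero] at h1
  refine squeeze_zero (fun _ => norm_nonneg _) (fun ε => ?_) h1
  have hA' := hA.comp_affine s (ε ^ 2)
  have := hC _ (fun _ => A₀) hA'.meas hA'.bdd stronglyMeasurable_const (fun _ => hA₀) a ha b hb a ha b hb
  simpa using this

theorem tendsto_act {X : Type*} {l : Filter X} {P : X → Mat n d} {v : X → Sp n d} {P₀ : Mat n d}
    {v₀ : Sp n d} (hP : Tendsto P l (𝓝 P₀)) (hv : Tendsto v l (𝓝 v₀)) :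
    Tendsto (fun x => act (P x) (v x)) l (𝓝 (act P₀ v₀)) :=
  (continuous_act_uncurry.tendsto (P₀, v₀)).comp (hP.prodMk_nhds hv)

theorem tendsto_rho {X : Type*} {l : Filter X} (a : ℝ) {v : X → Sp n d} {v₀ : Sp n d}
    (hv : Tendsto v l (𝓝 v₀)) : Tendsto (fun x => rho a (v x)) l (𝓝 (rho a v₀)) :=
  (continuous_rho.tendsto (a, v₀)).comp (tendsto_const_nhds.prodMk_nhds hv)

theorem linCurve_self (hF : DriftAssumption η κ 𝓔 F) (s : ℝ) (x : Sp n d) :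
    linCurve F s x s = subGrad F s x := by rw [linCurve, flow_self hF]

/-- The blow-up of the quasi-distance to `(s, x)`. -/
theorem tendsto_qdist_blowup (hη : 0 < η) (hη1 : η ≤ 1) (hκ : 0 ≤ κ) (hF : DriftAssumption η κ 𝓔 F)
    {s : ℝ} {x : Sp n d} (h : IsBlowup (linCurve F s x) s (linCurve F s x s)) {a : ℝ}
    (ha : a ∈ Icc (-2 : ℝ) 2) (w : Sp n d) :
    Tendsto (fun ε => qdist F (s + ε ^ 2 * a, flow F (s + ε ^ 2 * a) s x + act (dil ε) w) (s, x) / ε)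
      (𝓝[>] 0) (𝓝 (rho (-a) (act (Phi (fun _ => linCurve F s x s) 0 a) w))) := by
  have hA := isCurve_linCurve hη hκ hF s x
  obtain ⟨V, hV⟩ : ∃ V : ℝ → Sp n d, V = fun ε => act (dil ε⁻¹)
    (flow F s (s + ε ^ 2 * a) (flow F (s + ε ^ 2 * a) s x + act (dil ε) w) - x) := ⟨_, rfl⟩
  have hev : ∀ᶠ ε : ℝ in 𝓝[>] 0, 0 < ε ∧ ε ≤ 2 := by
    filter_upwards [Ioc_mem_nhdsGT (zero_lt_two : (0 : ℝ) < 2)] with ε hε using hε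
  have e1 : ∀ᶠ ε : ℝ in 𝓝[>] 0, rho (-a) (V ε) =
      qdist F (s + ε ^ 2 * a, flow F (s + ε ^ 2 * a) s x + act (dil ε) w) (s, x) / ε := by
    filter_upwards [hev] with ε hε
    rw [eq_div_iff hε.1.ne', mul_comm, ← rho_scaled hε.1, hV, qdist]
    simp only [act_dil_dil_inv hε.1.ne']
    congr 1
    ring
  refine Tendsto.congr' e1 ?_
  obtain ⟨H, hH⟩ : ∃ H, H = (n * d : ℝ) * ((d + 4) * 4 ^ n * κ) *
    (1 + Real.exp (scaleConst n d * κ * |0 - a|) * ‖w‖) ^ 2 * |0 - a| *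
      Real.exp ((n * d : ℝ) ^ 2 * (scaleConst n d * κ) * |0 - a|) := ⟨_, rfl⟩
  -- At scale `ε` the flow differs from its linearization by `O(ε ^ η)`, so only the linear part
  -- survives in the limit.
  have hd : ∀ᶠ ε : ℝ in 𝓝[>] 0,
      ‖V ε - act (Phi (fun u => linCurve F s x (s + ε ^ 2 * u)) 0 a) w‖ ≤ H * ε ^ η := by
    filter_upwards [hev] with ε hε
    obtain ⟨x', rfl⟩ := exists_eq_act_dil hε.1 x
    have hS := hF.scaled hη hη1 hκ s hε.1 hε.2
    have f1 := act_dil_flow_scaled hF hη hη1 hκ s hε.1 hε.2 a 0 x'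
    have f2 := act_dil_flow_scaled hF hη hη1 hκ s hε.1 hε.2 0 a (flow (scaled F s ε) a 0 x' + w)
    have f3 := linCurve_scaled hF hη hη1 hκ s hε.1 hε.2 0 x'
    have hT := norm_traj_taylor_le hη (mul_nonneg scaleConst_nonneg hκ) hS
      (h := (n * d : ℝ) * ((d + 4) * 4 ^ n * κ) * ε ^ η)
      (by have := hε.1; positivity) (norm_scaled_taylor_le hF hη hη1 hκ s hε.1 hε.2)
      (isTraj_flow hS a (flow (scaled F s ε) a 0 x' + w)) (isTraj_flow hS 0 x') a 0
    simp only [mul_zero, add_zero] at f1 f2 f3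
    rw [act_add, f1] at f2
    rw [flow_self hS, flow_self hS, add_sub_cancel_left] at hT
    change ‖_ - _ - act (Phi (linCurve (scaled F s ε) 0 x') 0 a) w‖ ≤ _ at hT
    rw [f3] at hT
    have e3 : V ε = flow (scaled F s ε) 0 a (flow (scaled F s ε) a 0 x' + w) - x' := by
      rw [hV]
      simp only
      rw [← f2, ← act_sub, act_dil_inv_dil hε.1.ne']
    rw [e3, hH]
    refine hT.trans (le_of_eq ?_)
    ring
  have hlim : Tendsto (fun ε : ℝ => H * ε ^ η) (𝓝[>] 0) (𝓝 0) := by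
    have hc : Continuous fun ε : ℝ => H * ε ^ η :=
      (continuous_id.rpow_const fun _ => Or.inr hη.le).const_mul H
    have := hc.tendsto 0
    simp only [Real.zero_rpow hη.ne', mul_zero] at this
    exact this.mono_left nhdsWithin_le_nhds
  have h0 : Tendsto (fun ε => V ε - act (Phi (fun u => linCurve F s x (s + ε ^ 2 * u)) 0 a) w)
      (𝓝[>] 0) (𝓝 0) := squeeze_zero_norm' hd hlim
  have hP := tendsto_phi_blowup hA (hA.bdd s) h ha zero_mem_window
  have hPw : Tendsto (fun ε : ℝ => act (Phi (fun u => linCurve F s x (s + ε ^ 2 * u)) 0 a) w) (𝓝[>] 0)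
      (𝓝 (act (Phi (fun _ => linCurve F s x s) 0 a) w)) :=
    tendsto_act hP tendsto_const_nhds
  have hVt := h0.add hPw
  simp only [sub_add_cancel, zero_add] at hVt
  exact tendsto_rho (-a) hVt

variable [NeZero n]

theorem tendsto_gaussKer {X : Type*} {l : Filter X} (i j : Fin d) {K P : X → Mat n d} {v : X → Sp n d}
    {K₀ P₀ : Mat n d} {v₀ : Sp n d} (hK₀ : 0 < K₀.det) (hK : Tendsto K l (𝓝 K₀))
    (hP : Tendsto P l (𝓝 P₀)) (hv : Tendsto v l (𝓝 v₀)) :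
    Tendsto (fun x => gaussKer i j (K x) (P x) (v x)) l (𝓝 (gaussKer i j K₀ P₀ v₀)) :=
  Tendsto.comp (g := fun x : Mat n d × Mat n d × Sp n d => gaussKer i j x.1 x.2.1 x.2.2)
    (f := fun x => (K x, P x, v x)) (y := 𝓝 (K₀, P₀, v₀))
    (continuousAt_gaussKer i j (x := (K₀, P₀, v₀)) hK₀) (hK.prodMk_nhds (hP.prodMk_nhds hv))

theorem tendsto_cov_blowup (hA : IsCurve L 𝓔 A) (hς : DiffusionAssumption lam ς) (hlam : 1 ≤ lam)
    {s : ℝ} {A₀ : Mat n d} (hA₀ : ‖A₀‖ ≤ L) (h : IsBlowup A s A₀)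
    (hS : IsBlowup (src (n := n) ς) s (src ς s)) {a b : ℝ} (ha : a ∈ Icc (-2 : ℝ) 2)
    (hb : b ∈ Icc (-2 : ℝ) 2) :
    Tendsto (fun ε : ℝ => Cov (fun u => A (s + ε ^ 2 * u)) (src fun u => ς (s + ε ^ 2 * u)) a b)
      (𝓝[>] 0) (𝓝 (Cov (fun _ => A₀) (src fun _ => ς s) a b)) := by
  obtain ⟨C, -, hC⟩ := exists_cov_stability n d L ((n * d : ℝ) ^ 2 * lam)
  rw [tendsto_iff_norm_sub_tendsto_zero]
  have h1 := (Tendsto.add h hS).const_mul C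
  rw [add_zero, mul_zero] at h1
  refine squeeze_zero (fun _ => norm_nonneg _) (fun ε => ?_) h1
  have hA' := hA.comp_affine s (ε ^ 2)
  have hς' := hς.comp_affine s (ε ^ 2)
  have := hC _ (fun _ => A₀) _ _ hA'.meas hA'.bdd stronglyMeasurable_const (fun _ => hA₀)
    (stronglyMeasurable_src hς') (norm_src_le hς' hlam) (stronglyMeasurable_src (hς.const s))
    (norm_src_le (hς.const s) hlam) a ha b hb a ha b hb
  simp only [sub_self, abs_zero, zero_add, add_zero] at this
  exact this

/-- Rescaling maps `[s, t]` to `[0, 1]`. The constants depend on the times, but only positivity of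
the covariance and finiteness are needed here. -/
theorem exists_isElliptic_cov_of_lt (h𝓔 : IsNondegenerateFamily 𝓔) (hA : IsCurve L 𝓔 A)
    (hς : DiffusionAssumption lam ς) (hlam : 1 ≤ lam) {s t : ℝ} (hst : s < t) :
    ∃ c C : ℝ, 0 < c ∧ 0 < C ∧ IsElliptic c C (Cov A (src ς) s t) := by
  obtain ⟨c, C, hc, -, h⟩ := exists_isElliptic_cov (n := n) h𝓔 L hlam
  have hr : 0 < √(t - s) := Real.sqrt_pos.2 (sub_pos.2 hst)
  have hsq : √(t - s) ^ 2 = t - s := Real.sq_sqrt (sub_pos.2 hst).le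
  have hK := h _ _ (hA.comp_affine s (√(t - s) ^ 2)) (hς.comp_affine s (√(t - s) ^ 2)) 0
    zero_mem_window 1 one_mem_window (by norm_num)
  have e := cov_rescale hA hς hlam hr s 0 1
  rw [mul_zero, add_zero, mul_one, hsq, add_sub_cancel] at e
  rw [hsq] at hK
  have hsymm := cov_transpose hA hς hlam s t
  generalize Cov A (src ς) s t = K at *
  generalize Cov (fun u => A (s + (t - s) * u)) (src fun u => ς (s + (t - s) * u)) 0 1 = K' at *
  generalize √(t - s) = r at *
  have hN : 0 < ‖(dil r⁻¹ : Mat n d)‖ + 1 := by positivity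
  refine ⟨c / (‖(dil r⁻¹ : Mat n d)‖ + 1) ^ 2, ‖K‖ + 1, by positivity, by positivity, hsymm,
    by linarith, fun ξ => ?_⟩
  rw [e, act_mul, act_mul, inner_act, dil_transpose]
  refine le_trans ?_ (hK.lower (act (dil r) ξ))
  have h1 : ‖ξ‖ ≤ (‖(dil r⁻¹ : Mat n d)‖ + 1) * ‖act (dil r) ξ‖ := by
    have := norm_act_le (dil r⁻¹) (act (dil r) ξ)
    rw [act_dil_inv_dil hr.ne'] at this
    linarith [norm_nonneg (act (dil r) ξ)]
  rw [div_mul_eq_mul_div, div_le_iff₀ (by positivity), mul_assoc, ← mul_pow]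
  refine mul_le_mul_of_nonneg_left (pow_le_pow_left₀ (norm_nonneg _) ?_ 2) hc.le
  linarith

/-- Factoring out the resolvent from time `0` to `t` leaves an integrand independent of `t`, whose
primitive is continuous. -/
theorem continuous_cov (hA : IsCurve L 𝓔 A) (hς : DiffusionAssumption lam ς) (hlam : 1 ≤ lam) :
    Continuous fun p : ℝ × ℝ => Cov A (src (n := n) ς) p.1 p.2 := by
  have hi := intervalIntegrable_cov hA.meas hA.bdd (stronglyMeasurable_src (n := n) hς)
    (norm_src_le hς hlam) 0
  have e : ∀ s t, Cov A (src (n := n) ς) s t = Phi A t 0 *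
      ((∫ u in (0)..t, Phi A 0 u * src ς u * (Phi A 0 u)ᵀ) -
        ∫ u in (0)..s, Phi A 0 u * src ς u * (Phi A 0 u)ᵀ) * (Phi A t 0)ᵀ := by
    intro s t
    rw [intervalIntegral.integral_interval_sub_left (hi 0 t) (hi 0 s), ← integral_matrix_mul (hi s t),
      ← integral_mul_matrix, Cov]
    · refine intervalIntegral.integral_congr fun u _ => ?_
      rw [← phi_mul_phi hA.meas hA.bdd t 0 u, Matrix.transpose_mul]
      simp only [mul_assoc]
    · exact ⟨(ContinuousLinearMap.mul ℝ (Mat n d) (Phi A t 0)).integrable_comp (hi s t).1,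
        (ContinuousLinearMap.mul ℝ (Mat n d) (Phi A t 0)).integrable_comp (hi s t).2⟩
  simp_rw [e]
  have hp := intervalIntegral.continuous_primitive (μ := volume) hi 0
  have hP := (continuous_phi hA.meas hA.bdd 0).comp (continuous_snd (X := ℝ) (Y := ℝ))
  exact (hP.mul ((hp.comp continuous_snd).sub (hp.comp continuous_fst))).mul
    hP.matrix_transpose

theorem continuousAt_curveKer (h𝓔 : IsNondegenerateFamily 𝓔) (hA : IsCurve L 𝓔 A)
    (hς : DiffusionAssumption lam ς) (hlam : 1 ≤ lam) (i j : Fin d) {X : Type*} [TopologicalSpace X]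
    {f g : X → ℝ} {v : X → Sp n d} {x : X} (hf : ContinuousAt f x) (hg : ContinuousAt g x)
    (hv : ContinuousAt v x) (hfg : f x < g x) :
    ContinuousAt (fun x => curveKer i j A ς (f x) (g x) (v x)) x := by
  obtain ⟨c, C, hc, -, hK⟩ := exists_isElliptic_cov_of_lt h𝓔 hA hς hlam hfg
  have h1 : ContinuousAt (fun x => Cov A (src (n := n) ς) (f x) (g x)) x :=
    ContinuousAt.comp' (f := fun x => (f x, g x)) (continuous_cov hA hς hlam).continuousAt
      (hf.prodMk hg)
  have h2 : ContinuousAt (fun x => Phi A (g x) (f x)) x :=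
    ContinuousAt.comp' (f := fun x => (g x, f x)) (continuous_phi_uncurry hA.meas hA.bdd).continuousAt
      (hg.prodMk hf)
  exact tendsto_gaussKer i j (hK.det_pos hc) h1 h2 hv

theorem integral_curveKer (h𝓔 : IsNondegenerateFamily 𝓔) (hA : IsCurve L 𝓔 A)
    (hς : DiffusionAssumption lam ς) (hlam : 1 ≤ lam) (i j : Fin d) {s t : ℝ} (hst : s < t) :
    ∫ z, curveKer i j A ς s t z = 0 := by
  obtain ⟨c, C, hc, hC, hK⟩ := exists_isElliptic_cov_of_lt h𝓔 hA hς hlam hst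
  exact integral_gaussKer hK hc hC i j _

theorem tendsto_curveKer_blowup (h𝓔 : IsNondegenerateFamily 𝓔) (hA : IsCurve L 𝓔 A)
    (hς : DiffusionAssumption lam ς) (hlam : 1 ≤ lam) (i j : Fin d) {s : ℝ} (h : IsBlowup A s (A s))
    (hS : IsBlowup (src (n := n) ς) s (src ς s)) {a b : ℝ} (ha : a ∈ Icc (-2 : ℝ) 2)
    (hb : b ∈ Icc (-2 : ℝ) 2) (hab : a < b) {v : ℝ → Sp n d} {v₀ : Sp n d}
    (hv : Tendsto v (𝓝[>] 0) (𝓝 v₀)) :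
    Tendsto (fun ε : ℝ => curveKer i j (fun u => A (s + ε ^ 2 * u)) (fun u => ς (s + ε ^ 2 * u)) a b
      (v ε)) (𝓝[>] 0) (𝓝 (curveKer i j (fun _ => A s) (fun _ => ς s) a b v₀)) := by
  obtain ⟨c, C, hc, -, hK⟩ := exists_isElliptic_cov_of_lt h𝓔 (hA.const s) (hς.const s) hlam hab
  exact tendsto_gaussKer i j (hK.det_pos hc) (tendsto_cov_blowup hA hς hlam (hA.bdd s) h hS ha hb)
    (tendsto_phi_blowup hA (hA.bdd s) h ha hb) hv

end KernelBlowup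

/-! ### The model kernels: measurability, vanishing integrals, blow-ups. -/

section ModelKernels

variable {η κ lam : ℝ} {𝓔 : Fin n → Set (Matrix (Fin d) (Fin d) ℝ)} {F : ℝ → Sp n d → Sp n d}
  {ς : ℝ → Matrix (Fin d) (Fin d) ℝ}

theorem measurable_indicator_of_continuousAt {f : ℝ × Sp n d → ℝ} {U : Set (ℝ × Sp n d)}
    (hU : MeasurableSet U) (hf : ∀ q ∈ U, ContinuousAt f q) : Measurable (indicator U f) := by
  classical
  rw [← piecewise_eq_indicator]
  exact ContinuousOn.measurable_piecewise (fun q hq => (hf q hq).continuousWithinAt)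
    continuousOn_const hU

theorem continuous_qdist_left (hF : DriftAssumption η κ 𝓔 F) (hκ : 0 ≤ κ) (p : ℝ × Sp n d) :
    Continuous fun q => qdist F q p :=
  continuous_rho.comp ((continuous_const.sub continuous_fst).prodMk
    ((continuous_flow hF hκ p.1).sub continuous_const))

theorem continuous_qdist_right (hF : DriftAssumption η κ 𝓔 F) (p : ℝ × Sp n d) :
    Continuous fun q => qdist F p q :=
  continuous_rho.comp ((continuous_fst.sub continuous_const).prodMk
    (((continuous_flow_left hF p.1 p.2).comp continuous_fst).sub continuous_snd))

theorem qdist_self (hF : DriftAssumption η κ 𝓔 F) (p : ℝ × Sp n d) : qdist F p p = 0 := by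
  have h0 : ∀ i : Fin n, ‖block (0 : Sp n d) i‖ = 0 := fun i =>
    le_antisymm ((norm_block_le 0 i).trans norm_zero.le) (norm_nonneg _)
  rw [qdist, flow_self hF, sub_self, sub_self, rho, abs_zero, Real.zero_rpow (by norm_num), zero_add]
  refine Finset.sum_eq_zero fun i _ => ?_
  rw [h0, Real.zero_rpow (by positivity)]

variable [NeZero n]

/-- The kernel with coefficients frozen along the trajectory through the first point. -/
def frozenKer (F : ℝ → Sp n d → Sp n d) (ς : ℝ → Matrix (Fin d) (Fin d) ℝ) (i j : Fin d)
    (p : ℝ × Sp n d) : ℝ × Sp n d → ℝ :=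
  indicator {q | p.1 < q.1} fun q =>
    curveKer i j (linCurve F p.1 p.2) ς p.1 q.1 (flow F q.1 p.1 p.2 - q.2)

/-- The singular kernel as a function of its first point. -/
def backKer (F : ℝ → Sp n d → Sp n d) (ς : ℝ → Matrix (Fin d) (Fin d) ℝ) (i j : Fin d)
    (p q : ℝ × Sp n d) : ℝ := kKer F ς i j q.1 p.1 q.2 p.2

/-- The linearization is attached to the second point of the kernel, which is the fixed point `p`.
The integration variable enters only through an affine deviation, so no freezing is needed. -/
theorem backKer_eq (hη : 0 < η) (hκ : 0 ≤ κ) (hF : DriftAssumption η κ 𝓔 F)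
    (hς : DiffusionAssumption lam ς) (hlam : 1 ≤ lam) (i j : Fin d) (p : ℝ × Sp n d) :
    backKer F ς i j p = indicator {q | q.1 < p.1} fun q => curveKer i j (linCurve F p.1 p.2) ς q.1 p.1
      (act (Phi (linCurve F p.1 p.2) p.1 q.1) (q.2 - flow F q.1 p.1 p.2)) := by
  funext q
  unfold backKer
  by_cases hq : q.1 < p.1
  · rw [indicator_of_mem (by exact hq), kKer_eq hη hκ hF hς hlam i j hq]
  · rw [indicator_of_notMem (by exact hq), kKer, if_neg hq]

theorem measurable_frozenKer (h𝓔 : IsNondegenerateFamily 𝓔) (hη : 0 < η) (hκ : 0 ≤ κ)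
    (hF : DriftAssumption η κ 𝓔 F) (hς : DiffusionAssumption lam ς) (hlam : 1 ≤ lam) (i j : Fin d)
    (p : ℝ × Sp n d) : Measurable (frozenKer F ς i j p) := by
  refine measurable_indicator_of_continuousAt (measurableSet_lt measurable_const measurable_fst)
    fun q hq => ?_
  refine continuousAt_curveKer h𝓔 (isCurve_linCurve hη hκ hF p.1 p.2) hς hlam i j continuousAt_const
    continuousAt_fst ?_ hq
  exact (((continuous_flow_left hF p.1 p.2).comp continuous_fst).sub continuous_snd).continuousAt

theorem measurable_backKer (h𝓔 : IsNondegenerateFamily 𝓔) (hη : 0 < η) (hκ : 0 ≤ κ)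
    (hF : DriftAssumption η κ 𝓔 F) (hς : DiffusionAssumption lam ς) (hlam : 1 ≤ lam) (i j : Fin d)
    (p : ℝ × Sp n d) : Measurable (backKer F ς i j p) := by
  have hA := isCurve_linCurve hη hκ hF p.1 p.2
  rw [backKer_eq hη hκ hF hς hlam]
  refine measurable_indicator_of_continuousAt (measurableSet_lt measurable_fst measurable_const)
    fun q hq => ?_
  refine continuousAt_curveKer h𝓔 hA hς hlam i j continuousAt_fst continuousAt_const ?_ hq
  refine (continuous_act_uncurry.comp (((continuous_phi_right hA.meas hA.bdd p.1).comp
    continuous_fst).prodMk (continuous_snd.sub ?_))).continuousAt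
  exact (continuous_flow_left hF p.1 p.2).comp continuous_fst

theorem integral_frozenKer (h𝓔 : IsNondegenerateFamily 𝓔) (hη : 0 < η) (hκ : 0 ≤ κ)
    (hF : DriftAssumption η κ 𝓔 F) (hς : DiffusionAssumption lam ς) (hlam : 1 ≤ lam) (i j : Fin d)
    (p : ℝ × Sp n d) (t : ℝ) : ∫ y, frozenKer F ς i j p (t, y) = 0 := by
  unfold frozenKer
  by_cases ht : p.1 < t
  · have h1 := integral_sub_left_eq_self (curveKer i j (linCurve F p.1 p.2) ς p.1 t) volume
      (flow F t p.1 p.2)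
    rw [integral_curveKer h𝓔 (isCurve_linCurve hη hκ hF p.1 p.2) hς hlam i j ht] at h1
    rw [← h1]
    exact integral_congr_ae (ae_of_all _ fun y => indicator_of_mem (by exact ht) _)
  · rw [← integral_zero (Sp n d) ℝ]
    exact integral_congr_ae (ae_of_all _ fun y => indicator_of_notMem (by exact ht) _)

/-- The substitution `y ↦ Φ (y - θ)` has constant nonzero determinant and reduces the integral to
that of a differentiated Gaussian. -/
theorem integral_backKer (h𝓔 : IsNondegenerateFamily 𝓔) (hη : 0 < η) (hκ : 0 ≤ κ)
    (hF : DriftAssumption η κ 𝓔 F) (hς : DiffusionAssumption lam ς) (hlam : 1 ≤ lam) (i j : Fin d)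
    (p : ℝ × Sp n d) (t : ℝ) : ∫ y, backKer F ς i j p (t, y) = 0 := by
  have hA := isCurve_linCurve hη hκ hF p.1 p.2
  rw [backKer_eq hη hκ hF hς hlam]
  by_cases ht : t < p.1
  · have h1 := integral_comp_act (det_phi_ne_zero hA p.1 t)
      (curveKer i j (linCurve F p.1 p.2) ς t p.1)
    rw [integral_curveKer h𝓔 hA hς hlam i j ht, mul_zero,
      ← integral_sub_right_eq_self _ (flow F t p.1 p.2)] at h1
    rw [← h1]
    exact integral_congr_ae (ae_of_all _ fun y => indicator_of_mem (by exact ht) _)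
  · rw [← integral_zero (Sp n d) ℝ]
    exact integral_congr_ae (ae_of_all _ fun y => indicator_of_notMem (by exact ht) _)

/-- By exact homogeneity, zooming in on the kernel amounts to zooming in on its coefficients, which
become constant at a Lebesgue point. For `a ≤ 0` the kernel vanishes. -/
theorem exists_tendsto_frozenKer (h𝓔 : IsNondegenerateFamily 𝓔) (hη : 0 < η) (hκ : 0 ≤ κ)
    (hF : DriftAssumption η κ 𝓔 F) (hς : DiffusionAssumption lam ς) (hlam : 1 ≤ lam) (i j : Fin d)
    {s : ℝ} {x : Sp n d} (h : IsBlowup (linCurve F s x) s (linCurve F s x s))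
    (hS : IsBlowup (src (n := n) ς) s (src ς s)) {a : ℝ} (ha : a ∈ Icc (-2 : ℝ) 2) (w : Sp n d) :
    ∃ ℓ : ℝ, Tendsto (fun ε => ε ^ (n ^ 2 * d + 2) * frozenKer F ς i j (s, x)
      (s + ε ^ 2 * a, flow F (s + ε ^ 2 * a) s x + act (dil ε) w)) (𝓝[>] 0) (𝓝 ℓ) := by
  have hA := isCurve_linCurve hη hκ hF s x
  rcases lt_or_ge 0 a with h0 | h0
  · have ht := tendsto_curveKer_blowup h𝓔 hA hς hlam i j h hS zero_mem_window ha h0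
      (v := fun _ => -w) tendsto_const_nhds
    refine ⟨_, ht.congr' ?_⟩
    filter_upwards [self_mem_nhdsWithin] with ε hε
    have hε : 0 < ε := hε
    have hlt : s < s + ε ^ 2 * a := by have := mul_pos (sq_pos_of_pos hε) h0; linarith
    have e := curveKer_scaled hA hς hlam i j s hε 0 a (-w)
    rw [mul_zero, add_zero] at e
    rw [frozenKer, indicator_of_mem (by exact hlt)]
    simp only
    rw [sub_add_cancel_left, ← act_neg, e, ← mul_assoc, mul_inv_cancel₀ (by positivity), one_mul]
  · refine ⟨0, tendsto_const_nhds.congr' ?_⟩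
    filter_upwards [self_mem_nhdsWithin] with ε hε
    have hle : s + ε ^ 2 * a ≤ s := by
      have := mul_nonneg (sq_nonneg ε) (neg_nonneg.2 h0); linarith
    rw [frozenKer, indicator_of_notMem (by simpa using hle), mul_zero]

theorem exists_tendsto_backKer (h𝓔 : IsNondegenerateFamily 𝓔) (hη : 0 < η) (hκ : 0 ≤ κ)
    (hF : DriftAssumption η κ 𝓔 F) (hς : DiffusionAssumption lam ς) (hlam : 1 ≤ lam) (i j : Fin d)
    {s : ℝ} {x : Sp n d} (h : IsBlowup (linCurve F s x) s (linCurve F s x s))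
    (hS : IsBlowup (src (n := n) ς) s (src ς s)) {a : ℝ} (ha : a ∈ Icc (-2 : ℝ) 2) (w : Sp n d) :
    ∃ ℓ : ℝ, Tendsto (fun ε => ε ^ (n ^ 2 * d + 2) * backKer F ς i j (s, x)
      (s + ε ^ 2 * a, flow F (s + ε ^ 2 * a) s x + act (dil ε) w)) (𝓝[>] 0) (𝓝 ℓ) := by
  have hA := isCurve_linCurve hη hκ hF s x
  rw [backKer_eq hη hκ hF hς hlam]
  rcases lt_or_ge a 0 with h0 | h0
  · have ht := tendsto_curveKer_blowup h𝓔 hA hς hlam i j h hS ha zero_mem_window h0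
      (tendsto_act (tendsto_phi_blowup hA (hA.bdd s) h ha zero_mem_window)
        (tendsto_const_nhds (x := w)))
    refine ⟨_, ht.congr' ?_⟩
    filter_upwards [self_mem_nhdsWithin] with ε hε
    have hε : 0 < ε := hε
    have hlt : s + ε ^ 2 * a < s := by have := mul_pos (sq_pos_of_pos hε) (neg_pos.2 h0); linarith
    have e := curveKer_scaled hA hς hlam i j s hε a 0
      (act (Phi (fun u => linCurve F s x (s + ε ^ 2 * u)) 0 a) w)
    have e2 : act (Phi (linCurve F s x) s (s + ε ^ 2 * a)) (act (dil ε) w) =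
        act (dil ε) (act (Phi (fun u => linCurve F s x (s + ε ^ 2 * u)) 0 a) w) := by
      rw [phi_rescale hA.meas hA.bdd hA.sub hε, mul_zero, add_zero, mul_assoc, act_mul, act_mul,
        act_dil_dil_inv hε.ne']
    rw [mul_zero, add_zero] at e
    rw [indicator_of_mem (by exact hlt)]
    simp only
    rw [add_sub_cancel_left, e2, e, ← mul_assoc, mul_inv_cancel₀ (by positivity), one_mul]
  · refine ⟨0, tendsto_const_nhds.congr' ?_⟩
    filter_upwards [self_mem_nhdsWithin] with ε hε
    have hle : s ≤ s + ε ^ 2 * a := by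
      have := mul_nonneg (sq_nonneg ε) h0; linarith
    rw [indicator_of_notMem (by simpa using hle), mul_zero]

/-- This serves measurability only: the curve of linearization varies with `q`, so continuity is
read off from the quantitative Hölder estimate. The bound on the time gap keeps the scale at most
`2`. -/
theorem continuousAt_kKer (h𝓔 : IsNondegenerateFamily 𝓔) (hlam : 1 ≤ lam) (hη : 0 < η) (hη1 : η ≤ 1)
    (hκ : 0 ≤ κ) (hF : DriftAssumption η κ 𝓔 F) (hς : DiffusionAssumption lam ς) (i j : Fin d)
    (p : ℝ × Sp n d) {q : ℝ × Sp n d} (h1 : p.1 < q.1) (h2 : q.1 < p.1 + 4) :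
    ContinuousAt (fun q => kKer F ς i j p.1 q.1 p.2 q.2) q := by
  obtain ⟨D, hD, h⟩ := exists_kKer_second (n := n) h𝓔 hlam hη hη1 hκ 0
  have hr : 0 < √(q.1 - p.1) := Real.sqrt_pos.2 (by linarith)
  have hsq : √(q.1 - p.1) ^ 2 = q.1 - p.1 := Real.sq_sqrt (by linarith)
  have hr2 : √(q.1 - p.1) ≤ 2 := by
    rw [show (2 : ℝ) = √4 by rw [show (4 : ℝ) = 2 ^ 2 by norm_num]; simp]
    exact Real.sqrt_le_sqrt (by linarith)
  have hb := fun q' : ℝ × Sp n d => h F ς hF hς i j q.1 _ q'.1 q.2 p.2 q'.2 hr hr2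
  simp only [hsq, sub_sub_cancel, pow_zero, div_one] at hb
  generalize √(q.1 - p.1) = r at *
  have hc := continuous_qdist_right hF q
  have hq0 := qdist_self hF q
  rw [ContinuousAt, tendsto_iff_norm_sub_tendsto_zero]
  have hlim : Tendsto (fun q' => (r ^ (n ^ 2 * d + 2))⁻¹ * (D * (qdist F q q' / r) ^ η)) (𝓝 q)
      (𝓝 0) := by
    have hc2 : Continuous fun q' => (r ^ (n ^ 2 * d + 2))⁻¹ * (D * (qdist F q q' / r) ^ η) :=
      continuous_const.mul (continuous_const.mul ((hc.div_const r).rpow_const fun _ => Or.inr hη.le))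
    have := hc2.tendsto q
    simpa only [hq0, zero_div, Real.zero_rpow hη.ne', mul_zero] using this
  have hev : ∀ᶠ q' in 𝓝 q, gapConst n d * qdist F q q' ≤ r := by
    have := (hc.tendsto q).const_mul (gapConst n d)
    rw [hq0, mul_zero] at this
    exact (this.eventually_lt_const hr).mono fun _ h => h.le
  refine squeeze_zero' (Eventually.of_forall fun _ => norm_nonneg _) ?_ hlim
  filter_upwards [hev] with q' hq'
  rw [norm_sub_rev]
  exact hb q' hq'

theorem aestronglyMeasurable_kLoc (h𝓔 : IsNondegenerateFamily 𝓔) (hlam : 1 ≤ lam) (hη : 0 < η)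
    (hη1 : η ≤ 1) (hκ : 0 ≤ κ) (hF : DriftAssumption η κ 𝓔 F) (hς : DiffusionAssumption lam ς)
    {χ : ℝ × Sp n d → ℝ} (hχ : Continuous χ) (i j : Fin d) {T : ℝ} (hT : T ≤ 1) {p : ℝ × Sp n d}
    (hp : p.1 ∈ Icc (-T) T) : AEStronglyMeasurable (kLoc F ς χ i j p) (stripMeasure n d T) := by
  have hm : Measurable (indicator {q : ℝ × Sp n d | p.1 < q.1 ∧ q.1 < p.1 + 4} (kLoc F ς χ i j p)) := by
    refine measurable_indicator_of_continuousAt ((measurableSet_lt measurable_const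
      measurable_fst).inter (measurableSet_lt measurable_fst measurable_const)) fun q hq => ?_
    refine ContinuousAt.mul ?_ (continuousAt_kKer h𝓔 hlam hη hη1 hκ hF hς i j p hq.1 hq.2)
    exact (hχ.comp ((continuous_fst.sub continuous_const).prodMk
      (((continuous_flow_left hF p.1 p.2).comp continuous_fst).sub continuous_snd))).continuousAt
  refine hm.aestronglyMeasurable.congr ?_
  rw [← restrict_strip]
  filter_upwards [ae_restrict_mem (measurableSet_Icc.prod MeasurableSet.univ)] with q hq
  by_cases hlt : p.1 < q.1
  · exact indicator_of_mem (by exact ⟨hlt, by linarith [hq.1.2, hp.1]⟩) _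
  · rw [indicator_of_notMem (fun hc => hlt hc.1), kLoc_eq_zero (not_lt.1 hlt)]

end ModelKernels

/-! ### The cancellation property of the two kernels. -/

section Cancellation

variable {η κ lam : ℝ} {𝓔 : Fin n → Set (Matrix (Fin d) (Fin d) ℝ)}

/-- The cut-off equals one up to distance `δ`, and beyond that `R / δ ≥ 1`. The cut-off error is
thus linear in the distance and integrable against the kernel. -/
theorem IsCutoff.abs_sub_one_le {δ X R : ℝ} {χ : ℝ × Sp n d → ℝ} (hχ : IsCutoff δ χ) (hδ : 0 < δ)
    (hX : ∀ p, |χ p| ≤ X) {p : ℝ × Sp n d} (hR : rho p.1 p.2 ≤ R) :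
    |χ p - 1| ≤ (X + 1) * (R / δ) := by
  have hR0 : 0 ≤ R := (rho_nonneg _ _).trans hR
  have hX0 : 0 ≤ X := (abs_nonneg _).trans (hX p)
  by_cases h : rho p.1 p.2 ≤ δ
  · rw [hχ.eq_one p h, sub_self, abs_zero]
    positivity
  · have h1 : 1 ≤ R / δ := (one_le_div hδ).2 (by linarith)
    have h2 : |χ p - 1| ≤ X + 1 := by
      refine (abs_sub _ _).trans ?_
      rw [abs_one]
      linarith [hX p]
    exact h2.trans (le_mul_of_one_le_right (by linarith) h1)

/-- The splitting is `c k - k₀ = c (k - k₀) + (c - 1) k₀`. The second term spends one power of decay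
to turn the distance into `r`, and `r ≤ 2 r ^ η`. -/
theorem abs_cutoff_mul_sub_le {c X δ G D D' r w N η k k₀ : ℝ} {M : ℕ} (hr : 0 ≤ r) (hw : 0 ≤ w)
    (hδ : 0 < δ) (hG : 0 ≤ G) (hN : 0 ≤ N) (hD' : 0 ≤ D') (hX : |c| ≤ X)
    (hc : |c - 1| ≤ (X + 1) * (G * (r * (1 + w)) / δ)) (hk : |k - k₀| ≤ N * (D * r ^ η / (1 + w) ^ M))
    (hk₀ : |k₀| ≤ N * (D' / (1 + w) ^ (M + 1))) (hη : r ≤ 2 * r ^ η) :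
    |c * k - k₀| ≤ (X * D + 2 * ((X + 1) * (G / δ)) * D') * r ^ η * (N * (1 / (1 + w) ^ M)) := by
  have hX0 : 0 ≤ X := (abs_nonneg _).trans hX
  have e : c * k - k₀ = c * (k - k₀) + (c - 1) * k₀ := by ring
  rw [e]
  refine (abs_add_le _ _).trans ?_
  rw [abs_mul, abs_mul]
  have h1 : |c| * |k - k₀| ≤ X * (N * (D * r ^ η / (1 + w) ^ M)) :=
    mul_le_mul hX hk (abs_nonneg _) hX0
  have h2 : |c - 1| * |k₀| ≤
      (X + 1) * (G * (r * (1 + w)) / δ) * (N * (D' / (1 + w) ^ (M + 1))) :=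
    mul_le_mul hc hk₀ (abs_nonneg _) (by positivity)
  have e2 : (X + 1) * (G * (r * (1 + w)) / δ) * (N * (D' / (1 + w) ^ (M + 1))) =
      r * ((X + 1) * (G / δ) * (D' * (N * (1 / (1 + w) ^ M)))) := by
    rw [pow_succ]
    field_simp
  have h3 : r * ((X + 1) * (G / δ) * (D' * (N * (1 / (1 + w) ^ M)))) ≤
      2 * r ^ η * ((X + 1) * (G / δ) * (D' * (N * (1 / (1 + w) ^ M)))) :=
    mul_le_mul_of_nonneg_right hη (by positivity)
  rw [e2] at h2
  calc _ ≤ _ := add_le_add h1 (h2.trans h3)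
    _ = _ := by ring

theorem le_two_mul_rpow {r η : ℝ} (h0 : 0 < r) (h2 : r ≤ 2) (hη : 0 < η) (hη1 : η ≤ 1) :
    r ≤ 2 * r ^ η := by
  rcases le_total r 1 with h | h
  · have := Real.rpow_le_rpow_of_exponent_ge h0 h hη1
    rw [Real.rpow_one] at this
    linarith [Real.rpow_nonneg h0.le η]
  · have := Real.one_le_rpow h hη.le
    linarith

theorem sqrt_rpow_eq {a : ℝ} (ha : 0 ≤ a) (η : ℝ) : √a ^ η = a ^ (η / 2) := by
  rw [Real.sqrt_eq_rpow, ← Real.rpow_mul ha]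
  congr 1
  ring

theorem rpow_le_two {r η : ℝ} (h0 : 0 < r) (h2 : r ≤ 2) (hη : 0 < η) (hη1 : η ≤ 1) : r ^ η ≤ 2 := by
  refine (Real.rpow_le_rpow h0.le h2 hη.le).trans ?_
  have := Real.rpow_le_rpow_of_exponent_le (one_le_two : (1 : ℝ) ≤ 2) hη1
  rwa [Real.rpow_one] at this

theorem sqrt_abs_sub_bounds {T s t : ℝ} (hT : T ≤ 1) (hs : s ∈ Icc (-T) T) (ht : t ∈ Icc (-T) T)
    (hts : t ≠ s) : 0 < √|t - s| ∧ √|t - s| ≤ 2 ∧ √|t - s| ^ 2 = |t - s| := by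
  have h1 : |t - s| ≤ 4 := by
    rw [abs_le]; constructor <;> linarith [ht.1, ht.2, hs.1, hs.2]
  refine ⟨Real.sqrt_pos.2 (abs_pos.2 (sub_ne_zero.2 hts)), ?_, Real.sq_sqrt (abs_nonneg _)⟩
  rw [show (2 : ℝ) = √4 by rw [show (4 : ℝ) = 2 ^ 2 by norm_num]; simp]
  exact Real.sqrt_le_sqrt h1

theorem truncDomain_restrict {F : ℝ → Sp n d → Sp n d} (hF : DriftAssumption η κ 𝓔 F) (hκ : 0 ≤ κ)
    (T ε : ℝ) (p : ℝ × Sp n d) : volume.restrict (truncDomain F T ε p) =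
      (stripMeasure n d T).restrict {q | ε < qdist F q p} := by
  have hm : MeasurableSet {q | ε < qdist F q p} :=
    measurableSet_lt measurable_const (continuous_qdist_left hF hκ p).measurable
  rw [← restrict_strip, Measure.restrict_restrict hm, inter_comm]
  rfl

theorem gauge_bounds {F : ℝ → Sp n d → Sp n d} (hF : DriftAssumption η κ 𝓔 F)
    (hη : 0 < η) (hη1 : η ≤ 1) (hκ : 0 ≤ κ) {T s : ℝ} (hT : T ≤ 1) (hs : s ∈ Icc (-T) T) (x : Sp n d) :
    (∀ t y, √|t - s| ≤ qdist F (t, y) (s, x)) ∧ ∀ t ∈ Icc (-T) T, t ≠ s → ∀ y,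
      qdist F (t, y) (s, x) ≤ distConst n d κ * (√|t - s| *
        (1 + ‖act (dil (√|t - s|)⁻¹) (y - flow F t s x)‖)) := by
  refine ⟨fun t y => ?_, fun t ht hts y => ?_⟩
  · rw [abs_sub_comm]
    exact sqrt_le_rho _ _
  · obtain ⟨hr0, hr2, hsq⟩ := sqrt_abs_sub_bounds hT hs ht hts
    exact qdist_le_back hF hη hη1 hκ hr0 hr2 (p := (t, y)) (q := (s, x)) (by rw [hsq, abs_sub_comm])

/-- The cancellation property of a kernel with model kernels `k₀ p` that have blow-ups. -/
theorem cancellation_of_isCancelling {F : ℝ → Sp n d → Sp n d} (hF : DriftAssumption η κ 𝓔 F)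
    (hη : 0 < η) (hη1 : η ≤ 1) (hκ : 0 ≤ κ) {T D G : ℝ} {M : ℕ} (hT : T ≤ 1) (hD : 0 ≤ D) (hG : 0 ≤ G)
    (hM : n * d < M) {k k₀ : ℝ × Sp n d → ℝ × Sp n d → ℝ}
    (h : ∀ p : ℝ × Sp n d, p.1 ∈ Icc (-T) T → IsCancelling T p.1 D G η M (fun t => flow F t p.1 p.2)
      (fun q => qdist F q p) (k p) (k₀ p))
    (hm : ∀ p, Measurable (k₀ p)) {S : ℝ → Prop} (hS : ∀ᵐ s, S s)
    (hblow : ∀ s x, S s → IsBlowup (linCurve F s x) s (linCurve F s x s) → ∀ a ∈ Icc (-2 : ℝ) 2, ∀ w,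
      ∃ ℓ : ℝ, Tendsto (fun ε => ε ^ (n ^ 2 * d + 2) *
        k₀ (s, x) (s + ε ^ 2 * a, flow F (s + ε ^ 2 * a) s x + act (dil ε) w)) (𝓝[>] 0) (𝓝 ℓ)) :
    Cancellation F T (D * majMass n d M * timeMass (η / 2 - 1) +
      D * G * majMass n d M * timeMass (-(1 / 2))) k := by
  constructor
  · intro p hp ε hε
    have hc := h p hp.1
    rw [IntegrableOn, truncDomain_restrict hF hκ]
    exact ⟨(hc.integrableOn hD hG hT hp.1 hM hη hε).1,
      hc.abs_integral_le hD hG hT hp.1 hM hη (hm p) hε⟩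
  · rw [restrict_strip]
    -- The good times are interior Lebesgue points. The condition holds for all `x` at once, so it
    -- passes to almost every point of the strip through the time projection.
    have h1 : ∀ᵐ s ∂(volume.restrict (Icc (-T) T)), s ∈ Ioo (-T) T ∧ S s ∧
        ∀ x, IsBlowup (fun u => subGrad F u x) s (subGrad F s x) := by
      filter_upwards [ae_restrict_mem measurableSet_Icc, ae_restrict_of_ae (Measure.ae_ne volume (-T)),
        ae_restrict_of_ae (Measure.ae_ne volume T), ae_restrict_of_ae hS,
        ae_restrict_of_ae (ae_isBlowup_subGrad hη hκ hF)] with s h1 h2 h3 h4 h5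
      exact ⟨⟨lt_of_le_of_ne h1.1 h2.symm, lt_of_le_of_ne h1.2 h3⟩, h4, h5⟩
    have h2 : ∀ᵐ p ∂(stripMeasure n d T), p.1 ∈ Ioo (-T) T ∧ S p.1 ∧
        ∀ x, IsBlowup (fun u => subGrad F u x) p.1 (subGrad F p.1 x) :=
      Measure.quasiMeasurePreserving_fst.ae h1
    filter_upwards [h2] with p hp
    obtain ⟨s, x⟩ := p
    obtain ⟨hs, hSs, hb⟩ := hp
    have hc := h (s, x) (Ioo_subset_Icc_self hs)
    have hA := isCurve_linCurve hη hκ hF s x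
    have hbl : IsBlowup (linCurve F s x) s (linCurve F s x s) := by
      rw [linCurve_self hF]
      exact isBlowup_linCurve hη hκ hF (hb x)
    simp_rw [truncDomain_restrict hF hκ]
    refine hc.exists_tendsto hD hG hT hs hM hη (hm _) ?_
    filter_upwards [ae_ne_zero_window, ae_restrict_mem measurableSet_Icc,
      ae_restrict_of_ae (ae_rho_ne_one n d)] with a ha0 ha har
    exact hc.exists_tendsto_slice hs hM (hm _) ha0 (hblow s x hSs hbl a ha)
      (tendsto_qdist_blowup hη hη1 hκ hF hbl ha) (har _ (det_phi_ne_zero (hA.const s) 0 a))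

variable [NeZero n]

/-- The pointwise bounds for the kernel and its frozen version. -/
theorem exists_frozenKer_bounds (h𝓔 : IsNondegenerateFamily 𝓔) (hlam : 1 ≤ lam) (hη : 0 < η)
    (hη1 : η ≤ 1) (hκ : 0 ≤ κ) {δ : ℝ} (hδ : 0 < δ) {χ : ℝ × Sp n d → ℝ} (hχ : IsCutoff δ χ) (M : ℕ) :
    ∃ D : ℝ, 0 < D ∧ ∀ (F : ℝ → Sp n d → Sp n d)
      (ς : ℝ → Matrix (Fin d) (Fin d) ℝ), DriftAssumption η κ 𝓔 F → DiffusionAssumption lam ς →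
      ∀ (i j : Fin d) (T s t : ℝ) (x y : Sp n d), T ≤ 1 → s ∈ Icc (-T) T → t ∈ Icc (-T) T → t ≠ s →
      |frozenKer F ς i j (s, x) (t, y)| ≤ D * maj (M + 1) √|t - s| (flow F t s x) y ∧
      |kLoc F ς χ i j (s, x) (t, y) - frozenKer F ς i j (s, x) (t, y)| ≤
        D * |t - s| ^ (η / 2) * maj M √|t - s| (flow F t s x) y := by
  obtain ⟨D, hD, h⟩ := exists_kKer_le (n := n) h𝓔 hlam hη hη1 hκ (M + 1)
  obtain ⟨D', hD', h'⟩ := exists_kKer_frozen (n := n) h𝓔 hlam hη hη1 hκ (M + 1)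
  obtain ⟨X, hX0, hX, -⟩ := hχ.exists_bounds hδ
  obtain ⟨G, hG⟩ : ∃ G, G = distConst n d κ := ⟨_, rfl⟩
  have hG0 : 0 ≤ G := by rw [hG]; linarith [one_le_distConst (n := n) (d := d) hκ]
  have hD1 : 0 ≤ X * D' + 2 * ((X + 1) * (G / δ)) * (D + 2 * D') := by positivity
  refine ⟨(D + 2 * D') + (X * D' + 2 * ((X + 1) * (G / δ)) * (D + 2 * D')), by positivity,
    fun F ς hF hς i j T s t x y hT hs ht hts => ?_⟩
  obtain ⟨hr0, hr2, hsq⟩ := sqrt_abs_sub_bounds hT hs ht hts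
  have hmaj := fun M => maj_nonneg M hr0.le (flow F t s x) y
  rcases lt_or_gt_of_ne hts with hlt | hlt
  · rw [frozenKer, indicator_of_notMem (by simpa using hlt.le), kLoc_eq_zero (by exact hlt.le), sub_zero,
      abs_zero]
    exact ⟨mul_nonneg (by positivity) (hmaj _), mul_nonneg (by positivity) (hmaj _)⟩
  · have hk := (h F ς hF hς i j s _ x y hr0 hr2).1
    have hf := h' F ς hF hς i j s _ x y hr0 hr2
    have hq := qdist_le (F := F) hκ hr0 (p := (s, x)) (q := (t, y)) (by rw [hsq])
    have hst : s + |t - s| = t := by rw [abs_of_pos (sub_pos.2 hlt)]; ring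
    have hp : |t - s| ^ (η / 2) = √|t - s| ^ η := (sqrt_rpow_eq (abs_nonneg _) η).symm
    rw [hp]
    rw [hsq, hst] at hk hf
    rw [← hG] at hq
    rw [frozenKer, indicator_of_mem (by exact hlt), kLoc]
    simp only at hq ⊢
    have hcut := hχ.abs_sub_one_le hδ hX (p := (t - s, flow F t s x - y)) hq
    have hXp := hX (t - s, flow F t s x - y)
    unfold maj
    rw [norm_act_sub_comm _ y]
    have hrη := le_two_mul_rpow hr0 hr2 hη hη1
    have hr2' := rpow_le_two hr0 hr2 hη hη1
    have hw := norm_nonneg (act (dil (√|t - s|)⁻¹) (flow F t s x - y))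
    generalize ‖act (dil (√|t - s|)⁻¹) (flow F t s x - y)‖ = w at *
    generalize √|t - s| = r at *
    generalize χ (t - s, flow F t s x - y) = c at *
    generalize kKer F ς i j s t x y = k at *
    generalize curveKer i j (linCurve F s x) ς s t (flow F t s x - y) = k₀ at *
    have hN : 0 ≤ (r ^ (n ^ 2 * d + 2))⁻¹ := by positivity
    generalize (r ^ (n ^ 2 * d + 2))⁻¹ = N at *
    -- The frozen kernel inherits its decay from the kernel and the freezing error, using `r ^ η ≤
    -- 2`.
    have hk₀ : |k₀| ≤ N * ((D + 2 * D') / (1 + w) ^ (M + 1)) := by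
      have e : k₀ = k - (k - k₀) := by ring
      rw [e]
      refine (abs_sub _ _).trans ((add_le_add hk hf).trans ?_)
      rw [← mul_add, ← add_div]
      refine mul_le_mul_of_nonneg_left (div_le_div_of_nonneg_right ?_ (by positivity)) hN
      nlinarith
    have hkk : |k - k₀| ≤ N * (D' * r ^ η / (1 + w) ^ M) := by
      refine hf.trans (mul_le_mul_of_nonneg_left ?_ hN)
      refine div_le_div_of_nonneg_left (by positivity) (by positivity) ?_
      exact pow_le_pow_right₀ (by linarith) (Nat.le_succ M)
    constructor
    · refine hk₀.trans ?_
      rw [div_eq_mul_one_div, mul_left_comm]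
      refine mul_le_mul_of_nonneg_right ?_ (by positivity)
      linarith
    · refine (abs_cutoff_mul_sub_le hr0.le hw hδ hG0 hN (by positivity) hXp hcut hkk hk₀ hrη).trans ?_
      refine mul_le_mul_of_nonneg_right (mul_le_mul_of_nonneg_right ?_ (by positivity)) (by positivity)
      linarith

/-- The pointwise bounds for the adjoint kernel. -/
theorem exists_backKer_bounds (h𝓔 : IsNondegenerateFamily 𝓔) (hlam : 1 ≤ lam) (hη : 0 < η)
    (hη1 : η ≤ 1) (hκ : 0 ≤ κ) {δ : ℝ} (hδ : 0 < δ) {χ : ℝ × Sp n d → ℝ} (hχ : IsCutoff δ χ) (M : ℕ) :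
    ∃ D : ℝ, 0 < D ∧ ∀ (F : ℝ → Sp n d → Sp n d)
      (ς : ℝ → Matrix (Fin d) (Fin d) ℝ), DriftAssumption η κ 𝓔 F → DiffusionAssumption lam ς →
      ∀ (i j : Fin d) (T s t : ℝ) (x y : Sp n d), T ≤ 1 → s ∈ Icc (-T) T → t ∈ Icc (-T) T → t ≠ s →
      |backKer F ς i j (s, x) (t, y)| ≤ D * maj (M + 1) √|t - s| (flow F t s x) y ∧
      |kLocAdj F ς χ i j (s, x) (t, y) - backKer F ς i j (s, x) (t, y)| ≤
        D * |t - s| ^ (η / 2) * maj M √|t - s| (flow F t s x) y := by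
  obtain ⟨D, hD, h⟩ := exists_kKer_le (n := n) h𝓔 hlam hη hη1 hκ (M + 1)
  obtain ⟨X, hX0, hX, -⟩ := hχ.exists_bounds hδ
  obtain ⟨G, hG⟩ : ∃ G, G = distConst n d κ := ⟨_, rfl⟩
  have hG0 : 0 ≤ G := by rw [hG]; linarith [one_le_distConst (n := n) (d := d) hκ]
  have hD1 : 0 ≤ X * 0 + 2 * ((X + 1) * (G / δ)) * D := by positivity
  refine ⟨D + (X * 0 + 2 * ((X + 1) * (G / δ)) * D), by positivity,
    fun F ς hF hς i j T s t x y hT hs ht hts => ?_⟩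
  obtain ⟨hr0, hr2, hsq⟩ := sqrt_abs_sub_bounds hT hs ht hts
  have hmaj := fun M => maj_nonneg M hr0.le (flow F t s x) y
  rcases lt_or_gt_of_ne hts with hlt | hlt
  · have hk₀ := (h F ς hF hς i j t _ y x hr0 hr2).2
    have hq := qdist_le_back hF hη hη1 hκ hr0 hr2 (p := (t, y)) (q := (s, x))
      (by rw [hsq, abs_sub_comm])
    have hst : t + |t - s| = s := by rw [abs_of_neg (sub_neg.2 hlt)]; ring
    have hp : |t - s| ^ (η / 2) = √|t - s| ^ η := (sqrt_rpow_eq (abs_nonneg _) η).symm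
    rw [hp]
    rw [hsq, hst] at hk₀
    rw [← hG] at hq
    rw [backKer, kLocAdj, kLoc]
    simp only at hq ⊢
    have hcut := hχ.abs_sub_one_le hδ hX (p := (s - t, flow F s t y - x)) hq
    have hXp := hX (s - t, flow F s t y - x)
    unfold maj
    have hrη := le_two_mul_rpow hr0 hr2 hη hη1
    have hw := norm_nonneg (act (dil (√|t - s|)⁻¹) (y - flow F t s x))
    generalize ‖act (dil (√|t - s|)⁻¹) (y - flow F t s x)‖ = w at *
    generalize √|t - s| = r at *
    generalize χ (s - t, flow F s t y - x) = c at *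
    generalize kKer F ς i j t s y x = k₀ at *
    have hN : 0 ≤ (r ^ (n ^ 2 * d + 2))⁻¹ := by positivity
    generalize (r ^ (n ^ 2 * d + 2))⁻¹ = N at *
    -- The model is the kernel itself, so the error is due to the cut-off alone.
    have hkk : |k₀ - k₀| ≤ N * (0 * r ^ η / (1 + w) ^ M) := by simp
    constructor
    · refine hk₀.trans ?_
      rw [div_eq_mul_one_div, mul_left_comm]
      refine mul_le_mul_of_nonneg_right ?_ (by positivity)
      linarith
    · refine (abs_cutoff_mul_sub_le hr0.le hw hδ hG0 hN hD.le hXp hcut hkk hk₀ hrη).trans ?_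
      refine mul_le_mul_of_nonneg_right (mul_le_mul_of_nonneg_right ?_ (by positivity)) (by positivity)
      linarith
  · rw [backKer, kLocAdj, kLoc_eq_zero (by exact hlt.le), kKer, if_neg (by simpa using hlt.le), sub_zero,
      abs_zero]
    exact ⟨mul_nonneg (by positivity) (hmaj _), mul_nonneg (by positivity) (hmaj _)⟩

theorem exists_cancellation (h𝓔 : IsNondegenerateFamily 𝓔) (hlam : 1 ≤ lam) (hη : 0 < η)
    (hη1 : η ≤ 1) (hκ : 0 ≤ κ) {δ : ℝ} (hδ : 0 < δ) {χ : ℝ × Sp n d → ℝ} (hχ : IsCutoff δ χ) :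
    ∃ C : ℝ, 0 ≤ C ∧ ∀ (F : ℝ → Sp n d → Sp n d)
      (ς : ℝ → Matrix (Fin d) (Fin d) ℝ), DriftAssumption η κ 𝓔 F → DiffusionAssumption lam ς →
      ∀ (i j : Fin d) (T : ℝ), T ≤ 1 → Cancellation F T C (kLoc F ς χ i j) := by
  obtain ⟨D, hD, h⟩ := exists_frozenKer_bounds (n := n) h𝓔 hlam hη hη1 hκ hδ hχ (n * d + 1)
  have hG : 0 ≤ distConst n d κ := by linarith [one_le_distConst (n := n) (d := d) hκ]
  -- Decay of order `n d + 1`, one more than the dimension of space, makes the majorant integrable.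
  have hM : n * d < n * d + 1 := Nat.lt_succ_self _
  refine ⟨_, ?_, fun F ς hF hς i j T hT => cancellation_of_isCancelling hF hη hη1 hκ hT hD.le hG hM
    (k₀ := frozenKer F ς i j) (fun p hp => ?_) (measurable_frozenKer h𝓔 hη hκ hF hς hlam i j)
    (ae_isBlowup (stronglyMeasurable_src (n := n) hς) (norm_src_le hς hlam))
    fun s x hS hb a ha w => exists_tendsto_frozenKer h𝓔 hη hκ hF hς hlam i j hb hS ha w⟩
  · have h1 := majMass_nonneg (n := n) (d := d) (n * d + 1)
    have h2 := timeMass_nonneg (η / 2 - 1)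
    have h3 := timeMass_nonneg (-(1 / 2))
    positivity
  · obtain ⟨s, x⟩ := p
    obtain ⟨g1, g2⟩ := gauge_bounds hF hη hη1 hκ hT hp x
    exact
      { meas := aestronglyMeasurable_kLoc h𝓔 hlam hη hη1 hκ hF hς hχ.smooth.continuous i j hT hp
        meas₀ := (measurable_frozenKer h𝓔 hη hκ hF hς hlam i j _).aestronglyMeasurable
        gauge_meas := (continuous_qdist_left hF hκ _).measurable
        le_gauge := g1
        gauge_le := g2
        le₀ := fun t ht hts y => (h F ς hF hς i j T s t x y hT hp ht hts).1
        sub_le := fun t ht hts y => (h F ς hF hς i j T s t x y hT hp ht hts).2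
        integral_eq_zero := fun t _ _ => integral_frozenKer h𝓔 hη hκ hF hς hlam i j _ t }

theorem exists_cancellation_adj (h𝓔 : IsNondegenerateFamily 𝓔) (hlam : 1 ≤ lam) (hη : 0 < η)
    (hη1 : η ≤ 1) (hκ : 0 ≤ κ) {δ : ℝ} (hδ : 0 < δ) {χ : ℝ × Sp n d → ℝ} (hχ : IsCutoff δ χ) :
    ∃ C : ℝ, 0 ≤ C ∧ ∀ (F : ℝ → Sp n d → Sp n d)
      (ς : ℝ → Matrix (Fin d) (Fin d) ℝ), DriftAssumption η κ 𝓔 F → DiffusionAssumption lam ς →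
      ∀ (i j : Fin d) (T : ℝ), T ≤ 1 → Cancellation F T C (kLocAdj F ς χ i j) := by
  obtain ⟨D, hD, h⟩ := exists_backKer_bounds (n := n) h𝓔 hlam hη hη1 hκ hδ hχ (n * d + 1)
  have hG : 0 ≤ distConst n d κ := by linarith [one_le_distConst (n := n) (d := d) hκ]
  have hM : n * d < n * d + 1 := Nat.lt_succ_self _
  refine ⟨_, ?_, fun F ς hF hς i j T hT => cancellation_of_isCancelling hF hη hη1 hκ hT hD.le hG hM
    (k₀ := backKer F ς i j) (fun p hp => ?_) (measurable_backKer h𝓔 hη hκ hF hς hlam i j)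
    (ae_isBlowup (stronglyMeasurable_src (n := n) hς) (norm_src_le hς hlam))
    fun s x hS hb a ha w => exists_tendsto_backKer h𝓔 hη hκ hF hς hlam i j hb hS ha w⟩
  · have h1 := majMass_nonneg (n := n) (d := d) (n * d + 1)
    have h2 := timeMass_nonneg (η / 2 - 1)
    have h3 := timeMass_nonneg (-(1 / 2))
    positivity
  · obtain ⟨s, x⟩ := p
    obtain ⟨g1, g2⟩ := gauge_bounds hF hη hη1 hκ hT hp x
    have hm := measurable_backKer h𝓔 hη hκ hF hς hlam i j (s, x)
    have hχm : Measurable fun q : ℝ × Sp n d => χ (s - q.1, flow F s q.1 q.2 - x) :=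
      (hχ.smooth.continuous.comp ((continuous_const.sub continuous_fst).prodMk
        ((continuous_flow hF hκ s).sub continuous_const))).measurable
    exact
      { meas := (hχm.mul hm).aestronglyMeasurable
        meas₀ := hm.aestronglyMeasurable
        gauge_meas := (continuous_qdist_left hF hκ _).measurable
        le_gauge := g1
        gauge_le := g2
        le₀ := fun t ht hts y => (h F ς hF hς i j T s t x y hT hp ht hts).1
        sub_le := fun t ht hts y => (h F ς hF hς i j T s t x y hT hp ht hts).2
        integral_eq_zero := fun t _ _ => integral_backKer h𝓔 hη hκ hF hς hlam i j _ t }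

end Cancellation

/-! ### Monotonicity in the constants. -/

section Monotonicity

variable {η κ κ' T Λ c C C' : ℝ} {𝓔 : Fin n → Set (Matrix (Fin d) (Fin d) ℝ)}
  {F : ℝ → Sp n d → Sp n d} {k : ℝ × Sp n d → ℝ × Sp n d → ℝ}

theorem DriftAssumption.mono (hF : DriftAssumption η κ 𝓔 F) (h : κ ≤ κ') : DriftAssumption η κ' 𝓔 F :=
  { hF with
    lip := fun t x x' => (hF.lip t x x').trans (mul_le_mul_of_nonneg_right h (norm_nonneg _))
    holder := fun t x x' i j hij k l => (hF.holder t x x' i j hij k l).trans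
      (mul_le_mul_of_nonneg_right h (by positivity)) }

theorem SizeEstimate.mono (hk : SizeEstimate F T C k) (h : C ≤ C') : SizeEstimate F T C' k :=
  fun p hp q hq => (hk p hp q hq).trans
    (div_le_div_of_nonneg_right h (pow_nonneg (qdist_nonneg F p q) _))

theorem SmoothnessEstimate.mono (hk : SmoothnessEstimate F η T Λ c C k) (h : C ≤ C') :
    SmoothnessEstimate F η T Λ c C' k := fun p hp p' hp' q hq h1 h2 =>
  (hk p hp p' hp' q hq h1 h2).trans (mul_le_mul_of_nonneg_right h (by
    have := qdist_nonneg F p p'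
    have := qdist_nonneg F p q
    positivity))

theorem Cancellation.mono (hk : Cancellation F T C k) (h : C ≤ C') : Cancellation F T C' k :=
  ⟨fun p hp ε hε => ⟨(hk.1 p hp ε hε).1, (hk.1 p hp ε hε).2.trans h⟩, hk.2⟩

end Monotonicity

end DegenerateCZ

end

/-! ### The main theorem. -/

open DegenerateCZ in
theorem mainTheorem5 (n d : ℕ) [NeZero n] (η κ lam : ℝ) (hη : 0 < η) (hη1 : η ≤ 1)
    (hlam : 1 ≤ lam) (𝓔 : Fin n → Set (Matrix (Fin d) (Fin d) ℝ))
    (h𝓔 : IsNondegenerateFamily 𝓔) :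
    ∃ T₀ Λ c : ℝ, 0 < T₀ ∧ T₀ ≤ 1 ∧ 0 < Λ ∧ Λ ≤ 1 ∧ 0 < c ∧
      ∀ T : ℝ, 0 < T → T ≤ T₀ →
      ∀ δ : ℝ, 0 < δ → ∀ χ : ℝ × Sp n d → ℝ, IsCutoff δ χ →
      ∃ C : ℝ, 0 < C ∧
        ∀ (F : ℝ → Sp n d → Sp n d) (ς : ℝ → Matrix (Fin d) (Fin d) ℝ),
          DriftAssumption η κ 𝓔 F → DiffusionAssumption lam ς →
          ∀ i j : Fin d,
            SizeEstimate F T C (kLoc F ς χ i j) ∧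
            SmoothnessEstimate F η T Λ c C (kLoc F ς χ i j) ∧
            SizeEstimate F T C (kLocAdj F ς χ i j) ∧
            SmoothnessEstimate F η T Λ c C (kLocAdj F ς χ i j) ∧
            Cancellation F T C (kLoc F ς χ i j) ∧
            Cancellation F T C (kLocAdj F ς χ i j) := by
  -- The sign of `κ` is unrestricted; the assumptions persist with `|κ|` in its place.
  have hκ : 0 ≤ |κ| := abs_nonneg κ
  obtain ⟨G, hG, hGt⟩ := exists_qdist_triangle 𝓔 hη hη1 hκ
  -- `T₀ = Λ = 1` keep times and distances in the range of the scaling argument; `c = 2 G` makes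
  -- `𝐝(p', q)` comparable with `𝐝(p, q)`.
  refine ⟨1, 1, 2 * G, one_pos, le_rfl, one_pos, le_rfl, by linarith, fun T _ hT δ hδ χ hχ => ?_⟩
  obtain ⟨C₁, h₁, H₁⟩ := exists_sizeEstimate h𝓔 hlam hη hη1 hκ hδ hχ
  obtain ⟨C₂, h₂, H₂⟩ := exists_smoothnessEstimate h𝓔 hlam hη hη1 hκ hG hGt hδ hχ
  obtain ⟨C₃, h₃, H₃⟩ := exists_smoothnessEstimate_adj h𝓔 hlam hη hη1 hκ hG hGt hδ hχ
  obtain ⟨C₄, h₄, H₄⟩ := exists_cancellation h𝓔 hlam hη hη1 hκ hδ hχ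
  obtain ⟨C₅, h₅, H₅⟩ := exists_cancellation_adj h𝓔 hlam hη hη1 hκ hδ hχ
  refine ⟨C₁ + C₂ + C₃ + C₄ + C₅, by positivity, fun F ς hF hς i j => ?_⟩
  have hF' := hF.mono (le_abs_self κ)
  exact ⟨(H₁ F ς hF' hς i j T hT).1.mono (by linarith),
    (H₂ F ς hF' hς i j T hT).mono (by linarith),
    (H₁ F ς hF' hς i j T hT).2.mono (by linarith),
    (H₃ F ς hF' hς i j T hT).mono (by linarith),
    (H₄ F ς hF' hς i j T hT).mono (by linarith),
    (H₅ F ς hF' hς i j T hT).mono (by linarith)⟩
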